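/- **Definitions.** A convex $n$-gon ($n\ge 3$) has no parallel adjacent edges, and its vertices are given in counterclockwise (ccw) order. An *arc* of a convex polygon $Q$ is a contiguous portion of $\partial Q$ of positive length (it may start and end inside edges) whose supporting lines have angles in an interval of length $<\pi/3$, i.e. the turning angles at its inner vertices sum to less than $\pi/3$. A *pairing* $M$ between arcs $\Gamma,\Gamma'$ is a subdivision of the edges of $\Gamma$ and of $\Gamma'$ into (non-degenerate) sub-edges together with a bijection $e\mapsto M(e)$ from the sub-edges of $\Gamma$ to those of $\Gamma'$; it is *monotonically increasing* if $M(e)$ advances in ccw order along $\Gamma'$ as $e$ advances in ccw order along $\Gamma$. A pair of points $(q,q')$ is *covered* by $M$ if $q\in e$ and $q'\in M(e)$ for some sub-edge $e$ of $\Gamma$. A triple of points $(q_1,q_2,q_3)$ is *covered* by a list $L$ of triples of edges if $q_i\in e_i$ ($i=1,2,3$) for some $(e_1,e_2,e_3)\in L$. A *similarity transformation* is a map $(x,y)\mapsto(sx-ty+u,\;tx+sy+v)$ with $(s,t)\ne(0,0)$. The machine model is a real RAM (exact unit-cost arithmetic and comparisons on reals, integer counters and addresses with addition and subtraction, indirect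 addressing, no rounding). **Theorem.** There are a real-RAM program and absolute constants $C,c$ such that the following holds for every $n\ge 3$, every convex $n$-gon $Q$, every (non-degenerate) triangle $\triangle p_1p_2p_3$ and all arcs $\Gamma_1,\Gamma_2,\Gamma_3$ of $Q$ (which may overlap or coincide). On this input the program halts after at most $C\,n\log^{c} n$ steps and outputs * a collection $\mathcal M$ of at most $C\log n$ monotonically increasing pairings, each of them between $\Gamma_1$ and $\Gamma_2$, between $\Gamma_2$ and $\Gamma_3$, or between $\Gamma_1$ and $\Gamma_3$, and each with at most $Cn$ sub-edges on either arc, and * a list $L$ of at most $C\,n\log n$ triples $(e_1,e_2,e_3)$, with $e_i$ an edge of $\Gamma_i$, such that for every similarity transformation $\varphi$ with $\varphi(p_i)\in\Gamma_i$ for $i=1,2,3$, one of the pairs $(\varphi(p_1),\varphi(p_2))$, $(\varphi(p_2),\varphi(p_3))$, $(\varphi(p_1),\varphi(p_3))$ is covered by a pairing in $\mathcal M$ between the corresponding arcs, or $(\varphi(p_1),\varphi(p_2),\varphi(p_3))$ is covered by $L$. -/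

import Mathlib

/-! ## A real RAM

Memory consists of finitely many (as many as the program names) unbounded arrays of natural numbers
and arrays of real numbers. Natural numbers serve as counters and addresses; their only operations
are addition and truncated subtraction. Real cells admit exact arithmetic and comparison.
There is no rounding and no conversion from reals to naturals. -/

namespace RealRAM

/-- Contents of the memory: `nat a i` and `real a i` are the `i`-th cells of the `a`-th arrays. -/
structure Store where
  nat : ℕ → ℕ → ℕ
  real : ℕ → ℕ → ℝ

/-- Expressions for natural numbers, with indirect addressing. -/
inductive NatExpr where
  | const (k : ℕ)
  | load (a : ℕ) (i : NatExpr)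
  | add (e f : NatExpr)
  | sub (e f : NatExpr)

def NatExpr.eval (s : Store) : NatExpr → ℕ
  | .const k => k
  | .load a i => s.nat a (i.eval s)
  | .add e f => e.eval s + f.eval s
  | .sub e f => e.eval s - f.eval s

/-- Expressions for real numbers. The constants are rational; division by zero gives zero. -/
inductive RealExpr where
  | const (q : ℚ)
  | load (a : ℕ) (i : NatExpr)
  | add (e f : RealExpr)
  | sub (e f : RealExpr)
  | mul (e f : RealExpr)
  | div (e f : RealExpr)

noncomputable def RealExpr.eval (s : Store) : RealExpr → ℝ
  | .const q => (q : ℝ)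
  | .load a i => s.real a (i.eval s)
  | .add e f => e.eval s + f.eval s
  | .sub e f => e.eval s - f.eval s
  | .mul e f => e.eval s * f.eval s
  | .div e f => e.eval s / f.eval s

/-- Tests. -/
inductive Test where
  | natLt (e f : NatExpr)
  | realLt (e f : RealExpr)
  | not (b : Test)
  | and (b c : Test)

def Test.Holds (s : Store) : Test → Prop
  | .natLt e f => e.eval s < f.eval s
  | .realLt e f => e.eval s < f.eval s
  | .not b => ¬ b.Holds s
  | .and b c => b.Holds s ∧ c.Holds s

def Store.setNat (s : Store) (a i v : ℕ) : Store where
  nat := fun a' i' => if a' = a ∧ i' = i then v else s.nat a' i'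
  real := s.real

noncomputable def Store.setReal (s : Store) (a i : ℕ) (v : ℝ) : Store where
  nat := s.nat
  real := fun a' i' => if a' = a ∧ i' = i then v else s.real a' i'

/-- Programs. A program is one fixed finite text, for inputs of all sizes. -/
inductive Prog where
  | skip
  | setNat (a : ℕ) (i e : NatExpr)
  | setReal (a : ℕ) (i : NatExpr) (e : RealExpr)
  | seq (p q : Prog)
  | ite (b : Test) (p q : Prog)
  | loop (b : Test) (p : Prog)

/-- `Exec p s t s'`: started in the store `s`, the program `p` halts after `t` steps in the store
`s'`. Every execution of an assignment and every evaluation of the test of a conditional or of a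
while loop is one step; as the expressions in a program have a fixed size, this is the number of
elementary operations up to a constant factor that depends only on the program. -/
inductive Exec : Prog → Store → ℕ → Store → Prop where
  | skip (s : Store) : Exec .skip s 0 s
  | setNat (s : Store) (a : ℕ) (i e : NatExpr) :
      Exec (.setNat a i e) s 1 (s.setNat a (i.eval s) (e.eval s))
  | setReal (s : Store) (a : ℕ) (i : NatExpr) (e : RealExpr) :
      Exec (.setReal a i e) s 1 (s.setReal a (i.eval s) (e.eval s))
  | seq {p q : Prog} {s s' s'' : Store} {t t' : ℕ} :
      Exec p s t s' → Exec q s' t' s'' → Exec (.seq p q) s (t + t') s''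
  | iteTrue {b : Test} {p q : Prog} {s s' : Store} {t : ℕ} :
      b.Holds s → Exec p s t s' → Exec (.ite b p q) s (t + 1) s'
  | iteFalse {b : Test} {p q : Prog} {s s' : Store} {t : ℕ} :
      ¬ b.Holds s → Exec q s t s' → Exec (.ite b p q) s (t + 1) s'
  | loopStop {b : Test} {p : Prog} {s : Store} :
      ¬ b.Holds s → Exec (.loop b p) s 1 s
  | loopStep {b : Test} {p : Prog} {s s' s'' : Store} {t t' : ℕ} :
      b.Holds s → Exec p s t s' → Exec (.loop b p) s' t' s'' →
        Exec (.loop b p) s (t + t' + 1) s''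

end RealRAM

/-! ## Convex polygons, arcs, pairings -/

namespace TriangleCover

/-- The cross product of two plane vectors, the plane being identified with `ℂ`. -/
def cross (z w : ℂ) : ℝ := z.re * w.im - z.im * w.re

/-- A convex `n`-gon without parallel adjacent edges, its vertices listed counterclockwise. -/
structure ConvexPolygon (n : ℕ) where
  vertex : Fin n → ℂ
  three_le : 3 ≤ n
  ccw : ∀ i j k : Fin n, i < j → j < k →
    0 < cross (vertex j - vertex i) (vertex k - vertex i)

namespace ConvexPolygon

variable {n : ℕ} (Q : ConvexPolygon n)

/-- The vertices with indices read modulo `n`. -/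
def vtx (i : ℕ) : ℂ :=
  Q.vertex ⟨i % n, Nat.mod_lt i (lt_of_lt_of_le (by norm_num) Q.three_le)⟩

/-- The vector along the `i`-th edge, which runs from vertex `i` to vertex `i + 1`. -/
def dir (i : ℕ) : ℂ := Q.vtx (i + 1) - Q.vtx i

/-- The angle, in `(0, π)`, by which the boundary turns from edge `i` to edge `i + 1`. -/
noncomputable def turn (i : ℕ) : ℝ := Complex.arg (Q.dir (i + 1) / Q.dir i)

end ConvexPolygon

/-- An arc: a contiguous portion of the boundary, of positive length, that meets the `len`
consecutive edges from edge number `first` on. It starts at the point with parameter `lo` of its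
first edge and ends at the point with parameter `hi` of its last edge. The angles of its supporting
lines range over an interval whose length is the sum of the turning angles at its inner vertices;
this length is less than `π / 3`. -/
structure Arc {n : ℕ} (Q : ConvexPolygon n) where
  first : Fin n
  len : ℕ
  lo : ℝ
  hi : ℝ
  len_pos : 1 ≤ len
  len_le : len ≤ n
  lo_nonneg : 0 ≤ lo
  lo_lt_one : lo < 1
  hi_pos : 0 < hi
  hi_le_one : hi ≤ 1
  lo_lt_hi : len = 1 → lo < hi
  turning_lt : ∑ k ∈ Finset.range (len - 1), Q.turn (first + k) < Real.pi / 3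

/-- A sub-edge of an arc: the part of the `edge`-th edge of the arc (counted from 0) between the
parameters `lo` and `hi`, where the whole edge of the polygon has parameters from 0 to 1. -/
structure SubEdge where
  edge : ℕ
  lo : ℝ
  hi : ℝ

namespace Arc

variable {n : ℕ} {Q : ConvexPolygon n} (Γ : Arc Q)

/-- The point with parameter `t` on the (extended) `k`-th edge of the arc. -/
noncomputable def point (k : ℕ) (t : ℝ) : ℂ := Q.vtx (Γ.first + k) + (t : ℂ) * Q.dir (Γ.first + k)

/-- The points of a sub-edge. -/
def subEdgeSet (e : SubEdge) : Set ℂ := Γ.point e.edge '' Set.Icc e.lo e.hi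

/-- The `k`-th edge of the arc; the first and the last one may be proper parts of polygon edges. -/
noncomputable def edge (k : ℕ) : SubEdge where
  edge := k
  lo := if k = 0 then Γ.lo else 0
  hi := if k + 1 = Γ.len then Γ.hi else 1

/-- The points of the arc. -/
def carrier : Set ℂ := ⋃ k : Fin Γ.len, Γ.subEdgeSet (Γ.edge k)

end Arc

/-- A subdivision of the edges of an arc into sub-edges, listed in counterclockwise order. -/
structure Subdivision {n : ℕ} {Q : ConvexPolygon n} (Γ : Arc Q) where
  size : ℕ
  size_pos : 0 < size
  piece : Fin size → SubEdge
  lo_lt_hi : ∀ i, (piece i).lo < (piece i).hi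
  first_piece : ∀ i : Fin size, (i : ℕ) = 0 → (piece i).edge = 0 ∧ (piece i).lo = Γ.lo
  last_piece : ∀ i : Fin size, (i : ℕ) + 1 = size →
    (piece i).edge + 1 = Γ.len ∧ (piece i).hi = Γ.hi
  next_piece : ∀ i j : Fin size, (j : ℕ) = i + 1 →
    ((piece j).edge = (piece i).edge ∧ (piece j).lo = (piece i).hi) ∨
    ((piece j).edge = (piece i).edge + 1 ∧ (piece i).hi = 1 ∧ (piece j).lo = 0)

/-- A pairing between two arcs: subdivisions of both, and a bijection between the sub-edges. -/
structure Pairing {n : ℕ} {Q : ConvexPolygon n} (Γ Γ' : Arc Q) where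
  left : Subdivision Γ
  right : Subdivision Γ'
  map : Fin left.size ≃ Fin right.size

namespace Pairing

variable {n : ℕ} {Q : ConvexPolygon n} {Γ Γ' : Arc Q}

/-- The partner of a sub-edge advances counterclockwise as the sub-edge does. -/
def IsIncreasing (M : Pairing Γ Γ') : Prop := StrictMono M.map

/-- `q` is on some sub-edge of the first arc and `q'` is on its partner. -/
def Covers (M : Pairing Γ Γ') (q q' : ℂ) : Prop :=
  ∃ i, q ∈ Γ.subEdgeSet (M.left.piece i) ∧ q' ∈ Γ'.subEdgeSet (M.right.piece (M.map i))

end Pairing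

/-- Similarity transformations of the plane, composed of a rotation, a scaling by a positive factor
and a translation: `(x, y) ↦ (s x - t y + u, t x + s y + v)` with `(s, t) ≠ (0, 0)`. -/
def IsSimilarity (φ : ℂ → ℂ) : Prop := ∃ a b : ℂ, a ≠ 0 ∧ ∀ z, φ z = a * z + b

/-! ## Input and output in the memory of the machine -/

/-- The initial memory: the polygon, the triangle and the arcs; all other cells are zero. -/
noncomputable def inputStore {n : ℕ} (Q : ConvexPolygon n) (p : Fin 3 → ℂ) (Γ₁ Γ₂ Γ₃ : Arc Q) :
    RealRAM.Store where
  nat := fun a i =>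
    if a = 0 then
      [n, (Γ₁.first : ℕ), Γ₁.len, (Γ₂.first : ℕ), Γ₂.len, (Γ₃.first : ℕ), Γ₃.len].getD i 0
    else 0
  real := fun a i =>
    if a = 0 then (if h : i < n then (Q.vertex ⟨i, h⟩).re else 0)
    else if a = 1 then (if h : i < n then (Q.vertex ⟨i, h⟩).im else 0)
    else if a = 2 then
      [(p 0).re, (p 0).im, (p 1).re, (p 1).im, (p 2).re, (p 2).im,
        Γ₁.lo, Γ₁.hi, Γ₂.lo, Γ₂.hi, Γ₃.lo, Γ₃.hi].getD i 0
    else 0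

/-- Cell `i` of the arrays of a table with number `a` holds the sub-edge `e`. -/
def StoresSubEdge (s : RealRAM.Store) (a i : ℕ) (e : SubEdge) : Prop :=
  s.nat a i = e.edge ∧ s.real (2 * a) i = e.lo ∧ s.real (2 * a + 1) i = e.hi

/-- The arrays from number `b` on hold a list of pairings: their number, for the `r`-th pairing its
number of sub-edges and the position `o` from which on it is written, and from there the pairs of
a sub-edge of the first arc, in counterclockwise order, and its partner. -/
def StoresPairings {n : ℕ} {Q : ConvexPolygon n} {Γ Γ' : Arc Q} (s : RealRAM.Store) (b : ℕ)
    (l : List (Pairing Γ Γ')) : Prop :=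
  s.nat b 0 = l.length ∧
  ∀ r : Fin l.length,
    s.nat (b + 1) r = (l.get r).left.size ∧
    ∃ o : ℕ, s.nat (b + 2) r = o ∧
      ∀ i : Fin (l.get r).left.size,
        StoresSubEdge s (b + 3) (o + i) ((l.get r).left.piece i) ∧
        StoresSubEdge s (b + 4) (o + i) ((l.get r).right.piece ((l.get r).map i))

/-- The arrays from number `b` on hold a list of triples of edges of the three arcs. -/
def StoresTriples {n : ℕ} {Q : ConvexPolygon n} {Γ₁ Γ₂ Γ₃ : Arc Q} (s : RealRAM.Store) (b : ℕ)
    (l : List (Fin Γ₁.len × Fin Γ₂.len × Fin Γ₃.len)) : Prop :=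
  s.nat b 0 = l.length ∧
  ∀ r : Fin l.length,
    s.nat (b + 1) r = (l.get r).1 ∧
    s.nat (b + 2) r = (l.get r).2.1 ∧
    s.nat (b + 3) r = (l.get r).2.2

/-- The triple of points is on the three edges of some triple in the list. -/
def TripleCovers {n : ℕ} {Q : ConvexPolygon n} {Γ₁ Γ₂ Γ₃ : Arc Q}
    (l : List (Fin Γ₁.len × Fin Γ₂.len × Fin Γ₃.len)) (q₁ q₂ q₃ : ℂ) : Prop :=
  ∃ e ∈ l, q₁ ∈ Γ₁.subEdgeSet (Γ₁.edge e.1) ∧ q₂ ∈ Γ₂.subEdgeSet (Γ₂.edge e.2.1) ∧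
    q₃ ∈ Γ₃.subEdgeSet (Γ₃.edge e.2.2)

end TriangleCover

open RealRAM TriangleCover

/-! ## Program logic for the real RAM -/

namespace RealRAM

instance : Add NatExpr := ⟨.add⟩
instance : Sub NatExpr := ⟨.sub⟩
instance (k : ℕ) : OfNat NatExpr k := ⟨.const k⟩
instance : Add RealExpr := ⟨.add⟩
instance : Sub RealExpr := ⟨.sub⟩
instance : Mul RealExpr := ⟨.mul⟩
instance : Div RealExpr := ⟨.div⟩
instance (k : ℕ) : OfNat RealExpr k := ⟨.const k⟩

/-- The scalar variable stored in cell 0 of a natural number array. -/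
abbrev nv (a : ℕ) : NatExpr := .load a 0
/-- The scalar variable stored in cell 0 of a real array. -/
abbrev rv (a : ℕ) : RealExpr := .load a 0
/-- Assignment to a scalar natural number variable. -/
abbrev nset (a : ℕ) (e : NatExpr) : Prog := .setNat a 0 e
/-- Assignment to a scalar real variable. -/
abbrev rset (a : ℕ) (e : RealExpr) : Prog := .setReal a 0 e

infixr:60 " ;; " => Prog.seq

section Eval
variable (s : Store)

@[simp] theorem NatExpr.eval_add (e f : NatExpr) : (e + f).eval s = e.eval s + f.eval s := rfl
@[simp] theorem NatExpr.eval_sub (e f : NatExpr) : (e - f).eval s = e.eval s - f.eval s := rfl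
@[simp] theorem NatExpr.eval_zero : (0 : NatExpr).eval s = 0 := rfl
@[simp] theorem NatExpr.eval_one : (1 : NatExpr).eval s = 1 := rfl
@[simp] theorem NatExpr.eval_two : (2 : NatExpr).eval s = 2 := rfl
@[simp] theorem NatExpr.eval_load (a : ℕ) (i : NatExpr) :
    (NatExpr.load a i).eval s = s.nat a (i.eval s) := rfl
@[simp] theorem RealExpr.eval_add (e f : RealExpr) : (e + f).eval s = e.eval s + f.eval s := rfl
@[simp] theorem RealExpr.eval_sub (e f : RealExpr) : (e - f).eval s = e.eval s - f.eval s := rfl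
@[simp] theorem RealExpr.eval_mul (e f : RealExpr) : (e * f).eval s = e.eval s * f.eval s := rfl
@[simp] theorem RealExpr.eval_div (e f : RealExpr) : (e / f).eval s = e.eval s / f.eval s := rfl
@[simp] theorem RealExpr.eval_zero : (0 : RealExpr).eval s = 0 := by
  change (((0 : ℕ) : ℚ) : ℝ) = 0
  simp
@[simp] theorem RealExpr.eval_one : (1 : RealExpr).eval s = 1 := by
  change (((1 : ℕ) : ℚ) : ℝ) = 1
  simp
@[simp] theorem RealExpr.eval_two : (2 : RealExpr).eval s = 2 := by
  change (((2 : ℕ) : ℚ) : ℝ) = 2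
  simp
@[simp] theorem RealExpr.eval_load (a : ℕ) (i : NatExpr) :
    (RealExpr.load a i).eval s = s.real a (i.eval s) := rfl
@[simp] theorem Test.holds_natLt (e f : NatExpr) :
    (Test.natLt e f).Holds s ↔ e.eval s < f.eval s := Iff.rfl
@[simp] theorem Test.holds_realLt (e f : RealExpr) :
    (Test.realLt e f).Holds s ↔ e.eval s < f.eval s := Iff.rfl
@[simp] theorem Test.holds_not (b : Test) : (Test.not b).Holds s ↔ ¬ b.Holds s := Iff.rfl
@[simp] theorem Test.holds_and (b c : Test) :
    (Test.and b c).Holds s ↔ b.Holds s ∧ c.Holds s := Iff.rfl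
@[simp] theorem Store.setNat_nat (a i v a' i' : ℕ) :
    (s.setNat a i v).nat a' i' = if a' = a ∧ i' = i then v else s.nat a' i' := rfl
@[simp] theorem Store.setNat_real (a i v : ℕ) : (s.setNat a i v).real = s.real := rfl
@[simp] theorem Store.setReal_nat (a i : ℕ) (v : ℝ) : (s.setReal a i v).nat = s.nat := rfl
@[simp] theorem Store.setReal_real (a i : ℕ) (v : ℝ) (a' i' : ℕ) :
    (s.setReal a i v).real a' i' = if a' = a ∧ i' = i then v else s.real a' i' := rfl

end Eval

/-- The disjunction of two tests. -/
def Test.or (b c : Test) : Test := .not (.and (.not b) (.not c))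

@[simp] theorem Test.holds_or (s : Store) (b c : Test) :
    (b.or c).Holds s ↔ b.Holds s ∨ c.Holds s := by
  simp only [Test.or, Test.holds_not, Test.holds_and]
  tauto

/-- The arrays of natural numbers to which a program may write. -/
def Prog.writesNat : Prog → ℕ → Bool
  | .skip, _ => false
  | .setNat a _ _, a' => a == a'
  | .setReal _ _ _, _ => false
  | .seq p q, a' => p.writesNat a' || q.writesNat a'
  | .ite _ p q, a' => p.writesNat a' || q.writesNat a'
  | .loop _ p, a' => p.writesNat a'

/-- The arrays of real numbers to which a program may write. -/
def Prog.writesReal : Prog → ℕ → Bool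
  | .skip, _ => false
  | .setNat _ _ _, _ => false
  | .setReal a _ _, a' => a == a'
  | .seq p q, a' => p.writesReal a' || q.writesReal a'
  | .ite _ p q, a' => p.writesReal a' || q.writesReal a'
  | .loop _ p, a' => p.writesReal a'

/-- The program writes to no array with a number in `[200, N)`. -/
def Prog.above (N : ℕ) : Prog → Bool
  | .skip => true
  | .setNat a _ _ => a.blt 200 || N.ble a
  | .setReal a _ _ => a.blt 200 || N.ble a
  | .seq p q => p.above N && q.above N
  | .ite _ p q => p.above N && q.above N
  | .loop _ p => p.above N

/-- The stores agree on the arrays that `p` does not write. -/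
def Frame (p : Prog) (s s' : Store) : Prop :=
  (∀ a, p.writesNat a = false → s'.nat a = s.nat a) ∧
    ∀ a, p.writesReal a = false → s'.real a = s.real a

/-- The stores agree on the arrays with numbers in `[200, N)`. -/
def Agree (N : ℕ) (s s' : Store) : Prop :=
  ∀ a, 200 ≤ a → a < N → s'.nat a = s.nat a ∧ s'.real a = s.real a

theorem Agree.refl (N : ℕ) (s : Store) : Agree N s s := fun _ _ _ => ⟨rfl, rfl⟩

theorem Agree.trans {N : ℕ} {s s' s'' : Store} (h : Agree N s s') (h' : Agree N s' s'') :
    Agree N s s'' := fun a h₁ h₂ =>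
  ⟨(h' a h₁ h₂).1.trans (h a h₁ h₂).1, (h' a h₁ h₂).2.trans (h a h₁ h₂).2⟩

theorem Agree.mono {N N' : ℕ} {s s' : Store} (h : Agree N s s') (hN : N' ≤ N) :
    Agree N' s s' := fun a h₁ h₂ => h a h₁ (h₂.trans_le hN)

theorem Exec.frame {p : Prog} {s s' : Store} {t : ℕ} (h : Exec p s t s') : Frame p s s' := by
  induction h with
  | skip => exact ⟨fun _ _ => rfl, fun _ _ => rfl⟩
  | setNat s a i e =>
    refine ⟨fun a' ha' => ?_, fun _ _ => rfl⟩
    have : a' ≠ a := by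
      rintro rfl
      simp [Prog.writesNat] at ha'
    funext i'
    simp [this]
  | setReal s a i e =>
    refine ⟨fun _ _ => rfl, fun a' ha' => ?_⟩
    have : a' ≠ a := by
      rintro rfl
      simp [Prog.writesReal] at ha'
    funext i'
    simp [this]
  | seq _ _ ih₁ ih₂ =>
    constructor <;> intro a ha
    · simp only [Prog.writesNat, Bool.or_eq_false_iff] at ha
      rw [ih₂.1 a ha.2, ih₁.1 a ha.1]
    · simp only [Prog.writesReal, Bool.or_eq_false_iff] at ha
      rw [ih₂.2 a ha.2, ih₁.2 a ha.1]
  | iteTrue _ _ ih =>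
    constructor <;> intro a ha
    · simp only [Prog.writesNat, Bool.or_eq_false_iff] at ha
      exact ih.1 a ha.1
    · simp only [Prog.writesReal, Bool.or_eq_false_iff] at ha
      exact ih.2 a ha.1
  | iteFalse _ _ ih =>
    constructor <;> intro a ha
    · simp only [Prog.writesNat, Bool.or_eq_false_iff] at ha
      exact ih.1 a ha.2
    · simp only [Prog.writesReal, Bool.or_eq_false_iff] at ha
      exact ih.2 a ha.2
  | loopStop => exact ⟨fun _ _ => rfl, fun _ _ => rfl⟩
  | loopStep _ _ _ ih₁ ih₂ =>
    constructor <;> intro a ha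
    · rw [ih₂.1 a ha, ih₁.1 a ha]
    · rw [ih₂.2 a ha, ih₁.2 a ha]

theorem Prog.writes_of_above {N a : ℕ} (h₁ : 200 ≤ a) (h₂ : a < N) (p : Prog)
    (h : p.above N = true) : p.writesNat a = false ∧ p.writesReal a = false := by
  induction p with
  | skip => exact ⟨rfl, rfl⟩
  | setNat a' _ _ =>
    have h' : a' < 200 ∨ N ≤ a' := by simpa [Prog.above] using h
    refine ⟨?_, rfl⟩
    simp only [Prog.writesNat, beq_eq_false_iff_ne]
    omega
  | setReal a' _ _ =>
    have h' : a' < 200 ∨ N ≤ a' := by simpa [Prog.above] using h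
    refine ⟨rfl, ?_⟩
    simp only [Prog.writesReal, beq_eq_false_iff_ne]
    omega
  | seq p q ihp ihq =>
    simp only [Prog.above, Bool.and_eq_true] at h
    simp [Prog.writesNat, Prog.writesReal, ihp h.1, ihq h.2]
  | ite _ p q ihp ihq =>
    simp only [Prog.above, Bool.and_eq_true] at h
    simp [Prog.writesNat, Prog.writesReal, ihp h.1, ihq h.2]
  | loop _ p ih =>
    simp only [Prog.above] at h
    simp [Prog.writesNat, Prog.writesReal, ih h]

theorem Frame.agree {p : Prog} {s s' : Store} (h : Frame p s s') (N : ℕ)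
    (hp : p.above N = true) : Agree N s s' := fun a h₁ h₂ =>
  ⟨h.1 a (p.writes_of_above h₁ h₂ hp).1, h.2 a (p.writes_of_above h₁ h₂ hp).2⟩

/-- Total correctness: from `s` the program halts after some number of steps in some store, which
together satisfy `R`. -/
def Runs (p : Prog) (s : Store) (R : ℕ → Store → Prop) : Prop :=
  ∃ t s', Exec p s t s' ∧ R t s'

theorem Runs.mono {p : Prog} {s : Store} {R R' : ℕ → Store → Prop} (h : Runs p s R)
    (hR : ∀ t s', Frame p s s' → R t s' → R' t s') : Runs p s R' := by
  obtain ⟨t, s', h₁, h₂⟩ := h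
  exact ⟨t, s', h₁, hR t s' h₁.frame h₂⟩

theorem runs_skip {s : Store} {R : ℕ → Store → Prop} (h : R 0 s) : Runs .skip s R :=
  ⟨0, s, .skip s, h⟩

theorem runs_setNat {s : Store} {R : ℕ → Store → Prop} {a : ℕ} {i e : NatExpr}
    (h : R 1 (s.setNat a (i.eval s) (e.eval s))) : Runs (.setNat a i e) s R :=
  ⟨1, _, .setNat s a i e, h⟩

theorem runs_setReal {s : Store} {R : ℕ → Store → Prop} {a : ℕ} {i : NatExpr} {e : RealExpr}
    (h : R 1 (s.setReal a (i.eval s) (e.eval s))) : Runs (.setReal a i e) s R :=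
  ⟨1, _, .setReal s a i e, h⟩

theorem runs_seq {p q : Prog} {s : Store} {R : ℕ → Store → Prop}
    (h : Runs p s fun t s' => Runs q s' fun t' s'' => R (t + t') s'') : Runs (p ;; q) s R := by
  obtain ⟨t, s', h₁, t', s'', h₂, h₃⟩ := h
  exact ⟨_, s'', .seq h₁ h₂, h₃⟩

theorem Runs.seq {p q : Prog} {s : Store} {R R' : ℕ → Store → Prop} (h : Runs p s R)
    (h' : ∀ t s', Frame p s s' → R t s' → Runs q s' fun t' s'' => R' (t + t') s'') :
    Runs (p ;; q) s R' :=
  runs_seq (h.mono h')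

theorem runs_ite {b : Test} {p q : Prog} {s : Store} {R : ℕ → Store → Prop}
    (h₁ : b.Holds s → Runs p s fun t s' => R (t + 1) s')
    (h₂ : ¬ b.Holds s → Runs q s fun t s' => R (t + 1) s') : Runs (.ite b p q) s R := by
  by_cases hb : b.Holds s
  · obtain ⟨t, s', h, h'⟩ := h₁ hb
    exact ⟨_, s', .iteTrue hb h, h'⟩
  · obtain ⟨t, s', h, h'⟩ := h₂ hb
    exact ⟨_, s', .iteFalse hb h, h'⟩

/-- The rule for loops: the invariant may mention the time spent so far. -/
theorem runs_loop {b : Test} {p : Prog} (I : ℕ → Store → Prop) (v : Store → ℕ) {s₀ : Store}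
    (h₀ : I 0 s₀)
    (hstep : ∀ t s, Frame p s₀ s → I t s → b.Holds s →
      Runs p s fun t' s' => I (t + t' + 1) s' ∧ v s' < v s) :
    Runs (.loop b p) s₀ fun t s => ∃ t', t = t' + 1 ∧ I t' s ∧ ¬ b.Holds s := by
  suffices h : ∀ k t s, Frame p s₀ s → I t s → v s = k →
      ∃ t' s', Exec (.loop b p) s (t' + 1) s' ∧ I (t + t') s' ∧ ¬ b.Holds s' by
    obtain ⟨t', s', h₁, h₂, h₃⟩ := h _ 0 s₀ ⟨fun _ _ => rfl, fun _ _ => rfl⟩ h₀ rfl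
    exact ⟨_, s', h₁, t', rfl, by simpa using h₂, h₃⟩
  intro k
  induction k using Nat.strong_induction_on with
  | _ k ih =>
    intro t s hF hI hk
    by_cases hb : b.Holds s
    · obtain ⟨t₁, s₁, h₁, h₂, h₃⟩ := hstep t s hF hI hb
      have hF' : Frame p s₀ s₁ :=
        ⟨fun a ha => (h₁.frame.1 a ha).trans (hF.1 a ha),
          fun a ha => (h₁.frame.2 a ha).trans (hF.2 a ha)⟩
      obtain ⟨t₂, s₂, h₄, h₅, h₆⟩ := ih (v s₁) (hk ▸ h₃) _ s₁ hF' h₂ rfl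
      refine ⟨t₁ + (t₂ + 1), s₂, .loopStep hb h₁ h₄, ?_, h₆⟩
      convert h₅ using 1
      omega
    · exact ⟨0, s, .loopStop hb, by simpa using hI, hb⟩

end RealRAM

/-! ## Polygonal chains with separated directions -/

namespace TriangleCover

theorem cross_add_right (u v w : ℂ) : cross u (v + w) = cross u v + cross u w := by
  simp only [cross, Complex.add_re, Complex.add_im]; ring
theorem cross_sub_right (u v w : ℂ) : cross u (v - w) = cross u v - cross u w := by
  simp only [cross, Complex.sub_re, Complex.sub_im]; ring
theorem cross_neg_right (u v : ℂ) : cross u (-v) = -cross u v := by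
  simp only [cross, Complex.neg_re, Complex.neg_im]; ring
theorem cross_smul_right (t : ℝ) (u v : ℂ) : cross u (t * v) = t * cross u v := by
  simp only [cross, Complex.mul_re, Complex.mul_im, Complex.ofReal_re, Complex.ofReal_im]; ring
theorem cross_self (u : ℂ) : cross u u = 0 := by
  simp only [cross]; ring
theorem cross_comm (u v : ℂ) : cross u v = -cross v u := by
  simp only [cross]; ring
theorem cross_zero_right (u : ℂ) : cross u 0 = 0 := by simp [cross]
theorem cross_zero_left (u : ℂ) : cross 0 u = 0 := by simp [cross]

/-- The point with parameter `t` on edge `a` does not come after the point with parameter `t'` on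
edge `a'`. -/
def PosLE (a : ℕ) (t : ℝ) (a' : ℕ) (t' : ℝ) : Prop :=
  (a = a' ∧ t ≤ t') ∨ (a < a' ∧ t ≤ 1 ∧ 0 ≤ t')

/-- The point with parameter `t` on the line of edge `a`. -/
noncomputable def linePt (B D : ℕ → ℂ) (a : ℕ) (t : ℝ) : ℂ := B a + (t : ℂ) * D a

theorem linePt_succ {B D : ℕ → ℂ} {a : ℕ} (h : B (a + 1) = B a + D a) :
    linePt B D (a + 1) 0 = linePt B D a 1 := by
  simp [linePt, h]

/-- The directions between two positions pair nonnegatively with a functional that is positive on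
the edges. -/
theorem cross_linePt_mono {B D : ℕ → ℂ} {s e : ℕ} {σ : ℝ} {v : ℂ}
    (link : ∀ a, s ≤ a → a + 1 < e → B (a + 1) = B a + D a)
    (pos : ∀ a, s ≤ a → a < e → 0 < σ * cross v (D a))
    {a a' : ℕ} {t t' : ℝ} (ha : s ≤ a) (ha' : a' < e) (h : PosLE a t a' t') :
    σ * cross v (linePt B D a t) ≤ σ * cross v (linePt B D a' t') ∧
      ((a : ℝ) + t < a' + t' →
        σ * cross v (linePt B D a t) < σ * cross v (linePt B D a' t')) := by
  have key : ∀ (a : ℕ) (t t' : ℝ), σ * cross v (linePt B D a t') - σ * cross v (linePt B D a t) =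
      (t' - t) * (σ * cross v (D a)) := by
    intro a t t'
    simp only [linePt, cross_add_right, cross_smul_right]
    ring
  rcases h with ⟨rfl, h⟩ | ⟨hlt, ht, ht'⟩
  · have hp := pos a ha ha'
    refine ⟨?_, fun h' => ?_⟩
    · nlinarith [key a t t']
    · have : t < t' := by linarith
      nlinarith [key a t t']
  · induction a', hlt using Nat.le_induction generalizing t' with
    | base =>
      have hp := pos a ha (by omega)
      have hp' := pos (a + 1) (by omega) ha'
      have h1 := key a t 1
      have h2 := key (a + 1) 0 t'
      rw [linePt_succ (link a ha ha')] at h2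
      push_cast
      refine ⟨by nlinarith, fun h' => ?_⟩
      rcases lt_or_eq_of_le ht with h3 | h3
      · nlinarith
      · have : 0 < t' := by linarith
        nlinarith
    | succ c hc ih =>
      have hp := pos c (by omega) (by omega)
      have hp' := pos (c + 1) (by omega) ha'
      have h1 := key c 0 1
      have h2 := key (c + 1) 0 t'
      have h3 := (ih (t' := 0) (by omega) le_rfl).1
      rw [linePt_succ (link c (by omega) ha')] at h2
      have : σ * cross v (linePt B D a t) < σ * cross v (linePt B D (c + 1) t') := by nlinarith
      exact ⟨this.le, fun _ => this⟩

/-- The edges of the second chain are on one side of all the directions of the first one, those of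
the third chain are on the other side. -/
structure Separated (Bi Di Bj Dj Bk Dk : ℕ → ℂ) (si ei sj ej sk ek : ℕ) (σ : ℝ) : Prop where
  linki : ∀ m, si ≤ m → m + 1 < ei → Bi (m + 1) = Bi m + Di m
  linkj : ∀ a, sj ≤ a → a + 1 < ej → Bj (a + 1) = Bj a + Dj a
  linkk : ∀ b, sk ≤ b → b + 1 < ek → Bk (b + 1) = Bk b + Dk b
  posj : ∀ m a, si ≤ m → m < ei → sj ≤ a → a < ej → 0 < σ * cross (Di m) (Dj a)
  negk : ∀ m b, si ≤ m → m < ei → sk ≤ b → b < ek → 0 < -σ * cross (Di m) (Dk b)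

/-- The points on edge `a` of the second and edge `b` of the third chain and a point on edge `m` of
the first chain, prolonged by rays, add up to zero. -/
structure OnCurve (Bi Di Bj Dj Bk Dk : ℕ → ℂ) (si ei a : ℕ) (t : ℝ) (b : ℕ) (u : ℝ) (m : ℕ)
    (r : ℝ) : Prop where
  sum_eq : linePt Bj Dj a t + linePt Bk Dk b u + linePt Bi Di m r = 0
  le : si ≤ m
  lt : m < ei
  nonneg : si < m → 0 ≤ r
  le_one : m + 1 < ei → r ≤ 1

section
variable {Bi Di Bj Dj Bk Dk : ℕ → ℂ} {si ei sj ej sk ek : ℕ} {σ : ℝ}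

theorem Separated.symm (h : Separated Bi Di Bj Dj Bk Dk si ei sj ej sk ek σ) :
    Separated Bi Di Bk Dk Bj Dj si ei sk ek sj ej (-σ) :=
  ⟨h.linki, h.linkk, h.linkj, h.negk, by simpa using h.posj⟩

theorem OnCurve.symm {a b m : ℕ} {t u r : ℝ}
    (h : OnCurve Bi Di Bj Dj Bk Dk si ei a t b u m r) :
    OnCurve Bi Di Bk Dk Bj Dj si ei b u a t m r :=
  ⟨by rw [add_comm (linePt Bk Dk b u)]; exact h.sum_eq, h.le, h.lt, h.nonneg, h.le_one⟩

theorem OnCurve.posLE_of_le {a b m a' b' m' : ℕ} {t u r t' u' r' : ℝ}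
    (h : OnCurve Bi Di Bj Dj Bk Dk si ei a t b u m r)
    (h' : OnCurve Bi Di Bj Dj Bk Dk si ei a' t' b' u' m' r') (hm : m < m') :
    PosLE m r m' r' :=
  Or.inr ⟨hm, h.le_one (by have := h'.lt; omega), h'.nonneg (by have := h.le; omega)⟩

theorem OnCurve.posLE_total {a b m a' b' m' : ℕ} {t u r t' u' r' : ℝ}
    (h : OnCurve Bi Di Bj Dj Bk Dk si ei a t b u m r)
    (h' : OnCurve Bi Di Bj Dj Bk Dk si ei a' t' b' u' m' r') :
    (PosLE m r m' r' ∧ (m : ℝ) + r ≤ m' + r') ∨ (PosLE m' r' m r ∧ (m' : ℝ) + r' ≤ m + r) := by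
  rcases lt_trichotomy m m' with hm | rfl | hm
  · have hp := h.posLE_of_le h' hm
    refine Or.inl ⟨hp, ?_⟩
    rcases hp with ⟨hp, -⟩ | ⟨-, h1, h2⟩
    · omega
    · have : (m : ℝ) + 1 ≤ m' := by exact_mod_cast hm
      linarith
  · rcases le_total r r' with hr | hr
    · exact Or.inl ⟨Or.inl ⟨rfl, hr⟩, by linarith⟩
    · exact Or.inr ⟨Or.inl ⟨rfl, hr⟩, by linarith⟩
  · have hp := h'.posLE_of_le h hm
    refine Or.inr ⟨hp, ?_⟩
    rcases hp with ⟨hp, -⟩ | ⟨-, h1, h2⟩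
    · omega
    · have : (m' : ℝ) + 1 ≤ m := by exact_mod_cast hm
      linarith

/-- Along the curve the second and the third chain advance together. -/
theorem Separated.not_cross (S : Separated Bi Di Bj Dj Bk Dk si ei sj ej sk ek σ)
    {a b m a' b' m' : ℕ} {t u r t' u' r' : ℝ}
    (h : OnCurve Bi Di Bj Dj Bk Dk si ei a t b u m r)
    (h' : OnCurve Bi Di Bj Dj Bk Dk si ei a' t' b' u' m' r')
    (ha : sj ≤ a) (ha' : a' < ej) (hb : b < ek) (hb' : sk ≤ b')
    (hj : PosLE a t a' t') (hk : PosLE b' u' b u) :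
    ¬ ((a : ℝ) + t < a' + t' ∨ (b' : ℝ) + u' < b + u) := by
  intro hlt
  set v : ℂ := (linePt Bj Dj a' t' + linePt Bk Dk b' u') -
    (linePt Bj Dj a t + linePt Bk Dk b u) with hv
  have hpos : ∀ c, si ≤ c → c < ei → 0 < σ * cross (Di c) v := by
    intro c hc hc'
    have h1 := cross_linePt_mono S.linkj (fun x hx hx' => S.posj c x hc hc' hx hx') ha ha' hj
    have h2 := cross_linePt_mono S.linkk (fun x hx hx' => S.negk c x hc hc' hx hx') hb' hb hk
    simp only [hv, cross_add_right, cross_sub_right]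
    rcases hlt with hlt | hlt
    · nlinarith [h1.2 hlt, h2.1]
    · nlinarith [h2.2 hlt, h1.1]
  have hpos' : ∀ c, si ≤ c → c < ei → 0 < -σ * cross v (Di c) := by
    intro c hc hc'
    have := hpos c hc hc'
    rw [cross_comm] at this
    linarith
  have hvi : linePt Bi Di m' r' - linePt Bi Di m r = -v := by
    have e1 := h.sum_eq
    have e2 := h'.sum_eq
    rw [hv]
    linear_combination e2 - e1
  have hz : -σ * cross v (linePt Bi Di m r) = -σ * cross v (linePt Bi Di m' r') := by
    have : cross v (linePt Bi Di m' r' - linePt Bi Di m r) = 0 := by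
      rw [hvi, cross_neg_right, cross_self, neg_zero]
    rw [cross_sub_right] at this
    rw [sub_eq_zero.1 this]
  have hcase : linePt Bi Di m r = linePt Bi Di m' r' := by
    rcases h.posLE_total h' with ⟨hp, hle⟩ | ⟨hp, hle⟩
    · have hm := cross_linePt_mono S.linki hpos' h.le h'.lt hp
      rcases hle.lt_or_eq with hlt' | heq
      · exact absurd hz (hm.2 hlt').ne
      · rcases hp with ⟨rfl, -⟩ | ⟨h1, h2, h3⟩
        · have : r = r' := by linarith
          rw [this]
        · have h4 : (m : ℝ) + 1 ≤ m' := by exact_mod_cast h1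
          have h5 : r = 1 := by linarith
          have h6 : r' = 0 := by linarith
          have h7 : m' = m + 1 := by
            have : (m' : ℝ) = m + 1 := by linarith
            exact_mod_cast this
          subst h7
          rw [h5, h6, linePt_succ (S.linki m h.le h'.lt)]
    · have hm := cross_linePt_mono S.linki hpos' h'.le h.lt hp
      rcases hle.lt_or_eq with hlt' | heq
      · exact absurd hz (hm.2 hlt').ne'
      · rcases hp with ⟨rfl, -⟩ | ⟨h1, h2, h3⟩
        · have : r = r' := by linarith
          rw [this]
        · have h4 : (m' : ℝ) + 1 ≤ m := by exact_mod_cast h1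
          have h5 : r' = 1 := by linarith
          have h6 : r = 0 := by linarith
          have h7 : m = m' + 1 := by
            have : (m : ℝ) = m' + 1 := by linarith
            exact_mod_cast this
          subst h7
          rw [h5, h6, linePt_succ (S.linki m' h'.le h.lt)]
  have hv0 : v = 0 := by
    rw [hcase, sub_self] at hvi
    exact neg_eq_zero.1 hvi.symm
  have := hpos m h.le h.lt
  rw [hv0, cross_zero_right, mul_zero] at this
  exact lt_irrefl _ this

/-- Within a pair of edges the first chain moves in a direction given by the slopes. -/
theorem Separated.first_mono (S : Separated Bi Di Bj Dj Bk Dk si ei sj ej sk ek σ)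
    {a b m m' : ℕ} {t u r t' u' r' : ℝ}
    (h : OnCurve Bi Di Bj Dj Bk Dk si ei a t b u m r)
    (h' : OnCurve Bi Di Bj Dj Bk Dk si ei a t' b u' m' r')
    (hb : sk ≤ b) (hb' : b < ek) (ht : t ≤ t') :
    (0 ≤ σ * cross (Dj a) (Dk b) → (m : ℝ) + r ≤ m' + r') ∧
      (σ * cross (Dj a) (Dk b) ≤ 0 → (m' : ℝ) + r' ≤ m + r) := by
  have hneg : ∀ c, si ≤ c → c < ei → 0 < σ * cross (Dk b) (Di c) := by
    intro c hc hc'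
    have := S.negk c b hc hc' hb hb'
    rw [cross_comm] at this
    linarith
  have hsum : σ * cross (Dk b) (linePt Bi Di m' r') - σ * cross (Dk b) (linePt Bi Di m r) =
      (t' - t) * (σ * cross (Dj a) (Dk b)) := by
    have e : linePt Bi Di m' r' - linePt Bi Di m r =
        -(((t' - t : ℝ) : ℂ) * Dj a + ((u' - u : ℝ) : ℂ) * Dk b) := by
      have e1 := h.sum_eq
      have e2 := h'.sum_eq
      simp only [linePt] at e1 e2 ⊢
      push_cast
      linear_combination e2 - e1
    rw [← mul_sub, ← cross_sub_right, e, cross_neg_right, cross_add_right, cross_smul_right,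
      cross_smul_right, cross_self, cross_comm (Dk b)]
    ring
  constructor
  · intro h0
    by_contra hlt
    rcases h.posLE_total h' with ⟨hp, hle⟩ | ⟨hp, -⟩
    · exact hlt hle
    · have := (cross_linePt_mono S.linki hneg h'.le h.lt hp).2 (not_le.1 hlt)
      nlinarith
  · intro h0
    by_contra hlt
    rcases h.posLE_total h' with ⟨hp, -⟩ | ⟨hp, hle⟩
    · have := (cross_linePt_mono S.linki hneg h.le h'.lt hp).2 (not_le.1 hlt)
      nlinarith
    · exact hlt hle

end

/-- The line through `x` with direction `d` meets the line of an edge. -/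
theorem line_inter {x d b e : ℂ} (h : cross d e ≠ 0) :
    x + ((-cross (x + b) e / cross d e : ℝ) : ℂ) * d +
      (b + ((-cross d (x + b) / cross d e : ℝ) : ℂ) * e) = 0 := by
  have key : ∀ v : ℂ, cross d e * v.re + -cross v e * d.re + -cross d v * e.re = 0 ∧
      cross d e * v.im + -cross v e * d.im + -cross d v * e.im = 0 := by
    intro v
    simp only [cross]
    constructor <;> ring
  obtain ⟨h1, h2⟩ := key (x + b)
  simp only [Complex.add_re, Complex.add_im] at h1 h2
  apply Complex.ext
  · simp only [Complex.add_re, Complex.mul_re, Complex.ofReal_re, Complex.ofReal_im,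
      Complex.zero_re, zero_mul, sub_zero]
    field_simp
    linarith
  · simp only [Complex.add_im, Complex.mul_im, Complex.ofReal_re, Complex.ofReal_im,
      Complex.zero_im, zero_mul, add_zero]
    field_simp
    linarith

end TriangleCover

/-! ## Names of the arrays -/

namespace TriangleCover

/-! Tables that are computed once. -/
local notation "aOff" => (201 : ℕ)
local notation "aLen" => (202 : ℕ)
local notation "aPow" => (203 : ℕ)
local notation "vLog" => (204 : ℕ)
local notation "vLeaves" => (205 : ℕ)
local notation "aCut" => (206 : ℕ)
local notation "aCutOff" => (207 : ℕ)
local notation "aBX" => (210 : ℕ)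
local notation "aBY" => (211 : ℕ)
local notation "aDX" => (212 : ℕ)
local notation "aDY" => (213 : ℕ)
local notation "aLo" => (214 : ℕ)
local notation "aHi" => (215 : ℕ)
local notation "aSign" => (216 : ℕ)

/-! Output: pieces of pairings, triples, and the number of pieces written. -/
local notation "aLE" => (13 : ℕ)
local notation "aRE" => (14 : ℕ)
local notation "aLlo" => (26 : ℕ)
local notation "aLhi" => (27 : ℕ)
local notation "aRlo" => (28 : ℕ)
local notation "aRhi" => (29 : ℕ)
local notation "vTrip" => (40 : ℕ)
local notation "vOut" => (15 : ℕ)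
local notation "aRole" => (16 : ℕ)

/-! Variables of a level and of a choice of roles for the arcs. -/
local notation "vHalf" => (300 : ℕ)
local notation "vI" => (301 : ℕ)
local notation "vJ" => (302 : ℕ)
local notation "vK" => (303 : ℕ)
local notation "vSide" => (304 : ℕ)
local notation "vRev" => (305 : ℕ)
local notation "vStart" => (306 : ℕ)
local notation "vOi" => (307 : ℕ)
local notation "vOj" => (308 : ℕ)
local notation "vOk" => (309 : ℕ)

/-! Variables of a node. -/
local notation "vBase" => (400 : ℕ)
local notation "vSi" => (401 : ℕ)
local notation "vEi" => (402 : ℕ)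
local notation "vSj" => (403 : ℕ)
local notation "vEj" => (404 : ℕ)
local notation "vSk" => (405 : ℕ)
local notation "vEk" => (406 : ℕ)
local notation "vMid" => (407 : ℕ)
local notation "vTop" => (408 : ℕ)
local notation "vXi" => (410 : ℕ)
local notation "vYi" => (411 : ℕ)
local notation "vXj" => (412 : ℕ)
local notation "vYj" => (413 : ℕ)

/-! Variables of a walk. -/
local notation "vA" => (500 : ℕ)
local notation "vB" => (501 : ℕ)
local notation "vFirst" => (502 : ℕ)
local notation "vPrev" => (503 : ℕ)
local notation "vNA" => (510 : ℕ)
local notation "vNB" => (511 : ℕ)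
local notation "vRec" => (512 : ℕ)
local notation "rT" => (513 : ℕ)
local notation "rU" => (514 : ℕ)
local notation "rNT" => (515 : ℕ)
local notation "rNU" => (516 : ℕ)
local notation "vM" => (600 : ℕ)
local notation "vBit" => (601 : ℕ)
local notation "vC" => (602 : ℕ)
local notation "rEX" => (604 : ℕ)
local notation "rEY" => (605 : ℕ)
local notation "rXX" => (606 : ℕ)
local notation "rXY" => (607 : ℕ)
local notation "vLoM" => (610 : ℕ)
local notation "vHiM" => (611 : ℕ)
local notation "vKB" => (612 : ℕ)
local notation "rMid" => (613 : ℕ)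
local notation "rLim" => (614 : ℕ)

/-- The vertex at which edge `m` of the chain stored at position `o` starts. -/
noncomputable def chB (s : Store) (o m : ℕ) : ℂ := ⟨s.real aBX (o + m), s.real aBY (o + m)⟩
/-- The direction of edge `m` of the chain stored at position `o`. -/
noncomputable def chD (s : Store) (o m : ℕ) : ℂ := ⟨s.real aDX (o + m), s.real aDY (o + m)⟩

/-! ## Search for the edge of a chain that meets a line -/

/-- The direction of the query line. -/
noncomputable def queryD (s : Store) : ℂ := ⟨s.real rEX 0, s.real rEY 0⟩
/-- The base point of the query line. -/
noncomputable def queryX (s : Store) : ℂ := ⟨s.real rXX 0, s.real rXY 0⟩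

/-- The cross product of the query direction and an edge. -/
def slopeExpr (m : NatExpr) : RealExpr :=
  rv rEX * .load aDY (nv vOi + m) - rv rEY * .load aDX (nv vOi + m)

/-- The cross product of the query direction and the vector to the start of an edge. -/
def offsetExpr (m : NatExpr) : RealExpr :=
  rv rEX * (rv rXY + .load aBY (nv vOi + m)) - rv rEY * (rv rXX + .load aBX (nv vOi + m))

/-- Finds the edge of the first chain that meets the query line. -/
def search : Prog :=
  nset vM (nv vSi) ;;
  nset vBit (nv vLog) ;;
  .loop (.natLt 0 (nv vBit)) (
    nset vBit (nv vBit - 1) ;;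
    nset vC (nv vM + .load aPow (nv vBit)) ;;
    .ite (.and (.natLt (nv vC) (nv vEi)) (.not (.realLt 0 (offsetExpr (nv vC) * slopeExpr (nv vC)))))
      (nset vM (nv vC))
      .skip)

theorem slopeExpr_eval (s : Store) (m : NatExpr) :
    (slopeExpr m).eval s = cross (queryD s) (chD s (s.nat vOi 0) (m.eval s)) := by
  simp [slopeExpr, cross, queryD, chD]

theorem search_spec (s : Store) {τ : ℝ} {si ei oi : ℕ} (hsi : s.nat vSi 0 = si)
    (hei : s.nat vEi 0 = ei) (hoi : s.nat vOi 0 = oi)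
    (hpow : ∀ k, k < s.nat vLog 0 → s.nat aPow k = 2 ^ k)
    (hlt : si < ei) (hlog : ei ≤ si + 2 ^ s.nat vLog 0)
    (link : ∀ m, si ≤ m → m + 1 < ei → chB s oi (m + 1) = chB s oi m + chD s oi m)
    (hτ : ∀ m, si ≤ m → m < ei → 0 < τ * cross (queryD s) (chD s oi m)) :
    Runs search s fun t s' => t ≤ 6 * s.nat vLog 0 + 3 ∧ si ≤ s'.nat vM 0 ∧ s'.nat vM 0 < ei ∧
      (si < s'.nat vM 0 → cross (queryD s) (queryX s + chB s oi (s'.nat vM 0)) *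
        cross (queryD s) (chD s oi (s'.nat vM 0)) ≤ 0) ∧
      (s'.nat vM 0 + 1 < ei → 0 < cross (queryD s) (queryX s + chB s oi (s'.nat vM 0 + 1)) *
        cross (queryD s) (chD s oi (s'.nat vM 0 + 1))) := by
  set C : ℕ → Prop := fun m => cross (queryD s) (queryX s + chB s oi m) *
    cross (queryD s) (chD s oi m) ≤ 0 with hC
  have hCiff : ∀ m, si ≤ m → m < ei →
      (C m ↔ τ * cross (queryD s) (queryX s + chB s oi m) ≤ 0) := by
    intro m h1 h2
    have h3 := hτ m h1 h2
    have h0 : τ ≠ 0 := by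
      rintro rfl
      simp at h3
    have h4 : 0 < τ * τ := mul_self_pos.2 h0
    simp only [hC]
    set f := cross (queryD s) (queryX s + chB s oi m)
    set g := cross (queryD s) (chD s oi m)
    have h5 : (τ * f) * (τ * g) = (τ * τ) * (f * g) := by ring
    constructor
    · intro h
      by_contra hh
      have := mul_pos (not_le.1 hh) h3
      nlinarith
    · intro h
      by_contra hh
      have := mul_nonpos_of_nonpos_of_nonneg h h3.le
      have h6 := mul_pos h4 (not_le.1 hh)
      linarith
  have hmono : ∀ c c', si ≤ c → c ≤ c' → c' < ei → C c' → C c := by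
    intro c c' hc hcc' hc' h
    induction c', hcc' using Nat.le_induction with
    | base => exact h
    | succ d hd ih =>
      refine ih (by omega) ?_
      rw [hCiff _ (by omega) (by omega)] at h ⊢
      rw [link d (by omega) hc', ← add_assoc, cross_add_right, mul_add] at h
      linarith [hτ d (by omega) (by omega)]
  refine runs_seq (runs_setNat (runs_seq (runs_setNat ?_)))
  refine (runs_loop (fun t s' => t + 6 * s'.nat vBit 0 ≤ 6 * s.nat vLog 0 ∧
    s'.nat vBit 0 ≤ s.nat vLog 0 ∧ si ≤ s'.nat vM 0 ∧
    s'.nat vM 0 < ei ∧ (si < s'.nat vM 0 → C (s'.nat vM 0)) ∧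
    ∀ c, s'.nat vM 0 + 2 ^ s'.nat vBit 0 ≤ c → c < ei → ¬ C c) (fun s' => s'.nat vBit 0)
    ?_ ?_).mono ?_
  · refine ⟨by simp, by simp, by simp [hsi], by simp [hsi, hlt], by simp [hsi], ?_⟩
    intro c hc hc'
    simp [hsi] at hc
    omega
  · intro t s' hF ⟨h1, h1', h2, h3, h4, h5⟩ hb
    have hb' : 0 < s'.nat vBit 0 := by simpa using hb
    have e1 : ∀ a, a < 600 → s'.nat a = s.nat a := by
      intro a ha
      have hw : Prog.writesNat
          (nset vBit (nv vBit - 1) ;;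
          nset vC (nv vM + .load aPow (nv vBit)) ;;
          .ite (.and (.natLt (nv vC) (nv vEi))
            (.not (.realLt 0 (offsetExpr (nv vC) * slopeExpr (nv vC)))))
            (nset vM (nv vC)) .skip) a = false := by
        simp [Prog.writesNat]
        omega
      rw [hF.1 a hw]
      funext i
      simp only [Store.setNat_nat]
      rw [if_neg (by omega), if_neg (by omega)]
    have e2 : s'.real = s.real := by
      funext a
      exact hF.2 a (by simp [Prog.writesReal])
    have hp : s'.nat aPow (s'.nat vBit 0 - 1) = 2 ^ (s'.nat vBit 0 - 1) := by
      rw [e1 _ (by norm_num)]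
      exact hpow _ (by omega)
    have h2p : (2 : ℕ) ^ s'.nat vBit 0 = 2 ^ (s'.nat vBit 0 - 1) + 2 ^ (s'.nat vBit 0 - 1) := by
      conv_lhs => rw [show s'.nat vBit 0 = (s'.nat vBit 0 - 1) + 1 by omega, pow_succ]
      omega
    refine runs_seq (runs_setNat (runs_seq (runs_setNat (runs_ite ?_ ?_))))
    · intro hb1
      refine runs_setNat ?_
      have hb2 : s'.nat vM 0 + 2 ^ (s'.nat vBit 0 - 1) < ei ∧
          C (s'.nat vM 0 + 2 ^ (s'.nat vBit 0 - 1)) := by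
        simpa [slopeExpr, offsetExpr, hC, cross, queryD, queryX, chB, chD, e2, hp, e1, hei, hoi]
          using hb1
      simp only [NatExpr.eval_load, NatExpr.eval_sub, NatExpr.eval_add, NatExpr.eval_zero, NatExpr.eval_one,
        Store.setNat_nat]
      simp only [hp, Nat.reduceEqDiff, and_self, if_true, if_false, false_and]
      refine ⟨⟨by omega, by omega, by omega, hb2.1, fun _ => hb2.2, ?_⟩, by omega⟩
      intro c hc
      exact h5 c (by omega)
    · intro hb1
      refine runs_skip ?_
      have hb2 : s'.nat vM 0 + 2 ^ (s'.nat vBit 0 - 1) < ei →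
          ¬ C (s'.nat vM 0 + 2 ^ (s'.nat vBit 0 - 1)) := by
        simpa [slopeExpr, offsetExpr, hC, cross, queryD, queryX, chB, chD, e2, hp, e1, hei, hoi]
          using hb1
      simp only [NatExpr.eval_load, NatExpr.eval_sub, NatExpr.eval_add, NatExpr.eval_zero, NatExpr.eval_one,
        Store.setNat_nat]
      simp only [hp, Nat.reduceEqDiff, and_self, if_true, if_false, false_and]
      refine ⟨⟨by omega, by omega, by omega, h3, h4, ?_⟩, by omega⟩
      intro c hc hc' hcC
      by_cases hlt' : s'.nat vM 0 + 2 ^ (s'.nat vBit 0 - 1) < ei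
      · exact hb2 hlt' (hmono _ c (by omega) hc hc' hcC)
      · omega
  · rintro t s' hF ⟨t', rfl, ⟨h1, h1', h2, h3, h4, h5⟩, hb⟩
    have hb' : s'.nat vBit 0 = 0 := by simpa using hb
    refine ⟨by omega, h2, h3, h4, fun h => ?_⟩
    have := h5 (s'.nat vM 0 + 1) (by simp [hb']) h
    simpa only [hC, not_le] using this

/-! ## Leaving a pair of edges -/

/-- The lower end of the parameters of an edge. -/
noncomputable def chLo (s : Store) (o m : ℕ) : ℝ := s.real aLo (o + m)
/-- The upper end of the parameters of an edge. -/
noncomputable def chHi (s : Store) (o m : ℕ) : ℝ := s.real aHi (o + m)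

/-- The parameter ranges of the edges `sj, …, ej - 1` fit together to a connected chain. -/
structure GoodParams (lo hi : ℕ → ℝ) (sj ej : ℕ) : Prop where
  lo_nonneg : ∀ a, sj ≤ a → a < ej → 0 ≤ lo a
  lo_lt_hi : ∀ a, sj ≤ a → a < ej → lo a < hi a
  hi_le : ∀ a, sj ≤ a → a < ej → hi a ≤ 1
  lo_eq : ∀ a, sj < a → a < ej → lo a = 0
  hi_eq : ∀ a, sj ≤ a → a + 1 < ej → hi a = 1

/-- The memory holds the parameters of a walk over pairs of edges of two chains. -/
structure Setup (s : Store) (oi oj ok si ei sj ej sk ek : ℕ) (σ : ℝ) : Prop where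
  hoi : s.nat vOi 0 = oi
  hoj : s.nat vOj 0 = oj
  hok : s.nat vOk 0 = ok
  hsi : s.nat vSi 0 = si
  hei : s.nat vEi 0 = ei
  hsj : s.nat vSj 0 = sj
  hej : s.nat vEj 0 = ej
  hsk : s.nat vSk 0 = sk
  hek : s.nat vEk 0 = ek
  hpow : ∀ k, k < s.nat vLog 0 → s.nat aPow k = 2 ^ k
  hlog : ei ≤ si + 2 ^ s.nat vLog 0
  hlt : si < ei
  sep : Separated (chB s oi) (chD s oi) (chB s oj) (chD s oj) (chB s ok) (chD s ok)
    si ei sj ej sk ek σ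
  rangei : GoodParams (chLo s oi) (chHi s oi) si ei
  rangej : GoodParams (chLo s oj) (chHi s oj) sj ej
  rangek : GoodParams (chLo s ok) (chHi s ok) sk ek

theorem chB_congr {s s' : Store} {N : ℕ} (h : Agree N s s') (hN : 300 ≤ N) (o : ℕ) :
    chB s' o = chB s o := by
  funext m
  simp only [chB, (h aBX (by norm_num) (by omega)).2, (h aBY (by norm_num) (by omega)).2]

theorem chD_congr {s s' : Store} {N : ℕ} (h : Agree N s s') (hN : 300 ≤ N) (o : ℕ) :
    chD s' o = chD s o := by
  funext m
  simp only [chD, (h aDX (by norm_num) (by omega)).2, (h aDY (by norm_num) (by omega)).2]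

theorem chLo_congr {s s' : Store} {N : ℕ} (h : Agree N s s') (hN : 300 ≤ N) (o : ℕ) :
    chLo s' o = chLo s o := by
  funext m
  simp only [chLo, (h aLo (by norm_num) (by omega)).2]

theorem chHi_congr {s s' : Store} {N : ℕ} (h : Agree N s s') (hN : 300 ≤ N) (o : ℕ) :
    chHi s' o = chHi s o := by
  funext m
  simp only [chHi, (h aHi (by norm_num) (by omega)).2]

theorem Setup.congr {s s' : Store} {oi oj ok si ei sj ej sk ek : ℕ} {σ : ℝ}
    (h : Setup s oi oj ok si ei sj ej sk ek σ) (hA : Agree 500 s s') :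
    Setup s' oi oj ok si ei sj ej sk ek σ := by
  have e : ∀ a, 200 ≤ a → a < 500 → s'.nat a = s.nat a := fun a h₁ h₂ => (hA a h₁ h₂).1
  constructor
  case sep =>
    simpa only [chB_congr hA (by norm_num : 300 ≤ 500), chD_congr hA (by norm_num : 300 ≤ 500)]
      using h.sep
  case rangei => simpa only [chLo_congr hA (by norm_num : 300 ≤ 500), chHi_congr hA (by norm_num : 300 ≤ 500)]
      using h.rangei
  case rangej => simpa only [chLo_congr hA (by norm_num : 300 ≤ 500), chHi_congr hA (by norm_num : 300 ≤ 500)]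
      using h.rangej
  case rangek => simpa only [chLo_congr hA (by norm_num : 300 ≤ 500), chHi_congr hA (by norm_num : 300 ≤ 500)]
      using h.rangek
  case hlt => exact h.hlt
  all_goals
    simp only [e, Nat.reduceLeDiff, Nat.reduceLT]
  exacts [h.hoi, h.hoj, h.hok, h.hsi, h.hei, h.hsj, h.hej, h.hsk, h.hek, h.hpow, h.hlog]

/-- Intersects the line of an edge of one chain, translated by the end of an edge of another chain,
with the first chain; the parameter on the line goes to the variable `r`. -/
def meet (o a o' b r : ℕ) : Prog :=
  rset rEX (.load aDX (nv o + nv a)) ;;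
  rset rEY (.load aDY (nv o + nv a)) ;;
  rset rXX (.load aBX (nv o + nv a) + (.load aBX (nv o' + nv b) +
    .load aHi (nv o' + nv b) * .load aDX (nv o' + nv b))) ;;
  rset rXY (.load aBY (nv o + nv a) + (.load aBY (nv o' + nv b) +
    .load aHi (nv o' + nv b) * .load aDY (nv o' + nv b))) ;;
  search ;;
  rset r (((rv rXY + .load aBY (nv vOi + nv vM)) * .load aDX (nv vOi + nv vM) -
    (rv rXX + .load aBX (nv vOi + nv vM)) * .load aDY (nv vOi + nv vM)) / slopeExpr (nv vM))

theorem meet_spec {o a o' b r : ℕ} (s : Store) {oi oj ok si ei sj ej sk ek : ℕ} {σ : ℝ}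
    (hsi : s.nat vSi 0 = si) (hei : s.nat vEi 0 = ei) (hoi : s.nat vOi 0 = oi)
    (hpow : ∀ k, k < s.nat vLog 0 → s.nat aPow k = 2 ^ k)
    (hlt : si < ei) (hlog : ei ≤ si + 2 ^ s.nat vLog 0)
    (sep : Separated (chB s oi) (chD s oi) (chB s oj) (chD s oj) (chB s ok) (chD s ok)
      si ei sj ej sk ek σ)
    (ho : s.nat o 0 = oj) (ho' : s.nat o' 0 = ok) (ha : sj ≤ s.nat a 0) (ha' : s.nat a 0 < ej) :
    Runs (meet o a o' b r) s fun t s' => t ≤ 6 * s.nat vLog 0 + 8 ∧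
      ∃ q, OnCurve (chB s oi) (chD s oi) (chB s oj) (chD s oj) (chB s ok) (chD s ok) si ei
        (s.nat a 0) (s'.real r 0) (s.nat b 0) (chHi s ok (s.nat b 0)) (s'.nat vM 0) q ∧
        (s'.nat vM 0 + 1 < ei → q < 1) := by
  refine runs_seq (runs_setReal (runs_seq (runs_setReal (runs_seq (runs_setReal
    (runs_seq (runs_setReal ?_)))))))
  set s₁ := ((((s.setReal rEX _ _).setReal rEY _ _).setReal rXX _ _).setReal rXY _ _) with hs₁
  have hn : s₁.nat = s.nat := rfl
  have hr : ∀ c, c < 600 → s₁.real c = s.real c := by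
    intro c hc
    funext i
    simp only [hs₁, Store.setReal_real]
    repeat rw [if_neg (by omega)]
  have hB : ∀ o, chB s₁ o = chB s o := by
    intro o
    funext m
    simp only [chB, hr aBX (by norm_num), hr aBY (by norm_num)]
  have hD : ∀ o, chD s₁ o = chD s o := by
    intro o
    funext m
    simp only [chD, hr aDX (by norm_num), hr aDY (by norm_num)]
  have hqd : queryD s₁ = chD s oj (s.nat a 0) := by
    simp [queryD, hs₁, chD, ho]
  have hqx : queryX s₁ = chB s oj (s.nat a 0) +
      linePt (chB s ok) (chD s ok) (s.nat b 0) (chHi s ok (s.nat b 0)) := by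
    apply Complex.ext <;> simp [queryX, hs₁, chD, chB, chHi, linePt, ho, ho']
  have hτ : ∀ m, si ≤ m → m < ei → 0 < -σ * cross (queryD s₁) (chD s₁ oi m) := by
    intro m h1 h2
    have := sep.posj m _ h1 h2 ha ha'
    rw [cross_comm] at this
    rw [hqd, hD]
    linarith
  refine (search_spec s₁ (si := si) (ei := ei) (oi := oi) (by rw [hn, hsi]) (by rw [hn, hei])
    (by rw [hn, hoi]) (by rwa [hn]) hlt (by rwa [hn])
    (by simpa only [hB, hD] using sep.linki) hτ).seq ?_
  rintro t s₂ hF ⟨h1, h2, h3, h4, h5⟩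
  refine runs_setReal ?_
  have hF1 : ∀ c, c < 600 → s₂.nat c = s.nat c := by
    intro c hc
    rw [hF.1 c _, hn]
    simp [search, Prog.writesNat]
    omega
  have hF2 : s₂.real = s₁.real := by
    funext c
    exact hF.2 c (by simp [search, Prog.writesReal])
  rw [hn] at h1
  rw [hqd, hqx] at h4 h5
  simp only [hB, hD] at h4 h5 hτ
  rw [hqd] at hτ
  set m := s₂.nat vM 0 with hm
  have hg := hτ m h2 h3
  have hg0 : cross (chD s oj (s.nat a 0)) (chD s oi m) ≠ 0 := by
    intro h0
    simp [h0] at hg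
  set x := chB s oj (s.nat a 0) +
    linePt (chB s ok) (chD s ok) (s.nat b 0) (chHi s ok (s.nat b 0)) with hx
  set d := chD s oj (s.nat a 0)
  have hval : RealExpr.eval s₂ (((rv rXY + .load aBY (nv vOi + nv vM)) * .load aDX (nv vOi + nv vM) -
      (rv rXX + .load aBX (nv vOi + nv vM)) * .load aDY (nv vOi + nv vM)) / slopeExpr (nv vM)) =
      -cross (x + chB s oi m) (chD s oi m) / cross d (chD s oi m) := by
    have e1 : queryD s₂ = d := by rw [← hqd]; simp only [queryD, hF2]
    have e2 : queryX s₂ = x := by rw [← hqx]; simp only [queryX, hF2]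
    have e3 : chD s₂ oi m = chD s oi m := by rw [← hD]; simp only [chD, hF2]
    have e4 : chB s₂ oi m = chB s oi m := by rw [← hB]; simp only [chB, hF2]
    have e5 : s₂.nat vOi 0 = oi := by rw [hF1 _ (by norm_num), hoi]
    rw [← e2, ← e3, ← e4, RealExpr.eval_div, slopeExpr_eval]
    simp only [RealExpr.eval_sub, RealExpr.eval_mul, RealExpr.eval_add, RealExpr.eval_load,
      NatExpr.eval_add, NatExpr.eval_load, NatExpr.eval_zero, e5, e1, ← hm]
    congr 1
    simp only [cross, queryX, chB, chD, Complex.add_re, Complex.add_im]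
    ring
  rw [hval]
  simp only [Store.setReal_nat, Store.setReal_real, NatExpr.eval_zero, and_self, if_true, ← hm]
  refine ⟨by omega, -cross d (x + chB s oi m) / cross d (chD s oi m),
    ⟨?_, h2, h3, ?_, ?_⟩, ?_⟩
  · have := line_inter (x := x) (d := d) (b := chB s oi m) (e := chD s oi m) hg0
    rw [← this, hx]
    simp only [linePt, d]
    ring
  · intro h
    have := h4 h
    rw [div_eq_mul_inv, neg_mul, neg_nonneg, ← div_eq_mul_inv]
    have h0 : cross d (x + chB s oi m) / cross d (chD s oi m) =
      (cross d (x + chB s oi m) * cross d (chD s oi m)) / cross d (chD s oi m) ^ 2 := by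
      field_simp
    rw [h0]
    exact div_nonpos_of_nonpos_of_nonneg this (sq_nonneg _)
  all_goals
    intro h
    have h6 := h5 h
    rw [sep.linki m h2 h, ← add_assoc, cross_add_right] at h6
    have h7 := hτ (m + 1) (by omega) h
    set g := cross d (chD s oi m)
    set g' := cross d (chD s oi (m + 1))
    have h8 : 0 < (cross d (x + chB s oi m) + g) / g := by
      have e : (cross d (x + chB s oi m) + g) / g =
        ((cross d (x + chB s oi m) + g) * g') * ((-σ * g) * (-σ * g')) / ((-σ * g) * (-σ * g)
          * (g' * g') ) * ( (-σ * g) * (-σ * g))/ ((-σ * g) * (-σ * g)) := by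
        have hσ : σ ≠ 0 := by
          rintro rfl
          simp at hg
        have hg' : g' ≠ 0 := by
          intro h0
          simp [h0] at h7
        field_simp
      rw [e]
      have hg' : g' ≠ 0 := by
        intro h0
        simp [h0] at h7
      have : 0 < g' * g' := mul_self_pos.2 hg'
      positivity
    rw [add_div, div_self hg0] at h8
    rw [neg_div]
    linarith

/-- The curve leaves the pair of edges `(a, b)` at the point with parameters `t`, `u`; the walk goes
on to the pair `(na, nb)`, where the point has the parameters `nt`, `nu`. -/
structure IsExit (Bi Di Bj Dj Bk Dk : ℕ → ℂ) (si ei : ℕ) (loj hij lok hik : ℝ) (a b m : ℕ)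
    (t u : ℝ) (na nb : ℕ) (nt nu : ℝ) (rec : ℕ) : Prop where
  curve : ∃ q, OnCurve Bi Di Bj Dj Bk Dk si ei a t b u m q ∧ (m + 1 < ei → q < 1)
  cases : (t < hij ∧ u = hik ∧ na = a ∧ nb = b + 1 ∧ nt = t ∧ nu = 0 ∧
      (rec = 1 ∧ loj < t ∨ rec = 0 ∧ t ≤ loj)) ∨
    (t = hij ∧ u < hik ∧ na = a + 1 ∧ nb = b ∧ nt = 0 ∧ nu = u ∧
      (rec = 1 ∧ lok < u ∨ rec = 0 ∧ u ≤ lok)) ∨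
    (t = hij ∧ u = hik ∧ na = a + 1 ∧ nb = b + 1 ∧ nt = 0 ∧ nu = 0 ∧ rec = 1)

/-- Computes where the curve leaves the pair of edges. -/
def leave : Prog :=
  meet vOj vA vOk vB rT ;;
  .ite (.realLt (rv rT) (.load aHi (nv vOj + nv vA)))
    (rset rU (.load aHi (nv vOk + nv vB)) ;;
      nset vNA (nv vA) ;; nset vNB (nv vB + 1) ;; rset rNT (rv rT) ;; rset rNU 0 ;;
      .ite (.realLt (.load aLo (nv vOj + nv vA)) (rv rT)) (nset vRec 1) (nset vRec 0))
    (.ite (.realLt (.load aHi (nv vOj + nv vA)) (rv rT))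
      (rset rT (.load aHi (nv vOj + nv vA)) ;;
        meet vOk vB vOj vA rU ;;
        nset vNA (nv vA + 1) ;; nset vNB (nv vB) ;; rset rNT 0 ;; rset rNU (rv rU) ;;
        .ite (.realLt (.load aLo (nv vOk + nv vB)) (rv rU)) (nset vRec 1) (nset vRec 0))
      (rset rU (.load aHi (nv vOk + nv vB)) ;;
        nset vNA (nv vA + 1) ;; nset vNB (nv vB + 1) ;; rset rNT 0 ;; rset rNU 0 ;;
        nset vRec 1))

theorem leave_spec (s : Store) {oi oj ok si ei sj ej sk ek : ℕ} {σ : ℝ}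
    (S : Setup s oi oj ok si ei sj ej sk ek σ) {a b : ℕ} (ha : s.nat vA 0 = a)
    (hb : s.nat vB 0 = b) (hsj : sj ≤ a) (hej : a < ej) (hsk : sk ≤ b) (hek : b < ek) :
    Runs leave s fun t s' => t ≤ 12 * s.nat vLog 0 + 30 ∧
      IsExit (chB s oi) (chD s oi) (chB s oj) (chD s oj) (chB s ok) (chD s ok) si ei
        (chLo s oj a) (chHi s oj a) (chLo s ok b) (chHi s ok b) a b (s'.nat vM 0)
        (s'.real rT 0) (s'.real rU 0) (s'.nat vNA 0) (s'.nat vNB 0) (s'.real rNT 0)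
        (s'.real rNU 0) (s'.nat vRec 0) := by
  refine (meet_spec s S.hsi S.hei S.hoi S.hpow S.hlt S.hlog S.sep S.hoj S.hok
    (by rw [ha]; exact hsj) (by rw [ha]; exact hej)).seq ?_
  rintro t s₁ hF ⟨ht, q, hq, hq1⟩
  rw [ha, hb] at hq
  have hA : Agree 500 s s₁ := hF.agree 500 (by decide)
  have S₁ := S.congr hA
  have ha₁ : s₁.nat vA 0 = a := by rw [hF.1 vA (by decide), ha]
  have hb₁ : s₁.nat vB 0 = b := by rw [hF.1 vB (by decide), hb]
  have eHi : ∀ x, s₁.real aHi x = s.real aHi x := fun x => by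
    rw [(hA aHi (by norm_num) (by norm_num)).2]
  have eLo : ∀ x, s₁.real aLo x = s.real aLo x := fun x => by
    rw [(hA aLo (by norm_num) (by norm_num)).2]
  refine runs_ite ?_ ?_
  · intro h1
    have h1' : s₁.real rT 0 < chHi s oj a := by simpa [chHi, chLo, S₁.hoj, ha₁, eHi] using h1
    refine runs_seq (runs_setReal (runs_seq (runs_setNat (runs_seq (runs_setNat
      (runs_seq (runs_setReal (runs_seq (runs_setReal (runs_ite ?_ ?_))))))))))
    · intro h2
      have h2' : chLo s oj a < s₁.real rT 0 := by simpa [chHi, chLo, S₁.hoj, ha₁, eLo] using h2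
      refine runs_setNat ⟨by omega, ?_, ?_⟩
      · refine ⟨q, ?_, ?_⟩
        · simpa [chHi, S₁.hok, hb₁, eHi] using hq
        · simpa using hq1
      · left
        simp [S₁.hok, hb₁, ha₁, eHi, chHi, h2']
        exact h1'
    · intro h2
      have h2' : s₁.real rT 0 ≤ chLo s oj a := by simpa [chHi, chLo, S₁.hoj, ha₁, eLo] using h2
      refine runs_setNat ⟨by omega, ?_, ?_⟩
      · refine ⟨q, ?_, ?_⟩
        · simpa [chHi, S₁.hok, hb₁, eHi] using hq
        · simpa using hq1
      · left
        simp [S₁.hok, hb₁, ha₁, eHi, chHi, h2']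
        exact h1'
  · intro h1
    have h1' : chHi s oj a ≤ s₁.real rT 0 := by simpa [chHi, chLo, S₁.hoj, ha₁, eHi] using h1
    refine runs_ite ?_ ?_
    · intro h2
      have h2' : chHi s oj a < s₁.real rT 0 := by simpa [chHi, chLo, S₁.hoj, ha₁, eHi] using h2
      refine runs_seq (runs_setReal ?_)
      set s₂ := s₁.setReal rT _ _ with hs₂
      have hn₂ : s₂.nat = s₁.nat := rfl
      have hA₂ : Agree 500 s s₂ := by
        intro x hx hx'
        refine ⟨(hA x hx hx').1, ?_⟩
        rw [← (hA x hx hx').2]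
        funext i
        simp only [hs₂, Store.setReal_real]
        rw [if_neg (by omega)]
      have S₂ := S.congr hA₂
      have eT : s₂.real rT 0 = chHi s oj a := by
        simp [hs₂, S₁.hoj, ha₁, eHi, chHi]
      refine (meet_spec s₂ S₂.hsi S₂.hei S₂.hoi S₂.hpow S₂.hlt S₂.hlog S₂.sep.symm S₂.hok S₂.hoj
        (by rw [hn₂, hb₁]; exact hsk) (by rw [hn₂, hb₁]; exact hek)).seq ?_
      rintro t' s₃ hF₃ ⟨ht', q', hq', hq1'⟩
      rw [hn₂, ha₁, hb₁] at hq'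
      rw [hn₂, (hA vLog (by norm_num) (by norm_num)).1] at ht'
      have hA₃ : Agree 500 s₂ s₃ := hF₃.agree 500 (by decide)
      have S₃ := S₂.congr hA₃
      have ha₃ : s₃.nat vA 0 = a := by rw [hF₃.1 vA (by decide), hn₂, ha₁]
      have hb₃ : s₃.nat vB 0 = b := by rw [hF₃.1 vB (by decide), hn₂, hb₁]
      have eT₃ : s₃.real rT 0 = chHi s oj a := by rw [hF₃.2 rT (by decide), eT]
      have eLo₃ : ∀ x, s₃.real aLo x = s.real aLo x := fun x => by
        rw [((hA₂.trans hA₃) aLo (by norm_num) (by norm_num)).2]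
      simp only [chB_congr hA₂ (by norm_num), chD_congr hA₂ (by norm_num),
        chHi_congr hA₂ (by norm_num)] at hq'
      have hu : s₃.real rU 0 < chHi s ok b := by
        by_contra hu
        exact S.sep.not_cross hq'.symm hq hsj hej hek hsk (Or.inl ⟨rfl, h2'.le⟩)
          (Or.inl ⟨rfl, not_lt.1 hu⟩) (Or.inl (by linarith))
      refine runs_seq (runs_setNat (runs_seq (runs_setNat (runs_seq (runs_setReal
        (runs_seq (runs_setReal (runs_ite ?_ ?_))))))))
      · intro h3
        have h3' : chLo s ok b < s₃.real rU 0 := by simpa [chHi, chLo, S₃.hok, hb₃, eLo₃] using h3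
        refine runs_setNat ⟨by omega, ?_, ?_⟩
        · refine ⟨q', ?_, ?_⟩
          · simpa [eT₃] using hq'.symm
          · simpa using hq1'
        · right; left
          simp [hb₃, ha₃, eT₃, hu, h3']
      · intro h3
        have h3' : s₃.real rU 0 ≤ chLo s ok b := by simpa [chHi, chLo, S₃.hok, hb₃, eLo₃] using h3
        refine runs_setNat ⟨by omega, ?_, ?_⟩
        · refine ⟨q', ?_, ?_⟩
          · simpa [eT₃] using hq'.symm
          · simpa using hq1'
        · right; left
          simp [hb₃, ha₃, eT₃, hu, h3']
    · intro h2
      have h2' : s₁.real rT 0 ≤ chHi s oj a := by simpa [chHi, chLo, S₁.hoj, ha₁, eHi] using h2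
      have heq : s₁.real rT 0 = chHi s oj a := le_antisymm h2' h1'
      refine runs_seq (runs_setReal (runs_seq (runs_setNat (runs_seq (runs_setNat
        (runs_seq (runs_setReal (runs_seq (runs_setReal (runs_setNat ⟨by omega, ?_, ?_⟩))))))))))
      · refine ⟨q, ?_, ?_⟩
        · simpa [chHi, S₁.hok, hb₁, eHi] using hq
        · simpa using hq1
      · right; right
        simp [S₁.hok, hb₁, ha₁, eHi, chHi, heq]

/-! ## The points of the curve that the walk has not met -/

section
variable {Bi Di Bj Dj Bk Dk : ℕ → ℂ} {si ei sj ej sk ek : ℕ} {σ : ℝ}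

/-- The point with parameters `t'`, `u'` on the edges `a'`, `b'` has not been passed by a walk that
has entered the pair of edges `(a, b)` at the parameters `t`, `u`. -/
structure Ahead (a b : ℕ) (t u : ℝ) (a' b' : ℕ) (t' u' : ℝ) : Prop where
  left : PosLE a t a' t'
  right : PosLE b u b' u'

theorem PosLE.le {a a' : ℕ} {t t' : ℝ} (h : PosLE a t a' t') : a ≤ a' := by
  rcases h with ⟨rfl, -⟩ | ⟨h, -⟩
  · exact le_rfl
  · exact h.le

theorem Ahead.symm {a b a' b' : ℕ} {t u t' u' : ℝ} (h : Ahead a b t u a' b' t' u') :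
    Ahead b a u t b' a' u' t' := ⟨h.right, h.left⟩

/-- A step of the walk through the end of the edge of the third chain: a point ahead lies in the
current pair of edges before the exit, or is ahead afterwards. -/
theorem Separated.ahead_up (S : Separated Bi Di Bj Dj Bk Dk si ei sj ej sk ek σ)
    {loj hij lok hik : ℕ → ℝ} (Gj : GoodParams loj hij sj ej) (Gk : GoodParams lok hik sk ek)
    {a b m m' a' b' : ℕ} {t u q t' u' q' t₀ u₀ : ℝ}
    (hsj : sj ≤ a) (hsk : sk ≤ b) (hek : b < ek)
    (h : OnCurve Bi Di Bj Dj Bk Dk si ei a t b u m q) (ht : t ≤ hij a) (hu : u = hik b)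
    (hP : OnCurve Bi Di Bj Dj Bk Dk si ei a' t' b' u' m' q')
    (ha' : a' < ej) (hb' : b' < ek) (hlo : loj a' ≤ t') (hhi : t' ≤ hij a') (hlo' : lok b' ≤ u')
    (hhi' : u' ≤ hik b') (A : Ahead a b t₀ u₀ a' b' t' u') :
    (b' = b ∧ (a' = a ∧ t' ≤ t ∨ a' = a + 1 ∧ t = 1 ∧ t' = 0 ∧ u' = u)) ∨
      (b < b' ∧ PosLE a t a' t' ∧ PosLE (b + 1) 0 b' u') := by
  have haa := A.left.le
  have hbb := A.right.le
  have hlo0 := Gj.lo_nonneg a' (by omega) ha'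
  have hj1 := Gj.hi_le a hsj (by omega)
  have hmain : ¬ (PosLE a t a' t' ∧ PosLE b' u' b u ∧
      ((a : ℝ) + t < a' + t' ∨ (b' : ℝ) + u' < b + u)) := fun hh =>
    S.not_cross h hP hsj ha' hek (by omega) hh.1 hh.2.1 hh.2.2
  rcases hbb.eq_or_lt with rfl | hlt
  · left
    refine ⟨rfl, ?_⟩
    have hle : PosLE b u' b u := Or.inl ⟨rfl, hu ▸ hhi'⟩
    rcases haa.eq_or_lt with rfl | hlt'
    · left
      refine ⟨rfl, ?_⟩
      by_contra hc
      exact hmain ⟨Or.inl ⟨rfl, (not_le.1 hc).le⟩, hle, Or.inl (by linarith)⟩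
    · right
      have hp : PosLE a t a' t' := Or.inr ⟨hlt', by linarith, by linarith⟩
      have h1 : (a : ℝ) + 1 ≤ a' := by exact_mod_cast hlt'
      have h2 : ¬ ((a : ℝ) + t < a' + t') := fun hc => hmain ⟨hp, hle, Or.inl hc⟩
      have h3 : (a' : ℝ) = a + 1 := by linarith
      refine ⟨by exact_mod_cast h3, by linarith, by linarith, ?_⟩
      by_contra hc
      have : u' < u := lt_of_le_of_ne (hu ▸ hhi') hc
      exact hmain ⟨hp, hle, Or.inr (by linarith)⟩
  · right
    have hlk0 := Gk.lo_nonneg b' (by omega) hb'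
    refine ⟨hlt, ?_, ?_⟩
    · rcases haa.eq_or_lt with rfl | hlt'
      · left
        refine ⟨rfl, ?_⟩
        by_contra hc
        have hk1 := Gk.hi_le b hsk hek
        refine S.not_cross hP h (by omega) (by omega) hb' hsk (Or.inl ⟨rfl, (not_le.1 hc).le⟩)
          (Or.inr ⟨hlt, by linarith, by linarith⟩) (Or.inl (by linarith))
      · exact Or.inr ⟨hlt', by linarith, by linarith⟩
    · rcases (Nat.succ_le_of_lt hlt).eq_or_lt with he | hlt'
      · exact Or.inl ⟨he, by linarith⟩
      · exact Or.inr ⟨hlt', by norm_num, by linarith⟩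

end

/-- The point `z` is on edge `a` of a part of a chain, with parameter `t`. -/
structure IsRep (B D : ℕ → ℂ) (lo hi : ℕ → ℝ) (sj ej : ℕ) (z : ℂ) (a : ℕ) (t : ℝ) : Prop where
  le : sj ≤ a
  lt : a < ej
  lo_le : lo a ≤ t
  le_hi : t ≤ hi a
  eq : linePt B D a t = z

theorem IsRep.posLE_lo {B D : ℕ → ℂ} {lo hi : ℕ → ℝ} {sj ej : ℕ} {z : ℂ} {a a' : ℕ} {t : ℝ}
    (h : IsRep B D lo hi sj ej z a' t) (G : GoodParams lo hi sj ej) (hs : sj ≤ a) (ha : a ≤ a') :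
    PosLE a (lo a) a' t := by
  rcases ha.eq_or_lt with rfl | hlt
  · exact Or.inl ⟨rfl, h.lo_le⟩
  · exact Or.inr ⟨hlt, (G.lo_lt_hi a hs (hlt.trans h.lt)).le.trans (G.hi_le a hs (hlt.trans h.lt)),
      (G.lo_nonneg a' h.le h.lt).trans h.lo_le⟩

section
variable {Bi Di Bj Dj Bk Dk : ℕ → ℂ} {si ei sj ej sk ek : ℕ} {σ : ℝ}
  {loi hii loj hij lok hik : ℕ → ℝ} {zi zj zk : ℂ}

theorem onCurve_of_isRep (Gi : GoodParams loi hii si ei) {a b m : ℕ} {t u q : ℝ}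
    (hz : zi + zj + zk = 0) (hi : IsRep Bi Di loi hii si ei zi m q)
    (hj : linePt Bj Dj a t = zj) (hk : linePt Bk Dk b u = zk) :
    OnCurve Bi Di Bj Dj Bk Dk si ei a t b u m q :=
  ⟨by rw [hi.eq, hj, hk, ← hz]; ring, hi.le, hi.lt,
    fun _ => (Gi.lo_nonneg m hi.le hi.lt).trans hi.lo_le,
    fun _ => hi.le_hi.trans (Gi.hi_le m hi.le hi.lt)⟩

/-- After a step of the walk, a point ahead has been passed within the pair of edges just left, or
it is still ahead. -/
theorem IsExit.ahead_step (S : Separated Bi Di Bj Dj Bk Dk si ei sj ej sk ek σ)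
    (Gi : GoodParams loi hii si ei) (Gj : GoodParams loj hij sj ej) (Gk : GoodParams lok hik sk ek)
    {a b m na nb rec : ℕ} {t u nt nu t₀ u₀ : ℝ}
    (E : IsExit Bi Di Bj Dj Bk Dk si ei (loj a) (hij a) (lok b) (hik b) a b m t u na nb nt nu rec)
    (hsj : sj ≤ a) (hej : a < ej) (hsk : sk ≤ b) (hek : b < ek)
    (hz : zi + zj + zk = 0) {m' : ℕ} {q' : ℝ} (hi : IsRep Bi Di loi hii si ei zi m' q')
    (h₀ : t₀ ≤ hij a) (h₀' : u₀ ≤ hik b)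
    {a' b' : ℕ} {t' u' : ℝ} (hj : IsRep Bj Dj loj hij sj ej zj a' t')
    (hk : IsRep Bk Dk lok hik sk ek zk b' u') (A : Ahead a b t₀ u₀ a' b' t' u') :
    (∃ t₁ u₁, IsRep Bj Dj loj hij sj ej zj a t₁ ∧ IsRep Bk Dk lok hik sk ek zk b u₁ ∧
      t₀ ≤ t₁ ∧ t₁ ≤ t ∧ u₀ ≤ u₁ ∧ u₁ ≤ u) ∨ Ahead na nb nt nu a' b' t' u' := by
  obtain ⟨q, hq, -⟩ := E.curve
  have hP := onCurve_of_isRep (Bj := Bj) (Dj := Dj) (Bk := Bk) (Dk := Dk) Gi hz hi hj.eq hk.eq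
  have cell : a' = a → b' = b → t' ≤ t → u' ≤ u →
      ∃ t₁ u₁, IsRep Bj Dj loj hij sj ej zj a t₁ ∧ IsRep Bk Dk lok hik sk ek zk b u₁ ∧
      t₀ ≤ t₁ ∧ t₁ ≤ t ∧ u₀ ≤ u₁ ∧ u₁ ≤ u := by
    rintro rfl rfl h1 h2
    refine ⟨t', u', hj, hk, ?_, h1, ?_, h2⟩
    · rcases A.left with ⟨-, h⟩ | ⟨h, -⟩
      · exact h
      · exact absurd h (lt_irrefl _)
    · rcases A.right with ⟨-, h⟩ | ⟨h, -⟩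
      · exact h
      · exact absurd h (lt_irrefl _)
  have h1j := Gj.hi_le a hsj hej
  have h1k := Gk.hi_le b hsk hek
  have up : t ≤ hij a → u = hik b → _ := fun e1 e2 => S.ahead_up Gj Gk hsj hsk hek hq e1 e2 hP
    hj.lt hk.lt hj.lo_le hj.le_hi hk.lo_le hk.le_hi A
  have right : u ≤ hik b → t = hij a → _ := fun e1 e2 => S.symm.ahead_up Gk Gj hsk hsj hej hq.symm
    e1 e2 hP.symm hk.lt hj.lt hk.lo_le hk.le_hi hj.lo_le hj.le_hi A.symm
  rcases E.cases with ⟨h1, h2, h3, h4, h5, h6, -⟩ | ⟨h1, h2, h3, h4, h5, h6, -⟩ |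
    ⟨h1, h2, h3, h4, h5, h6, -⟩
  · rcases up h1.le h2 with ⟨e1, ⟨e2, e3⟩ | ⟨-, e3, -⟩⟩ | ⟨-, e2, e3⟩
    · subst e1
      exact Or.inl (cell e2 rfl e3 (h2 ▸ hk.le_hi))
    · linarith
    · subst h3 h4 h5 h6
      exact Or.inr ⟨e2, e3⟩
  · rcases right h2.le h1 with ⟨e1, ⟨e2, e3⟩ | ⟨-, e3, -⟩⟩ | ⟨-, e2, e3⟩
    · subst e1
      exact Or.inl (cell rfl e2 (h1 ▸ hj.le_hi) e3)
    · linarith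
    · subst h3 h4 h5 h6
      exact Or.inr ⟨e3, e2⟩
  · rcases up h1.le h2 with ⟨e1, ⟨e2, e3⟩ | ⟨e2, e3, e4, e5⟩⟩ | ⟨e1, e2, e3⟩
    · subst e1
      exact Or.inl (cell e2 rfl e3 (h2 ▸ hk.le_hi))
    · subst e1 e2
      refine Or.inl ⟨t, u, ⟨hsj, hej, ?_, h1.le, ?_⟩, ⟨hsk, hek, ?_, h2.le, ?_⟩, h1 ▸ h₀, le_rfl,
        h2 ▸ h₀', le_rfl⟩
      · rw [h1]; exact (Gj.lo_lt_hi a hsj hej).le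
      · rw [← hj.eq, e3, e4, linePt_succ (S.linkj a hsj hj.lt)]
      · rw [h2]; exact (Gk.lo_lt_hi b' hsk hek).le
      · rw [← hk.eq, e5]
    · rcases right h2.le h1 with ⟨e4, ⟨e5, -⟩ | ⟨e5, e6, e7, e8⟩⟩ | ⟨-, e5, e6⟩
      · omega
      · subst e4 e5
        refine Or.inl ⟨t, u, ⟨hsj, hej, ?_, h1.le, ?_⟩, ⟨hsk, hek, ?_, h2.le, ?_⟩, h1 ▸ h₀, le_rfl,
          h2 ▸ h₀', le_rfl⟩
        · rw [h1]; exact (Gj.lo_lt_hi a' hsj hej).le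
        · rw [← hj.eq, e8]
        · rw [h2]; exact (Gk.lo_lt_hi b hsk hek).le
        · rw [← hk.eq, e6, e7, linePt_succ (S.linkk b hsk hk.lt)]
      · subst h3 h4 h5 h6
        exact Or.inr ⟨e6, e3⟩

/-- If the curve leaves the pair of edges at its lower end, then the points on the pair are also on
the next pair. -/
theorem IsExit.next_of_rec_eq_zero (S : Separated Bi Di Bj Dj Bk Dk si ei sj ej sk ek σ)
    (Gi : GoodParams loi hii si ei) (Gj : GoodParams loj hij sj ej) (Gk : GoodParams lok hik sk ek)
    {a b m na nb rec : ℕ} {t u nt nu : ℝ}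
    (E : IsExit Bi Di Bj Dj Bk Dk si ei (loj a) (hij a) (lok b) (hik b) a b m t u na nb nt nu rec)
    (hrec : rec ≠ 1)
    (hsj : sj ≤ a) (hsk : sk ≤ b) (hna : na < ej) (hnb : nb < ek)
    (hz : zi + zj + zk = 0) {m' : ℕ} {q' : ℝ} (hi : IsRep Bi Di loi hii si ei zi m' q')
    {t' u' : ℝ} (hj : IsRep Bj Dj loj hij sj ej zj a t')
    (hk : IsRep Bk Dk lok hik sk ek zk b u') (ht : t' ≤ t) (hu : u' ≤ u) :
    ∃ t₁ u₁, IsRep Bj Dj loj hij sj ej zj na t₁ ∧ IsRep Bk Dk lok hik sk ek zk nb u₁ := by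
  obtain ⟨q, hq, -⟩ := E.curve
  have hP := onCurve_of_isRep (Bj := Bj) (Dj := Dj) (Bk := Bk) (Dk := Dk) Gi hz hi hj.eq hk.eq
  rcases E.cases with ⟨h1, h2, h3, h4, h5, h6, h7⟩ | ⟨h1, h2, h3, h4, h5, h6, h7⟩ |
    ⟨h1, h2, h3, h4, h5, h6, h7⟩
  · rcases h7 with ⟨h7, -⟩ | ⟨-, h7⟩
    · exact absurd h7 hrec
    subst h3 h4
    have e1 : t' = t := le_antisymm ht (h7.trans hj.lo_le)
    have e2 : u' = u := by
      by_contra hne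
      have hlt := lt_of_le_of_ne hu hne
      exact S.not_cross hq hP hsj hj.lt hk.lt hsk (Or.inl ⟨rfl, e1.ge⟩) (Or.inl ⟨rfl, hu⟩)
        (Or.inr (by linarith))
    refine ⟨t', 0, hj, ⟨by omega, hnb, (Gk.lo_eq _ (by omega) hnb).le, ?_, ?_⟩⟩
    · rw [← Gk.lo_eq _ (by omega) hnb]
      exact (Gk.lo_lt_hi _ (by omega) hnb).le
    · rw [linePt_succ (S.linkk b hsk hnb), ← hk.eq, e2, h2, Gk.hi_eq b hsk hnb]
  · rcases h7 with ⟨h7, -⟩ | ⟨-, h7⟩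
    · exact absurd h7 hrec
    subst h3 h4
    have e1 : u' = u := le_antisymm hu (h7.trans hk.lo_le)
    have e2 : t' = t := by
      by_contra hne
      have hlt := lt_of_le_of_ne ht hne
      exact S.not_cross hP hq hsj hj.lt hk.lt hsk (Or.inl ⟨rfl, ht⟩) (Or.inl ⟨rfl, e1.ge⟩)
        (Or.inl (by linarith))
    refine ⟨0, u', ⟨by omega, hna, (Gj.lo_eq _ (by omega) hna).le, ?_, ?_⟩, hk⟩
    · rw [← Gj.lo_eq _ (by omega) hna]
      exact (Gj.lo_lt_hi _ (by omega) hna).le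
    · rw [linePt_succ (S.linkj a hsj hna), ← hj.eq, e2, h1, Gj.hi_eq a hsj hna]
  · exact absurd h7 hrec

/-- If the walk has entered the pair of edges on the curve, then it proceeds strictly. -/
theorem IsExit.lt_of_onCurve (S : Separated Bi Di Bj Dj Bk Dk si ei sj ej sk ek σ)
    {a b m na nb rec : ℕ} {t u nt nu : ℝ} {lj hj lk hk : ℝ}
    (E : IsExit Bi Di Bj Dj Bk Dk si ei lj hj lk hk a b m t u na nb nt nu rec)
    (hsj : sj ≤ a) (hej : a < ej) (hsk : sk ≤ b) (hek : b < ek)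
    {t₀ u₀ q₀ : ℝ} {m₀ : ℕ} (h : OnCurve Bi Di Bj Dj Bk Dk si ei a t₀ b u₀ m₀ q₀)
    (ht : t₀ < hj) (hu : u₀ < hk) (hlt : lj ≤ t₀) (hlu : lk ≤ u₀) :
    t₀ < t ∧ u₀ < u ∧ rec = 1 := by
  obtain ⟨q, hq, -⟩ := E.curve
  rcases E.cases with ⟨h1, h2, h3, h4, h5, h6, h7⟩ | ⟨h1, h2, h3, h4, h5, h6, h7⟩ |
    ⟨h1, h2, h3, h4, h5, h6, h7⟩
  · have e : t₀ < t := by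
      by_contra hc
      exact S.not_cross hq h hsj hej hek hsk (Or.inl ⟨rfl, not_lt.1 hc⟩)
        (Or.inl ⟨rfl, h2 ▸ hu.le⟩) (Or.inr (by linarith))
    refine ⟨e, h2 ▸ hu, ?_⟩
    rcases h7 with h7 | h7
    · exact h7.1
    · linarith
  · have e : u₀ < u := by
      by_contra hc
      exact S.not_cross h hq hsj hej hek hsk (Or.inl ⟨rfl, h1 ▸ ht.le⟩)
        (Or.inl ⟨rfl, not_lt.1 hc⟩) (Or.inl (by linarith))
    refine ⟨h1 ▸ ht, e, ?_⟩
    rcases h7 with h7 | h7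
    · exact h7.1
    · linarith
  · exact ⟨h1 ▸ ht, h2 ▸ hu, h7⟩

/-- The exit point, seen from the next pair of edges. -/
theorem IsExit.next (S : Separated Bi Di Bj Dj Bk Dk si ei sj ej sk ek σ)
    (Gj : GoodParams loj hij sj ej) (Gk : GoodParams lok hik sk ek)
    {a b m na nb rec : ℕ} {t u nt nu : ℝ}
    (E : IsExit Bi Di Bj Dj Bk Dk si ei (loj a) (hij a) (lok b) (hik b) a b m t u na nb nt nu rec)
    (hrec : rec = 1) (hsj : sj ≤ a) (hsk : sk ≤ b) (hna : na < ej) (hnb : nb < ek) :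
    (∃ q, OnCurve Bi Di Bj Dj Bk Dk si ei na nt nb nu m q ∧ (m + 1 < ei → q < 1)) ∧
      loj na ≤ nt ∧ nt < hij na ∧ lok nb ≤ nu ∧ nu < hik nb ∧
      ((na = a ∧ nt = t) ∨ (na = a + 1 ∧ t = 1 ∧ nt = 0)) ∧
      ((nb = b ∧ nu = u) ∨ (nb = b + 1 ∧ u = 1 ∧ nu = 0)) := by
  obtain ⟨q, hq, hq1⟩ := E.curve
  rcases E.cases with ⟨h1, h2, h3, h4, h5, h6, h7⟩ | ⟨h1, h2, h3, h4, h5, h6, h7⟩ |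
    ⟨h1, h2, h3, h4, h5, h6, h7⟩
  · subst h3 h4 h5 h6
    have e := Gk.hi_eq b hsk hnb
    have e0 := Gk.lo_eq _ (by omega) hnb
    refine ⟨⟨q, ⟨?_, hq.le, hq.lt, hq.nonneg, hq.le_one⟩, hq1⟩, ?_, h1, e0.le, ?_,
      Or.inl ⟨rfl, rfl⟩, Or.inr ⟨rfl, h2.trans e, rfl⟩⟩
    · rw [linePt_succ (S.linkk b hsk hnb), ← e, ← h2, hq.sum_eq]
    · rcases h7 with h7 | h7
      · exact h7.2.le
      · omega
    · rw [← e0]; exact Gk.lo_lt_hi _ (by omega) hnb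
  · subst h3 h4 h5 h6
    have e := Gj.hi_eq a hsj hna
    have e0 := Gj.lo_eq _ (by omega) hna
    refine ⟨⟨q, ⟨?_, hq.le, hq.lt, hq.nonneg, hq.le_one⟩, hq1⟩, e0.le, ?_, ?_, h2,
      Or.inr ⟨rfl, h1.trans e, rfl⟩, Or.inl ⟨rfl, rfl⟩⟩
    · rw [linePt_succ (S.linkj a hsj hna), ← e, ← h1, hq.sum_eq]
    · rw [← e0]; exact Gj.lo_lt_hi _ (by omega) hna
    · rcases h7 with h7 | h7
      · exact h7.2.le
      · omega
  · subst h3 h4 h5 h6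
    have e := Gk.hi_eq b hsk hnb
    have e0 := Gk.lo_eq _ (by omega) hnb
    have e' := Gj.hi_eq a hsj hna
    have e0' := Gj.lo_eq _ (by omega) hna
    refine ⟨⟨q, ⟨?_, hq.le, hq.lt, hq.nonneg, hq.le_one⟩, hq1⟩, e0'.le, ?_, e0.le, ?_,
      Or.inr ⟨rfl, h1.trans e', rfl⟩, Or.inr ⟨rfl, h2.trans e, rfl⟩⟩
    · rw [linePt_succ (S.linkk b hsk hnb), linePt_succ (S.linkj a hsj hna), ← hq.sum_eq, h1, h2,
        e, e']
    · rw [← e0']; exact Gj.lo_lt_hi _ (by omega) hna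
    · rw [← e0]; exact Gk.lo_lt_hi _ (by omega) hnb

end

/-! ## Output of triples -/

/-- The assignments of roles to the three arcs. -/
def IsRoles (i j k : ℕ) : Prop :=
  (i = 0 ∧ j = 1 ∧ k = 2) ∨ (i = 1 ∧ j = 0 ∧ k = 2) ∨ (i = 2 ∧ j = 0 ∧ k = 1)

/-- The list of triples has an entry with the given edges of the arcs `i`, `j`, `k`. -/
def TripleIn (s : Store) (i j k m a b : ℕ) : Prop :=
  ∃ r < s.nat vTrip 0, s.nat (41 + i) r = m ∧ s.nat (41 + j) r = a ∧ s.nat (41 + k) r = b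

/-- The list of triples has grown. -/
def TripleExt (s s' : Store) : Prop :=
  s.nat vTrip 0 ≤ s'.nat vTrip 0 ∧
    ∀ c, 41 ≤ c → c ≤ 43 → ∀ r < s.nat vTrip 0, s'.nat c r = s.nat c r

/-- The entries of the list of triples are edges of the arcs. -/
def TripleOk (f : ℕ → ℕ) (s : Store) : Prop :=
  ∀ c < 3, ∀ r < s.nat vTrip 0, s.nat (41 + c) r < f c

theorem TripleExt.refl (s : Store) : TripleExt s s := ⟨le_rfl, fun _ _ _ _ _ => rfl⟩

section
variable {s s' s'' : Store} {a b x : ℕ}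

theorem TripleExt.trans (h : TripleExt s s') (h' : TripleExt s' s'') :
    TripleExt s s'' :=
  ⟨h.1.trans h'.1, fun c h₁ h₂ r hr =>
    (h'.2 c h₁ h₂ r (hr.trans_le h.1)).trans (h.2 c h₁ h₂ r hr)⟩

theorem TripleExt.of_eq (h : ∀ c, 40 ≤ c → c ≤ 43 → s'.nat c = s.nat c) :
    TripleExt s s' := by
  refine ⟨by rw [h vTrip (by norm_num) (by norm_num)], fun c h₁ h₂ r _ => ?_⟩
  rw [h c (by omega) h₂]

theorem TripleOk.of_eq {f : ℕ → ℕ} (hf : TripleOk f s)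
    (h : ∀ c, 40 ≤ c → c ≤ 43 → s'.nat c = s.nat c) : TripleOk f s' := by
  intro c hc r hr
  rw [h vTrip (by norm_num) (by norm_num)] at hr
  rw [h (41 + c) (by omega) (by omega)]
  exact hf c hc r hr

theorem TripleIn.ext {i j k m : ℕ} (hR : IsRoles i j k) (h : TripleIn s i j k m a b)
    (h' : TripleExt s s') : TripleIn s' i j k m a b := by
  obtain ⟨r, hr, h1, h2, h3⟩ := h
  have e : ∀ c, c ≤ 2 → s'.nat (41 + c) r = s.nat (41 + c) r := fun c hc =>
    h'.2 (41 + c) (by omega) (by omega) r hr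
  unfold IsRoles at hR
  exact ⟨r, hr.trans_le h'.1, by rw [e i (by omega), h1], by rw [e j (by omega), h2],
    by rw [e k (by omega), h3]⟩

/-- Appends the triples of the current pair of edges and the edges in a range of the first chain. -/
def outTriples : Prog :=
  .ite (.natLt 0 (nv vRev)) (nset vKB (.load aLen (nv vK) - 1 - nv vB)) (nset vKB (nv vB)) ;;
  .loop (.natLt (nv vLoM) (nv vHiM)) (
    .setNat aRole (nv vI) (nv vLoM) ;;
    .setNat aRole (nv vJ) (nv vA) ;;
    .setNat aRole (nv vK) (nv vKB) ;;
    .setNat 41 (nv vTrip) (.load aRole 0) ;;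
    .setNat 42 (nv vTrip) (.load aRole 1) ;;
    .setNat 43 (nv vTrip) (.load aRole 2) ;;
    nset vTrip (nv vTrip + 1) ;;
    nset vLoM (nv vLoM + 1))

/-- The number of an edge of the third chain within its arc. -/
def edgeK (s : Store) (b : ℕ) : ℕ :=
  if 0 < s.nat vRev 0 then s.nat aLen (s.nat vK 0) - 1 - b else b

theorem outTriples_spec (s : Store) {i j k lo hi a : ℕ} {f : ℕ → ℕ} (hR : IsRoles i j k)
    (hi' : s.nat vI 0 = i) (hj : s.nat vJ 0 = j) (hk : s.nat vK 0 = k)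
    (hlo : s.nat vLoM 0 = lo) (hhi : s.nat vHiM 0 = hi) (ha : s.nat vA 0 = a)
    (hle : lo ≤ hi) (hf : TripleOk f s) (hfi : ∀ m < hi, m < f i) (hfj : a < f j)
    (hfk : edgeK s (s.nat vB 0) < f k) :
    Runs outTriples s fun t s' => t ≤ 9 * (hi - lo) + 3 ∧ TripleExt s s' ∧ TripleOk f s' ∧
      s'.nat vTrip 0 = s.nat vTrip 0 + (hi - lo) ∧
      ∀ m, lo ≤ m → m < hi → TripleIn s' i j k m a (edgeK s (s.nat vB 0)) := by
  set b := edgeK s (s.nat vB 0) with hb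
  have h₀ : Runs (.ite (.natLt 0 (nv vRev)) (nset vKB (.load aLen (nv vK) - 1 - nv vB))
      (nset vKB (nv vB))) s fun t s' => t ≤ 2 ∧ s'.nat vKB 0 = b ∧
        (∀ c, c ≠ vKB → s'.nat c = s.nat c) ∧ s'.real = s.real := by
    refine runs_ite (fun h => runs_setNat ⟨by norm_num, ?_, ?_, rfl⟩)
      (fun h => runs_setNat ⟨by norm_num, ?_, ?_, rfl⟩)
    · have : 0 < s.nat vRev 0 := by simpa using h
      simp [hb, edgeK, this]
    · intro c hc
      funext x
      simp [hc]
    · have : ¬ 0 < s.nat vRev 0 := by simpa using h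
      simp [hb, edgeK, this]
    · intro c hc
      funext x
      simp [hc]
  refine h₀.seq ?_
  rintro t s₁ - ⟨ht, e1, e2, -⟩
  refine (runs_loop (fun t s' => ∃ c, s'.nat vLoM 0 = lo + c ∧ lo + c ≤ hi ∧ t ≤ 9 * c ∧
    TripleExt s s' ∧ TripleOk f s' ∧ s'.nat vTrip 0 = s.nat vTrip 0 + c ∧
    ∀ m, lo ≤ m → m < lo + c → TripleIn s' i j k m a b)
    (fun s' => hi - s'.nat vLoM 0) ⟨0, ?_⟩ ?_).mono ?_
  · refine ⟨by rw [e2 _ (by norm_num), hlo]; rfl, by omega, by omega,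
      TripleExt.of_eq fun c _ _ => e2 c (by omega), hf.of_eq fun c _ _ => e2 c (by omega),
      by rw [e2 _ (by norm_num)]; rfl, fun m h1 h2 => by omega⟩
  · rintro t' s' hF ⟨c, h1, h2, h3, h4, h5, h6, h7⟩ hlt
    have ev : ∀ x, 300 ≤ x → x < 600 → s'.nat x = s.nat x := fun x hx hx' => by
      rw [hF.1 x, e2 x (by omega)]
      simp only [Prog.writesNat, Bool.or_eq_false_iff, beq_eq_false_iff_ne]
      omega
    have eHi : s'.nat vHiM 0 = hi := by
      rw [hF.1 vHiM (by decide), e2 _ (by norm_num), hhi]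
    have eKB : s'.nat vKB 0 = b := by
      rw [hF.1 vKB (by decide), e1]
    have eI : s'.nat vI 0 = i := by rw [ev _ (by norm_num) (by norm_num), hi']
    have eJ : s'.nat vJ 0 = j := by rw [ev _ (by norm_num) (by norm_num), hj]
    have eK : s'.nat vK 0 = k := by rw [ev _ (by norm_num) (by norm_num), hk]
    have eA : s'.nat vA 0 = a := by rw [ev _ (by norm_num) (by norm_num), ha]
    have hlt' : lo + c < hi := by simpa [h1, eHi] using hlt
    refine runs_seq (runs_setNat (runs_seq (runs_setNat (runs_seq (runs_setNat
      (runs_seq (runs_setNat (runs_seq (runs_setNat (runs_seq (runs_setNat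
      (runs_seq (runs_setNat (runs_setNat ?_))))))))))))))
    simp only [NatExpr.eval_load, NatExpr.eval_add, NatExpr.eval_zero, NatExpr.eval_one,
      NatExpr.eval_two, Store.setNat_nat, eI, eJ, eK, eA, eKB, h1, h6, Nat.reduceEqDiff,
      false_and, true_and, if_false, if_true, and_self]
    set s'' := Store.setNat _ vLoM 0 (lo + c + 1) with hs''
    have g1 : s''.nat vTrip 0 = s.nat vTrip 0 + (c + 1) := by
      simp [hs'']; rfl
    have g2 : ∀ x, x ≤ 2 → ∀ r, r < s.nat vTrip 0 + c → s''.nat (41 + x) r = s'.nat (41 + x) r := by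
      intro x hx r hr
      have : r ≠ s.nat vTrip 0 + c := by omega
      interval_cases x <;> simp [hs'', this]
    have g3 : s''.nat (41 + i) (s.nat vTrip 0 + c) = lo + c ∧
        s''.nat (41 + j) (s.nat vTrip 0 + c) = a ∧ s''.nat (41 + k) (s.nat vTrip 0 + c) = b := by
      rcases hR with ⟨rfl, rfl, rfl⟩ | ⟨rfl, rfl, rfl⟩ | ⟨rfl, rfl, rfl⟩ <;> simp [hs'']
    have hE : TripleExt s' s'' := by
      refine ⟨by omega, fun x hx hx' r hr => ?_⟩
      rw [h6] at hr
      have := g2 (x - 41) (by omega) r hr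
      rwa [show 41 + (x - 41) = x by omega] at this
    refine ⟨⟨c + 1, ?_, by omega, by omega, h4.trans hE, ?_, g1, ?_⟩, ?_⟩
    · omega
    · intro x hx r hr
      rw [g1] at hr
      rcases Nat.lt_succ_iff_lt_or_eq.1 (show r < (s.nat vTrip 0 + c) + 1 by omega) with hr' | hr'
      · rw [g2 x (by omega) r hr']
        exact h5 x hx r (by omega)
      · rw [hr']
        have : x = i ∨ x = j ∨ x = k := by
          unfold IsRoles at hR
          omega
        rcases this with rfl | rfl | rfl
        · rw [g3.1]; exact hfi _ hlt'
        · rw [g3.2.1]; exact hfj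
        · rw [g3.2.2]; exact hfk
    · intro m hm hm'
      rcases Nat.lt_succ_iff_lt_or_eq.1 (show m < (lo + c) + 1 by omega) with hr' | hr'
      · exact (h7 m hm hr').ext hR hE
      · exact ⟨s.nat vTrip 0 + c, by omega, by rw [g3.1, hr'], g3.2.1, g3.2.2⟩
    · omega
  · rintro t' s' hF ⟨t'', rfl, ⟨c, h1, h2, h3, h4, h5, h6, h7⟩, hnb⟩
    have eHi : s'.nat vHiM 0 = hi := by
      rw [hF.1 vHiM (by decide), e2 _ (by norm_num), hhi]
    have hc : ¬ lo + c < hi := by simpa [h1, eHi] using hnb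
    have hc' : c = hi - lo := by omega
    subst hc'
    refine ⟨by omega, h4, h5, h6, fun m hm hm' => h7 m hm (by omega)⟩

/-! ## Output of pieces of pairings -/

/-- A sub-edge that ends at parameter `h` of edge `e` is followed by one that starts at parameter
`l` of edge `e'`. -/
def Follows (e : ℕ) (h : ℝ) (e' : ℕ) (l : ℝ) : Prop :=
  (e' = e ∧ l = h) ∨ (e' = e + 1 ∧ h = 1 ∧ l = 0)

/-- The next piece starts at the given edges and parameters. -/
structure CurAt (s : Store) (x a : ℕ) (t : ℝ) (b : ℕ) (u : ℝ) : Prop where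
  edgeL : s.nat aLE x = a
  loL : s.real aLlo x = t
  edgeR : s.nat aRE x = b
  loR : s.real aRlo x = u

/-- The pieces at positions from `x` on up to `y` are nondegenerate and fit together. -/
def PieceSteps (s : Store) (x y : ℕ) : Prop :=
  ∀ r, x ≤ r → r < y → s.real aLlo r < s.real aLhi r ∧ s.real aRlo r < s.real aRhi r ∧
    Follows (s.nat aLE r) (s.real aLhi r) (s.nat aLE (r + 1)) (s.real aLlo (r + 1)) ∧
    Follows (s.nat aRE r) (s.real aRhi r) (s.nat aRE (r + 1)) (s.real aRlo (r + 1))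

/-- The pieces at a position are the same. -/
structure PieceEq (s s' : Store) (r : ℕ) : Prop where
  edgeL : s'.nat aLE r = s.nat aLE r
  loL : s'.real aLlo r = s.real aLlo r
  hiL : s'.real aLhi r = s.real aLhi r
  edgeR : s'.nat aRE r = s.nat aRE r
  loR : s'.real aRlo r = s.real aRlo r
  hiR : s'.real aRhi r = s.real aRhi r

/-- Pieces that fit together have been appended. -/
structure PieceExt (s s' : Store) : Prop where
  le : s.nat vOut 0 ≤ s'.nat vOut 0
  old : ∀ r < s.nat vOut 0, PieceEq s s' r
  start : CurAt s' (s.nat vOut 0) (s.nat aLE (s.nat vOut 0)) (s.real aLlo (s.nat vOut 0))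
    (s.nat aRE (s.nat vOut 0)) (s.real aRlo (s.nat vOut 0))
  steps : PieceSteps s' (s.nat vOut 0) (s'.nat vOut 0)

theorem PieceExt.of_eq (h : ∀ c, c < 200 → c ≠ 16 → c < 40 ∨ 43 < c →
    s'.nat c = s.nat c ∧ s'.real c = s.real c) : PieceExt s s' := by
  have e : ∀ c, c < 40 → c ≠ 16 → s'.nat c = s.nat c ∧ s'.real c = s.real c := fun c hc hc' =>
    h c (by omega) hc' (Or.inl hc)
  have e1 := (e vOut (by norm_num) (by norm_num)).1
  have e2 := (e aLE (by norm_num) (by norm_num)).1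
  have e3 := (e aRE (by norm_num) (by norm_num)).1
  have e4 := (e aLlo (by norm_num) (by norm_num)).2
  have e5 := (e aLhi (by norm_num) (by norm_num)).2
  have e6 := (e aRlo (by norm_num) (by norm_num)).2
  have e7 := (e aRhi (by norm_num) (by norm_num)).2
  refine ⟨by rw [e1], fun r _ => ⟨by rw [e2], by rw [e4], by rw [e5], by rw [e3], by rw [e6],
    by rw [e7]⟩, ⟨by rw [e2], by rw [e4], by rw [e3], by rw [e6]⟩, fun r h1 h2 => ?_⟩
  rw [e1] at h2
  omega

theorem PieceExt.refl (s : Store) : PieceExt s s := PieceExt.of_eq fun _ _ _ _ => ⟨rfl, rfl⟩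

theorem PieceSteps.ext {y : ℕ} (h : PieceSteps s x y) (h' : PieceExt s s') (hy : y ≤ s.nat vOut 0) :
    PieceSteps s' x y := by
  intro r hr hr'
  obtain ⟨g1, g2, g3, g4⟩ := h r hr hr'
  have hE := h'.old r (by omega)
  have e5 := hE.hiL
  have hE' : s'.nat aLE (r + 1) = s.nat aLE (r + 1) ∧ s'.real aLlo (r + 1) = s.real aLlo (r + 1) ∧
      s'.nat aRE (r + 1) = s.nat aRE (r + 1) ∧ s'.real aRlo (r + 1) = s.real aRlo (r + 1) := by
    rcases lt_or_ge (r + 1) (s.nat vOut 0) with h1 | h1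
    · have hF := h'.old _ h1
      exact ⟨hF.edgeL, hF.loL, hF.edgeR, hF.loR⟩
    · have h2 : r + 1 = s.nat vOut 0 := by omega
      rw [h2]
      have hF := h'.start
      exact ⟨hF.edgeL, hF.loL, hF.edgeR, hF.loR⟩
  obtain ⟨k1, k2, k3, k4⟩ := hE'
  rw [hE.loL, hE.hiL, hE.loR, hE.hiR, hE.edgeL, hE.edgeR, k1, k2, k3, k4]
  exact ⟨g1, g2, g3, g4⟩

theorem CurAt.ext {t u : ℝ} (h : CurAt s x a t b u) (h' : PieceExt s s') (hx : x ≤ s.nat vOut 0) :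
    CurAt s' x a t b u := by
  rcases hx.lt_or_eq with h1 | h1
  · have hF := h'.old _ h1
    exact ⟨hF.edgeL.trans h.edgeL, hF.loL.trans h.loL, hF.edgeR.trans h.edgeR, hF.loR.trans h.loR⟩
  · subst h1
    have hF := h'.start
    exact ⟨hF.edgeL.trans h.edgeL, hF.loL.trans h.loL, hF.edgeR.trans h.edgeR, hF.loR.trans h.loR⟩

theorem PieceEq.trans {r : ℕ} (h : PieceEq s s' r) (h' : PieceEq s' s'' r) :
    PieceEq s s'' r :=
  ⟨h'.edgeL.trans h.edgeL, h'.loL.trans h.loL, h'.hiL.trans h.hiL, h'.edgeR.trans h.edgeR,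
    h'.loR.trans h.loR, h'.hiR.trans h.hiR⟩

theorem PieceExt.trans (h : PieceExt s s') (h' : PieceExt s' s'') :
    PieceExt s s'' := by
  refine ⟨h.le.trans h'.le, fun r hr => (h.old r hr).trans (h'.old r (hr.trans_le h.le)),
    h.start.ext h' h.le, fun r hr hr' => ?_⟩
  rcases lt_or_ge r (s'.nat vOut 0) with h1 | h1
  · exact h.steps.ext h' le_rfl r hr h1
  · exact h'.steps r h1 hr'

/-- Ends the current piece and starts the next one. -/
def emit (h₁ h₂ : RealExpr) (a : NatExpr) (t : RealExpr) (b : NatExpr) (u : RealExpr) : Prog :=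
  .setReal aLhi (nv vOut) h₁ ;;
  .setReal aRhi (nv vOut) h₂ ;;
  .setNat aLE (nv vOut + 1) a ;;
  .setReal aLlo (nv vOut + 1) t ;;
  .setNat aRE (nv vOut + 1) b ;;
  .setReal aRlo (nv vOut + 1) u ;;
  nset vOut (nv vOut + 1)

/-- The stores agree on the variables of a walk and on the start of the current piece. -/
structure EmitStable (s s' : Store) : Prop where
  nat : ∀ c, 200 ≤ c → s'.nat c = s.nat c
  real : ∀ c, 200 ≤ c → s'.real c = s.real c
  out : s'.nat vOut 0 = s.nat vOut 0
  edgeL : s'.nat aLE (s.nat vOut 0) = s.nat aLE (s.nat vOut 0)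
  edgeR : s'.nat aRE (s.nat vOut 0) = s.nat aRE (s.nat vOut 0)

theorem EmitStable.setReal (h : EmitStable s s') {c : ℕ} (hc : c < 200) (i : ℕ) (v : ℝ) :
    EmitStable s (s'.setReal c i v) := by
  refine ⟨h.nat, fun d hd => ?_, h.out, h.edgeL, h.edgeR⟩
  funext j
  rw [Store.setReal_real, if_neg (by omega), h.real d hd]

theorem EmitStable.setNat (h : EmitStable s s') {c i : ℕ} (hc : c < 15) (hi : i ≠ s.nat vOut 0)
    (v : ℕ) : EmitStable s (s'.setNat c i v) := by
  refine ⟨fun d hd => ?_, h.real, ?_, ?_, ?_⟩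
  · funext j
    rw [Store.setNat_nat, if_neg (by omega), h.nat d hd]
  · rw [Store.setNat_nat, if_neg (by omega), h.out]
  · rw [Store.setNat_nat, if_neg (by omega), h.edgeL]
  · rw [Store.setNat_nat, if_neg (by omega), h.edgeR]

theorem emit_spec {h₁ h₂ : RealExpr} {a : NatExpr} {t : RealExpr} {b : NatExpr} {u : RealExpr}
    (s : Store) {v₁ v₂ t₁ u₁ t₀ u₀ : ℝ} {a₁ b₁ x a₀ b₀ : ℕ} (hx : s.nat vOut 0 = x)
    (hcur : CurAt s x a₀ t₀ b₀ u₀)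
    (hst : ∀ s', EmitStable s s' → h₁.eval s' = v₁ ∧ h₂.eval s' = v₂ ∧ a.eval s' = a₁ ∧
      t.eval s' = t₁ ∧ b.eval s' = b₁ ∧ u.eval s' = u₁) (hl : t₀ < v₁) (hr : u₀ < v₂)
    (hfl : Follows a₀ v₁ a₁ t₁) (hfr : Follows b₀ v₂ b₁ u₁) :
    Runs (emit h₁ h₂ a t b u) s fun τ s' => τ = 7 ∧ s'.nat vOut 0 = x + 1 ∧ PieceExt s s' ∧
      CurAt s' (x + 1) a₁ t₁ b₁ u₁ ∧ CurAt s' x a₀ t₀ b₀ u₀ ∧ s'.real aLhi x = v₁ ∧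
      s'.real aRhi x = v₂ := by
  obtain ⟨c1, c2, c3, c4⟩ := hcur
  have key : ∀ s', EmitStable s s' → _ := hst
  refine runs_seq (runs_setReal (runs_seq (runs_setReal (runs_seq (runs_setNat
    (runs_seq (runs_setReal (runs_seq (runs_setNat (runs_seq (runs_setReal
      (runs_setNat ?_))))))))))))
  have k0 : EmitStable s s := ⟨fun _ _ => rfl, fun _ _ => rfl, rfl, rfl, rfl⟩
  rw [(key s k0).1]
  set s₁ := s.setReal aLhi _ _ with hs₁
  have k1 : EmitStable s s₁ := k0.setReal (by norm_num) _ _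
  rw [(key s₁ k1).2.1]
  set s₂ := s₁.setReal aRhi _ _ with hs₂
  have k2 : EmitStable s s₂ := k1.setReal (by norm_num) _ _
  rw [(key s₂ k2).2.2.1]
  set s₃ := s₂.setNat aLE _ _ with hs₃
  have k3 : EmitStable s s₃ := k2.setNat (by norm_num) (by simp [hs₁, hs₂]) _
  rw [(key s₃ k3).2.2.2.1]
  set s₄ := s₃.setReal aLlo _ _ with hs₄
  have k4 : EmitStable s s₄ := k3.setReal (by norm_num) _ _
  rw [(key s₄ k4).2.2.2.2.1]
  set s₅ := s₄.setNat aRE _ _ with hs₅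
  have k5 : EmitStable s s₅ := k4.setNat (by norm_num) (by simp [hs₁, hs₂, hs₃, hs₄]) _
  rw [(key s₅ k5).2.2.2.2.2]
  set s₇ := Store.setNat _ vOut _ _ with hs₇
  have m1 : s₇.nat vOut 0 = x + 1 := by simp [hs₇, hs₅, hs₄, hs₃, hs₂, hs₁, hx]
  have m2 : ∀ r, s₇.nat aLE r = if r = x + 1 then a₁ else s.nat aLE r := by
    intro r; simp [hs₇, hs₅, hs₄, hs₃, hs₂, hs₁, hx]
  have m3 : ∀ r, s₇.nat aRE r = if r = x + 1 then b₁ else s.nat aRE r := by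
    intro r; simp [hs₇, hs₅, hs₄, hs₃, hs₂, hs₁, hx]
  have m4 : ∀ r, s₇.real aLlo r = if r = x + 1 then t₁ else s.real aLlo r := by
    intro r; simp [hs₇, hs₅, hs₄, hs₃, hs₂, hs₁, hx]
  have m5 : ∀ r, s₇.real aRlo r = if r = x + 1 then u₁ else s.real aRlo r := by
    intro r; simp [hs₇, hs₅, hs₄, hs₃, hs₂, hs₁, hx]
  have m6 : ∀ r, s₇.real aLhi r = if r = x then v₁ else s.real aLhi r := by
    intro r; simp [hs₇, hs₅, hs₄, hs₃, hs₂, hs₁, hx]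
  have m7 : ∀ r, s₇.real aRhi r = if r = x then v₂ else s.real aRhi r := by
    intro r; simp [hs₇, hs₅, hs₄, hs₃, hs₂, hs₁, hx]
  have n0 : x ≠ x + 1 := by omega
  refine ⟨rfl, m1, ⟨by omega, fun r hr => ?_, ?_, fun r hr₁ hr₂ => ?_⟩, ?_, ?_, ?_, ?_⟩
  · rw [hx] at hr
    have n1 : r ≠ x := by omega
    have n2 : r ≠ x + 1 := by omega
    constructor <;> simp only [m2, m3, m4, m5, m6, m7, if_neg n1, if_neg n2]
  · rw [hx]
    constructor <;> simp only [m2, m3, m4, m5, if_neg n0]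
  · have hrx : r = x := by omega
    subst hrx
    simp only [m2, m3, m4, m5, m6, m7, if_neg n0, if_true, c1, c2, c3, c4]
    exact ⟨hl, hr, hfl, hfr⟩
  · constructor <;> simp only [m2, m3, m4, m5, if_true]
  · constructor <;> simp only [m2, m3, m4, m5, if_neg n0] <;> assumption
  · simp only [m6, if_true]
  · simp only [m7, if_true]

end

/-- Appends pieces from the start of the current piece up to a given pair of points. -/
def connect : Prog :=
  .loop (.natLt (.load aRE (nv vOut)) (nv vB)) (
    .ite (.natLt (.load aLE (nv vOut)) (nv vA)) (rset rLim 1) (rset rLim (rv rT)) ;;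
    rset rMid ((.load aLlo (nv vOut) + rv rLim) / 2) ;;
    emit (rv rMid) 1 (.load aLE (nv vOut)) (rv rMid) (.load aRE (nv vOut) + 1) 0) ;;
  .loop (.natLt (.load aLE (nv vOut)) (nv vA)) (
    rset rMid ((.load aRlo (nv vOut) + rv rU) / 2) ;;
    emit 1 (rv rMid) (.load aLE (nv vOut) + 1) 0 (.load aRE (nv vOut)) (rv rMid)) ;;
  emit (rv rT) (rv rU) (nv vNA) (rv rNT) (nv vNB) (rv rNU)

theorem connect_spec (s : Store) {x a₀ b₀ a b na nb : ℕ} {t₀ u₀ t u nt nu : ℝ}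
    (hx : s.nat vOut 0 = x) (hcur : CurAt s x a₀ t₀ b₀ u₀) (ha : s.nat vA 0 = a)
    (hb : s.nat vB 0 = b) (hna : s.nat vNA 0 = na) (hnb : s.nat vNB 0 = nb) (ht : s.real rT 0 = t)
    (hu : s.real rU 0 = u) (hnt : s.real rNT 0 = nt) (hnu : s.real rNU 0 = nu)
    (haa : a₀ ≤ a) (hbb : b₀ ≤ b) (htt : a₀ = a → t₀ < t) (huu : b₀ = b → u₀ < u)
    (ht1 : a₀ < a → t₀ < 1) (hu1 : b₀ < b → u₀ < 1) (htpos : 0 < t) (hupos : 0 < u)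
    (hfl : Follows a t na nt) (hfr : Follows b u nb nu) :
    Runs connect s fun τ s' => τ ≤ 11 * ((a - a₀) + (b - b₀) + 1) ∧
      s'.nat vOut 0 = x + ((a - a₀) + (b - b₀) + 1) ∧ PieceExt s s' ∧
      CurAt s' (s'.nat vOut 0) na nt nb nu ∧
      s'.nat aLE (x + ((a - a₀) + (b - b₀))) = a ∧ s'.real aLhi (x + ((a - a₀) + (b - b₀))) = t ∧
      s'.nat aRE (x + ((a - a₀) + (b - b₀))) = b ∧ s'.real aRhi (x + ((a - a₀) + (b - b₀))) = u := by
  refine Runs.seq (R := fun τ s₁ => τ ≤ 11 * (b - b₀) + 1 ∧ s₁.nat vOut 0 = x + (b - b₀) ∧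
    PieceExt s s₁ ∧ ∃ t₁ u₁, CurAt s₁ (x + (b - b₀)) a₀ t₁ b u₁ ∧ (a₀ = a → t₁ < t) ∧
      (a₀ < a → t₁ < 1) ∧ u₁ < u) ?_ ?_
  · refine (runs_loop (fun τ s₁ => ∃ c, b₀ + c ≤ b ∧ τ ≤ 11 * c ∧ s₁.nat vOut 0 = x + c ∧
      PieceExt s s₁ ∧ ∃ t₁ u₁, CurAt s₁ (x + c) a₀ t₁ (b₀ + c) u₁ ∧ (a₀ = a → t₁ < t) ∧
      (a₀ < a → t₁ < 1) ∧ (b₀ + c = b → u₁ < u) ∧ (b₀ + c < b → u₁ < 1))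
      (fun s₁ => b - s₁.nat aRE (s₁.nat vOut 0)) ⟨0, ?_⟩ ?_).mono ?_
    · exact ⟨hbb, le_rfl, hx, .refl s, t₀, u₀, hcur, htt, ht1, huu, hu1⟩
    · rintro τ s₁ hF ⟨c, h1, h2, h3, h4, t₁, u₁, h5, h6, h7, h8, h9⟩ hlt
      have ea : s₁.nat vA 0 = a := by rw [hF.1 vA (by decide), ha]
      have eb : s₁.nat vB 0 = b := by rw [hF.1 vB (by decide), hb]
      have et : s₁.real rT 0 = t := by rw [hF.2 rT (by decide), ht]
      have hlt' : b₀ + c < b := by simpa [h3, h5.edgeR, eb] using hlt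
      have hlim : Runs (.ite (.natLt (.load aLE (nv vOut)) (nv vA)) (rset rLim 1)
          (rset rLim (rv rT))) s₁ fun τ s₂ => τ = 2 ∧ s₂.nat = s₁.nat ∧
          (∀ c, c ≠ rLim → s₂.real c = s₁.real c) ∧ t₁ < s₂.real rLim 0 ∧
          (a₀ = a → s₂.real rLim 0 ≤ t) ∧ (a₀ < a → s₂.real rLim 0 ≤ 1) := by
        refine runs_ite (fun h => runs_setReal ⟨rfl, rfl, ?_, ?_, ?_, ?_⟩)
          (fun h => runs_setReal ⟨rfl, rfl, ?_, ?_, ?_, ?_⟩)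
        · intro c hc; funext y; simp [hc]
        · have : a₀ < a := by simpa [h3, h5.edgeL, ea] using h
          simpa using h7 this
        · have : a₀ < a := by simpa [h3, h5.edgeL, ea] using h
          intro h'; omega
        · simp
        · intro c hc; funext y; simp [hc]
        · have : a ≤ a₀ := by simpa [h3, h5.edgeL, ea] using h
          simpa [et] using h6 (by omega)
        · simp [et]
        · have : a ≤ a₀ := by simpa [h3, h5.edgeL, ea] using h
          intro h'; omega
      refine hlim.seq ?_
      rintro τ' s₂ - ⟨k1, k2, k3, k4, k5, k6⟩
      refine runs_seq (runs_setReal ?_)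
      set s₃ := s₂.setReal rMid _ _ with hs₃
      have e3 : s₃.nat = s₁.nat := by rw [← k2]; rfl
      have e4 : ∀ c, c < 200 → s₃.real c = s₁.real c := by
        intro c hc
        rw [← k3 c (by omega)]
        funext y
        simp only [hs₃, Store.setReal_real]
        rw [if_neg (by omega)]
      have emid : s₃.real rMid 0 = (t₁ + s₂.real rLim 0) / 2 := by
        have : s₂.real aLlo (x + c) = t₁ := by rw [k3 _ (by norm_num), h5.loL]
        simp [hs₃, k2, h3, this]
      have hcur₃ : CurAt s₃ (x + c) a₀ t₁ (b₀ + c) u₁ :=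
        ⟨by rw [e3, h5.edgeL], by rw [e4 _ (by norm_num), h5.loL], by rw [e3, h5.edgeR],
          by rw [e4 _ (by norm_num), h5.loR]⟩
      have hPE : PieceExt s₁ s₃ := PieceExt.of_eq fun d hd _ _ => ⟨by rw [e3], e4 d hd⟩
      refine (emit_spec s₃ (x := x + c) (v₁ := (t₁ + s₂.real rLim 0) / 2) (v₂ := 1) (a₁ := a₀)
        (t₁ := (t₁ + s₂.real rLim 0) / 2) (b₁ := b₀ + c + 1) (u₁ := 0) (by rw [e3, h3]) hcur₃ ?_
        (by linarith) (h9 hlt') (Or.inl ⟨rfl, rfl⟩) (Or.inr ⟨rfl, rfl, rfl⟩)).mono ?_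
      · intro s' hs'
        have o := hs'.out
        have oL := hs'.edgeL
        have oR := hs'.edgeR
        rw [e3, h3] at o oL oR
        rw [h5.edgeL] at oL
        rw [h5.edgeR] at oR
        simp [o, oL, oR, hs'.real, emid]
      · rintro τ'' s' - ⟨m1, m2, m3, m4, -⟩
        refine ⟨⟨c + 1, by omega, by omega, m2, (h4.trans hPE).trans m3, _, _, m4, ?_, ?_, ?_, ?_⟩,
          ?_⟩
        · intro h; have := k5 h; linarith
        · intro h; have := k6 h; linarith
        · intro; exact hupos
        · intro; exact one_pos
        · rw [h3, h5.edgeR, m2, m4.edgeR]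
          omega
    · rintro τ s₁ hF ⟨τ', rfl, ⟨c, h1, h2, h3, h4, t₁, u₁, h5, h6, h7, h8, h9⟩, hnb'⟩
      have eb : s₁.nat vB 0 = b := by rw [hF.1 vB (by decide), hb]
      have hge : b ≤ b₀ + c := by simpa [h3, h5.edgeR, eb] using hnb'
      have hc : c = b - b₀ := by omega
      have hc' : b₀ + c = b := by omega
      rw [hc'] at h5
      subst hc
      exact ⟨by omega, h3, h4, t₁, u₁, h5, h6, h7, h8 hc'⟩
  rintro τ s₁ hF₁ ⟨g1, g2, g3, t₁, u₁, g4, g5, g6, g7⟩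
  have va : s₁.nat vA 0 = a := by rw [hF₁.1 vA (by decide), ha]
  have vna : s₁.nat vNA 0 = na := by rw [hF₁.1 vNA (by decide), hna]
  have vnb : s₁.nat vNB 0 = nb := by rw [hF₁.1 vNB (by decide), hnb]
  have vt : s₁.real rT 0 = t := by rw [hF₁.2 rT (by decide), ht]
  have vu : s₁.real rU 0 = u := by rw [hF₁.2 rU (by decide), hu]
  have vnt : s₁.real rNT 0 = nt := by rw [hF₁.2 rNT (by decide), hnt]
  have vnu : s₁.real rNU 0 = nu := by rw [hF₁.2 rNU (by decide), hnu]
  set y := x + (b - b₀) with hy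
  refine Runs.seq (R := fun τ s₂ => τ ≤ 9 * (a - a₀) + 1 ∧ s₂.nat vOut 0 = y + (a - a₀) ∧
    PieceExt s₁ s₂ ∧ ∃ t₁ u₁, CurAt s₂ (y + (a - a₀)) a t₁ b u₁ ∧ t₁ < t ∧ u₁ < u) ?_ ?_
  · refine (runs_loop (fun τ s₂ => ∃ c, a₀ + c ≤ a ∧ τ ≤ 9 * c ∧ s₂.nat vOut 0 = y + c ∧
      PieceExt s₁ s₂ ∧ ∃ t₁ u₁, CurAt s₂ (y + c) (a₀ + c) t₁ b u₁ ∧ (a₀ + c = a → t₁ < t) ∧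
      (a₀ + c < a → t₁ < 1) ∧ u₁ < u)
      (fun s₂ => a - s₂.nat aLE (s₂.nat vOut 0)) ⟨0, ?_⟩ ?_).mono ?_
    · exact ⟨haa, le_rfl, g2, .refl s₁, t₁, u₁, g4, g5, g6, g7⟩
    · rintro τ s₂ hF ⟨c, h1, h2, h3, h4, t₁, u₁, h5, h6, h7, h8⟩ hlt
      have ea : s₂.nat vA 0 = a := by rw [hF.1 vA (by decide), va]
      have eu : s₂.real rU 0 = u := by rw [hF.2 rU (by decide), vu]
      have hlt' : a₀ + c < a := by simpa [h3, h5.edgeL, ea] using hlt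
      refine runs_seq (runs_setReal ?_)
      set s₃ := s₂.setReal rMid _ _ with hs₃
      have e3 : s₃.nat = s₂.nat := rfl
      have e4 : ∀ c, c < 200 → s₃.real c = s₂.real c := by
        intro c hc
        funext y
        simp only [hs₃, Store.setReal_real]
        rw [if_neg (by omega)]
      have emid : s₃.real rMid 0 = (u₁ + u) / 2 := by
        simp [hs₃, h3, h5.loR, eu]
      have hcur₃ : CurAt s₃ (y + c) (a₀ + c) t₁ b u₁ :=
        ⟨by rw [e3, h5.edgeL], by rw [e4 _ (by norm_num), h5.loL], by rw [e3, h5.edgeR],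
          by rw [e4 _ (by norm_num), h5.loR]⟩
      have hPE : PieceExt s₂ s₃ := PieceExt.of_eq fun d hd _ _ => ⟨by rw [e3], e4 d hd⟩
      refine (emit_spec s₃ (x := y + c) (v₁ := 1) (v₂ := (u₁ + u) / 2) (a₁ := a₀ + c + 1)
        (t₁ := 0) (b₁ := b) (u₁ := (u₁ + u) / 2) (by rw [e3, h3]) hcur₃ ?_
        (h7 hlt') (by linarith) (Or.inr ⟨rfl, rfl, rfl⟩) (Or.inl ⟨rfl, rfl⟩)).mono ?_
      · intro s' hs'
        have o := hs'.out
        have oL := hs'.edgeL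
        have oR := hs'.edgeR
        rw [e3, h3] at o oL oR
        rw [h5.edgeL] at oL
        rw [h5.edgeR] at oR
        simp [o, oL, oR, hs'.real, emid]
      · rintro τ'' s' - ⟨m1, m2, m3, m4, -⟩
        refine ⟨⟨c + 1, by omega, by omega, m2, (h4.trans hPE).trans m3, _, _, m4, ?_, ?_, ?_⟩, ?_⟩
        · intro; exact htpos
        · intro; exact one_pos
        · linarith
        · rw [h3, h5.edgeL, m2, m4.edgeL]
          omega
    · rintro τ s₂ hF ⟨τ', rfl, ⟨c, h1, h2, h3, h4, t₁, u₁, h5, h6, h7, h8⟩, hnb'⟩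
      have ea : s₂.nat vA 0 = a := by rw [hF.1 vA (by decide), va]
      have hge : a ≤ a₀ + c := by simpa [h3, h5.edgeL, ea] using hnb'
      have hc : c = a - a₀ := by omega
      have hc' : a₀ + c = a := by omega
      rw [hc'] at h5
      subst hc
      exact ⟨by omega, h3, h4, t₁, u₁, h5, h6 hc', h8⟩
  rintro τ₂ s₂ hF₂ ⟨f1, f2, f3, t₂, u₂, f4, f5, f6⟩
  refine (emit_spec s₂ (v₁ := t) (v₂ := u) (a₁ := na) (t₁ := nt) (b₁ := nb) (u₁ := nu) f2 f4 ?_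
    f5 f6 hfl hfr).mono ?_
  · intro s' hs'
    have w1 : s₂.nat vNA 0 = na := by rw [hF₂.1 vNA (by decide), vna]
    have w2 : s₂.nat vNB 0 = nb := by rw [hF₂.1 vNB (by decide), vnb]
    have w3 : s₂.real rT 0 = t := by rw [hF₂.2 rT (by decide), vt]
    have w4 : s₂.real rU 0 = u := by rw [hF₂.2 rU (by decide), vu]
    have w5 : s₂.real rNT 0 = nt := by rw [hF₂.2 rNT (by decide), vnt]
    have w6 : s₂.real rNU 0 = nu := by rw [hF₂.2 rNU (by decide), vnu]
    simp [hs'.nat, hs'.real, w1, w2, w3, w4, w5, w6]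
  · rintro τ₃ s' - ⟨m1, m2, m3, m4, m5, m6, m7⟩
    have e : y + (a - a₀) = x + ((a - a₀) + (b - b₀)) := by omega
    rw [e] at m2 m4 m5 m6 m7
    have e' : x + ((a - a₀) + (b - b₀)) + 1 = x + ((a - a₀) + (b - b₀) + 1) := by omega
    rw [e'] at m2 m4
    refine ⟨by omega, m2, (g3.trans f3).trans m3, m2 ▸ m4, m5.edgeL, m6, m5.edgeR, m7⟩

/-! ## The walk along the curve -/

section
variable {B D : ℕ → ℂ} {lo hi : ℕ → ℝ} {si ei : ℕ} {z : ℂ}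

/-- A point of a chain has a representation that is not at the end of an edge, except the last. -/
theorem IsRep.canonical (G : GoodParams lo hi si ei)
    (link : ∀ a, si ≤ a → a + 1 < ei → B (a + 1) = B a + D a) {m : ℕ} {q : ℝ}
    (h : IsRep B D lo hi si ei z m q) :
    ∃ m' q', IsRep B D lo hi si ei z m' q' ∧ (m' + 1 < ei → q' < 1) := by
  by_cases hc : m + 1 < ei → q < 1
  · exact ⟨m, q, h, hc⟩
  · push Not at hc
    obtain ⟨h1, h2⟩ := hc
    have hq : q = 1 := le_antisymm (h.le_hi.trans (G.hi_le m h.le h.lt)) h2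
    have hs := h.le
    have e := G.lo_eq (m + 1) (by omega) h1
    obtain ⟨m', hm', -⟩ : ∃ m', m' + 1 = ei ∧ m' = m' := ⟨ei - 1, by omega, rfl⟩
    have hlt := G.lo_lt_hi (m + 1) (by omega) h1
    refine ⟨m + 1, 0, ⟨by omega, h1, e.le, e ▸ hlt.le, ?_⟩, fun _ => one_pos⟩
    rw [linePt_succ (link m h.le h1), ← h.eq, hq]

end

theorem le_of_add_le {m m' ei si : ℕ} {q q' : ℝ} (h : (m : ℝ) + q ≤ m' + q')
    (h₁ : m' + 1 < ei → q' < 1) (h₂ : si < m → 0 ≤ q) (hm : m < ei) (hm' : si ≤ m') : m ≤ m' := by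
  by_contra hc
  have h3 := h₁ (by omega)
  have h4 := h₂ (by omega)
  have : (m' : ℝ) + 1 ≤ m := by exact_mod_cast not_le.1 hc
  linarith

/-- The slopes change sign at most once along the walk. -/
def OnePhase (κ : ℕ → ℕ → ℝ) (sj ej sk ek : ℕ) : Prop :=
  ∀ a a' b b', sj ≤ a → a ≤ a' → a' < ej → sk ≤ b → b ≤ b' → b' < ek → 0 < κ a b → 0 < κ a' b'

/-- A bound for the way of the first chain during a walk. -/
def PhaseBound (κ : ℕ → ℕ → ℝ) (si ei sj ej sk ek N a b m : ℕ) : Prop :=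
  (OnePhase κ sj ej sk ek ∧ (N + m + 1 ≤ a + b + ei ∨
    (∃ a₁ b₁, sj ≤ a₁ ∧ a₁ ≤ a ∧ sk ≤ b₁ ∧ b₁ ≤ b ∧ 0 < κ a₁ b₁) ∧
      N + si + si ≤ a + b + ei + m)) ∨
  (OnePhase (fun a b => -κ a b) sj ej sk ek ∧ (N + si ≤ a + b + m ∨
    (∃ a₁ b₁, sj ≤ a₁ ∧ a₁ ≤ a ∧ sk ≤ b₁ ∧ b₁ ≤ b ∧ 0 < -κ a₁ b₁) ∧
      N + si + m + 1 ≤ a + b + ei + ei))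

theorem PhaseBound.le {κ : ℕ → ℕ → ℝ} {si ei sj ej sk ek N a b m : ℕ}
    (h : PhaseBound κ si ei sj ej sk ek N a b m) (hm : si ≤ m) (hm' : m < ei) :
    N ≤ a + b + 2 * (ei - si) := by
  rcases h with ⟨-, h | ⟨-, h⟩⟩ | ⟨-, h | ⟨-, h⟩⟩ <;> omega

theorem PhaseBound.step {κ : ℕ → ℕ → ℝ} {si ei sj ej sk ek N N' a b m a' b' m' : ℕ}
    (h : PhaseBound κ si ei sj ej sk ek N a b m)
    (hsj : sj ≤ a) (hej : a < ej) (hsk : sk ≤ b) (hek : b < ek) (hm : si ≤ m) (hm₁ : m < ei)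
    (hm₂ : m' < ei)
    (haa : a ≤ a') (hbb : b ≤ b') (hab : a + b + 1 ≤ a' + b')
    (h₁ : 0 ≤ κ a b → m ≤ m') (h₂ : κ a b ≤ 0 → m' ≤ m)
    (hN : N' ≤ N + (max m m' - min m m') + 1) :
    PhaseBound κ si ei sj ej sk ek N' a' b' m' := by
  rcases h with ⟨ho, h⟩ | ⟨ho, h⟩
  · refine Or.inl ⟨ho, ?_⟩
    rcases lt_or_ge 0 (κ a b) with hk | hk
    · have := h₁ hk.le
      right
      refine ⟨⟨a, b, hsj, haa, hsk, hbb, hk⟩, ?_⟩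
      rcases h with h | ⟨-, h⟩ <;> omega
    · have := h₂ hk
      rcases h with h | ⟨⟨a₁, b₁, g1, g2, g3, g4, g5⟩, h⟩
      · left; omega
      · exact absurd (ho a₁ a b₁ b g1 g2 hej g3 g4 hek g5) (not_lt.2 hk)
  · refine Or.inr ⟨ho, ?_⟩
    rcases lt_or_ge 0 (-κ a b) with hk | hk
    · have := h₂ (by linarith)
      right
      refine ⟨⟨a, b, hsj, haa, hsk, hbb, hk⟩, ?_⟩
      rcases h with h | ⟨-, h⟩ <;> omega
    · have := h₁ (by linarith)
      rcases h with h | ⟨⟨a₁, b₁, g1, g2, g3, g4, g5⟩, h⟩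
      · left; omega
      · exact absurd (ho a₁ a b₁ b g1 g2 hej g3 g4 hek g5) (not_lt.2 hk)

/-- Chooses the edges of the first chain for which triples are recorded. -/
def chooseRange : Prog :=
  .ite (.natLt 0 (nv vFirst)) (nset vLoM (nv vSi) ;; nset vHiM (nv vEi))
    (.ite (.natLt 0 (nv vRev))
      (.ite (.natLt (nv vM) (nv vPrev)) (nset vLoM (nv vM) ;; nset vHiM (nv vPrev + 1))
        (nset vLoM (nv vPrev) ;; nset vHiM (nv vM + 1)))
      (nset vLoM 0 ;; nset vHiM 0))

/-- Records the exit from a pair of edges. -/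
def walkRecord : Prog :=
  chooseRange ;; outTriples ;; .ite (.natLt 0 (nv vRev)) .skip connect ;;
    nset vFirst 0 ;; nset vPrev (nv vM)

/-- One step of the walk. -/
def walkStep : Prog :=
  leave ;;
  .ite (.and (.natLt (nv vNA) (nv vEj)) (.natLt (nv vNB) (nv vEk)))
    (.ite (.natLt 0 (nv vRec))
      walkRecord
      .skip ;;
    nset vA (nv vNA) ;; nset vB (nv vNB))
    (nset vLoM (nv vSi) ;; nset vHiM (nv vEi) ;; outTriples ;; nset vA (nv vEj))

/-- Walks along the curve through the pairs of edges of two chains. -/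
def walk : Prog :=
  nset vA (nv vSj) ;; nset vB (nv vSk) ;; nset vFirst 1 ;;
  .loop (.and (.natLt (nv vA) (nv vEj)) (.natLt (nv vB) (nv vEk))) walkStep

theorem chooseRange_spec (s : Store) :
    Runs chooseRange s fun t s' => t ≤ 5 ∧ s'.real = s.real ∧
      (∀ c, c ≠ vLoM → c ≠ vHiM → s'.nat c = s.nat c) ∧
      (0 < s.nat vFirst 0 → s'.nat vLoM 0 = s.nat vSi 0 ∧ s'.nat vHiM 0 = s.nat vEi 0) ∧
      (s.nat vFirst 0 = 0 → 0 < s.nat vRev 0 → s'.nat vLoM 0 = min (s.nat vPrev 0) (s.nat vM 0) ∧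
        s'.nat vHiM 0 = max (s.nat vPrev 0) (s.nat vM 0) + 1) ∧
      (s.nat vFirst 0 = 0 → s.nat vRev 0 = 0 → s'.nat vLoM 0 = 0 ∧ s'.nat vHiM 0 = 0) := by
  have aux : ∀ (s : Store) (x y : NatExpr), ∀ c, c ≠ vLoM → c ≠ vHiM →
      ((s.setNat vLoM (NatExpr.eval s 0) (x.eval s)).setNat vHiM
        (NatExpr.eval (s.setNat vLoM (NatExpr.eval s 0) (x.eval s)) 0)
        (y.eval (s.setNat vLoM (NatExpr.eval s 0) (x.eval s)))).nat c = s.nat c := by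
    intro s x y c h1 h2
    funext r
    simp [h1, h2]
  refine runs_ite (fun h => ?_) (fun h => runs_ite (fun h' => runs_ite (fun h'' => ?_)
    (fun h'' => ?_)) (fun h' => ?_))
  · have h1 : 0 < s.nat vFirst 0 := by simpa using h
    refine runs_seq (runs_setNat (runs_setNat ⟨by norm_num, rfl, aux _ _ _, ?_, ?_, ?_⟩))
    · intro; simp
    · intro; omega
    · intro; omega
  · have h1 : ¬ 0 < s.nat vFirst 0 := by simpa using h
    have h2 : 0 < s.nat vRev 0 := by simpa using h'
    have h3 : s.nat vM 0 < s.nat vPrev 0 := by simpa using h''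
    refine runs_seq (runs_setNat (runs_setNat ⟨by norm_num, rfl, aux _ _ _, ?_, ?_, ?_⟩))
    · intro; omega
    · intro; simp; omega
    · intro; omega
  · have h1 : ¬ 0 < s.nat vFirst 0 := by simpa using h
    have h2 : 0 < s.nat vRev 0 := by simpa using h'
    have h3 : ¬ s.nat vM 0 < s.nat vPrev 0 := by simpa using h''
    refine runs_seq (runs_setNat (runs_setNat ⟨by norm_num, rfl, aux _ _ _, ?_, ?_, ?_⟩))
    · intro; omega
    · intro; simp; omega
    · intro; omega
  · have h1 : ¬ 0 < s.nat vFirst 0 := by simpa using h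
    have h2 : ¬ 0 < s.nat vRev 0 := by simpa using h'
    refine runs_seq (runs_setNat (runs_setNat ⟨by norm_num, rfl, aux _ _ _, ?_, ?_, ?_⟩))
    · intro; omega
    · intro; omega
    · intro; simp

theorem Separated.edge_mono {Bi Di Bj Dj Bk Dk : ℕ → ℂ} {si ei sj ej sk ek : ℕ} {σ : ℝ}
    (S : Separated Bi Di Bj Dj Bk Dk si ei sj ej sk ek σ) {a b m m' : ℕ} {t u r t' u' r' : ℝ}
    (h : OnCurve Bi Di Bj Dj Bk Dk si ei a t b u m r) (hr : m + 1 < ei → r < 1)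
    (h' : OnCurve Bi Di Bj Dj Bk Dk si ei a t' b u' m' r') (hr' : m' + 1 < ei → r' < 1)
    (hb : sk ≤ b) (hb' : b < ek) (ht : t ≤ t') :
    (0 ≤ σ * cross (Dj a) (Dk b) → m ≤ m') ∧ (σ * cross (Dj a) (Dk b) ≤ 0 → m' ≤ m) :=
  ⟨fun hc => le_of_add_le ((S.first_mono h h' hb hb' ht).1 hc) hr' h.nonneg h.lt h'.le,
    fun hc => le_of_add_le ((S.first_mono h h' hb hb' ht).2 hc) hr h'.nonneg h'.lt h.le⟩

/-- The parameters of a walk: the roles of the arcs, the positions of the chains, the ranges of the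
edges and an orientation. -/
structure WalkPar where
  (i j k oi oj ok si ei sj ej sk ek : ℕ)
  σ : ℝ

section
variable {s s' s₀ : Store} {N x a b : ℕ} {P : WalkPar} {f : ℕ → ℕ} {zi zj zk : ℂ} {t₀ u₀ : ℝ}

/-- The point `z` is on edge `a` of the chain at position `o`, with parameter `t`. -/
abbrev RepAt (s : Store) (o x y : ℕ) (z : ℂ) (a : ℕ) (t : ℝ) : Prop :=
  IsRep (chB s o) (chD s o) (chLo s o) (chHi s o) x y z a t

theorem RepAt.congr {o y : ℕ} {z : ℂ} {t : ℝ} (hA : Agree N s s') (hN : 300 ≤ N) :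
    RepAt s' o x y z a t ↔ RepAt s o x y z a t := by
  simp only [RepAt, chB_congr hA hN, chD_congr hA hN, chLo_congr hA hN, chHi_congr hA hN]

/-- The sign of this number tells how the first chain is passed while the walk is on a pair of
edges. -/
noncomputable def slope (s : Store) (P : WalkPar) (a b : ℕ) : ℝ :=
  P.σ * cross (chD s P.oj a) (chD s P.ok b)

/-- The assumptions on the memory before a walk. -/
structure WalkCtx (s : Store) (P : WalkPar) (f : ℕ → ℕ) : Prop where
  setup : Setup s P.oi P.oj P.ok P.si P.ei P.sj P.ej P.sk P.ek P.σ
  roles : IsRoles P.i P.j P.k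
  hi : s.nat vI 0 = P.i
  hj : s.nat vJ 0 = P.j
  hk : s.nat vK 0 = P.k
  fi : P.ei ≤ f P.i
  fj : P.ej ≤ f P.j
  fk : ∀ b < P.ek, edgeK s b < f P.k
  hsj : P.sj < P.ej
  hsk : P.sk < P.ek
  phase : 0 < s.nat vRev 0 → OnePhase (slope s P) P.sj P.ej P.sk P.ek ∨
    OnePhase (fun a b => -slope s P a b) P.sj P.ej P.sk P.ek

theorem edgeK_congr (h : Agree N s s') (hN : 306 ≤ N) (b : ℕ) :
    edgeK s' b = edgeK s b := by
  simp only [edgeK, (h vRev (by norm_num) (by omega)).1, (h aLen (by norm_num) (by omega)).1,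
    (h vK (by norm_num) (by omega)).1]

theorem slope_congr (h : Agree N s s') (hN : 300 ≤ N) (P : WalkPar) :
    slope s' P = slope s P := by
  funext a b
  simp only [slope, chD_congr h hN]

theorem WalkCtx.congr (h : WalkCtx s P f) (hA : Agree 500 s s') :
    WalkCtx s' P f := by
  refine ⟨h.setup.congr hA, h.roles, ?_, ?_, ?_, h.fi, h.fj, ?_, h.hsj, h.hsk, ?_⟩
  · rw [(hA vI (by norm_num) (by norm_num)).1, h.hi]
  · rw [(hA vJ (by norm_num) (by norm_num)).1, h.hj]
  · rw [(hA vK (by norm_num) (by norm_num)).1, h.hk]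
  · intro b hb
    rw [edgeK_congr hA (by norm_num)]
    exact h.fk b hb
  · rw [(hA vRev (by norm_num) (by norm_num)).1, slope_congr hA (by norm_num)]
    exact h.phase

/-- The triple of points is on the edges of some recorded triple. -/
def CovTriple (s₀ s : Store) (P : WalkPar) (zi zj zk : ℂ) : Prop :=
  ∃ m q a t b u, RepAt s₀ P.oi P.si P.ei zi m q ∧ RepAt s₀ P.oj P.sj P.ej zj a t ∧
    RepAt s₀ P.ok P.sk P.ek zk b u ∧ TripleIn s P.i P.j P.k m a (edgeK s₀ b)

/-- The pair of points is on the two sub-edges of some piece. -/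
def CovPiece (s₀ s : Store) (x : ℕ) (P : WalkPar) (zj zk : ℂ) : Prop :=
  ∃ r t u, x ≤ r ∧ r < s.nat vOut 0 ∧ s.real aLlo r ≤ t ∧ t ≤ s.real aLhi r ∧
    s.real aRlo r ≤ u ∧ u ≤ s.real aRhi r ∧
    linePt (chB s₀ P.oj) (chD s₀ P.oj) (s.nat aLE r) t = zj ∧
    linePt (chB s₀ P.ok) (chD s₀ P.ok) (s.nat aRE r) u = zk

theorem CovTriple.ext (hR : IsRoles P.i P.j P.k) (h : CovTriple s₀ s P zi zj zk)
    (h' : TripleExt s s') : CovTriple s₀ s' P zi zj zk := by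
  obtain ⟨m, q, a, t, b, u, h1, h2, h3, h4⟩ := h
  exact ⟨m, q, a, t, b, u, h1, h2, h3, h4.ext hR h'⟩

theorem CovPiece.ext (h : CovPiece s₀ s x P zj zk) (h' : PieceExt s s') :
    CovPiece s₀ s' x P zj zk := by
  obtain ⟨r, t, u, h1, h2, h3, h4, h5, h6, h7, h8⟩ := h
  have e := h'.old r h2
  exact ⟨r, t, u, h1, h2.trans_le h'.le, e.loL ▸ h3, e.hiL ▸ h4, e.loR ▸ h5, e.hiR ▸ h6,
    by rw [e.edgeL, h7], by rw [e.edgeR, h8]⟩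

/-- A position on two chains from which a pairing can be continued. -/
structure Cur where
  (a b : ℕ)
  (t u : ℝ)

variable {c₀ c : Cur}

/-- The position is before the ends of the edges. -/
structure Cur.Ok (c : Cur) (s : Store) (P : WalkPar) : Prop where
  a_lt : c.a < P.ej
  b_lt : c.b < P.ek
  t_lt_one : c.t < 1
  u_lt_one : c.u < 1
  t_lt : c.t < chHi s P.oj c.a
  u_lt : c.u < chHi s P.ok c.b

/-- The position is not after the start of the walk. -/
structure Cur.Before (c : Cur) (s : Store) (P : WalkPar) : Prop where
  a_le : c.a ≤ P.sj
  b_le : c.b ≤ P.sk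
  t_le : c.a = P.sj → c.t ≤ chLo s P.oj c.a
  u_le : c.b = P.sk → c.u ≤ chLo s P.ok c.b

/-- The part of the invariant of a walk that does not depend on whether the walk goes on. -/
structure WalkCore (s₀ : Store) (P : WalkPar) (f : ℕ → ℕ) (c₀ : Cur) (s : Store) (c : Cur) :
    Prop where
  agree : Agree 500 s₀ s
  text : TripleExt s₀ s
  tok : TripleOk f s
  pext : PieceExt s₀ s
  out_eq : 0 < s₀.nat vRev 0 → s.nat vOut 0 = s₀.nat vOut 0
  cur : s₀.nat vRev 0 = 0 → CurAt s (s.nat vOut 0) c.a c.t c.b c.u ∧ c.Ok s₀ P ∧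
    s.nat vOut 0 + c₀.a + c₀.b ≤ s₀.nat vOut 0 + c.a + c.b

/-- The points are covered by what has been written. -/
def Covered (s₀ s : Store) (P : WalkPar) (zi zj zk : ℂ) : Prop :=
  CovTriple s₀ s P zi zj zk ∨ (s₀.nat vRev 0 = 0 ∧ CovPiece s₀ s (s₀.nat vOut 0) P zj zk)

theorem Covered.ext (hR : IsRoles P.i P.j P.k) (h : Covered s₀ s P zi zj zk) (h' : TripleExt s s')
    (h'' : PieceExt s s') :
    Covered s₀ s' P zi zj zk := by
  rcases h with h | ⟨h1, h⟩
  · exact Or.inl (h.ext hR h')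
  · exact Or.inr ⟨h1, h.ext h''⟩

/-- The result of a walk. -/
structure WalkDone (s₀ : Store) (P : WalkPar) (f : ℕ → ℕ) (c₀ : Cur) (s : Store) (c : Cur) : Prop
    extends WalkCore s₀ P f c₀ s c where
  cover : ∀ zi zj zk, zi + zj + zk = 0 → ∀ m q a t b u, RepAt s₀ P.oi P.si P.ei zi m q →
    RepAt s₀ P.oj P.sj P.ej zj a t → RepAt s₀ P.ok P.sk P.ek zk b u → Covered s₀ s P zi zj zk
  count : s.nat vTrip 0 ≤ s₀.nat vTrip 0 + 4 * (P.ei - P.si) + (P.ej - P.sj) + (P.ek - P.sk)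

/-- The invariant of a walk that is on the pair of edges `(a, b)`, which it entered at the point
with parameters `t₀`, `u₀`. -/
structure WalkAt (s₀ : Store) (P : WalkPar) (f : ℕ → ℕ) (c₀ : Cur) (s : Store) (c : Cur)
    (a b : ℕ) (t₀ u₀ : ℝ) : Prop extends WalkCore s₀ P f c₀ s c where
  ha : s.nat vA 0 = a
  hb : s.nat vB 0 = b
  sj_le : P.sj ≤ a
  lt_ej : a < P.ej
  sk_le : P.sk ≤ b
  lt_ek : b < P.ek
  lo_le_t : chLo s₀ P.oj a ≤ t₀
  t_lt_hi : t₀ < chHi s₀ P.oj a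
  lo_le_u : chLo s₀ P.ok b ≤ u₀
  u_lt_hi : u₀ < chHi s₀ P.ok b
  first : 0 < s.nat vFirst 0 → t₀ = chLo s₀ P.oj a ∧ u₀ = chLo s₀ P.ok b ∧
    s.nat vTrip 0 = s₀.nat vTrip 0 ∧ (s₀.nat vRev 0 = 0 → c.Before s₀ P)
  later : s.nat vFirst 0 = 0 → (∃ q, OnCurve (chB s₀ P.oi) (chD s₀ P.oi) (chB s₀ P.oj)
    (chD s₀ P.oj) (chB s₀ P.ok) (chD s₀ P.ok) P.si P.ei a t₀ b u₀ (s.nat vPrev 0) q ∧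
      (s.nat vPrev 0 + 1 < P.ei → q < 1)) ∧
    (s₀.nat vRev 0 = 0 → c = ⟨a, b, t₀, u₀⟩ ∧
      s.nat vTrip 0 = s₀.nat vTrip 0 + (P.ei - P.si)) ∧
    (0 < s₀.nat vRev 0 → ∃ N, N + s₀.nat vTrip 0 + (P.ei - P.si) = s.nat vTrip 0 + P.sj + P.sk ∧
      PhaseBound (slope s₀ P) P.si P.ei P.sj P.ej P.sk P.ek N a b (s.nat vPrev 0))
  cover : ∀ zi zj zk, zi + zj + zk = 0 → ∀ m q a' t' b' u', RepAt s₀ P.oi P.si P.ei zi m q →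
    RepAt s₀ P.oj P.sj P.ej zj a' t' → RepAt s₀ P.ok P.sk P.ek zk b' u' →
    Covered s₀ s P zi zj zk ∨ ∃ a' t' b' u', RepAt s₀ P.oj P.sj P.ej zj a' t' ∧
      RepAt s₀ P.ok P.sk P.ek zk b' u' ∧ Ahead a b t₀ u₀ a' b' t' u'

theorem WalkCore.of_eq (h : WalkCore s₀ P f c₀ s c) (hA : Agree 500 s s')
    (hn : ∀ x, x < 200 → s'.nat x = s.nat x) (hr : ∀ x, x < 200 → s'.real x = s.real x) :
    WalkCore s₀ P f c₀ s' c := by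
  have e1 : s'.nat vOut 0 = s.nat vOut 0 := by rw [hn _ (by norm_num)]
  refine ⟨h.agree.trans hA, h.text.trans (TripleExt.of_eq fun x _ _ => hn x (by omega)),
    h.tok.of_eq fun x _ _ => hn x (by omega),
    h.pext.trans (PieceExt.of_eq fun x hx _ _ => ⟨hn x hx, hr x hx⟩), ?_, ?_⟩
  · rw [e1]; exact h.out_eq
  · intro h0
    obtain ⟨g1, g2, g3⟩ := h.cur h0
    rw [e1]
    refine ⟨⟨?_, ?_, ?_, ?_⟩, g2, g3⟩
    · rw [hn _ (by norm_num), g1.edgeL]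
    · rw [hr _ (by norm_num), g1.loL]
    · rw [hn _ (by norm_num), g1.edgeR]
    · rw [hr _ (by norm_num), g1.loR]

theorem WalkAt.of_eq (hR : IsRoles P.i P.j P.k) (h : WalkAt s₀ P f c₀ s c a b t₀ u₀)
    (hA : Agree 500 s s') (hn : ∀ x, x < 200 ∨ 500 ≤ x ∧ x ≤ 503 → s'.nat x = s.nat x)
    (hr : ∀ x, x < 200 → s'.real x = s.real x) : WalkAt s₀ P f c₀ s' c a b t₀ u₀ := by
  have e1 : s'.nat vTrip 0 = s.nat vTrip 0 := by rw [hn _ (by norm_num)]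
  have e2 : s'.nat vPrev 0 = s.nat vPrev 0 := by rw [hn _ (by norm_num)]
  have e3 : s'.nat vFirst 0 = s.nat vFirst 0 := by rw [hn _ (by norm_num)]
  refine ⟨h.toWalkCore.of_eq hA (fun x hx => hn x (Or.inl hx)) hr, ?_, ?_, h.sj_le, h.lt_ej,
    h.sk_le, h.lt_ek, h.lo_le_t, h.t_lt_hi, h.lo_le_u, h.u_lt_hi, ?_, ?_, ?_⟩
  · rw [hn _ (by norm_num), h.ha]
  · rw [hn _ (by norm_num), h.hb]
  · rw [e1, e3]; exact h.first
  · rw [e1, e2, e3]; exact h.later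
  · intro zi zj zk hz m q a' t' b' u' h1 h2 h3
    rcases h.cover zi zj zk hz m q a' t' b' u' h1 h2 h3 with h4 | h4
    · exact Or.inl (h4.ext hR (TripleExt.of_eq fun x _ _ => hn x (by omega))
        (PieceExt.of_eq fun x hx _ _ => ⟨hn x (Or.inl hx), hr x hx⟩))
    · exact Or.inr h4

theorem WalkAt.count_le (h : WalkAt s₀ P f c₀ s c a b t₀ u₀) :
    s.nat vTrip 0 ≤ s₀.nat vTrip 0 + 3 * (P.ei - P.si) + (P.ej - P.sj) + (P.ek - P.sk) := by
  have h1 := h.lt_ej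
  have h2 := h.lt_ek
  have h5 := h.sj_le
  have h6 := h.sk_le
  rcases Nat.eq_zero_or_pos (s.nat vFirst 0) with h0 | h0
  · obtain ⟨⟨q, hq, -⟩, g1, g2⟩ := h.later h0
    rcases Nat.eq_zero_or_pos (s₀.nat vRev 0) with h3 | h3
    · have := (g1 h3).2
      omega
    · obtain ⟨N, hN, hP⟩ := g2 h3
      have := hP.le hq.le hq.lt
      omega
  · have := (h.first h0).2.2.1
    omega

end

/-- The exit from the current pair of edges of a walk. -/
abbrev ExitAt (s₀ : Store) (P : WalkPar) (s : Store) (a b : ℕ) : Prop :=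
  IsExit (chB s₀ P.oi) (chD s₀ P.oi) (chB s₀ P.oj) (chD s₀ P.oj) (chB s₀ P.ok) (chD s₀ P.ok)
    P.si P.ei (chLo s₀ P.oj a) (chHi s₀ P.oj a) (chLo s₀ P.ok b) (chHi s₀ P.ok b) a b
    (s.nat vM 0) (s.real rT 0) (s.real rU 0) (s.nat vNA 0) (s.nat vNB 0) (s.real rNT 0)
    (s.real rNU 0) (s.nat vRec 0)

section
variable {s₀ s s' : Store} {P : WalkPar} {f : ℕ → ℕ} {c₀ c : Cur} {a b m : ℕ} {t₀ u₀ t u : ℝ}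

theorem WalkAt.cover_cell (hC : WalkCtx s₀ P f) (h : WalkAt s₀ P f c₀ s c a b t₀ u₀)
    (E : ExitAt s₀ P s a b) {zi zj zk : ℂ} (hz : zi + zj + zk = 0) {m : ℕ} {q : ℝ}
    (hi : RepAt s₀ P.oi P.si P.ei zi m q) {a' b' : ℕ} {t' u' : ℝ}
    (hj : RepAt s₀ P.oj P.sj P.ej zj a' t') (hk : RepAt s₀ P.ok P.sk P.ek zk b' u') :
    Covered s₀ s P zi zj zk ∨
    (∃ t₁ u₁, RepAt s₀ P.oj P.sj P.ej zj a t₁ ∧ RepAt s₀ P.ok P.sk P.ek zk b u₁ ∧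
      t₀ ≤ t₁ ∧ t₁ ≤ s.real rT 0 ∧ u₀ ≤ u₁ ∧ u₁ ≤ s.real rU 0) ∨
    ∃ a' t' b' u', RepAt s₀ P.oj P.sj P.ej zj a' t' ∧ RepAt s₀ P.ok P.sk P.ek zk b' u' ∧
      Ahead (s.nat vNA 0) (s.nat vNB 0) (s.real rNT 0) (s.real rNU 0) a' b' t' u' := by
  rcases h.cover zi zj zk hz m q a' t' b' u' hi hj hk with h1 | ⟨a₁, t₁, b₁, u₁, h1, h2, h3⟩
  · exact Or.inl h1
  · rcases E.ahead_step hC.setup.sep hC.setup.rangei hC.setup.rangej hC.setup.rangek h.sj_le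
      h.lt_ej h.sk_le h.lt_ek hz hi h.t_lt_hi.le h.u_lt_hi.le h1 h2 h3 with h4 | h4
    · exact Or.inr (Or.inl h4)
    · exact Or.inr (Or.inr ⟨a₁, t₁, b₁, u₁, h1, h2, h4⟩)

theorem Ahead.le {a' b' : ℕ} {t' u' : ℝ} (h : Ahead a b t u a' b' t' u') :
    a ≤ a' ∧ b ≤ b' := by
  constructor
  · rcases h.left with ⟨h, -⟩ | ⟨h, -⟩ <;> omega
  · rcases h.right with ⟨h, -⟩ | ⟨h, -⟩ <;> omega

theorem IsExit.add_le {Bi Di Bj Dj Bk Dk : ℕ → ℂ} {si ei : ℕ} {loj hij lok hik : ℝ} {na nb rec : ℕ} {nt nu : ℝ}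
    (E : IsExit Bi Di Bj Dj Bk Dk si ei loj hij lok hik a b m t u na nb nt nu rec) :
    a ≤ na ∧ b ≤ nb ∧ a + b + 1 ≤ na + nb := by
  rcases E.cases with ⟨-, -, h3, h4, -⟩ | ⟨-, -, h3, h4, -⟩ | ⟨-, -, h3, h4, -⟩ <;> omega

theorem Covered.of_triple {zi zj zk : ℂ} {q : ℝ} (h1 : RepAt s₀ P.oi P.si P.ei zi m q)
    (h2 : RepAt s₀ P.oj P.sj P.ej zj a t) (h3 : RepAt s₀ P.ok P.sk P.ek zk b u)
    (h4 : TripleIn s P.i P.j P.k m a (edgeK s₀ b)) :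
    Covered s₀ s P zi zj zk :=
  Or.inl ⟨m, q, a, t, b, u, h1, h2, h3, h4⟩

/-- The last step of a walk. -/
theorem WalkAt.done (hC : WalkCtx s₀ P f) (h : WalkAt s₀ P f c₀ s c a b t₀ u₀)
    (E : ExitAt s₀ P s a b) (hout : ¬ (s.nat vNA 0 < P.ej ∧ s.nat vNB 0 < P.ek))
    (hcore : WalkCore s₀ P f c₀ s' c) (hT : TripleExt s s') (hP : PieceExt s s')
    (hcnt : s'.nat vTrip 0 = s.nat vTrip 0 + (P.ei - P.si))
    (hin : ∀ m, P.si ≤ m → m < P.ei → TripleIn s' P.i P.j P.k m a (edgeK s₀ b)) :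
    WalkDone s₀ P f c₀ s' c := by
  refine ⟨hcore, ?_, ?_⟩
  · intro zi zj zk hz m q a' t' b' u' hi hj hk
    rcases h.cover_cell hC E hz hi hj hk with h1 | ⟨t₁, u₁, h1, h2, -⟩ |
      ⟨a₁, t₁, b₁, u₁, h1, h2, h3⟩
    · exact h1.ext hC.roles hT hP
    · exact Covered.of_triple hi h1 h2 (hin m hi.le hi.lt)
    · have := h3.le
      have e1 := h1.lt
      have e2 := h2.lt
      exact absurd ⟨by omega, by omega⟩ hout
  · have := h.count_le
    omega

/-- A step before the walk has met the two chains. -/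
theorem WalkAt.skip (hC : WalkCtx s₀ P f) (h : WalkAt s₀ P f c₀ s c a b t₀ u₀)
    (E : ExitAt s₀ P s a b) (hna : s.nat vNA 0 < P.ej) (hnb : s.nat vNB 0 < P.ek)
    (hrec : s.nat vRec 0 ≠ 1) (hcore : WalkCore s₀ P f c₀ s' c) (hT : TripleExt s s')
    (hP : PieceExt s s') (hcnt : s'.nat vTrip 0 = s.nat vTrip 0)
    (hF : s'.nat vFirst 0 = s.nat vFirst 0) (ha : s'.nat vA 0 = s.nat vNA 0)
    (hb : s'.nat vB 0 = s.nat vNB 0) :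
    WalkAt s₀ P f c₀ s' c (s.nat vNA 0) (s.nat vNB 0) (chLo s₀ P.oj (s.nat vNA 0))
      (chLo s₀ P.ok (s.nat vNB 0)) := by
  have hle := E.add_le
  have S := hC.setup
  have h1 : P.sj ≤ s.nat vNA 0 := h.sj_le.trans hle.1
  have h2 : P.sk ≤ s.nat vNB 0 := h.sk_le.trans hle.2.1
  have hfirst : 0 < s.nat vFirst 0 := by
    rcases Nat.eq_zero_or_pos (s.nat vFirst 0) with h0 | h0
    · obtain ⟨⟨q, hq, -⟩, -⟩ := h.later h0
      exact absurd (E.lt_of_onCurve S.sep h.sj_le h.lt_ej h.sk_le h.lt_ek hq h.t_lt_hi h.u_lt_hi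
        h.lo_le_t h.lo_le_u).2.2 hrec
    · exact h0
  refine ⟨hcore, ha, hb, h1, hna, h2, hnb, le_rfl, S.rangej.lo_lt_hi _ h1 hna, le_rfl,
    S.rangek.lo_lt_hi _ h2 hnb, ?_, ?_, ?_⟩
  · intro h0
    have := h.first hfirst
    exact ⟨rfl, rfl, by rw [hcnt, this.2.2.1], this.2.2.2⟩
  · intro h0
    omega
  · intro zi zj zk hz m q a' t' b' u' hi hj hk
    have ahead : ∀ {a₁ t₁ b₁ u₁}, RepAt s₀ P.oj P.sj P.ej zj a₁ t₁ →
        RepAt s₀ P.ok P.sk P.ek zk b₁ u₁ → s.nat vNA 0 ≤ a₁ → s.nat vNB 0 ≤ b₁ →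
        Ahead (s.nat vNA 0) (s.nat vNB 0) (chLo s₀ P.oj (s.nat vNA 0))
          (chLo s₀ P.ok (s.nat vNB 0)) a₁ b₁ t₁ u₁ := fun g1 g2 g3 g4 =>
      ⟨g1.posLE_lo S.rangej h1 g3, g2.posLE_lo S.rangek h2 g4⟩
    rcases h.cover_cell hC E hz hi hj hk with g | ⟨t₁, u₁, g1, g2, -, g3, -, g4⟩ |
      ⟨a₁, t₁, b₁, u₁, g1, g2, g3⟩
    · exact Or.inl (g.ext hC.roles hT hP)
    · obtain ⟨t₂, u₂, g5, g6⟩ := E.next_of_rec_eq_zero S.sep S.rangei S.rangej S.rangek hrec h.sj_le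
        h.sk_le hna hnb hz hi g1 g2 g3 g4
      exact Or.inr ⟨_, t₂, _, u₂, g5, g6, ahead g5 g6 le_rfl le_rfl⟩
    · exact Or.inr ⟨a₁, t₁, b₁, u₁, g1, g2, ahead g1 g2 g3.le.1 g3.le.2⟩

/-- A step along the curve. -/
theorem WalkAt.step {c' : Cur} (hC : WalkCtx s₀ P f) (h : WalkAt s₀ P f c₀ s c a b t₀ u₀)
    (E : ExitAt s₀ P s a b) (hna : s.nat vNA 0 < P.ej) (hnb : s.nat vNB 0 < P.ek)
    (hrec : s.nat vRec 0 = 1) (hcore : WalkCore s₀ P f c₀ s' c') (hT : TripleExt s s')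
    (hP : PieceExt s s') (hF : s'.nat vFirst 0 = 0) (hprev : s'.nat vPrev 0 = s.nat vM 0)
    (ha : s'.nat vA 0 = s.nat vNA 0) (hb : s'.nat vB 0 = s.nat vNB 0)
    (hc : s₀.nat vRev 0 = 0 → c' = ⟨s.nat vNA 0, s.nat vNB 0, s.real rNT 0, s.real rNU 0⟩)
    (hfirst : 0 < s.nat vFirst 0 → s'.nat vTrip 0 = s.nat vTrip 0 + (P.ei - P.si) ∧
      ∀ m, P.si ≤ m → m < P.ei → TripleIn s' P.i P.j P.k m a (edgeK s₀ b))
    (hlater : s.nat vFirst 0 = 0 → 0 < s₀.nat vRev 0 →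
      s'.nat vTrip 0 = s.nat vTrip 0 +
        (max (s.nat vPrev 0) (s.nat vM 0) + 1 - min (s.nat vPrev 0) (s.nat vM 0)) ∧
      ∀ m, min (s.nat vPrev 0) (s.nat vM 0) ≤ m → m < max (s.nat vPrev 0) (s.nat vM 0) + 1 →
        TripleIn s' P.i P.j P.k m a (edgeK s₀ b))
    (hpair : s.nat vFirst 0 = 0 → s₀.nat vRev 0 = 0 → s'.nat vTrip 0 = s.nat vTrip 0 ∧
      ∃ r, s₀.nat vOut 0 ≤ r ∧ r < s'.nat vOut 0 ∧ s'.nat aLE r = a ∧ s'.nat aRE r = b ∧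
        s'.real aLlo r = t₀ ∧ s'.real aRlo r = u₀ ∧ s'.real aLhi r = s.real rT 0 ∧
        s'.real aRhi r = s.real rU 0) :
    WalkAt s₀ P f c₀ s' c' (s.nat vNA 0) (s.nat vNB 0) (s.real rNT 0) (s.real rNU 0) := by
  have hle := E.add_le
  have S := hC.setup
  have h1 : P.sj ≤ s.nat vNA 0 := h.sj_le.trans hle.1
  have h2 : P.sk ≤ s.nat vNB 0 := h.sk_le.trans hle.2.1
  obtain ⟨⟨q, hq, hq1⟩, n1, n2, n3, n4, -, -⟩ := E.next S.sep S.rangej S.rangek hrec h.sj_le h.sk_le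
    hna hnb
  obtain ⟨q', hq', hq1'⟩ := E.curve
  have hm := hq.le
  have hm' := hq.lt
  refine ⟨hcore, ha, hb, h1, hna, h2, hnb, n1, n2, n3, n4, by omega, ?_, ?_⟩
  · intro _
    rw [hprev]
    refine ⟨⟨q, hq, hq1⟩, fun h0 => ⟨hc h0, ?_⟩, fun h0 => ?_⟩
    · rcases Nat.eq_zero_or_pos (s.nat vFirst 0) with h3 | h3
      · have := ((h.later h3).2.1 h0).2
        have := (hpair h3 h0).1
        omega
      · have := (h.first h3).2.2.1
        have := (hfirst h3).1
        omega
    · rcases Nat.eq_zero_or_pos (s.nat vFirst 0) with h3 | h3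
      · obtain ⟨⟨q₀, hq₀, hq₀'⟩, -, g⟩ := h.later h3
        obtain ⟨N, hN, hB⟩ := g h0
        have hcnt := (hlater h3 h0).1
        refine ⟨N + (max (s.nat vPrev 0) (s.nat vM 0) + 1 - min (s.nat vPrev 0) (s.nat vM 0)),
          by omega, hB.step h.sj_le h.lt_ej h.sk_le h.lt_ek hq₀.le hq₀.lt hm' hle.1 hle.2.1
          hle.2.2 ?_ ?_ (by omega)⟩
        all_goals
          have ht := (E.lt_of_onCurve S.sep h.sj_le h.lt_ej h.sk_le h.lt_ek hq₀ h.t_lt_hi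
            h.u_lt_hi h.lo_le_t h.lo_le_u).1
        · exact (S.sep.edge_mono hq₀ hq₀' hq' hq1' h.sk_le h.lt_ek ht.le).1
        · exact (S.sep.edge_mono hq₀ hq₀' hq' hq1' h.sk_le h.lt_ek ht.le).2
      · have e1 := (h.first h3).2.2.1
        have e2 := (hfirst h3).1
        have e3 := h.sj_le
        have e4 := h.sk_le
        refine ⟨P.sj + P.sk, by omega, ?_⟩
        rcases hC.phase h0 with h4 | h4
        · exact Or.inl ⟨h4, Or.inl (by omega)⟩
        · exact Or.inr ⟨h4, Or.inl (by omega)⟩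
  · intro zi zj zk hz m₀ r₀ a' t' b' u' hi hj hk
    rcases h.cover_cell hC E hz hi hj hk with g | ⟨t₁, u₁, g1, g2, g3, g4, g5, g6⟩ | g
    · exact Or.inl (g.ext hC.roles hT hP)
    · left
      rcases Nat.eq_zero_or_pos (s.nat vFirst 0) with h3 | h3
      · rcases Nat.eq_zero_or_pos (s₀.nat vRev 0) with h0 | h0
        · obtain ⟨-, r, k1, k2, k3, k4, k5, k6, k7, k8⟩ := hpair h3 h0
          refine Or.inr ⟨h0, r, t₁, u₁, k1, k2, k5 ▸ g3, k7 ▸ g4, k6 ▸ g5, k8 ▸ g6, ?_, ?_⟩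
          · rw [k3, g1.eq]
          · rw [k4, g2.eq]
        · obtain ⟨m₁, r₁, hi₁, hr₁⟩ := hi.canonical S.rangei S.sep.linki
          obtain ⟨⟨q₀, hq₀, hq₀'⟩, -, -⟩ := h.later h3
          have hP₁ := onCurve_of_isRep (Bj := chB s₀ P.oj) (Dj := chD s₀ P.oj)
            (Bk := chB s₀ P.ok) (Dk := chD s₀ P.ok) S.rangei hz hi₁ g1.eq g2.eq
          have e1 := S.sep.edge_mono hq₀ hq₀' hP₁ hr₁ h.sk_le h.lt_ek g3
          have e2 := S.sep.edge_mono hP₁ hr₁ hq' hq1' h.sk_le h.lt_ek g4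
          refine Covered.of_triple hi₁ g1 g2 ((hlater h3 h0).2 m₁ ?_ ?_)
          all_goals
            rcases le_total 0 (P.σ * cross (chD s₀ P.oj a) (chD s₀ P.ok b)) with h5 | h5
            · have := e1.1 h5
              have := e2.1 h5
              omega
            · have := e1.2 h5
              have := e2.2 h5
              omega
      · exact Covered.of_triple hi g1 g2 ((hfirst h3).2 m₀ hi.le hi.lt)
    · exact Or.inr g

end

section
variable {s s' s₀ : Store} {P : WalkPar} {f : ℕ → ℕ} {c₀ c : Cur} {a b x i v : ℕ} {t₀ u₀ : ℝ}

theorem _root_.RealRAM.Frame.pieceExt {p : Prog} (h : Frame p s s')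
    (hp : p.writesNat aLE = false ∧ p.writesNat aRE = false ∧ p.writesNat vOut = false ∧
      p.writesReal aLlo = false ∧ p.writesReal aLhi = false ∧ p.writesReal aRlo = false ∧
      p.writesReal aRhi = false) : PieceExt s s' := by
  obtain ⟨h1, h2, h3, h4, h5, h6, h7⟩ := hp
  have e1 := h.1 _ h1
  have e2 := h.1 _ h2
  have e3 := h.1 _ h3
  have e4 := h.2 _ h4
  have e5 := h.2 _ h5
  have e6 := h.2 _ h6
  have e7 := h.2 _ h7
  refine ⟨by rw [e3], fun r _ => ⟨by rw [e1], by rw [e4], by rw [e5], by rw [e2], by rw [e6],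
    by rw [e7]⟩, ⟨by rw [e1], by rw [e4], by rw [e2], by rw [e6]⟩, fun r g1 g2 => ?_⟩
  rw [e3] at g2
  omega

theorem WalkCore.of_ext (h : WalkCore s₀ P f c₀ s c) (hA : Agree 500 s s') (hT : TripleExt s s')
    (hf : TripleOk f s') (hP : PieceExt s s') (ho : s'.nat vOut 0 = s.nat vOut 0) :
    WalkCore s₀ P f c₀ s' c := by
  refine ⟨h.agree.trans hA, h.text.trans hT, hf, h.pext.trans hP, ?_, ?_⟩
  · rw [ho]; exact h.out_eq
  · intro h0
    obtain ⟨g1, g2, g3⟩ := h.cur h0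
    rw [ho]
    exact ⟨g1.ext hP le_rfl, g2, g3⟩

theorem outTriples_core {lo hi : ℕ} (hC : WalkCtx s₀ P f) (h : WalkCore s₀ P f c₀ s c)
    (ha : s.nat vA 0 = a) (hb : s.nat vB 0 = b) (hj : a < P.ej) (hk : b < P.ek)
    (hlo : s.nat vLoM 0 = lo) (hhi : s.nat vHiM 0 = hi) (hle : lo ≤ hi) (hi' : hi ≤ P.ei) :
    Runs outTriples s fun t s' => t ≤ 9 * (hi - lo) + 3 ∧ WalkCore s₀ P f c₀ s' c ∧
      TripleExt s s' ∧ PieceExt s s' ∧ s'.nat vTrip 0 = s.nat vTrip 0 + (hi - lo) ∧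
      s'.nat vOut 0 = s.nat vOut 0 ∧
      ∀ m, lo ≤ m → m < hi → TripleIn s' P.i P.j P.k m a (edgeK s₀ b) := by
  have hC' := hC.congr h.agree
  refine (outTriples_spec s hC.roles hC'.hi hC'.hj hC'.hk hlo hhi ha hle h.tok
    (fun m hm => (hm.trans_le hi').trans_le hC.fi) (hj.trans_le hC.fj)
    (by rw [hb]; exact hC'.fk b hk)).mono ?_
  rintro t s' hF ⟨h1, h2, h3, h4, h5⟩
  have hP : PieceExt s s' := hF.pieceExt (by decide)
  have ho : s'.nat vOut 0 = s.nat vOut 0 := by rw [hF.1 vOut (by decide)]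
  refine ⟨h1, h.of_ext (hF.agree 500 (by decide)) h2 h3 hP ho, h2, hP, h4, ho, ?_⟩
  rw [hb, edgeK_congr h.agree (by norm_num)] at h5
  exact h5

/-- What a step of the walk does after the exit from a pair of edges has been computed. -/
def WalkNext (s₀ : Store) (P : WalkPar) (f : ℕ → ℕ) (c₀ : Cur) (a b : ℕ) (s' : Store) : Prop :=
  ∃ c', (∃ a' b' t' u', a + b + 1 ≤ a' + b' ∧ WalkAt s₀ P f c₀ s' c' a' b' t' u') ∨
    (s'.nat vA 0 = P.ej ∧ s'.nat vB 0 = b ∧ WalkDone s₀ P f c₀ s' c')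

set_option maxRecDepth 20000 in
theorem leave_walkAt (hC : WalkCtx s₀ P f) (h : WalkAt s₀ P f c₀ s c a b t₀ u₀) :
    Runs leave s fun t s' => t ≤ 12 * s₀.nat vLog 0 + 30 ∧ WalkAt s₀ P f c₀ s' c a b t₀ u₀ ∧
      ExitAt s₀ P s' a b ∧ s'.nat vTrip 0 = s.nat vTrip 0 ∧ s'.nat vOut 0 = s.nat vOut 0 := by
  refine (leave_spec s (hC.congr h.agree).setup h.ha h.hb h.sj_le h.lt_ej h.sk_le h.lt_ek).mono ?_
  rintro t s' hF ⟨h1, h2⟩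
  have hn : ∀ x < 504, Prog.writesNat leave x = false := by decide
  have hr : ∀ x < 200, Prog.writesReal leave x = false := by decide
  refine ⟨?_, h.of_eq hC.roles (hF.agree 500 (by decide)) (fun x hx => hF.1 x (hn x (by omega)))
    (fun x hx => hF.2 x (hr x hx)), ?_, by rw [hF.1 _ (hn _ (by norm_num))],
    by rw [hF.1 _ (hn _ (by norm_num))]⟩
  · rwa [(h.agree vLog (by norm_num) (by norm_num)).1] at h1
  · simpa only [chB_congr h.agree (by norm_num : 300 ≤ 500),
      chD_congr h.agree (by norm_num : 300 ≤ 500), chLo_congr h.agree (by norm_num : 300 ≤ 500),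
      chHi_congr h.agree (by norm_num : 300 ≤ 500)] using h2

theorem agree_setNat {N : ℕ} (h : x < 200 ∨ N ≤ x) :
    Agree N s (s.setNat x i v) := by
  intro y h1 h2
  refine ⟨?_, rfl⟩
  funext r
  rw [Store.setNat_nat, if_neg (by omega)]

theorem setNat_nat_of_ne {y : ℕ} (h : y ≠ x) :
    (s.setNat x i v).nat y = s.nat y := by
  funext r
  simp [h]

theorem WalkCore.setNat (h : WalkCore s₀ P f c₀ s c) (hx : 500 ≤ x) :
    WalkCore s₀ P f c₀ (s.setNat x i v) c :=
  h.of_eq (agree_setNat (Or.inr hx)) (fun _ _ => setNat_nat_of_ne (by omega)) fun _ _ => rfl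

theorem tripleExt_setNat (hx : 200 ≤ x) : TripleExt s (s.setNat x i v) :=
  TripleExt.of_eq fun _ _ _ => setNat_nat_of_ne (by omega)

theorem pieceExt_setNat (hx : 200 ≤ x) : PieceExt s (s.setNat x i v) :=
  PieceExt.of_eq fun _ _ _ _ => ⟨setNat_nat_of_ne (by omega), rfl⟩

theorem leaving_spec (hC : WalkCtx s₀ P f) (h : WalkAt s₀ P f c₀ s c a b t₀ u₀)
    (E : ExitAt s₀ P s a b) (hout : ¬ (s.nat vNA 0 < P.ej ∧ s.nat vNB 0 < P.ek)) :
    Runs (nset vLoM (nv vSi) ;; nset vHiM (nv vEi) ;; outTriples ;; nset vA (nv vEj)) s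
      fun t s' => t + 9 * s.nat vTrip 0 ≤ 9 * s'.nat vTrip 0 + 6 ∧
        s'.nat vOut 0 = s.nat vOut 0 ∧ WalkNext s₀ P f c₀ a b s' := by
  have S := (hC.congr h.agree).setup
  refine runs_seq (runs_setNat (runs_seq (runs_setNat ?_)))
  rw [show NatExpr.eval s (nv vSi) = P.si from S.hsi]
  rw [show NatExpr.eval (s.setNat vLoM (NatExpr.eval s 0) P.si) (nv vEi) = P.ei from by
    simp [S.hei]]
  set s₁ := (s.setNat vLoM _ _).setNat vHiM _ _ with hs₁
  have e : ∀ x, x ≠ vLoM → x ≠ vHiM → s₁.nat x = s.nat x := fun x h1 h2 => by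
    rw [hs₁, setNat_nat_of_ne h2, setNat_nat_of_ne h1]
  refine (outTriples_core (lo := P.si) (hi := P.ei) hC
    ((h.toWalkCore.setNat (by norm_num)).setNat (by norm_num)) (by rw [e _ (by norm_num) (by norm_num), h.ha])
    (by rw [e _ (by norm_num) (by norm_num), h.hb]) h.lt_ej h.lt_ek (by simp) (by simp)
    S.hlt.le le_rfl).seq ?_
  rintro t s₂ hF ⟨h1, h2, h3, h4, h5, h6, h7⟩
  have eN : NatExpr.eval s₂ (nv vEj) = P.ej := by
    have := (h2.agree vEj (by norm_num) (by norm_num)).1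
    simp [this, hC.setup.hej]
  have eT : s₁.nat vTrip 0 = s.nat vTrip 0 := by rw [e _ (by norm_num) (by norm_num)]
  have eO : s₁.nat vOut 0 = s.nat vOut 0 := by rw [e _ (by norm_num) (by norm_num)]
  have hT : TripleExt s s₂ :=
    ((tripleExt_setNat (by norm_num)).trans (tripleExt_setNat (by norm_num))).trans h3
  have hP : PieceExt s s₂ :=
    ((pieceExt_setNat (by norm_num)).trans (pieceExt_setNat (by norm_num))).trans h4
  refine runs_setNat ?_
  rw [eN]
  set s₃ := s₂.setNat vA _ _ with hs₃
  have e3 : ∀ x, x ≠ vA → s₃.nat x = s₂.nat x := fun x hx => setNat_nat_of_ne hx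
  have e4 : s₃.nat vTrip 0 = s.nat vTrip 0 + (P.ei - P.si) := by
    rw [e3 _ (by norm_num), h5, eT]
  refine ⟨by omega, by rw [e3 _ (by norm_num), h6, eO], c, Or.inr ⟨by simp [hs₃], ?_, ?_⟩⟩
  · rw [e3 _ (by norm_num), hF.1 vB (by decide), e _ (by norm_num) (by norm_num), h.hb]
  · exact h.done hC E hout (h2.setNat (by norm_num)) (hT.trans (tripleExt_setNat (by norm_num)))
      (hP.trans (pieceExt_setNat (by norm_num))) e4
      fun m hm hm' => (h7 m hm hm').ext hC.roles (tripleExt_setNat (by norm_num))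

end

/-- What has been recorded at the exit from a pair of edges. -/
structure Recorded (s₀ : Store) (P : WalkPar) (f : ℕ → ℕ) (c₀ : Cur) (a b : ℕ) (t₀ u₀ : ℝ)
    (s s' : Store) (c' : Cur) : Prop where
  core : WalkCore s₀ P f c₀ s' c'
  text : TripleExt s s'
  pext : PieceExt s s'
  cur : s₀.nat vRev 0 = 0 → c' = ⟨s.nat vNA 0, s.nat vNB 0, s.real rNT 0, s.real rNU 0⟩
  first : 0 < s.nat vFirst 0 → s'.nat vTrip 0 = s.nat vTrip 0 + (P.ei - P.si) ∧
      ∀ m, P.si ≤ m → m < P.ei → TripleIn s' P.i P.j P.k m a (edgeK s₀ b)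
  later : s.nat vFirst 0 = 0 → 0 < s₀.nat vRev 0 →
      s'.nat vTrip 0 = s.nat vTrip 0 +
        (max (s.nat vPrev 0) (s.nat vM 0) + 1 - min (s.nat vPrev 0) (s.nat vM 0)) ∧
      ∀ m, min (s.nat vPrev 0) (s.nat vM 0) ≤ m → m < max (s.nat vPrev 0) (s.nat vM 0) + 1 →
        TripleIn s' P.i P.j P.k m a (edgeK s₀ b)
  pair : s.nat vFirst 0 = 0 → s₀.nat vRev 0 = 0 → s'.nat vTrip 0 = s.nat vTrip 0 ∧
      ∃ r, s₀.nat vOut 0 ≤ r ∧ r < s'.nat vOut 0 ∧ s'.nat aLE r = a ∧ s'.nat aRE r = b ∧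
        s'.real aLlo r = t₀ ∧ s'.real aRlo r = u₀ ∧ s'.real aLhi r = s.real rT 0 ∧
        s'.real aRhi r = s.real rU 0

section
variable {s₀ s : Store} {P : WalkPar} {f : ℕ → ℕ} {c₀ c : Cur} {a b : ℕ} {t₀ u₀ : ℝ}

theorem Recorded.of_eq {s' s'' : Store} {c' : Cur} (hR : IsRoles P.i P.j P.k) (h : Recorded s₀ P f c₀ a b t₀ u₀ s s' c')
    (hA : Agree 500 s' s'') (hn : ∀ x, x < 200 → s''.nat x = s'.nat x)
    (hr : ∀ x, x < 200 → s''.real x = s'.real x) :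
    Recorded s₀ P f c₀ a b t₀ u₀ s s'' c' := by
  have hT : TripleExt s' s'' := TripleExt.of_eq fun x _ _ => hn x (by omega)
  refine ⟨h.core.of_eq hA hn hr, h.text.trans hT,
    h.pext.trans (PieceExt.of_eq fun x hx _ _ => ⟨hn x hx, hr x hx⟩), h.cur, ?_, ?_, ?_⟩
  · intro h0
    rw [hn _ (by norm_num)]
    exact ⟨(h.first h0).1, fun m g1 g2 => ((h.first h0).2 m g1 g2).ext hR hT⟩
  · intro h0 h1
    rw [hn _ (by norm_num)]
    exact ⟨(h.later h0 h1).1, fun m g1 g2 => ((h.later h0 h1).2 m g1 g2).ext hR hT⟩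
  · intro h0 h1
    obtain ⟨g1, r, g2, g3, g4, g5, g6, g7, g8, g9⟩ := h.pair h0 h1
    refine ⟨by rw [hn _ (by norm_num), g1], r, g2, by rw [hn _ (by norm_num)]; exact g3, ?_⟩
    rw [hn _ (by norm_num), hn _ (by norm_num), hr _ (by norm_num), hr _ (by norm_num),
      hr _ (by norm_num), hr _ (by norm_num)]
    exact ⟨g4, g5, g6, g7, g8, g9⟩

set_option maxRecDepth 20000 in
theorem walkRecord_range (hC : WalkCtx s₀ P f) (h : WalkAt s₀ P f c₀ s c a b t₀ u₀)
    (E : ExitAt s₀ P s a b) :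
    Runs (chooseRange ;; outTriples) s fun t s' =>
      t + 9 * s.nat vTrip 0 ≤ 9 * s'.nat vTrip 0 + 8 ∧ s'.nat vOut 0 = s.nat vOut 0 ∧
      WalkCore s₀ P f c₀ s' c ∧ TripleExt s s' ∧ PieceExt s s' ∧
      (0 < s.nat vFirst 0 → s'.nat vTrip 0 = s.nat vTrip 0 + (P.ei - P.si) ∧
        ∀ m, P.si ≤ m → m < P.ei → TripleIn s' P.i P.j P.k m a (edgeK s₀ b)) ∧
      (s.nat vFirst 0 = 0 → 0 < s₀.nat vRev 0 →
        s'.nat vTrip 0 = s.nat vTrip 0 +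
          (max (s.nat vPrev 0) (s.nat vM 0) + 1 - min (s.nat vPrev 0) (s.nat vM 0)) ∧
        ∀ m, min (s.nat vPrev 0) (s.nat vM 0) ≤ m → m < max (s.nat vPrev 0) (s.nat vM 0) + 1 →
          TripleIn s' P.i P.j P.k m a (edgeK s₀ b)) ∧
      (s.nat vFirst 0 = 0 → s₀.nat vRev 0 = 0 → s'.nat vTrip 0 = s.nat vTrip 0) := by
  have S := (hC.congr h.agree).setup
  have eR : s.nat vRev 0 = s₀.nat vRev 0 := by
    rw [(h.agree vRev (by norm_num) (by norm_num)).1]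
  obtain ⟨q', hq', -⟩ := E.curve
  have hm' := hq'.lt
  have hmono := hC.setup.hlt
  refine (chooseRange_spec s).seq ?_
  rintro t s₁ hF ⟨h1, h2, h3, h4, h5, h6⟩
  have hA : Agree 500 s s₁ := hF.agree 500 (by decide)
  obtain ⟨lo, hlo⟩ : ∃ lo, s₁.nat vLoM 0 = lo := ⟨_, rfl⟩
  obtain ⟨hi, hhi⟩ : ∃ hi, s₁.nat vHiM 0 = hi := ⟨_, rfl⟩
  have hlast : s.nat vFirst 0 = 0 → s.nat vPrev 0 < P.ei := fun h0 => by
    obtain ⟨⟨q, hq, -⟩, -⟩ := h.later h0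
    exact hq.lt
  rw [eR, hlo, hhi] at h5 h6
  rw [S.hsi, S.hei, hlo, hhi] at h4
  have hle : lo ≤ hi ∧ hi ≤ P.ei := by
    rcases Nat.eq_zero_or_pos (s.nat vFirst 0) with h0 | h0
    · have := hlast h0
      rcases Nat.eq_zero_or_pos (s₀.nat vRev 0) with h0' | h0'
      · have := h6 h0 h0'
        omega
      · have := h5 h0 h0'
        omega
    · have := h4 h0
      omega
  have eT : s₁.nat vTrip 0 = s.nat vTrip 0 := by rw [h3 _ (by norm_num) (by norm_num)]
  have eO : s₁.nat vOut 0 = s.nat vOut 0 := by rw [h3 _ (by norm_num) (by norm_num)]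
  refine (outTriples_core hC (h.toWalkCore.of_eq hA
    (fun x hx => h3 x (by omega) (by omega)) (fun x _ => by rw [h2]))
    (by rw [h3 _ (by norm_num) (by norm_num), h.ha])
    (by rw [h3 _ (by norm_num) (by norm_num), h.hb]) h.lt_ej h.lt_ek hlo hhi hle.1 hle.2).mono ?_
  rintro t' s₂ hF₂ ⟨g1, g2, g3, g4, g5, g6, g7⟩
  rw [eT] at g5
  refine ⟨by omega, by rw [g6, eO], g2,
    (TripleExt.of_eq fun x _ _ => h3 x (by omega) (by omega)).trans g3,
    (PieceExt.of_eq fun x _ _ _ => ⟨h3 x (by omega) (by omega), by rw [h2]⟩).trans g4, ?_, ?_, ?_⟩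
  · intro h0
    obtain ⟨rfl, rfl⟩ := h4 h0
    exact ⟨g5, g7⟩
  · intro h0 h0'
    obtain ⟨rfl, rfl⟩ := h5 h0 h0'
    exact ⟨g5, g7⟩
  · intro h0 h0'
    obtain ⟨rfl, rfl⟩ := h6 h0 h0'
    exact g5

set_option maxRecDepth 20000 in
theorem walkRecord_spec (hC : WalkCtx s₀ P f) (h : WalkAt s₀ P f c₀ s c a b t₀ u₀)
    (E : ExitAt s₀ P s a b) (hna : s.nat vNA 0 < P.ej) (hnb : s.nat vNB 0 < P.ek)
    (hrec : s.nat vRec 0 = 1) :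
    Runs walkRecord s fun t s' =>
      t + 9 * s.nat vTrip 0 + 11 * s.nat vOut 0 ≤ 9 * s'.nat vTrip 0 + 11 * s'.nat vOut 0 + 11 ∧
      s'.nat vFirst 0 = 0 ∧ s'.nat vPrev 0 = s.nat vM 0 ∧
      ∃ c', Recorded s₀ P f c₀ a b t₀ u₀ s s' c' := by
  have S := hC.setup
  have hle := E.add_le
  have eR : s.nat vRev 0 = s₀.nat vRev 0 := by
    rw [(h.agree vRev (by norm_num) (by norm_num)).1]
  obtain ⟨-, n1, n2, n3, n4, n5, n6⟩ := E.next S.sep S.rangej S.rangek hrec h.sj_le h.sk_le hna hnb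
  obtain ⟨t', s', hexec, hp⟩ := walkRecord_range hC h E
  suffices hs : Runs (.ite (.natLt 0 (nv vRev)) .skip connect ;;
      nset vFirst 0 ;; nset vPrev (nv vM)) s' fun t s'' =>
      (t' + t) + 9 * s.nat vTrip 0 + 11 * s.nat vOut 0 ≤
        9 * s''.nat vTrip 0 + 11 * s''.nat vOut 0 + 11 ∧
      s''.nat vFirst 0 = 0 ∧ s''.nat vPrev 0 = s.nat vM 0 ∧
      ∃ c', Recorded s₀ P f c₀ a b t₀ u₀ s s'' c' by
    obtain ⟨t'', s'', h1, h2⟩ := hs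
    cases hexec with
    | seq e1 e2 =>
      refine ⟨_, s'', .seq e1 (.seq e2 h1), ?_⟩
      rw [← add_assoc]
      exact h2
  have hF := hexec.frame
  obtain ⟨g1, g2, g3, g4, g5, g6, g7, g8⟩ := hp
  have fn : ∀ x < 600, x < 40 ∨ 43 < x → x ≠ 16 → s'.nat x = s.nat x := by
    intro x hx h1 h2
    refine hF.1 x ?_
    simp only [Prog.writesNat, chooseRange, outTriples, Bool.or_eq_false_iff, beq_eq_false_iff_ne]
    omega
  have fr : s'.real = s.real := by
    funext x
    exact hF.2 x (by simp [Prog.writesReal, chooseRange, outTriples])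
  have eR' : s'.nat vRev 0 = s₀.nat vRev 0 := by
    rw [fn _ (by norm_num) (by norm_num) (by norm_num), eR]
  refine Runs.seq (R := fun τ s'' => τ + 11 * s.nat vOut 0 ≤ 11 * s''.nat vOut 0 + 1 ∧
    s''.nat vTrip 0 = s'.nat vTrip 0 ∧ s''.nat vM 0 = s'.nat vM 0 ∧
    ∃ c', Recorded s₀ P f c₀ a b t₀ u₀ s s'' c') (runs_ite ?_ ?_) ?_
  · intro hb
    have hb' : 0 < s₀.nat vRev 0 := by simpa [eR'] using hb
    refine runs_skip ⟨by omega, rfl, rfl, c, g3, g4, g5, by omega, g6, g7, by omega⟩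
  · intro hb
    have hb' : s₀.nat vRev 0 = 0 := by simpa [eR'] using hb
    obtain ⟨k1, k2, k3⟩ := g3.cur hb'
    have haux : c.a ≤ a ∧ c.b ≤ b ∧ (c.a = a → c.t < s.real rT 0) ∧
        (c.b = b → c.u < s.real rU 0) ∧ 0 < s.real rT 0 ∧ 0 < s.real rU 0 := by
      have o1 := S.rangej.lo_nonneg a h.sj_le h.lt_ej
      have o2 := S.rangek.lo_nonneg b h.sk_le h.lt_ek
      rcases Nat.eq_zero_or_pos (s.nat vFirst 0) with h0 | h0
      · obtain ⟨⟨q, hq, -⟩, w, -⟩ := h.later h0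
        obtain ⟨w1, w2, -⟩ := E.lt_of_onCurve S.sep h.sj_le h.lt_ej h.sk_le h.lt_ek hq h.t_lt_hi
          h.u_lt_hi h.lo_le_t h.lo_le_u
        have := h.lo_le_t
        have := h.lo_le_u
        rw [(w hb').1]
        exact ⟨le_rfl, le_rfl, fun _ => w1, fun _ => w2, by linarith, by linarith⟩
      · obtain ⟨-, -, -, w⟩ := h.first h0
        have w := w hb'
        have w1 := w.a_le
        have w2 := w.b_le
        have w3 := h.sj_le
        have w4 := h.sk_le
        have o3 := S.rangej.lo_lt_hi a h.sj_le h.lt_ej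
        have o4 := S.rangek.lo_lt_hi b h.sk_le h.lt_ek
        have hlt : chLo s₀ P.oj a < s.real rT 0 ∧ chLo s₀ P.ok b < s.real rU 0 := by
          rcases E.cases with ⟨e1, e2, -, -, -, -, e7⟩ | ⟨e1, e2, -, -, -, -, e7⟩ |
            ⟨e1, e2, -⟩
          · rcases e7 with e7 | e7
            · exact ⟨e7.2, e2 ▸ o4⟩
            · omega
          · rcases e7 with e7 | e7
            · exact ⟨e1 ▸ o3, e7.2⟩
            · omega
          · exact ⟨e1 ▸ o3, e2 ▸ o4⟩
        refine ⟨by omega, by omega, fun e => ?_, fun e => ?_, by linarith, by linarith⟩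
        · have := w.t_le (by omega)
          rw [e] at this
          linarith
        · have := w.u_le (by omega)
          rw [e] at this
          linarith
    obtain ⟨x1, x2, x3, x4, x5, x6⟩ := haux
    have nn : ∀ x, 500 ≤ x → x ≤ 516 → s'.nat x = s.nat x := fun x h1 h2 =>
      fn x (by omega) (by omega) (by omega)
    refine (connect_spec s' (x := s.nat vOut 0) (a₀ := c.a) (b₀ := c.b) (a := a) (b := b)
      (na := s.nat vNA 0) (nb := s.nat vNB 0)
      (t₀ := c.t) (u₀ := c.u) (t := s.real rT 0) (u := s.real rU 0) (nt := s.real rNT 0)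
      (nu := s.real rNU 0) g2 (g2 ▸ k1) (by rw [nn _ (by norm_num) (by norm_num), h.ha])
      (by rw [nn _ (by norm_num) (by norm_num), h.hb])
      (by rw [nn _ (by norm_num) (by norm_num)]) (by rw [nn _ (by norm_num) (by norm_num)])
      (by rw [fr]) (by rw [fr]) (by rw [fr]) (by rw [fr]) x1 x2 x3 x4 (fun _ => k2.t_lt_one)
      (fun _ => k2.u_lt_one) x5 x6 n5 n6).mono ?_
    rintro τ s'' hF'' ⟨y1, y2, y3, y4, y5, y6, y7, y8⟩
    have hA'' : Agree 500 s' s'' := hF''.agree 500 (by decide)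
    have hT'' : TripleExt s' s'' := TripleExt.of_eq fun x hx hx' =>
      hF''.1 x (by interval_cases x <;> decide)
    have eT : s''.nat vTrip 0 = s'.nat vTrip 0 := by rw [hF''.1 vTrip (by decide)]
    have hok : TripleOk f s'' := g3.tok.of_eq fun x hx hx' =>
      hF''.1 x (by interval_cases x <;> decide)
    have hj1 := S.rangej.hi_le _ (h.sj_le.trans hle.1) hna
    have hk1 := S.rangek.hi_le _ (h.sk_le.trans hle.2.1) hnb
    refine ⟨by omega, eT, by rw [hF''.1 vM (by decide)],
      ⟨s.nat vNA 0, s.nat vNB 0, s.real rNT 0, s.real rNU 0⟩, ?_, g4.trans hT'', g5.trans y3,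
      fun _ => rfl, ?_, by omega, ?_⟩
    · refine ⟨g3.agree.trans hA'', g3.text.trans hT'', hok, g3.pext.trans y3, by omega, fun _ =>
        ⟨y4, ⟨hna, hnb, ?_, ?_, n2, n4⟩, ?_⟩⟩
      · simp only
        linarith
      · simp only
        linarith
      · simp only
        omega
    · intro h0
      exact ⟨by rw [eT, (g6 h0).1], fun m l1 l2 => ((g6 h0).2 m l1 l2).ext hC.roles hT''⟩
    · intro h0 _
      obtain ⟨⟨q, hq, -⟩, w, -⟩ := h.later h0
      have hc := (w hb').1
      have z1 : s₀.nat vOut 0 ≤ s.nat vOut 0 := h.pext.le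
      have z0 : a - c.a + (b - c.b) = 0 := by
        rw [hc]
        simp
      rw [z0] at y2 y5 y6 y7 y8
      have z2 : CurAt s'' (s.nat vOut 0) c.a c.t c.b c.u :=
        (g2 ▸ k1 : CurAt s' (s.nat vOut 0) c.a c.t c.b c.u).ext y3 (by omega)
      rw [hc] at z2
      exact ⟨by rw [eT, g8 h0 hb'], s.nat vOut 0, z1, by omega, z2.edgeL, z2.edgeR, z2.loL, z2.loR,
        y6, y8⟩
  · rintro τ s'' hF'' ⟨y1, y2, y3, c', y4⟩
    have eM : s'.nat vM 0 = s.nat vM 0 := by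
      rw [hF.1 vM (by decide)]
    refine runs_seq (runs_setNat (runs_setNat ?_))
    set s₃ := Store.setNat _ vPrev _ _ with hs₃
    have e3 : ∀ x, x ≠ vPrev → x ≠ vFirst → s₃.nat x = s''.nat x := fun x h1 h2 => by
      rw [hs₃, setNat_nat_of_ne h1, setNat_nat_of_ne h2]
    have e4 : s₃.nat vTrip 0 = s''.nat vTrip 0 := by rw [e3 _ (by norm_num) (by norm_num)]
    have e5 : s₃.nat vOut 0 = s''.nat vOut 0 := by rw [e3 _ (by norm_num) (by norm_num)]
    refine ⟨by omega, by simp [hs₃], by simp [hs₃, y3, eM], c',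
      y4.of_eq hC.roles ?_ (fun x hx => e3 x (by omega) (by omega)) (fun x hx => rfl)⟩
    exact (agree_setNat (Or.inr (by norm_num))).trans (agree_setNat (Or.inr (by norm_num)))

end

theorem walkStep_spec {s₀ s : Store} {P : WalkPar} {f : ℕ → ℕ} {c₀ c : Cur} {a b : ℕ}
    {t₀ u₀ : ℝ} (hC : WalkCtx s₀ P f) (h : WalkAt s₀ P f c₀ s c a b t₀ u₀) :
    Runs walkStep s fun t s' => t + 9 * s.nat vTrip 0 + 11 * s.nat vOut 0 ≤
      9 * s'.nat vTrip 0 + 11 * s'.nat vOut 0 + (12 * s₀.nat vLog 0 + 45) ∧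
      WalkNext s₀ P f c₀ a b s' := by
  refine (leave_walkAt hC h).seq ?_
  rintro t s₁ - ⟨h1, h2, E, e1, e2⟩
  have S := (hC.congr h2.agree).setup
  refine runs_ite (fun hb => ?_) (fun hb => ?_)
  · have hb' : s₁.nat vNA 0 < P.ej ∧ s₁.nat vNB 0 < P.ek := by
      simpa [S.hej, S.hek] using hb
    have hle := E.add_le
    refine runs_seq (runs_ite (fun hr => ?_) (fun hr => ?_))
    · have hrec : s₁.nat vRec 0 = 1 := by
        have : 0 < s₁.nat vRec 0 := by simpa using hr
        rcases E.cases with ⟨-, -, -, -, -, -, e7⟩ | ⟨-, -, -, -, -, -, e7⟩ |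
          ⟨-, -, -, -, -, -, e7⟩ <;> omega
      refine (walkRecord_spec hC h2 E hb'.1 hb'.2 hrec).mono ?_
      rintro t' s₂ hF ⟨g1, g2, g3, c', g4⟩
      refine runs_seq (runs_setNat (runs_setNat ?_))
      have eA : s₂.nat vNA 0 = s₁.nat vNA 0 := by rw [hF.1 vNA (by decide)]
      have eB : s₂.nat vNB 0 = s₁.nat vNB 0 := by rw [hF.1 vNB (by decide)]
      set s₃ := Store.setNat _ vB _ _ with hs₃
      have e3 : ∀ x, x ≠ vA → x ≠ vB → s₃.nat x = s₂.nat x := fun x h1 h2 => by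
        rw [hs₃, setNat_nat_of_ne h2, setNat_nat_of_ne h1]
      have e4 : s₃.nat vTrip 0 = s₂.nat vTrip 0 := by rw [e3 _ (by norm_num) (by norm_num)]
      have e5 : s₃.nat vOut 0 = s₂.nat vOut 0 := by rw [e3 _ (by norm_num) (by norm_num)]
      have g5 := g4.of_eq (s'' := s₃) hC.roles
        ((agree_setNat (Or.inr (by norm_num))).trans (agree_setNat (Or.inr (by norm_num))))
        (fun x hx => e3 x (by omega) (by omega)) (fun x hx => rfl)
      refine ⟨by omega, c', Or.inl ⟨_, _, _, _, hle.2.2,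
        h2.step hC E hb'.1 hb'.2 hrec g5.core g5.text g5.pext ?_ ?_ ?_ ?_ g5.cur g5.first
          g5.later g5.pair⟩⟩
      · rw [e3 _ (by norm_num) (by norm_num), g2]
      · rw [e3 _ (by norm_num) (by norm_num), g3]
      · simp [hs₃, eA]
      · simp [hs₃, eB]
    · have hrec : s₁.nat vRec 0 ≠ 1 := by
        have : ¬ 0 < s₁.nat vRec 0 := by simpa using hr
        omega
      refine runs_skip (runs_seq (runs_setNat (runs_setNat ?_)))
      set s₃ := Store.setNat _ vB _ _ with hs₃
      have e3 : ∀ x, x ≠ vA → x ≠ vB → s₃.nat x = s₁.nat x := fun x h1 h2 => by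
        rw [hs₃, setNat_nat_of_ne h2, setNat_nat_of_ne h1]
      have e4 : s₃.nat vTrip 0 = s₁.nat vTrip 0 := by rw [e3 _ (by norm_num) (by norm_num)]
      have e5 : s₃.nat vOut 0 = s₁.nat vOut 0 := by rw [e3 _ (by norm_num) (by norm_num)]
      refine ⟨by omega, c, Or.inl ⟨_, _, _, _, hle.2.2,
        h2.skip hC E hb'.1 hb'.2 hrec ((h2.toWalkCore.setNat (by norm_num)).setNat (by norm_num))
          ((tripleExt_setNat (by norm_num)).trans (tripleExt_setNat (by norm_num)))
          ((pieceExt_setNat (by norm_num)).trans (pieceExt_setNat (by norm_num))) e4 ?_ ?_ ?_⟩⟩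
      · rw [e3 _ (by norm_num) (by norm_num)]
      · simp [hs₃]
      · simp [hs₃]
  · have hb' : ¬ (s₁.nat vNA 0 < P.ej ∧ s₁.nat vNB 0 < P.ek) := by
      simpa [S.hej, S.hek] using hb
    refine (leaving_spec hC h2 E hb').mono ?_
    rintro t' s₂ - ⟨g1, g2, g3⟩
    exact ⟨by omega, g3⟩

/-- The walk covers all points on the parts of the chains that it treats. -/
theorem walk_spec {s : Store} {P : WalkPar} {f : ℕ → ℕ} {c₀ : Cur} (hC : WalkCtx s P f)
    (hf : TripleOk f s) (hcur : s.nat vRev 0 = 0 → CurAt s (s.nat vOut 0) c₀.a c₀.t c₀.b c₀.u ∧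
      c₀.Ok s P ∧ c₀.Before s P) :
    Runs walk s fun t s' => t + 9 * s.nat vTrip 0 + 11 * s.nat vOut 0 ≤
      9 * s'.nat vTrip 0 + 11 * s'.nat vOut 0 +
        (12 * s.nat vLog 0 + 46) * ((P.ej - P.sj) + (P.ek - P.sk) + 1) ∧
      ∃ c', WalkDone s P f c₀ s' c' := by
  have S := hC.setup
  refine runs_seq (runs_setNat (runs_seq (runs_setNat (runs_seq (runs_setNat ?_)))))
  set s₁ := Store.setNat _ vFirst _ _ with hs₁
  have e1 : ∀ x, x ≠ vA → x ≠ vB → x ≠ vFirst → s₁.nat x = s.nat x := fun x h1 h2 h3 => by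
    rw [hs₁, setNat_nat_of_ne h3, setNat_nat_of_ne h2, setNat_nat_of_ne h1]
  have eT : s₁.nat vTrip 0 = s.nat vTrip 0 := by rw [e1 _ (by norm_num) (by norm_num) (by norm_num)]
  have eO : s₁.nat vOut 0 = s.nat vOut 0 := by rw [e1 _ (by norm_num) (by norm_num) (by norm_num)]
  have eA : s₁.nat vA 0 = P.sj := by simp [hs₁, S.hsj]
  have eB : s₁.nat vB 0 = P.sk := by simp [hs₁, S.hsk]
  have eF : s₁.nat vFirst 0 = 1 := by simp [hs₁]
  have hcore : WalkCore s P f c₀ s₁ c₀ := by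
    refine WalkCore.setNat (WalkCore.setNat (WalkCore.setNat ⟨.refl _ _, .refl _, hf, .refl _,
      fun _ => rfl, fun h0 => ⟨(hcur h0).1, (hcur h0).2.1, le_rfl⟩⟩ ?_) ?_) ?_ <;> norm_num
  have hstart : WalkAt s P f c₀ s₁ c₀ P.sj P.sk (chLo s P.oj P.sj) (chLo s P.ok P.sk) := by
    refine ⟨hcore, eA, eB, le_rfl, hC.hsj, le_rfl, hC.hsk, le_rfl,
      S.rangej.lo_lt_hi _ le_rfl hC.hsj, le_rfl, S.rangek.lo_lt_hi _ le_rfl hC.hsk,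
      fun _ => ⟨rfl, rfl, eT, fun h0 => (hcur h0).2.2⟩, fun h0 => by omega, ?_⟩
    intro zi zj zk _ m q a' t' b' u' _ hj hk
    exact Or.inr ⟨a', t', b', u', hj, hk, hj.posLE_lo S.rangej le_rfl hj.le,
      hk.posLE_lo S.rangek le_rfl hk.le⟩
  set K := 12 * s.nat vLog 0 + 46 with hK
  refine (runs_loop (fun t s' => ∃ n, t + 9 * s.nat vTrip 0 + 11 * s.nat vOut 0 ≤
      9 * s'.nat vTrip 0 + 11 * s'.nat vOut 0 + K * n ∧ n ≤ (P.ej - P.sj) + (P.ek - P.sk) ∧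
      ∃ c, (∃ a b t₀ u₀, n + P.sj + P.sk ≤ a + b ∧ WalkAt s P f c₀ s' c a b t₀ u₀) ∨
        (s'.nat vA 0 = P.ej ∧ WalkDone s P f c₀ s' c))
    (fun s' => (P.ej - s'.nat vA 0) + (P.ek - s'.nat vB 0)) ⟨0, ?_⟩ ?_).mono ?_
  · exact ⟨by omega, by omega, c₀, Or.inl ⟨_, _, _, _, by omega, hstart⟩⟩
  · rintro t s₂ - ⟨n, h1, h2, c, ⟨a, b, t₀, u₀, h3, h4⟩ | ⟨h3, h4⟩⟩ hb
    · refine (walkStep_spec hC h4).mono ?_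
      have q1 := h4.lt_ej
      have q2 := h4.lt_ek
      have q3 := h4.sj_le
      have q4 := h4.sk_le
      have q5 := h4.ha
      have q6 := h4.hb
      have eK : K * (n + 1) = K * n + K := by ring
      rintro t' s₃ - ⟨g1, c', ⟨a', b', t', u', g2, g3⟩ | ⟨g2, g3, g4⟩⟩
      · have w1 := g3.lt_ej
        have w2 := g3.lt_ek
        have w3 := g3.ha
        have w4 := g3.hb
        have w5 := g3.sj_le
        have w6 := g3.sk_le
        exact ⟨⟨n + 1, by omega, by omega, c', Or.inl ⟨a', b', t', u', by omega, g3⟩⟩, by omega⟩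
      · exact ⟨⟨n + 1, by omega, by omega, c', Or.inr ⟨g2, g4⟩⟩, by omega⟩
    · have : s₂.nat vEj 0 = P.ej := by
        rw [(h4.agree vEj (by norm_num) (by norm_num)).1, S.hej]
      have hb' : s₂.nat vA 0 < s₂.nat vEj 0 ∧ s₂.nat vB 0 < s₂.nat vEk 0 := by simpa using hb
      omega
  · rintro t s₂ - ⟨t', rfl, ⟨n, h1, h2, c, ⟨a, b, t₀, u₀, h3, h4⟩ | ⟨h3, h4⟩⟩, hb⟩
    · refine absurd ?_ hb
      have S' := (hC.congr h4.agree).setup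
      have q1 := h4.lt_ej
      have q2 := h4.lt_ek
      simp [S'.hej, S'.hek, h4.ha, h4.hb, q1, q2]
    · have hn : K * n + K ≤ K * ((P.ej - P.sj) + (P.ek - P.sk) + 1) := by
        rw [← Nat.mul_succ]
        exact Nat.mul_le_mul_left _ (by omega)
      exact ⟨by omega, c, h4⟩

/-! ## The nodes of a level -/

theorem GoodParams.mono {lo hi : ℕ → ℝ} {x y x' y' : ℕ} (h : GoodParams lo hi x y) (hx : x ≤ x')
    (hy : y' ≤ y) : GoodParams lo hi x' y' :=
  ⟨fun a h1 h2 => h.lo_nonneg a (by omega) (by omega),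
    fun a h1 h2 => h.lo_lt_hi a (by omega) (by omega),
    fun a h1 h2 => h.hi_le a (by omega) (by omega),
    fun a h1 h2 => h.lo_eq a (by omega) (by omega),
    fun a h1 h2 => h.hi_eq a (by omega) (by omega)⟩

/-- The tables of a problem: the lengths and positions of the chains, the reversed chains, the
numbers of edges of the chains before each leaf, and the angles of the edges. -/
structure Tables (s : Store) (len off : ℕ → ℕ) (N : ℕ) (cut : ℕ → ℕ → ℕ) (eps : ℕ → ℝ)
    (θ : ℕ → ℕ → ℝ) : Prop where
  hoff : ∀ c < 6, s.nat aOff c = off c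
  hlen : ∀ c < 3, s.nat aLen c = len c
  hleaves : s.nat vLeaves 0 = N
  hcut : ∀ c < 3, ∀ r ≤ N, s.nat aCut (s.nat aCutOff c + r) = cut c r
  hsign : ∀ c < 3, s.real aSign c = eps c
  hpow : ∀ k, k < s.nat vLog 0 → s.nat aPow k = 2 ^ k
  hlog : ∀ c < 3, len c ≤ 2 ^ s.nat vLog 0
  len_pos : ∀ c < 3, 1 ≤ len c
  cut_zero : ∀ c < 3, cut c 0 = 0
  cut_last : ∀ c < 3, cut c N = len c
  cut_mono : ∀ c < 3, ∀ r r', r ≤ r' → r' ≤ N → cut c r ≤ cut c r'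
  eps_eq : ∀ c < 3, eps c = 1 ∨ eps c = -1
  link : ∀ c < 3, ∀ m, m + 1 < len c →
    chB s (off c) (m + 1) = chB s (off c) m + chD s (off c) m
  params : ∀ c < 3, GoodParams (chLo s (off c)) (chHi s (off c)) 0 (len c)
  rev : ∀ c < 3, ∀ m < len c,
    chB s (off (c + 3)) m = chB s (off c) (len c - 1 - m) + chD s (off c) (len c - 1 - m) ∧
    chD s (off (c + 3)) m = -chD s (off c) (len c - 1 - m) ∧
    chLo s (off (c + 3)) m = 1 - chHi s (off c) (len c - 1 - m) ∧
    chHi s (off (c + 3)) m = 1 - chLo s (off c) (len c - 1 - m)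
  angle : ∀ c < 3, ∀ c' < 3, ∀ m < len c, ∀ m' < len c',
    (0 < eps c * eps c' * cross (chD s (off c) m) (chD s (off c') m') ↔ θ c m < θ c' m')
  angle_mono : ∀ c < 3, ∀ m m', m ≤ m' → m' < len c → θ c m ≤ θ c m'
  sep : ∀ c < 3, ∀ c' < 3, ∀ r ≤ N, ∀ m < cut c r, ∀ m' < len c', cut c' r ≤ m' →
    θ c m < θ c' m'

theorem Tables.congr {s s' : Store} {len off : ℕ → ℕ} {N : ℕ} {cut : ℕ → ℕ → ℕ} {eps : ℕ → ℝ}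
    {θ : ℕ → ℕ → ℝ} (T : Tables s len off N cut eps θ) (hA : Agree 300 s s') :
    Tables s' len off N cut eps θ := by
  have e : ∀ x, 200 ≤ x → x < 300 → s'.nat x = s.nat x := fun x h1 h2 => (hA x h1 h2).1
  have e' : ∀ x, 200 ≤ x → x < 300 → s'.real x = s.real x := fun x h1 h2 => (hA x h1 h2).2
  have eB := chB_congr hA le_rfl
  have eD := chD_congr hA le_rfl
  have eL := chLo_congr hA le_rfl
  have eH := chHi_congr hA le_rfl
  constructor
  case link => simpa only [eB, eD] using T.link
  case params => simpa only [eL, eH] using T.params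
  case rev => simpa only [eB, eD, eL, eH] using T.rev
  case angle => simpa only [eD] using T.angle
  case hoff => simpa only [e aOff (by norm_num) (by norm_num)] using T.hoff
  case hlen => simpa only [e aLen (by norm_num) (by norm_num)] using T.hlen
  case hleaves => simpa only [e vLeaves (by norm_num) (by norm_num)] using T.hleaves
  case hcut =>
    simpa only [e aCut (by norm_num) (by norm_num), e aCutOff (by norm_num) (by norm_num)]
      using T.hcut
  case hsign => simpa only [e' aSign (by norm_num) (by norm_num)] using T.hsign
  case hpow =>
    simpa only [e vLog (by norm_num) (by norm_num), e aPow (by norm_num) (by norm_num)]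
      using T.hpow
  case hlog => simpa only [e vLog (by norm_num) (by norm_num)] using T.hlog
  exacts [T.len_pos, T.cut_zero, T.cut_last, T.cut_mono, T.eps_eq, T.angle_mono, T.sep]

section
variable {s : Store} {len off : ℕ → ℕ} {N : ℕ} {cut : ℕ → ℕ → ℕ} {eps : ℕ → ℝ}
  {θ : ℕ → ℕ → ℝ}

theorem Tables.cut_le (T : Tables s len off N cut eps θ) {c r : ℕ} (hc : c < 3) (hr : r ≤ N) :
    cut c r ≤ len c := by
  rw [← T.cut_last c hc]
  exact T.cut_mono c hc r N hr le_rfl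

theorem Tables.rev_params (T : Tables s len off N cut eps θ) {c : ℕ} (hc : c < 3) :
    GoodParams (chLo s (off (c + 3))) (chHi s (off (c + 3))) 0 (len c) := by
  have G := T.params c hc
  constructor
  · intro a _ ha
    obtain ⟨-, -, h1, h2⟩ := T.rev c hc a ha
    rw [h1]
    linarith [G.hi_le (len c - 1 - a) (by omega) (by omega)]
  · intro a _ ha
    obtain ⟨-, -, h1, h2⟩ := T.rev c hc a ha
    rw [h1, h2]
    linarith [G.lo_lt_hi (len c - 1 - a) (by omega) (by omega)]
  · intro a _ ha
    obtain ⟨-, -, h1, h2⟩ := T.rev c hc a ha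
    rw [h2]
    linarith [G.lo_nonneg (len c - 1 - a) (by omega) (by omega)]
  · intro a ha' ha
    obtain ⟨-, -, h1, h2⟩ := T.rev c hc a ha
    rw [h1]
    linarith [G.hi_eq (len c - 1 - a) (by omega) (by omega)]
  · intro a _ ha
    obtain ⟨-, -, h1, h2⟩ := T.rev c hc a (by omega)
    rw [h2]
    linarith [G.lo_eq (len c - 1 - a) (by omega) (by omega)]

theorem Tables.rev_link (T : Tables s len off N cut eps θ) {c : ℕ} (hc : c < 3) (m : ℕ)
    (hm : m + 1 < len c) :
    chB s (off (c + 3)) (m + 1) = chB s (off (c + 3)) m + chD s (off (c + 3)) m := by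
  obtain ⟨h1, h2, -⟩ := T.rev c hc m (by omega)
  obtain ⟨h3, -⟩ := T.rev c hc (m + 1) hm
  have := T.link c hc (len c - 1 - (m + 1)) (by omega)
  rw [show len c - 1 - (m + 1) + 1 = len c - 1 - m by omega] at this
  rw [h1, h2, h3, this]
  ring

theorem Tables.rev_linePt (T : Tables s len off N cut eps θ) {c m : ℕ} (hc : c < 3)
    (hm : m < len c) (t : ℝ) :
    linePt (chB s (off (c + 3))) (chD s (off (c + 3))) m t =
      linePt (chB s (off c)) (chD s (off c)) (len c - 1 - m) (1 - t) := by
  obtain ⟨h1, h2, -⟩ := T.rev c hc m hm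
  simp only [linePt, h1, h2]
  push_cast
  ring

theorem Tables.rev_rep (T : Tables s len off N cut eps θ) {c m x y : ℕ} (hc : c < 3) {z : ℂ}
    {t : ℝ} (hy : y ≤ len c) (h : RepAt s (off c) x y z m t) :
    RepAt s (off (c + 3)) (len c - y) (len c - x) z (len c - 1 - m) (1 - t) := by
  have h1 := h.le
  have h2 := h.lt
  obtain ⟨-, -, h3, h4⟩ := T.rev c hc (len c - 1 - m) (by omega)
  have e : len c - 1 - (len c - 1 - m) = m := by omega
  rw [e] at h3 h4
  refine ⟨by omega, by omega, ?_, ?_, ?_⟩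
  · rw [h3]; linarith [h.le_hi]
  · rw [h4]; linarith [h.lo_le]
  · rw [T.rev_linePt hc (by omega), e, sub_sub_cancel, h.eq]

theorem Tables.of_rev_rep (T : Tables s len off N cut eps θ) {c m x y : ℕ} (hc : c < 3) {z : ℂ}
    {t : ℝ} (hy : y ≤ len c) (h : RepAt s (off (c + 3)) (len c - y) (len c - x) z m t) :
    RepAt s (off c) x y z (len c - 1 - m) (1 - t) := by
  have h1 := h.le
  have h2 := h.lt
  obtain ⟨-, -, h3, h4⟩ := T.rev c hc m (by omega)
  refine ⟨by omega, by omega, ?_, ?_, ?_⟩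
  · have := h.le_hi
    rw [h4] at this
    linarith
  · have := h.lo_le
    rw [h3] at this
    linarith
  · rw [← T.rev_linePt hc (by omega), h.eq]

end

/-- The parameters of the walk for a node: the first chain has its edges in the leaves from `x` to
`x'`, the other chains theirs in the leaves from `y` to `y'`. -/
noncomputable def nodePar (len off : ℕ → ℕ) (cut : ℕ → ℕ → ℕ) (eps : ℕ → ℝ) (i j k : ℕ)
    (rev : Prop) [Decidable rev] (x x' y y' : ℕ) : WalkPar where
  i := i
  j := j
  k := k
  oi := off i
  oj := off j
  ok := if rev then off (k + 3) else off k
  si := cut i x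
  ei := cut i x'
  sj := cut j y
  ej := cut j y'
  sk := if rev then len k - cut k y' else cut k y
  ek := if rev then len k - cut k y else cut k y'
  σ := if x' ≤ y then eps i * eps j else -(eps i * eps j)

/-- The memory holds the roles of the arcs. -/
structure RoleVars (s : Store) (off : ℕ → ℕ) (eps : ℕ → ℝ) (i j k : ℕ) : Prop where
  roles : IsRoles i j k
  hi : s.nat vI 0 = i
  hj : s.nat vJ 0 = j
  hk : s.nat vK 0 = k
  hoi : s.nat vOi 0 = off i
  hoj : s.nat vOj 0 = off j
  hrev : 0 < s.nat vRev 0 ↔ eps j * eps k = 1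
  hok : s.nat vOk 0 = if 0 < s.nat vRev 0 then off (k + 3) else off k

theorem IsRoles.lt {i j k : ℕ} (h : IsRoles i j k) : i < 3 ∧ j < 3 ∧ k < 3 := by
  unfold IsRoles at h
  omega

theorem Tables.walkCtx {s : Store} {len off : ℕ → ℕ} {N : ℕ} {cut : ℕ → ℕ → ℕ} {eps : ℕ → ℝ}
    {θ : ℕ → ℕ → ℝ} (T : Tables s len off N cut eps θ) {i j k x x' y y' : ℕ}
    (R : RoleVars s off eps i j k) {P : WalkPar}
    (hP : P = nodePar len off cut eps i j k (0 < s.nat vRev 0) x x' y y')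
    (hx : x' ≤ y ∨ y' ≤ x) (hxle : x ≤ x') (hle : y ≤ y') (hx' : x' ≤ N) (hy' : y' ≤ N)
    (hxx : P.si < P.ei) (hj : P.sj < P.ej) (hk : P.sk < P.ek)
    (e1 : s.nat vSi 0 = P.si) (e2 : s.nat vEi 0 = P.ei) (e3 : s.nat vSj 0 = P.sj)
    (e4 : s.nat vEj 0 = P.ej) (e5 : s.nat vSk 0 = P.sk) (e6 : s.nat vEk 0 = P.ek) :
    WalkCtx s P len := by
  obtain ⟨li, lj, lk⟩ := R.roles.lt
  have ci := T.cut_le li hx'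
  have cj := T.cut_le lj hy'
  have ck := T.cut_le lk hy'
  have hyy : y ≤ N := hle.trans hy'
  have hxN : x ≤ N := hxle.trans hx'
  have ck' := T.cut_mono k lk y y' hle hy'
  have ho : P.oi = off i ∧ P.oj = off j ∧ P.i = i ∧ P.j = j ∧ P.k = k ∧ P.si = cut i x ∧
      P.ei = cut i x' ∧ P.sj = cut j y ∧ P.ej = cut j y' := by
    subst hP
    simp [nodePar]
  obtain ⟨o1, o2, o3, o4, o5, o6, o7, o8, o9⟩ := ho
  have hσ : ∀ m, P.si ≤ m → m < P.ei → ∀ c < 3, ∀ a, cut c y ≤ a → a < cut c y' →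
      0 < P.σ * eps j * eps c * cross (chD s (off i) m) (chD s (off c) a) := by
    intro m hm hm' c hc a ha ha'
    have hal : a < len c := ha'.trans_le (T.cut_le hc hy')
    have hml : m < len i := by omega
    have hjj : eps j * eps j = 1 := by rcases T.eps_eq j lj with h | h <;> rw [h] <;> norm_num
    by_cases hxy : x' ≤ y
    · have h1 := T.sep i li c hc y hyy m (by
        have := T.cut_mono i li x' y hxy hyy
        omega) a hal ha
      have h2 := (T.angle i li c hc m hml a hal).2 h1
      have : P.σ = eps i * eps j := by
        subst hP
        simp [nodePar, hxy]
      rw [this]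
      calc _ < _ := h2
        _ = (eps j * eps j) * (eps i * eps c * cross (chD s (off i) m) (chD s (off c) a)) := by
          rw [hjj, one_mul]
        _ = _ := by ring
    · have hyx : y' ≤ x := by omega
      have h1 := T.sep c hc i li y' hy' a ha' m hml (by
        have := T.cut_mono i li y' x hyx hxN
        omega)
      have h2 := (T.angle c hc i li a hal m hml).2 h1
      have : P.σ = -(eps i * eps j) := by
        subst hP
        simp [nodePar, hxy]
      rw [this]
      calc _ < _ := h2
        _ = (eps j * eps j) * (eps c * eps i * cross (chD s (off c) a) (chD s (off i) m)) := by
          rw [hjj, one_mul]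
        _ = _ := by rw [cross_comm (chD s (off c) a)]; ring
  have hjj : eps j * eps j = 1 := by rcases T.eps_eq j lj with h | h <;> rw [h] <;> norm_num
  have hlinkk : ∀ b, P.sk ≤ b → b + 1 < P.ek →
      chB s P.ok (b + 1) = chB s P.ok b + chD s P.ok b := by
    intro b hb hb'
    by_cases hr : 0 < s.nat vRev 0
    · have : P.ok = off (k + 3) ∧ P.ek ≤ len k := by
        subst hP
        simp [nodePar, hr]
      rw [this.1]
      exact T.rev_link lk b (by omega)
    · have : P.ok = off k ∧ P.ek ≤ len k := by
        subst hP
        simp only [nodePar, if_neg hr, true_and]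
        exact ck
      rw [this.1]
      exact T.link k lk b (by omega)
  have hrangek : GoodParams (chLo s P.ok) (chHi s P.ok) P.sk P.ek := by
    by_cases hr : 0 < s.nat vRev 0
    · have : P.ok = off (k + 3) ∧ P.ek ≤ len k := by
        subst hP
        simp [nodePar, hr]
      rw [this.1]
      exact (T.rev_params lk).mono (Nat.zero_le _) this.2
    · have : P.ok = off k ∧ P.ek ≤ len k := by
        subst hP
        simp only [nodePar, if_neg hr, true_and]
        exact ck
      rw [this.1]
      exact (T.params k lk).mono (Nat.zero_le _) this.2
  have hnegk : ∀ m b, P.si ≤ m → m < P.ei → P.sk ≤ b → b < P.ek →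
      0 < -P.σ * cross (chD s (off i) m) (chD s P.ok b) := by
    intro m b hm hm' hb hb'
    by_cases hr : 0 < s.nat vRev 0
    · have hjk := R.hrev.1 hr
      have : P.ok = off (k + 3) ∧ P.ek = len k - cut k y ∧ P.sk = len k - cut k y' := by
        subst hP
        simp [nodePar, hr]
      obtain ⟨q1, q2, q3⟩ := this
      obtain ⟨-, h2, -⟩ := T.rev k lk b (by omega)
      rw [q1, h2, cross_neg_right]
      have := hσ m hm hm' k lk (len k - 1 - b) (by omega) (by omega)
      calc _ < _ := this
        _ = (eps j * eps k) * (P.σ * cross (chD s (off i) m) (chD s (off k) (len k - 1 - b))) := by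
          ring
        _ = _ := by rw [hjk]; ring
    · have : P.ok = off k ∧ P.ek = cut k y' ∧ P.sk = cut k y := by
        subst hP
        simp [nodePar, hr]
      obtain ⟨q1, q2, q3⟩ := this
      have hjk : eps j * eps k = -1 := by
        have : ¬ eps j * eps k = 1 := fun h => hr (R.hrev.2 h)
        rcases T.eps_eq j lj with h | h <;> rcases T.eps_eq k lk with h' | h' <;>
          simp [h, h'] at this ⊢
      rw [q1]
      have := hσ m hm hm' k lk b (q3 ▸ hb) (q2 ▸ hb')
      calc _ < _ := this
        _ = (eps j * eps k) * (P.σ * cross (chD s (off i) m) (chD s (off k) b)) := by ring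
        _ = _ := by rw [hjk]; ring
  refine ⟨⟨o1 ▸ R.hoi, o2 ▸ R.hoj, ?_, e1, e2, e3, e4, e5, e6, T.hpow, ?_, hxx, ?_, ?_, ?_, hrangek⟩,
    by rw [o3, o4, o5]; exact R.roles, o3 ▸ R.hi, o4 ▸ R.hj, o5 ▸ R.hk, ?_, ?_, ?_, hj, hk, ?_⟩
  · rw [R.hok]
    subst hP
    rfl
  · have := T.hlog i li
    omega
  · rw [o1, o2]
    refine ⟨fun m _ hm => T.link i li m (by omega), fun m _ hm => T.link j lj m (by omega), hlinkk,
      fun m a h1 h2 h3 h4 => ?_, hnegk⟩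
    have := hσ m h1 h2 j lj a (by omega) (by omega)
    calc _ < _ := this
      _ = (eps j * eps j) * (P.σ * cross (chD s (off i) m) (chD s (off j) a)) := by ring
      _ = _ := by rw [hjj, one_mul]
  · rw [o1]
    exact (T.params i li).mono (Nat.zero_le _) (by omega)
  · rw [o2]
    exact (T.params j lj).mono (Nat.zero_le _) (by omega)
  · rw [o3, o7]; exact ci
  · rw [o4, o9]; exact cj
  · intro b hb
    rw [o5]
    have := T.len_pos k lk
    unfold edgeK
    rw [R.hk, T.hlen k lk]
    by_cases hr : 0 < s.nat vRev 0
    · rw [if_pos hr]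
      omega
    · rw [if_neg hr]
      have : P.ek = cut k y' := by
        subst hP
        simp [nodePar, hr]
      omega
  · intro hr
    have hjk := R.hrev.1 hr
    have : P.ok = off (k + 3) ∧ P.ek = len k - cut k y ∧ P.sk = len k - cut k y' := by
      subst hP
      simp [nodePar, hr]
    obtain ⟨q1, q2, q3⟩ := this
    have hsl : ∀ a b, a < P.ej → b < P.ek → slope s P a b =
        -P.σ * (eps j * eps k * cross (chD s (off j) a) (chD s (off k) (len k - 1 - b))) := by
      intro a b ha hb
      obtain ⟨-, h2, -⟩ := T.rev k lk b (by omega)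
      rw [slope, o2, q1, h2, cross_neg_right, hjk]
      ring
    have hph : OnePhase (fun a b => -(eps j * eps k *
        cross (chD s (off j) a) (chD s (off k) (len k - 1 - b)))) P.sj P.ej P.sk P.ek := by
      intro a a' b b' h1 h2 h3 h4 h5 h6 h7
      have e : ∀ a b, -(eps j * eps k * cross (chD s (off j) a) (chD s (off k) (len k - 1 - b))) =
          eps k * eps j * cross (chD s (off k) (len k - 1 - b)) (chD s (off j) a) := by
        intro a b
        rw [cross_comm (chD s (off k) _)]
        ring
      simp only [e] at h7 ⊢
      rw [T.angle k lk j lj (len k - 1 - b) (by omega) a (by omega)] at h7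
      rw [T.angle k lk j lj (len k - 1 - b') (by omega) a' (by omega)]
      have g1 := T.angle_mono j lj a a' h2 (by omega)
      have g2 := T.angle_mono k lk (len k - 1 - b') (len k - 1 - b) (by omega) (by omega)
      linarith
    have hσ1 : P.σ = 1 ∨ P.σ = -1 := by
      subst hP
      rcases T.eps_eq i li with h | h <;> rcases T.eps_eq j lj with h' | h' <;>
        by_cases hxy : x' ≤ y <;> simp [nodePar, h, h', hxy]
    rcases hσ1 with h0 | h0
    · left
      intro a a' b b' h1 h2 h3 h4 h5 h6 h7
      simp only [hsl _ _ (show a < P.ej by omega) (show b < P.ek by omega), hsl _ _ h3 h6, h0,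
        neg_one_mul] at h7 ⊢
      exact hph a a' b b' h1 h2 h3 h4 h5 h6 h7
    · right
      intro a a' b b' h1 h2 h3 h4 h5 h6 h7
      simp only [hsl _ _ (show a < P.ej by omega) (show b < P.ek by omega),
        hsl _ _ h3 h6, h0, neg_neg, one_mul] at h7 ⊢
      exact hph a a' b b' h1 h2 h3 h4 h5 h6 h7

/-- The number of the cut of a chain before a leaf. -/
def cutExpr (c x : NatExpr) : NatExpr := .load aCut (.load aCutOff c + x)

/-- Computes the ranges of the edges at a node. -/
def nodeRange : Prog :=
  nset vMid ((nv vBase + nv vHalf) - ((nv vBase + nv vHalf) - nv vLeaves)) ;;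
  nset vTop ((nv vBase + nv vHalf + nv vHalf) -
    ((nv vBase + nv vHalf + nv vHalf) - nv vLeaves)) ;;
  .ite (.natLt 0 (nv vSide))
    (nset vXi (nv vMid) ;; nset vYi (nv vTop) ;; nset vXj (nv vBase) ;; nset vYj (nv vMid))
    (nset vXi (nv vBase) ;; nset vYi (nv vMid) ;; nset vXj (nv vMid) ;; nset vYj (nv vTop)) ;;
  nset vSi (cutExpr (nv vI) (nv vXi)) ;;
  nset vEi (cutExpr (nv vI) (nv vYi)) ;;
  nset vSj (cutExpr (nv vJ) (nv vXj)) ;;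
  nset vEj (cutExpr (nv vJ) (nv vYj)) ;;
  .ite (.natLt 0 (nv vRev))
    (nset vSk (.load aLen (nv vK) - cutExpr (nv vK) (nv vYj)) ;;
      nset vEk (.load aLen (nv vK) - cutExpr (nv vK) (nv vXj)))
    (nset vSk (cutExpr (nv vK) (nv vXj)) ;; nset vEk (cutExpr (nv vK) (nv vYj)))

/-- Treats a node. -/
def node : Prog :=
  nodeRange ;;
  .ite (.and (.natLt (nv vSi) (nv vEi)) (.and (.natLt (nv vSj) (nv vEj))
    (.natLt (nv vSk) (nv vEk)))) walk .skip ;;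
  nset vBase (nv vBase + nv vHalf + nv vHalf)

/-- Treats all nodes of a level. -/
def nodes : Prog :=
  nset vBase 0 ;; .loop (.natLt (nv vBase) (nv vLeaves)) node

/-- The leaves of the node with the given base: the first chain is treated on the leaves from `x` to
`x'` and the other ones on those from `y` to `y'`. -/
def NodeLeaves (side h base N x x' y y' : ℕ) : Prop :=
  (side = 0 ∧ x = base ∧ x' = min (base + h) N ∧ y = min (base + h) N ∧
    y' = min (base + h + h) N) ∨
  (0 < side ∧ x = min (base + h) N ∧ x' = min (base + h + h) N ∧ y = base ∧
    y' = min (base + h) N)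

section
variable {s : Store} {len off : ℕ → ℕ} {N i j k : ℕ} {cut : ℕ → ℕ → ℕ} {eps : ℕ → ℝ}
  {θ : ℕ → ℕ → ℝ}

theorem nodeRange_spec (T : Tables s len off N cut eps θ) {i j k : ℕ} (R : RoleVars s off eps i j k)
    (hb : s.nat vBase 0 ≤ N) :
    Runs nodeRange s fun t s' => t ≤ 14 ∧ s'.real = s.real ∧
      (∀ c, c < 401 ∨ 413 < c → s'.nat c = s.nat c) ∧
      ∃ x x' y y', NodeLeaves (s.nat vSide 0) (s.nat vHalf 0) (s.nat vBase 0) N x x' y y' ∧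
        ∃ P, P = nodePar len off cut eps i j k (0 < s'.nat vRev 0) x x' y y' ∧
        s'.nat vSi 0 = P.si ∧ s'.nat vEi 0 = P.ei ∧ s'.nat vSj 0 = P.sj ∧ s'.nat vEj 0 = P.ej ∧
        s'.nat vSk 0 = P.sk ∧ s'.nat vEk 0 = P.ek := by
  obtain ⟨li, lj, lk⟩ := R.roles.lt
  have hmin : ∀ x, x - (x - N) = min x N := fun x => by omega
  set base := s.nat vBase 0 with hbase
  set h := s.nat vHalf 0 with hh
  refine runs_seq (runs_setNat (runs_seq (runs_setNat ?_)))
  set s₁ := Store.setNat _ vTop _ _ with hs₁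
  have a1 : s₁.nat vMid 0 = min (base + h) N := by
    simp [hs₁, T.hleaves, hmin, ← hbase, ← hh]
  have a2 : s₁.nat vTop 0 = min (base + h + h) N := by
    simp [hs₁, T.hleaves, hmin, ← hbase, ← hh]
  have a3 : ∀ c, c < 401 ∨ 413 < c → s₁.nat c = s.nat c := fun c hc => by
    rw [hs₁, setNat_nat_of_ne (by omega), setNat_nat_of_ne (by omega)]
  refine Runs.seq (R := fun t s₂ => t = 5 ∧ s₂.real = s.real ∧
    (∀ c, c < 401 ∨ 413 < c → s₂.nat c = s.nat c) ∧ NodeLeaves (s.nat vSide 0) h base N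
      (s₂.nat vXi 0) (s₂.nat vYi 0) (s₂.nat vXj 0) (s₂.nat vYj 0)) ?_ ?_
  · have e1 : s₁.nat vBase 0 = base := by rw [a3 _ (by norm_num)]
    have e2 : s₁.nat vSide 0 = s.nat vSide 0 := by rw [a3 _ (by norm_num)]
    refine runs_ite (fun hs => ?_) (fun hs => ?_)
    · refine runs_seq (runs_setNat (runs_seq (runs_setNat (runs_seq (runs_setNat
        (runs_setNat ⟨rfl, rfl, ?_, ?_⟩))))))
      · intro c hc
        rw [setNat_nat_of_ne (by omega), setNat_nat_of_ne (by omega), setNat_nat_of_ne (by omega),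
          setNat_nat_of_ne (by omega), a3 c hc]
      · right
        have : 0 < s.nat vSide 0 := by simpa [e2] using hs
        simp [a1, a2, e1, this]
    · refine runs_seq (runs_setNat (runs_seq (runs_setNat (runs_seq (runs_setNat
        (runs_setNat ⟨rfl, rfl, ?_, ?_⟩))))))
      · intro c hc
        rw [setNat_nat_of_ne (by omega), setNat_nat_of_ne (by omega), setNat_nat_of_ne (by omega),
          setNat_nat_of_ne (by omega), a3 c hc]
      · left
        have : s.nat vSide 0 = 0 := by simpa [e2] using hs
        simp [a1, a2, e1, this]
  rintro t s₂ - ⟨rfl, b1, b2, b3⟩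
  obtain ⟨x, hx⟩ : ∃ x, s₂.nat vXi 0 = x := ⟨_, rfl⟩
  obtain ⟨x', hx'⟩ : ∃ x', s₂.nat vYi 0 = x' := ⟨_, rfl⟩
  obtain ⟨y, hy⟩ : ∃ y, s₂.nat vXj 0 = y := ⟨_, rfl⟩
  obtain ⟨y', hy'⟩ : ∃ y', s₂.nat vYj 0 = y' := ⟨_, rfl⟩
  rw [hx, hx', hy, hy'] at b3
  have hN : x ≤ N ∧ x' ≤ N ∧ y ≤ N ∧ y' ≤ N := by
    unfold NodeLeaves at b3
    omega
  have c1 : s₂.nat vI 0 = i := by rw [b2 _ (by norm_num), R.hi]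
  have c2 : s₂.nat vJ 0 = j := by rw [b2 _ (by norm_num), R.hj]
  have c3 : s₂.nat vK 0 = k := by rw [b2 _ (by norm_num), R.hk]
  have c4 : ∀ c < 3, ∀ r ≤ N, s₂.nat aCut (s₂.nat aCutOff c + r) = cut c r := by
    rw [b2 _ (by norm_num), b2 _ (by norm_num)]
    exact T.hcut
  have c5 : s₂.nat aLen k = len k := by rw [b2 _ (by norm_num), T.hlen k lk]
  have c6 : s₂.nat vRev 0 = s.nat vRev 0 := by rw [b2 _ (by norm_num)]
  refine runs_seq (runs_setNat (runs_seq (runs_setNat (runs_seq (runs_setNat (runs_seq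
    (runs_setNat ?_)))))))
  set s₃ := Store.setNat _ vEj _ _ with hs₃
  have d1 : s₃.nat vSi 0 = cut i x := by
    simp [hs₃, cutExpr, c1, hx, c4 i li x hN.1]
  have d2 : s₃.nat vEi 0 = cut i x' := by
    simp [hs₃, cutExpr, c1, hx', c4 i li x' hN.2.1]
  have d3 : s₃.nat vSj 0 = cut j y := by
    simp [hs₃, cutExpr, c2, hy, c4 j lj y hN.2.2.1]
  have d4 : s₃.nat vEj 0 = cut j y' := by
    simp [hs₃, cutExpr, c2, hy', c4 j lj y' hN.2.2.2]
  have d5 : ∀ c, c < 401 ∨ 404 < c → s₃.nat c = s₂.nat c := fun c hc => by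
    rw [hs₃, setNat_nat_of_ne (by omega), setNat_nat_of_ne (by omega),
      setNat_nat_of_ne (by omega), setNat_nat_of_ne (by omega)]
  have d6 : s₃.nat vXj 0 = y := by rw [d5 _ (by norm_num), hy]
  have d7 : s₃.nat vYj 0 = y' := by rw [d5 _ (by norm_num), hy']
  have d8 : s₃.nat vK 0 = k := by rw [d5 _ (by norm_num), c3]
  have d9 : ∀ c < 3, ∀ r ≤ N, s₃.nat aCut (s₃.nat aCutOff c + r) = cut c r := by
    rw [d5 _ (by norm_num), d5 _ (by norm_num)]
    exact c4
  have d10 : s₃.nat aLen k = len k := by rw [d5 _ (by norm_num), c5]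
  have d11 : s₃.nat vRev 0 = s.nat vRev 0 := by rw [d5 _ (by norm_num), c6]
  refine runs_ite (fun hr => ?_) (fun hr => ?_)
  · have hr' : 0 < s.nat vRev 0 := by simpa [d11] using hr
    refine runs_seq (runs_setNat (runs_setNat ⟨by norm_num, b1, ?_, x, x', y, y', b3, _, rfl, ?_⟩))
    · intro c hc
      rw [setNat_nat_of_ne (by omega), setNat_nat_of_ne (by omega), d5 c (by omega), b2 c hc]
    · simp [nodePar, hr', d1, d2, d3, d4, d6, d7, d8, d9 k lk y hN.2.2.1, d9 k lk y' hN.2.2.2, d10,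
        d11, cutExpr]
  · have hr' : s.nat vRev 0 = 0 := by simpa [d11] using hr
    refine runs_seq (runs_setNat (runs_setNat ⟨by norm_num, b1, ?_, x, x', y, y', b3, _, rfl, ?_⟩))
    · intro c hc
      rw [setNat_nat_of_ne (by omega), setNat_nat_of_ne (by omega), d5 c (by omega), b2 c hc]
    · simp [nodePar, hr', d1, d2, d3, d4, d6, d7, d8, d9 k lk y hN.2.2.1, d9 k lk y' hN.2.2.2,
        d11, cutExpr]

/-- The points are on the edges of a recorded triple. -/
def CovT (s₀ s : Store) (len off : ℕ → ℕ) (z : ℕ → ℂ) : Prop :=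
  ∃ (m : ℕ → ℕ) (q : ℕ → ℝ), (∀ c < 3, RepAt s₀ (off c) 0 (len c) (z c) (m c) (q c)) ∧
    ∃ r < s.nat vTrip 0, ∀ c < 3, s.nat (41 + c) r = m c

/-- The pair of points is on the two sub-edges of some piece in a range. -/
def PiecesCover (s₀ s : Store) (x y oj ok : ℕ) (zj zk : ℂ) : Prop :=
  ∃ r t u, x ≤ r ∧ r < y ∧ s.real aLlo r ≤ t ∧ t ≤ s.real aLhi r ∧
    s.real aRlo r ≤ u ∧ u ≤ s.real aRhi r ∧
    linePt (chB s₀ oj) (chD s₀ oj) (s.nat aLE r) t = zj ∧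
    linePt (chB s₀ ok) (chD s₀ ok) (s.nat aRE r) u = zk

theorem IsRep.mono {B D : ℕ → ℂ} {lo hi : ℕ → ℝ} {x y x' y' a : ℕ} {z : ℂ} {t : ℝ}
    (h : IsRep B D lo hi x y z a t) (hx : x' ≤ x) (hy : y ≤ y') : IsRep B D lo hi x' y' z a t :=
  ⟨hx.trans h.le, h.lt.trans_le hy, h.lo_le, h.le_hi, h.eq⟩

theorem IsRoles.sum (h : IsRoles i j k) {z : ℕ → ℂ} (hz : z 0 + z 1 + z 2 = 0) :
    z i + z j + z k = 0 := by
  rcases h with ⟨rfl, rfl, rfl⟩ | ⟨rfl, rfl, rfl⟩ | ⟨rfl, rfl, rfl⟩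
  · exact hz
  · rw [← hz]; ring
  · rw [← hz]; ring

theorem CovT.of_roles {s₀ : Store} {z : ℕ → ℂ} (hR : IsRoles i j k) {mi mj mk : ℕ} {qi qj qk : ℝ}
    (hi : RepAt s₀ (off i) 0 (len i) (z i) mi qi) (hj : RepAt s₀ (off j) 0 (len j) (z j) mj qj)
    (hk : RepAt s₀ (off k) 0 (len k) (z k) mk qk) (h : TripleIn s i j k mi mj mk) :
    CovT s₀ s len off z := by
  obtain ⟨r, hr, h1, h2, h3⟩ := h
  have hj' : j ≠ i := by unfold IsRoles at hR; omega
  have hk' : k ≠ i ∧ k ≠ j := by unfold IsRoles at hR; omega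
  refine ⟨fun c => if c = i then mi else if c = j then mj else mk,
    fun c => if c = i then qi else if c = j then qj else qk, fun c hc => ?_, r, hr, fun c hc => ?_⟩
  all_goals
    have : c = i ∨ c = j ∨ c = k := by unfold IsRoles at hR; omega
    rcases this with rfl | rfl | rfl
    · simpa
    · simpa [hj']
    · simpa [hk'.1, hk'.2]

theorem Tables.cover_of_walk {s' : Store} (T : Tables s len off N cut eps θ) {i j k x x' y y' : ℕ}
    (R : RoleVars s off eps i j k) {P : WalkPar} {c c' : Cur}
    (hP : P = nodePar len off cut eps i j k (0 < s.nat vRev 0) x x' y y') (hx' : x' ≤ N)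
    (hy' : y' ≤ N) (hW : WalkDone s P len c s' c') {z : ℕ → ℂ} (hz : z 0 + z 1 + z 2 = 0)
    {mi mj mk : ℕ} {qi qj qk : ℝ} (hi : RepAt s (off i) (cut i x) (cut i x') (z i) mi qi)
    (hj : RepAt s (off j) (cut j y) (cut j y') (z j) mj qj)
    (hk : RepAt s (off k) (cut k y) (cut k y') (z k) mk qk) :
    CovT s s' len off z ∨ s.nat vRev 0 = 0 ∧
      PiecesCover s s' (s.nat vOut 0) (s'.nat vOut 0) (off j) (off k) (z j) (z k) := by
  obtain ⟨li, lj, lk⟩ := R.roles.lt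
  have ci := T.cut_le li hx'
  have cj := T.cut_le lj hy'
  have ck := T.cut_le lk hy'
  by_cases hr : 0 < s.nat vRev 0
  · rcases hW.cover (z i) (z j) (z k) (R.roles.sum hz) mi qi mj qj (len k - 1 - mk) (1 - qk)
      (by subst hP; simpa [nodePar] using hi) (by subst hP; simpa [nodePar] using hj)
      (by subst hP; simpa [nodePar, hr] using T.rev_rep lk ck hk) with h | ⟨h, -⟩
    · obtain ⟨m, q, a, t, b, u, h1, h2, h3, h4⟩ := h
      left
      have h5 : RepAt s (off k) (cut k y) (cut k y') (z k) (len k - 1 - b) (1 - u) := by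
        refine T.of_rev_rep lk ck ?_
        subst hP
        simpa [nodePar, hr] using h3
      refine CovT.of_roles R.roles (mi := m) (mj := a) (mk := len k - 1 - b)
        (qi := q) (qj := t) (qk := 1 - u) ?_ ?_ (h5.mono (Nat.zero_le _) ck) ?_
      · subst hP
        exact IsRep.mono h1 (Nat.zero_le _) ci
      · subst hP
        exact IsRep.mono h2 (Nat.zero_le _) cj
      · subst hP
        simpa [nodePar, edgeK, hr, R.hk, T.hlen k lk] using h4
    · omega
  · rcases hW.cover (z i) (z j) (z k) (R.roles.sum hz) mi qi mj qj mk qk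
      (by subst hP; simpa [nodePar] using hi) (by subst hP; simpa [nodePar] using hj)
      (by subst hP; simpa [nodePar, hr] using hk) with h | ⟨h, h'⟩
    · obtain ⟨m, q, a, t, b, u, h1, h2, h3, h4⟩ := h
      left
      refine CovT.of_roles R.roles (mi := m) (mj := a) (mk := b)
        (qi := q) (qj := t) (qk := u) ?_ ?_ ?_ ?_
      · subst hP
        exact IsRep.mono h1 (Nat.zero_le _) ci
      · subst hP
        exact IsRep.mono h2 (Nat.zero_le _) cj
      · subst hP
        simp only [nodePar, if_neg hr] at h3
        exact IsRep.mono h3 (Nat.zero_le _) ck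
      · subst hP
        simpa [nodePar, edgeK, hr] using h4
    · right
      refine ⟨h, ?_⟩
      subst hP
      simpa [nodePar, hr, CovPiece, PiecesCover] using h'

end

section
variable {s₀ s s' s₁ : Store} {len off : ℕ → ℕ} {z : ℕ → ℂ} {N x y oj ok i j k : ℕ} {zj zk : ℂ}

theorem CovT.ext (h : CovT s₀ s len off z) (h' : TripleExt s s') :
    CovT s₀ s' len off z := by
  obtain ⟨m, q, h1, r, h2, h3⟩ := h
  exact ⟨m, q, h1, r, h2.trans_le h'.1, fun c hc => by
    rw [h'.2 (41 + c) (by omega) (by omega) r h2, h3 c hc]⟩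

theorem CovT.congr (hA : Agree N s₀ s₁) (hN : 300 ≤ N) :
    CovT s₁ s len off z ↔ CovT s₀ s len off z := by
  simp only [CovT, RepAt.congr hA hN]

theorem PiecesCover.ext {y' : ℕ} (h : PiecesCover s₀ s x y oj ok zj zk)
    (h' : ∀ r, x ≤ r → r < y → PieceEq s s' r) (hy : y ≤ y') :
    PiecesCover s₀ s' x y' oj ok zj zk := by
  obtain ⟨r, t, u, h1, h2, h3, h4, h5, h6, h7, h8⟩ := h
  have e := h' r h1 h2
  exact ⟨r, t, u, h1, h2.trans_le hy, e.loL ▸ h3, e.hiL ▸ h4, e.loR ▸ h5, e.hiR ▸ h6,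
    by rw [e.edgeL, h7], by rw [e.edgeR, h8]⟩

theorem PiecesCover.mono {x' : ℕ} (h : PiecesCover s₀ s x y oj ok zj zk) (hx : x' ≤ x) :
    PiecesCover s₀ s x' y oj ok zj zk := by
  obtain ⟨r, t, u, h1, h2⟩ := h
  exact ⟨r, t, u, hx.trans h1, h2⟩

theorem PiecesCover.congr (hA : Agree N s₀ s₁) (hN : 300 ≤ N) :
    PiecesCover s₁ s x y oj ok zj zk ↔ PiecesCover s₀ s x y oj ok zj zk := by
  simp only [PiecesCover, chB_congr hA hN, chD_congr hA hN]

theorem RoleVars.congr {eps : ℕ → ℝ} (R : RoleVars s off eps i j k) (hA : Agree 400 s s') :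
    RoleVars s' off eps i j k := by
  have e : ∀ x, 300 ≤ x → x < 400 → s'.nat x = s.nat x := fun x h1 h2 =>
    (hA x (by omega) h2).1
  constructor
  case roles => exact R.roles
  case hi => rw [e _ (by norm_num) (by norm_num), R.hi]
  case hj => rw [e _ (by norm_num) (by norm_num), R.hj]
  case hk => rw [e _ (by norm_num) (by norm_num), R.hk]
  case hoi => rw [e _ (by norm_num) (by norm_num), R.hoi]
  case hoj => rw [e _ (by norm_num) (by norm_num), R.hoj]
  case hrev => rw [e vRev (by norm_num) (by norm_num), R.hrev]
  case hok =>
    rw [e vRev (by norm_num) (by norm_num), e vOk (by norm_num) (by norm_num), R.hok]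

/-- The invariant of the treatment of a level after `d` nodes. -/
structure NodesInv (s₁ : Store) (len off : ℕ → ℕ) (N : ℕ) (cut : ℕ → ℕ → ℕ)
    (side h' H i j k : ℕ) (s : Store) (c : Cur) (d : ℕ) : Prop where
  agree : Agree 400 s₁ s
  text : TripleExt s₁ s
  tok : TripleOk len s
  pext : PieceExt s₁ s
  out_eq : 0 < s₁.nat vRev 0 → s.nat vOut 0 = s₁.nat vOut 0
  cur : s₁.nat vRev 0 = 0 → CurAt s (s.nat vOut 0) c.a c.t c.b c.u ∧
    c.t < 1 ∧ c.u < 1 ∧ c.t < chHi s₁ (off j) c.a ∧ c.u < chHi s₁ (off k) c.b ∧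
    (c.a < cut j (min (H * d) N) ∨
      c.a = 0 ∧ c.t = chLo s₁ (off j) 0) ∧
    (c.b < cut k (min (H * d) N) ∨
      c.b = 0 ∧ c.u = chLo s₁ (off k) 0) ∧
    s.nat vOut 0 ≤ s₁.nat vOut 0 + c.a + c.b
  count : s.nat vTrip 0 ≤ s₁.nat vTrip 0 +
    4 * cut i (min (H * d) N) +
    cut j (min (H * d) N) +
    cut k (min (H * d) N)
  cover : ∀ d' < d, ∀ x x' y y', NodeLeaves side h'
    (H * d') N x x' y y' →
    ∀ z : ℕ → ℂ, z 0 + z 1 + z 2 = 0 → ∀ mi mj mk qi qj qk,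
      RepAt s₁ (off i) (cut i x) (cut i x') (z i) mi qi →
      RepAt s₁ (off j) (cut j y) (cut j y') (z j) mj qj →
      RepAt s₁ (off k) (cut k y) (cut k y') (z k) mk qk →
      CovT s₁ s len off z ∨ s₁.nat vRev 0 = 0 ∧
        PiecesCover s₁ s (s₁.nat vOut 0) (s.nat vOut 0) (off j) (off k) (z j) (z k)

theorem NodesInv.of_eq {cut : ℕ → ℕ → ℕ} {side h' H : ℕ} {c : Cur} {d : ℕ} (h : NodesInv s₁ len off N cut side h' H i j k s c d)
    (hA : Agree 400 s s') (hn : ∀ x, x < 200 → s'.nat x = s.nat x)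
    (hr : ∀ x, x < 200 → s'.real x = s.real x) : NodesInv s₁ len off N cut side h' H i j k s' c d := by
  have eO : s'.nat vOut 0 = s.nat vOut 0 := by rw [hn _ (by norm_num)]
  have eT : s'.nat vTrip 0 = s.nat vTrip 0 := by rw [hn _ (by norm_num)]
  have hT : TripleExt s s' := TripleExt.of_eq fun x _ _ => hn x (by omega)
  have hP : PieceExt s s' := PieceExt.of_eq fun x hx _ _ => ⟨hn x hx, hr x hx⟩
  refine ⟨h.agree.trans hA, h.text.trans hT, h.tok.of_eq fun x _ _ => hn x (by omega),
    h.pext.trans hP, by rw [eO]; exact h.out_eq, fun h0 => ?_, by rw [eT]; exact h.count, ?_⟩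
  · rw [eO]
    obtain ⟨g1, g2⟩ := h.cur h0
    exact ⟨g1.ext hP le_rfl, g2⟩
  · intro d' hd x x' y y' hL z hz mi mj mk qi qj qk hi hj hk
    rcases h.cover d' hd x x' y y' hL z hz mi mj mk qi qj qk hi hj hk with g | ⟨g, g'⟩
    · exact Or.inl (g.ext hT)
    · exact Or.inr ⟨g, g'.ext (fun r _ hr => hP.old r hr) eO.ge⟩

section
variable {s₁ : Store} {len off : ℕ → ℕ} {N : ℕ} {cut : ℕ → ℕ → ℕ} {eps : ℕ → ℝ}
  {θ : ℕ → ℕ → ℝ} {side h' H i j k : ℕ}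

/-- A node at which one of the ranges is empty needs no treatment. -/
theorem NodesInv.skip {s : Store} {c : Cur} {d : ℕ} (T : Tables s₁ len off N cut eps θ)
    (hR : IsRoles i j k)
    (h : NodesInv s₁ len off N cut side h' H i j k s c d) {x x' y y' : ℕ}
    (hL : NodeLeaves side h'
      (H * d) N x x' y y')
    (hemp : ¬ (cut i x < cut i x' ∧ cut j y < cut j y' ∧ cut k y < cut k y')) :
    NodesInv s₁ len off N cut side h' H i j k s c (d + 1) := by
  obtain ⟨li, lj, lk⟩ := hR.lt
  have hmm : min (H * d) N ≤ min (H * (d + 1)) N := by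
    have : H * (d + 1) = H * d + H := by ring
    omega
  have m1 := T.cut_mono i li _ _ hmm (min_le_right _ _)
  have m2 := T.cut_mono j lj _ _ hmm (min_le_right _ _)
  have m3 := T.cut_mono k lk _ _ hmm (min_le_right _ _)
  refine ⟨h.agree, h.text, h.tok, h.pext, h.out_eq, fun h0 => ?_, ?_, ?_⟩
  · obtain ⟨g1, g2, g3, g4, g5, g6, g7, g8⟩ := h.cur h0
    exact ⟨g1, g2, g3, g4, g5, g6.imp (fun g => g.trans_le m2) id,
      g7.imp (fun g => g.trans_le m3) id, g8⟩
  · have := h.count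
    omega
  · intro d' hd w w' v v' hL' z hz mi mj mk qi qj qk hi hj hk
    rcases Nat.lt_succ_iff_lt_or_eq.1 hd with hd' | rfl
    · exact h.cover d' hd' w w' v v' hL' z hz mi mj mk qi qj qk hi hj hk
    · have : w = x ∧ w' = x' ∧ v = y ∧ v' = y' := by
        unfold NodeLeaves at hL hL'
        omega
      obtain ⟨rfl, rfl, rfl, rfl⟩ := this
      exact absurd ⟨hi.le.trans_lt hi.lt, hj.le.trans_lt hj.lt, hk.le.trans_lt hk.lt⟩ hemp

theorem NodeLeaves.bounds {side h base N x x' y y' : ℕ} (hL : NodeLeaves side h base N x x' y y')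
    (hb : base ≤ N) : (x' ≤ y ∨ y' ≤ x) ∧ x ≤ x' ∧ y ≤ y' ∧ x' ≤ min (base + (h + h)) N ∧
      y' ≤ min (base + (h + h)) N ∧ min base N ≤ x ∧ min base N ≤ y := by
  unfold NodeLeaves at hL
  omega

/-- A walk treats a node. -/
theorem NodesInv.walk {s s' : Store} {c c' : Cur} {d : ℕ} (hH : H = h' + h')
    (T : Tables s₁ len off N cut eps θ)
    (R : RoleVars s₁ off eps i j k)
    (h : NodesInv s₁ len off N cut side h' H i j k s c d) {x x' y y' : ℕ}
    (hb : H * d ≤ N)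
    (hL : NodeLeaves side h'
      (H * d) N x x' y y') {P : WalkPar}
    (hP : P = nodePar len off cut eps i j k (0 < s₁.nat vRev 0) x x' y y')
    (hW : WalkDone s P len c s' c') :
    NodesInv s₁ len off N cut side h' H i j k s' c' (d + 1) := by
  obtain ⟨li, lj, lk⟩ := R.roles.lt
  have hrev : s.nat vRev 0 = s₁.nat vRev 0 := by rw [(h.agree _ (by norm_num) (by norm_num)).1]
  obtain ⟨-, hx, hy, hx', hy', hx0, hy0⟩ := hL.bounds hb
  have eH : H * (d + 1) = H * d + H := by ring
  rw [← hH, ← eH] at hx' hy'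
  have hxN : x' ≤ N := hx'.trans (min_le_right _ _)
  have hyN : y' ≤ N := hy'.trans (min_le_right _ _)
  have mono : ∀ c < 3, ∀ r r', r ≤ r' → r' ≤ N → cut c r ≤ cut c r' := T.cut_mono
  have i1 := mono i li _ _ hx0 (hx.trans hxN)
  have i2 := mono i li _ _ hx hxN
  have i3 := mono i li _ _ hx' (min_le_right _ _)
  have j1 := mono j lj _ _ hy0 (hy.trans hyN)
  have j2 := mono j lj _ _ hy hyN
  have j3 := mono j lj _ _ hy' (min_le_right _ _)
  have k1 := mono k lk _ _ hy0 (hy.trans hyN)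
  have k2 := mono k lk _ _ hy hyN
  have k3 := mono k lk _ _ hy' (min_le_right _ _)
  have k4 := T.cut_le lk hyN
  clear hx0 hy0 hx' hy'
  have hA : Agree 400 s₁ s' := h.agree.trans (hW.agree.mono (by norm_num))
  have hej : P.ej = cut j y' ∧ P.sj = cut j y ∧ P.ei = cut i x' ∧ P.si = cut i x ∧
      P.ek - P.sk = cut k y' - cut k y ∧ P.oj = off j := by
    subst hP
    by_cases hr : 0 < s₁.nat vRev 0
    · simp only [nodePar, if_pos hr, true_and, and_true]
      omega
    · simp [nodePar, hr]
  obtain ⟨p1, p2, p3, p4, p5, p6⟩ := hej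
  refine ⟨hA, h.text.trans hW.text, hW.tok, h.pext.trans hW.pext, fun h0 => ?_, fun h0 => ?_, ?_, ?_⟩
  · rw [hW.out_eq (by omega), h.out_eq h0]
  · obtain ⟨g1, g2, g3⟩ := hW.cur (by omega)
    obtain ⟨-, -, -, -, -, -, -, g4⟩ := h.cur h0
    have hok : P.ok = off k ∧ P.ek = cut k y' := by
      subst hP
      simp [nodePar, h0]
    have q1 := g2.a_lt
    have q2 := g2.b_lt
    have q3 := g2.t_lt
    have q4 := g2.u_lt
    rw [chHi_congr h.agree (by norm_num), p6] at q3
    rw [chHi_congr h.agree (by norm_num), hok.1] at q4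
    exact ⟨g1, g2.t_lt_one, g2.u_lt_one, q3, q4, Or.inl (by omega), Or.inl (by omega), by omega⟩
  · have := hW.count
    have := h.count
    omega
  · intro d' hd w w' v v' hL' z hz mi mj mk qi qj qk hi hj hk
    rcases Nat.lt_succ_iff_lt_or_eq.1 hd with hd' | rfl
    · rcases h.cover d' hd' w w' v v' hL' z hz mi mj mk qi qj qk hi hj hk with g | ⟨g, g'⟩
      · exact Or.inl (g.ext hW.text)
      · exact Or.inr ⟨g, g'.ext (fun r _ hr => hW.pext.old r hr) hW.pext.le⟩
    · have : w = x ∧ w' = x' ∧ v = y ∧ v' = y' := by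
        unfold NodeLeaves at hL hL'
        omega
      obtain ⟨rfl, rfl, rfl, rfl⟩ := this
      have e1 : s₁.nat vOut 0 ≤ s.nat vOut 0 := h.pext.le
      rcases (T.congr (h.agree.mono (by norm_num))).cover_of_walk (R.congr h.agree) (P := P)
        (by rw [hP]; simp only [hrev]) hxN hyN hW hz
        ((RepAt.congr h.agree (by norm_num)).2 hi) ((RepAt.congr h.agree (by norm_num)).2 hj)
        ((RepAt.congr h.agree (by norm_num)).2 hk) with g | ⟨g, g'⟩
      · exact Or.inl ((CovT.congr h.agree (by norm_num)).1 g)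
      · exact Or.inr ⟨by omega, ((PiecesCover.congr h.agree (by norm_num)).1 g').mono e1⟩

set_option maxHeartbeats 1000000 in
theorem node_spec {s : Store} {c : Cur} {d : ℕ} (hH : H = h' + h')
    (hhalf : s₁.nat vHalf 0 = h') (hsd : s₁.nat vSide 0 = side) (T : Tables s₁ len off N cut eps θ)
    (R : RoleVars s₁ off eps i j k)
    (h : NodesInv s₁ len off N cut side h' H i j k s c d)
    (hbase : s.nat vBase 0 = H * d)
    (hb : H * d < N) :
    Runs node s fun t s' =>
      s'.nat vBase 0 = H * (d + 1) ∧
      (∃ c', NodesInv s₁ len off N cut side h' H i j k s' c' (d + 1)) ∧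
      t + 9 * s.nat vTrip 0 + 11 * s.nat vOut 0 + (12 * s₁.nat vLog 0 + 62) *
          (cut j (min (H * d) N) +
            cut k (min (H * d) N)) ≤
        9 * s'.nat vTrip 0 + 11 * s'.nat vOut 0 + (12 * s₁.nat vLog 0 + 62) *
          (cut j (min (H * (d + 1)) N) +
            cut k (min (H * (d + 1)) N) + 1) := by
  obtain ⟨li, lj, lk⟩ := R.roles.lt
  have hh : s.nat vHalf 0 = h' := by rw [(h.agree _ (by norm_num) (by norm_num)).1, hhalf]
  have hside : s.nat vSide 0 = side := by
    rw [(h.agree _ (by norm_num) (by norm_num)).1, hsd]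
  have hmm : min (H * d) N ≤ min (H * (d + 1)) N := by
    have : H * (d + 1) = H * d + H := by ring
    omega
  have T' := T.congr (h.agree.mono (by norm_num))
  have R' := R.congr h.agree
  refine (nodeRange_spec T' R' (by omega)).seq ?_
  rintro t₁ s₂ - ⟨ht₁, f1, f2, x, x', y, y', hL, P, hP, e1, e2, e3, e4, e5, e6⟩
  rw [hh, hside, hbase] at hL
  have hA₂ : Agree 400 s s₂ := fun z h1 h2 => ⟨f2 z (Or.inl (by omega)), by rw [f1]⟩
  have h₂ : NodesInv s₁ len off N cut side h' H i j k s₂ c d :=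
    h.of_eq hA₂ (fun z hz => f2 z (by omega)) (fun z _ => by rw [f1])
  have hrev : s₂.nat vRev 0 = s₁.nat vRev 0 := by
    rw [(h₂.agree _ (by norm_num) (by norm_num)).1]
  simp only [hrev] at hP
  have hbase₂ : s₂.nat vBase 0 = H * d := by rw [f2 _ (by norm_num), hbase]
  have eT₂ : s₂.nat vTrip 0 = s.nat vTrip 0 := by rw [f2 _ (by norm_num)]
  have eO₂ : s₂.nat vOut 0 = s.nat vOut 0 := by rw [f2 _ (by norm_num)]
  have eK₂ : s₂.nat vLog 0 = s₁.nat vLog 0 := by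
    rw [(h₂.agree _ (by norm_num) (by norm_num)).1]
  obtain ⟨hsep, hx, hy, hx', hy', hx0, hy0⟩ := hL.bounds hb.le
  have eH : H * (d + 1) = H * d + H := by ring
  rw [← hH, ← eH] at hx' hy'
  have hxN : x' ≤ N := hx'.trans (min_le_right _ _)
  have hyN : y' ≤ N := hy'.trans (min_le_right _ _)
  have j1 := T.cut_mono j lj _ _ hy0 (hy.trans hyN)
  have j2 := T.cut_mono j lj _ _ hy hyN
  have j3 := T.cut_mono j lj _ _ hy' (min_le_right _ _)
  have k1 := T.cut_mono k lk _ _ hy0 (hy.trans hyN)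
  have k2 := T.cut_mono k lk _ _ hy hyN
  have k3 := T.cut_mono k lk _ _ hy' (min_le_right _ _)
  have k4 := T.cut_le lk hyN
  clear hmm hx0 hy0 hx' hy'
  have hpar : P.ej = cut j y' ∧ P.sj = cut j y ∧ P.ei = cut i x' ∧ P.si = cut i x ∧
      P.ek - P.sk = cut k y' - cut k y ∧ P.oj = off j ∧ (P.sk < P.ek ↔ cut k y < cut k y') := by
    subst hP
    by_cases hr : 0 < s₁.nat vRev 0
    · simp only [nodePar, if_pos hr, true_and]
      omega
    · simp [nodePar, hr]
  obtain ⟨p1, p2, p3, p4, p5, p6, p7⟩ := hpar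
  set K := 12 * s₁.nat vLog 0 + 62 with hK
  refine Runs.seq (R := fun t s₃ => (∃ c', NodesInv s₁ len off N cut side h' H i j k s₃ c' (d + 1)) ∧
      s₃.nat vBase 0 = H * d ∧
      t + 9 * s.nat vTrip 0 + 11 * s.nat vOut 0 + K * (cut j (min (H * d) N) +
        cut k (min (H * d) N)) + 15 ≤ 9 * s₃.nat vTrip 0 + 11 * s₃.nat vOut 0 +
        K * (cut j (min (H * (d + 1)) N) + cut k (min (H * (d + 1)) N) + 1))
    (runs_ite (fun hne => ?_) (fun hne => ?_)) ?_
  · have hne' : P.si < P.ei ∧ P.sj < P.ej ∧ P.sk < P.ek := by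
      simpa [e1, e2, e3, e4, e5, e6] using hne
    have T₂ := T.congr (h₂.agree.mono (by norm_num))
    have R₂ := R.congr h₂.agree
    have hC : WalkCtx s₂ P len := T₂.walkCtx R₂ (by simp only [hrev]; exact hP) hsep hx hy hxN hyN
      hne'.1 hne'.2.1 hne'.2.2 e1 e2 e3 e4 e5 e6
    refine (walk_spec (c₀ := c) hC h₂.tok ?_).mono ?_
    · intro h0
      rw [hrev] at h0
      obtain ⟨g1, g2, g3, g4, g5, g6, g7, -⟩ := h₂.cur h0
      have hok : P.ok = off k ∧ P.ek = cut k y' ∧ P.sk = cut k y := by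
        subst hP
        simp [nodePar, h0]
      obtain ⟨o1, o2, o3⟩ := hok
      refine ⟨g1, ⟨?_, ?_, g2, g3, ?_, ?_⟩, ⟨?_, ?_, ?_, ?_⟩⟩
      · rcases g6 with g | g <;> omega
      · rcases g7 with g | g <;> omega
      · rw [p6, chHi_congr h₂.agree (by norm_num)]; exact g4
      · rw [o1, chHi_congr h₂.agree (by norm_num)]; exact g5
      · rcases g6 with g | g <;> omega
      · rcases g7 with g | g <;> omega
      · intro e
        rcases g6 with g | g
        · omega
        · rw [p6, chLo_congr h₂.agree (by norm_num), g.1, g.2]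
      · intro e
        rcases g7 with g | g
        · omega
        · rw [o1, chLo_congr h₂.agree (by norm_num), g.1, g.2]
    · rintro t s₃ hF ⟨q1, c', q2⟩
      refine ⟨⟨c', h₂.walk hH T R hb.le hL hP q2⟩, by rw [hF.1 vBase (by decide), hbase₂], ?_⟩
      rw [eT₂, eO₂, eK₂] at q1
      have q3 : (12 * s₁.nat vLog 0 + 46) * ((P.ej - P.sj) + (P.ek - P.sk) + 1) + 16 +
          K * (cut j (min (H * d) N) + cut k (min (H * d) N)) ≤
          K * (cut j (min (H * (d + 1)) N) + cut k (min (H * (d + 1)) N) + 1) := by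
        calc _ ≤ K * ((P.ej - P.sj) + (P.ek - P.sk) + 1) +
              K * (cut j (min (H * d) N) + cut k (min (H * d) N)) := by
              refine Nat.add_le_add_right ?_ _
              rw [hK, show 12 * s₁.nat vLog 0 + 62 = (12 * s₁.nat vLog 0 + 46) + 16 from rfl,
                add_mul (12 * s₁.nat vLog 0 + 46)]
              exact Nat.add_le_add_left (by omega) _
          _ = K * ((P.ej - P.sj) + (P.ek - P.sk) + 1 +
              (cut j (min (H * d) N) + cut k (min (H * d) N))) := by ring
          _ ≤ _ := Nat.mul_le_mul_left _ (by omega)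
      omega
  · have hne' : ¬ (P.si < P.ei ∧ P.sj < P.ej ∧ P.sk < P.ek) := by
      simpa [e1, e2, e3, e4, e5, e6] using hne
    refine runs_skip ⟨⟨c, h₂.skip T R.roles hL ?_⟩, hbase₂, ?_⟩
    · rw [← p7]
      omega
    · have q3 : K * (cut j (min (H * d) N) + cut k (min (H * d) N)) + K ≤
          K * (cut j (min (H * (d + 1)) N) + cut k (min (H * (d + 1)) N) + 1) := by
        rw [← Nat.mul_succ]
        exact Nat.mul_le_mul_left _ (by omega)
      omega
  · rintro t s₃ - ⟨⟨c', g1⟩, g2, g3⟩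
    refine runs_setNat ?_
    set s₄ := Store.setNat _ vBase _ _ with hs₄
    have e : ∀ z, z ≠ vBase → s₄.nat z = s₃.nat z := fun z hz => setNat_nat_of_ne hz
    have eT₄ : s₄.nat vTrip 0 = s₃.nat vTrip 0 := by rw [e _ (by norm_num)]
    have eO₄ : s₄.nat vOut 0 = s₃.nat vOut 0 := by rw [e _ (by norm_num)]
    refine ⟨?_, ⟨c', g1.of_eq (agree_setNat (Or.inr le_rfl)) (fun z hz => e z (by omega))
      fun _ _ => rfl⟩, by omega⟩
    have : s₃.nat vHalf 0 = h' := by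
      rw [(g1.agree _ (by norm_num) (by norm_num)).1, hhalf]
    simp only [hs₄, Store.setNat_nat, NatExpr.eval_add, NatExpr.eval_load, NatExpr.eval_zero, and_self,
      if_true, g2, this]
    rw [eH, hH, add_assoc]

end

end

/-- The outcome of the treatment of all nodes of a level. -/
structure NodesDone (s : Store) (len off : ℕ → ℕ) (N : ℕ) (cut : ℕ → ℕ → ℕ)
    (side h' i j k : ℕ) (s' : Store) (c : Cur) : Prop where
  agree : Agree 400 s s'
  text : TripleExt s s'
  tok : TripleOk len s'
  pext : PieceExt s s'
  out_eq : 0 < s.nat vRev 0 → s'.nat vOut 0 = s.nat vOut 0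
  cur : s.nat vRev 0 = 0 → CurAt s' (s'.nat vOut 0) c.a c.t c.b c.u ∧
    c.t < 1 ∧ c.u < 1 ∧ c.t < chHi s (off j) c.a ∧ c.u < chHi s (off k) c.b ∧
    c.a < len j ∧ c.b < len k ∧ s'.nat vOut 0 ≤ s.nat vOut 0 + c.a + c.b
  count : s'.nat vTrip 0 ≤ s.nat vTrip 0 + 4 * len i + len j + len k
  cover : ∀ d, (h' + h') * d < N → ∀ x x' y y', NodeLeaves side h' ((h' + h') * d) N x x' y y' →
    ∀ z : ℕ → ℂ, z 0 + z 1 + z 2 = 0 → ∀ mi mj mk qi qj qk,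
      RepAt s (off i) (cut i x) (cut i x') (z i) mi qi →
      RepAt s (off j) (cut j y) (cut j y') (z j) mj qj →
      RepAt s (off k) (cut k y) (cut k y') (z k) mk qk →
      CovT s s' len off z ∨ s.nat vRev 0 = 0 ∧
        PiecesCover s s' (s.nat vOut 0) (s'.nat vOut 0) (off j) (off k) (z j) (z k)

theorem nodes_spec {s : Store} {len off : ℕ → ℕ} {N : ℕ} {cut : ℕ → ℕ → ℕ} {eps : ℕ → ℝ}
    {θ : ℕ → ℕ → ℝ} {side h' i j k : ℕ} (T : Tables s len off N cut eps θ)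
    (R : RoleVars s off eps i j k) (hhalf : s.nat vHalf 0 = h') (hsd : s.nat vSide 0 = side)
    (hpos : 1 ≤ h') (hok : TripleOk len s)
    (hcur : s.nat vRev 0 = 0 →
      CurAt s (s.nat vOut 0) 0 (chLo s (off j) 0) 0 (chLo s (off k) 0)) :
    Runs nodes s fun t s' => t + 9 * s.nat vTrip 0 + 11 * s.nat vOut 0 ≤
      9 * s'.nat vTrip 0 + 11 * s'.nat vOut 0 +
        (12 * s.nat vLog 0 + 63) * (len j + len k + N) + 2 ∧
      ∃ c, NodesDone s len off N cut side h' i j k s' c := by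
  obtain ⟨li, lj, lk⟩ := R.roles.lt
  refine runs_seq (runs_setNat ?_)
  set s₁ := Store.setNat _ vBase _ _ with hs₁
  have e1 : ∀ x, x ≠ vBase → s₁.nat x = s.nat x := fun x hx => setNat_nat_of_ne hx
  have eT : s₁.nat vTrip 0 = s.nat vTrip 0 := by rw [e1 _ (by norm_num)]
  have eO : s₁.nat vOut 0 = s.nat vOut 0 := by rw [e1 _ (by norm_num)]
  obtain ⟨H, hH⟩ : ∃ H, H = h' + h' := ⟨_, rfl⟩
  have hP : PieceExt s s₁ := PieceExt.of_eq fun x hx _ _ => ⟨e1 x (by omega), rfl⟩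
  have Pj := T.params j lj
  have Pk := T.params k lk
  have nj := T.len_pos j lj
  have nk := T.len_pos k lk
  have h₀ : NodesInv s len off N cut side h' H i j k s₁
      ⟨0, 0, chLo s (off j) 0, chLo s (off k) 0⟩ 0 := by
    refine ⟨agree_setNat (Or.inr le_rfl), TripleExt.of_eq fun x _ _ => e1 x (by omega),
      hok.of_eq fun x _ _ => e1 x (by omega), hP, fun _ => eO, fun h0 => ?_, by omega,
      fun d' hd => by omega⟩
    rw [eO]
    have w1 := Pj.lo_lt_hi 0 le_rfl nj
    have w2 := Pk.lo_lt_hi 0 le_rfl nk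
    exact ⟨(hcur h0).ext hP le_rfl, w1.trans_le (Pj.hi_le 0 le_rfl nj),
      w2.trans_le (Pk.hi_le 0 le_rfl nk), w1, w2, Or.inr ⟨rfl, rfl⟩, Or.inr ⟨rfl, rfl⟩, le_rfl⟩
  set K := 12 * s.nat vLog 0 + 62 with hK
  refine (runs_loop (fun t s' => ∃ c d, d ≤ N ∧ NodesInv s len off N cut side h' H i j k s' c d ∧
    s'.nat vBase 0 = H * d ∧ t + 9 * s.nat vTrip 0 + 11 * s.nat vOut 0 ≤
      9 * s'.nat vTrip 0 + 11 * s'.nat vOut 0 + K * (cut j (min (H * d) N) +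
        cut k (min (H * d) N) + d) + d) (fun s' => N - s'.nat vBase 0) ?_ ?_).mono ?_
  · refine ⟨_, 0, by omega, h₀, by simp [hs₁], by omega⟩
  · rintro t s₂ - ⟨c, d, h1, h2, h3, h4⟩ hb
    have hN : s₂.nat vLeaves 0 = N := by
      rw [(h2.agree _ (by norm_num) (by norm_num)).1, T.hleaves]
    have hb' : H * d < N := by simpa [h3, hN] using hb
    refine (node_spec hH hhalf hsd T R h2 h3 hb').mono ?_
    rintro t' s₃ - ⟨g1, ⟨c', g2⟩, g3⟩
    rw [← hK] at g3
    have eH : H * (d + 1) = H * d + H := by ring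
    have hd : d ≤ H * d := Nat.le_mul_of_pos_left d (by omega)
    refine ⟨⟨c', d + 1, by omega, g2, g1, ?_⟩, by omega⟩
    obtain ⟨A, hA⟩ : ∃ A, A = cut j (min (H * d) N) + cut k (min (H * d) N) := ⟨_, rfl⟩
    obtain ⟨B, hB⟩ : ∃ B, B = cut j (min (H * (d + 1)) N) + cut k (min (H * (d + 1)) N) := ⟨_, rfl⟩
    rw [← hA] at h4
    rw [← hA, ← hB] at g3
    rw [← hB]
    have q1 : K * (B + 1) = K * B + K := by ring
    have q2 : K * (A + d) = K * A + K * d := by ring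
    have q3 : K * (B + (d + 1)) = K * B + K * d + K := by ring
    omega
  · rintro t s₂ - ⟨t', rfl, ⟨c, d, h1, h2, h3, h4⟩, hb⟩
    have hN : s₂.nat vLeaves 0 = N := by
      rw [(h2.agree _ (by norm_num) (by norm_num)).1, T.hleaves]
    have hb' : N ≤ H * d := by simpa [h3, hN] using hb
    have hm : min (H * d) N = N := min_eq_right hb'
    have hc := h2.cur
    have hcnt := h2.count
    simp only [hm, T.cut_last i li, T.cut_last j lj, T.cut_last k lk] at h4 hc hcnt
    refine ⟨?_, c, h2.agree, h2.text, h2.tok, h2.pext, h2.out_eq, fun h0 => ?_, hcnt, ?_⟩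
    · have q1 : K * (len j + len k + d) ≤ K * (len j + len k + N) :=
        Nat.mul_le_mul_left _ (by omega)
      have q2 : (12 * s.nat vLog 0 + 63) * (len j + len k + N) =
        K * (len j + len k + N) + (len j + len k + N) := by rw [hK]; ring
      omega
    · obtain ⟨g1, g2, g3, g4, g5, g6, g7, g8⟩ := hc h0
      exact ⟨g1, g2, g3, g4, g5, by omega, by omega, g8⟩
    · intro d' hd'
      rw [← hH] at hd' ⊢
      exact h2.cover d' (Nat.lt_of_mul_lt_mul_left (hd'.trans_le hb'))

/-! ## A choice of roles for the arcs -/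

/-- Prepares the treatment of a level for a choice of roles. -/
def caseStart : Prog :=
  nset vOi (.load aOff (nv vI)) ;;
  nset vOj (.load aOff (nv vJ)) ;;
  .ite (.realLt 0 (.load aSign (nv vJ) * .load aSign (nv vK)))
    (nset vRev 1 ;; nset vOk (.load aOff (nv vK + 2 + 1)))
    (nset vRev 0 ;; nset vOk (.load aOff (nv vK)) ;;
      nset vStart (nv vOut) ;;
      .setNat aLE (nv vOut) 0 ;; .setReal aLlo (nv vOut) (.load aLo (nv vOj)) ;;
      .setNat aRE (nv vOut) 0 ;; .setReal aRlo (nv vOut) (.load aLo (nv vOk)))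

/-- Enters the current pairing into a table. -/
def register (b : ℕ) : Prog :=
  .setNat (b + 1) (nv b) (nv vOut - nv vStart) ;; .setNat (b + 2) (nv b) (nv vStart) ;;
    nset b (nv b + 1)

/-- Completes the current pairing. -/
def caseFinish : Prog :=
  nset vA (.load aLen (nv vJ) - 1) ;; nset vB (.load aLen (nv vK) - 1) ;;
  nset vNA (nv vA) ;; nset vNB (nv vB) ;;
  rset rT (.load aHi (nv vOj + nv vA)) ;; rset rU (.load aHi (nv vOk + nv vB)) ;;
  rset rNT (rv rT) ;; rset rNU (rv rU) ;;
  connect ;;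
  .ite (.natLt (nv vI) 1) (register 20) (.ite (.natLt (nv vI) 2) (register 30) (register 10))

/-- Treats a level for a choice of roles. -/
def runCase : Prog :=
  caseStart ;; nodes ;; .ite (.natLt 0 (nv vRev)) .skip caseFinish

theorem caseStart_spec {s : Store} {len off : ℕ → ℕ} {N : ℕ} {cut : ℕ → ℕ → ℕ} {eps : ℕ → ℝ}
    {θ : ℕ → ℕ → ℝ} {i j k : ℕ} (T : Tables s len off N cut eps θ) (hR : IsRoles i j k)
    (hi : s.nat vI 0 = i) (hj : s.nat vJ 0 = j) (hk : s.nat vK 0 = k) :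
    Runs caseStart s fun t s' => t ≤ 10 ∧ RoleVars s' off eps i j k ∧ Agree 300 s s' ∧
      (∀ x, x < 200 → x ≠ aLE → x ≠ aRE → s'.nat x = s.nat x) ∧
      (∀ r < s.nat vOut 0, PieceEq s s' r) ∧
      (s'.nat vRev 0 = 0 → s'.nat vStart 0 = s.nat vOut 0 ∧
        CurAt s' (s.nat vOut 0) 0 (chLo s (off j) 0) 0 (chLo s (off k) 0)) := by
  obtain ⟨li, lj, lk⟩ := hR.lt
  have o1 := T.hoff i (by omega)
  have o2 := T.hoff j (by omega)
  have o3 := T.hoff k (by omega)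
  have o4 := T.hoff (k + 3) (by omega)
  refine runs_seq (runs_setNat (runs_seq (runs_setNat (runs_ite (fun h => ?_) (fun h => ?_)))))
  · have h' : 0 < eps j * eps k := by
      simpa [hj, hk, T.hsign j lj, T.hsign k lk] using h
    have h1 : eps j * eps k = 1 := by
      rcases T.eps_eq j lj with e | e <;> rcases T.eps_eq k lk with e' | e' <;>
        simp [e, e'] at h' ⊢ <;> linarith
    refine runs_seq (runs_setNat (runs_setNat ⟨by norm_num, ⟨hR, ?_, ?_, ?_, ?_, ?_, ?_, ?_⟩, ?_,
      ?_, ?_, ?_⟩))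
    · simp [hi]
    · simp [hj]
    · simp [hk]
    · simp [hi, o1]
    · simp [hj, o2]
    · simp [h1]
    · simp [hk, o4, add_assoc]
    · refine ((agree_setNat ?_).trans (agree_setNat ?_)).trans
        ((agree_setNat ?_).trans (agree_setNat ?_)) <;> norm_num
    · intro x hx _ _
      rw [setNat_nat_of_ne (by omega), setNat_nat_of_ne (by omega), setNat_nat_of_ne (by omega),
        setNat_nat_of_ne (by omega)]
    · intro r _
      constructor <;> simp
    · simp
  · have h' : ¬ 0 < eps j * eps k := by
      simpa [hj, hk, T.hsign j lj, T.hsign k lk] using h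
    have h1 : ¬ eps j * eps k = 1 := fun e => h' (by rw [e]; norm_num)
    refine runs_seq (runs_setNat (runs_seq (runs_setNat (runs_seq (runs_setNat (runs_seq
      (runs_setNat (runs_seq (runs_setReal (runs_seq (runs_setNat (runs_setReal
        ⟨by norm_num, ⟨hR, ?_, ?_, ?_, ?_, ?_, ?_, ?_⟩, ?_, ?_, ?_, ?_⟩))))))))))))
    · simp [hi]
    · simp [hj]
    · simp [hk]
    · simp [hi, o1]
    · simp [hj, o2]
    · simp [h1]
    · simp [hk, o3]
    · intro x h1 h2
      constructor
      · funext r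
        simp only [Store.setReal_nat, Store.setNat_nat]
        repeat rw [if_neg (by omega)]
      · funext r
        simp only [Store.setReal_real, Store.setNat_real]
        repeat rw [if_neg (by omega)]
    · intro x hx h1 h2
      funext r
      simp only [Store.setReal_nat, Store.setNat_nat]
      repeat rw [if_neg (by omega)]
    · intro r hr
      have : r ≠ s.nat vOut 0 := by omega
      constructor <;> simp [this]
    · intro _
      refine ⟨by simp, ?_, ?_, ?_, ?_⟩
      · simp
      · simp [chLo, hj, o2]
      · simp
      · simp [chLo, hk, o3]

/-- The second chain when chain `i` is the first one. -/
def roleJ (i : ℕ) : ℕ := if i = 0 then 1 else 0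
/-- The third chain when chain `i` is the first one. -/
def roleK (i : ℕ) : ℕ := if i = 2 then 1 else 2
/-- The table for the pairings of the second and the third chain. -/
def tab (i : ℕ) : ℕ := if i = 0 then 20 else if i = 1 then 30 else 10

theorem isRoles_role {i : ℕ} (hi : i < 3) : IsRoles i (roleJ i) (roleK i) := by
  unfold IsRoles roleJ roleK
  interval_cases i <;> simp

/-- The pieces from position `x` on, `w` in number, form a pairing of two chains. -/
structure PairAt (S s : Store) (len off : ℕ → ℕ) (j k x w : ℕ) : Prop where
  pos : 0 < w
  le : w ≤ len j + len k
  out : x + w ≤ s.nat vOut 0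
  start : CurAt s x 0 (chLo S (off j) 0) 0 (chLo S (off k) 0)
  last_left : s.nat aLE (x + (w - 1)) = len j - 1 ∧
    s.real aLhi (x + (w - 1)) = chHi S (off j) (len j - 1)
  last_right : s.nat aRE (x + (w - 1)) = len k - 1 ∧
    s.real aRhi (x + (w - 1)) = chHi S (off k) (len k - 1)
  lt : ∀ r, x ≤ r → r < x + w → s.real aLlo r < s.real aLhi r ∧ s.real aRlo r < s.real aRhi r
  next : ∀ r, x ≤ r → r + 1 < x + w →
    Follows (s.nat aLE r) (s.real aLhi r) (s.nat aLE (r + 1)) (s.real aLlo (r + 1)) ∧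
    Follows (s.nat aRE r) (s.real aRhi r) (s.nat aRE (r + 1)) (s.real aRlo (r + 1))

/-- The memory has only been extended. -/
structure Grow (s s' : Store) : Prop where
  text : TripleExt s s'
  out : s.nat vOut 0 ≤ s'.nat vOut 0
  old : ∀ r < s.nat vOut 0, PieceEq s s' r
  num : ∀ i < 3, s.nat (tab i) 0 ≤ s'.nat (tab i) 0
  entry : ∀ i < 3, ∀ r < s.nat (tab i) 0, s'.nat (tab i + 1) r = s.nat (tab i + 1) r ∧
    s'.nat (tab i + 2) r = s.nat (tab i + 2) r

theorem Grow.trans {s s' s'' : Store} (h : Grow s s') (h' : Grow s' s'') : Grow s s'' :=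
  ⟨h.text.trans h'.text, h.out.trans h'.out,
    fun r hr => (h.old r hr).trans (h'.old r (hr.trans_le h.out)),
    fun i hi => (h.num i hi).trans (h'.num i hi), fun i hi r hr => by
      obtain ⟨g1, g2⟩ := h.entry i hi r hr
      obtain ⟨g3, g4⟩ := h'.entry i hi r (hr.trans_le (h.num i hi))
      exact ⟨g3.trans g1, g4.trans g2⟩⟩

theorem Grow.of_eq {s s' : Store} (hn : ∀ x, x < 200 → s'.nat x = s.nat x)
    (hr : ∀ x, x < 200 → s'.real x = s.real x) : Grow s s' := by
  have hP : PieceExt s s' := PieceExt.of_eq fun x hx _ _ => ⟨hn x hx, hr x hx⟩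
  have ht : ∀ i < 3, tab i ≤ 30 := by
    intro i hi
    interval_cases i <;> simp [tab]
  refine ⟨TripleExt.of_eq fun x _ _ => hn x (by omega), hP.le, hP.old, fun i hi => ?_,
    fun i hi r _ => ?_⟩
  · rw [hn (tab i) (by have := ht i hi; omega)]
  · have := ht i hi
    rw [hn _ (by omega), hn _ (by omega)]
    exact ⟨rfl, rfl⟩

theorem PairAt.congr {S s s' : Store} {len off : ℕ → ℕ} {j k x w : ℕ}
    (h : PairAt S s len off j k x w) (hE : ∀ r, x ≤ r → r < x + w → PieceEq s s' r)
    (ho : x + w ≤ s'.nat vOut 0) : PairAt S s' len off j k x w := by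
  have h0 := h.pos
  have e0 := hE x le_rfl (by omega)
  have e1 := hE (x + (w - 1)) (by omega) (by omega)
  refine ⟨h.pos, h.le, ho, ⟨?_, ?_, ?_, ?_⟩, ?_, ?_, ?_, ?_⟩
  · rw [e0.edgeL, h.start.edgeL]
  · rw [e0.loL, h.start.loL]
  · rw [e0.edgeR, h.start.edgeR]
  · rw [e0.loR, h.start.loR]
  · rw [e1.edgeL, e1.hiL]; exact h.last_left
  · rw [e1.edgeR, e1.hiR]; exact h.last_right
  · intro r h1 h2
    have e := hE r h1 h2
    rw [e.loL, e.hiL, e.loR, e.hiR]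
    exact h.lt r h1 h2
  · intro r h1 h2
    have e := hE r h1 (by omega)
    have e' := hE (r + 1) (by omega) h2
    rw [e.edgeL, e.hiL, e.edgeR, e.hiR, e'.edgeL, e'.loL, e'.edgeR, e'.loR]
    exact h.next r h1 h2

/-- All pairings in the table for chain `i` are valid. -/
def TabOk (S s : Store) (len off : ℕ → ℕ) (i : ℕ) : Prop :=
  ∀ r < s.nat (tab i) 0,
    PairAt S s len off (roleJ i) (roleK i) (s.nat (tab i + 2) r) (s.nat (tab i + 1) r)

/-- A pairing in the table for chain `i` covers the points. -/
def CovPair (S s : Store) (off : ℕ → ℕ) (i : ℕ) (z : ℕ → ℂ) : Prop :=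
  ∃ r < s.nat (tab i) 0, PiecesCover S s (s.nat (tab i + 2) r)
    (s.nat (tab i + 2) r + s.nat (tab i + 1) r) (off (roleJ i)) (off (roleK i)) (z (roleJ i))
    (z (roleK i))

/-- The points are covered by a triple or by a pairing. -/
def CovAll (S s : Store) (len off : ℕ → ℕ) (z : ℕ → ℂ) : Prop :=
  CovT S s len off z ∨ ∃ i < 3, CovPair S s off i z

/-- The output so far is valid. -/
structure OutOk (S s : Store) (len off : ℕ → ℕ) : Prop where
  tok : TripleOk len s
  tabs : ∀ i < 3, TabOk S s len off i

theorem CovAll.grow {S s s' : Store} {len off : ℕ → ℕ} {z : ℕ → ℂ} (h : CovAll S s len off z)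
    (hO : OutOk S s len off) (h' : Grow s s') : CovAll S s' len off z := by
  rcases h with h | ⟨i, hi, r, hr, h⟩
  · exact Or.inl (h.ext h'.text)
  · obtain ⟨e1, e2⟩ := h'.entry i hi r hr
    refine Or.inr ⟨i, hi, r, hr.trans_le (h'.num i hi), ?_⟩
    rw [e1, e2]
    have := (hO.tabs i hi r hr).out
    exact h.ext (fun x _ hx => h'.old x (by omega)) le_rfl

/-- The outcome of the treatment of a level for a choice of roles. -/
structure CaseDone (S s : Store) (len off : ℕ → ℕ) (N : ℕ) (cut : ℕ → ℕ → ℕ) (side h' i j k : ℕ)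
    (s' : Store) : Prop where
  agree : Agree 300 s s'
  grow : Grow s s'
  ok : OutOk S s' len off
  count : s'.nat vTrip 0 ≤ s.nat vTrip 0 + 4 * len i + len j + len k
  out : s'.nat vOut 0 ≤ s.nat vOut 0 + len j + len k
  num : s'.nat 10 0 + s'.nat 20 0 + s'.nat 30 0 ≤ s.nat 10 0 + s.nat 20 0 + s.nat 30 0 + 1
  cover : ∀ d, (h' + h') * d < N → ∀ x x' y y', NodeLeaves side h' ((h' + h') * d) N x x' y y' →
    ∀ z : ℕ → ℂ, z 0 + z 1 + z 2 = 0 → ∀ mi mj mk qi qj qk,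
      RepAt S (off i) (cut i x) (cut i x') (z i) mi qi →
      RepAt S (off j) (cut j y) (cut j y') (z j) mj qj →
      RepAt S (off k) (cut k y) (cut k y') (z k) mk qk → CovAll S s' len off z

theorem register_spec {s : Store} {b : ℕ} (hb : b < 40) :
    Runs (register b) s fun t s' => t = 3 ∧ s'.real = s.real ∧ s'.nat b 0 = s.nat b 0 + 1 ∧
      s'.nat (b + 1) (s.nat b 0) = s.nat vOut 0 - s.nat vStart 0 ∧
      s'.nat (b + 2) (s.nat b 0) = s.nat vStart 0 ∧
      (∀ r < s.nat b 0, s'.nat (b + 1) r = s.nat (b + 1) r ∧ s'.nat (b + 2) r = s.nat (b + 2) r) ∧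
      ∀ x, x ≠ b → x ≠ b + 1 → x ≠ b + 2 → s'.nat x = s.nat x := by
  refine runs_seq (runs_setNat (runs_seq (runs_setNat (runs_setNat ⟨rfl, rfl, ?_, ?_, ?_, ?_, ?_⟩))))
  · simp
  · simp
  · have : ¬ (306 = b + 1) := by omega
    simp [this]
  · intro r hr
    have : r ≠ s.nat b 0 := by omega
    simp [this]
  · intro x h1 h2 h3
    rw [setNat_nat_of_ne h1, setNat_nat_of_ne h3, setNat_nat_of_ne h2]

theorem caseFinish_spec {s : Store} {len off : ℕ → ℕ} {N : ℕ} {cut : ℕ → ℕ → ℕ} {eps : ℕ → ℝ}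
    {θ : ℕ → ℕ → ℝ} {i j k x : ℕ} {c : Cur} (T : Tables s len off N cut eps θ)
    (R : RoleVars s off eps i j k) (hrev : s.nat vRev 0 = 0) (hstart : s.nat vStart 0 = x)
    (hx : CurAt s x 0 (chLo s (off j) 0) 0 (chLo s (off k) 0)) (hx' : x ≤ s.nat vOut 0)
    (hsteps : PieceSteps s x (s.nat vOut 0)) (hc : CurAt s (s.nat vOut 0) c.a c.t c.b c.u)
    (ht : c.t < 1) (hu : c.u < 1) (ht' : c.t < chHi s (off j) c.a) (hu' : c.u < chHi s (off k) c.b)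
    (ha : c.a < len j) (hb : c.b < len k) (hout : s.nat vOut 0 ≤ x + c.a + c.b)
    (hok : ∀ i < 3, TabOk s s len off i) (htok : TripleOk len s) :
    Runs caseFinish s fun t s' => t + 11 * s.nat vOut 0 ≤ 11 * s'.nat vOut 0 + 13 ∧
      Agree 300 s s' ∧ Grow s s' ∧ TripleOk len s' ∧ (∀ i < 3, TabOk s s' len off i) ∧
      s'.nat vTrip 0 = s.nat vTrip 0 ∧
      s'.nat vOut 0 ≤ x + len j + len k ∧
      s'.nat 10 0 + s'.nat 20 0 + s'.nat 30 0 ≤ s.nat 10 0 + s.nat 20 0 + s.nat 30 0 + 1 ∧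
      ∃ r < s'.nat (tab i) 0, s'.nat (tab i + 2) r = x ∧ s'.nat (tab i + 1) r = s'.nat vOut 0 - x := by
  obtain ⟨li, lj, lk⟩ := R.roles.lt
  have hkk : s.nat vOk 0 = off k := by rw [R.hok, hrev]; simp
  have l1 := T.hlen j lj
  have l2 := T.hlen k lk
  refine runs_seq (runs_setNat (runs_seq (runs_setNat (runs_seq (runs_setNat (runs_seq
    (runs_setNat (runs_seq (runs_setReal (runs_seq (runs_setReal (runs_seq (runs_setReal
      (runs_seq (runs_setReal ?_)))))))))))))))
  set s₁ := Store.setReal _ rNU _ _ with hs₁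
  have n1 : ∀ y, y < 500 → s₁.nat y = s.nat y := by
    intro y hy
    funext r
    simp only [hs₁, Store.setReal_nat, Store.setNat_nat]
    repeat rw [if_neg (by omega)]
  have n2 : ∀ y, y < 500 → s₁.real y = s.real y := by
    intro y hy
    funext r
    simp only [hs₁, Store.setReal_real, Store.setNat_real]
    repeat rw [if_neg (by omega)]
  have v1 : s₁.nat vA 0 = len j - 1 := by simp [hs₁, R.hj, l1]
  have v2 : s₁.nat vB 0 = len k - 1 := by simp [hs₁, R.hk, l2]
  have v3 : s₁.nat vNA 0 = len j - 1 := by simp [hs₁, R.hj, l1]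
  have v4 : s₁.nat vNB 0 = len k - 1 := by simp [hs₁, R.hk, l2]
  have v5 : s₁.real rT 0 = chHi s (off j) (len j - 1) := by
    simp [hs₁, R.hj, l1, chHi, R.hoj]
  have v6 : s₁.real rU 0 = chHi s (off k) (len k - 1) := by
    simp [hs₁, R.hk, l2, chHi, hkk]
  have v7 : s₁.real rNT 0 = chHi s (off j) (len j - 1) := by
    simp [hs₁, R.hj, l1, chHi, R.hoj]
  have v8 : s₁.real rNU 0 = chHi s (off k) (len k - 1) := by
    simp [hs₁, R.hk, l2, chHi, hkk]
  have eO : s₁.nat vOut 0 = s.nat vOut 0 := by rw [n1 _ (by norm_num)]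
  have hP₁ : PieceExt s s₁ :=
    PieceExt.of_eq fun y hy _ _ => ⟨n1 y (by omega), n2 y (by omega)⟩
  have Pj := T.params j lj
  have Pk := T.params k lk
  have w1 := Pj.lo_nonneg (len j - 1) (by omega) (by omega)
  have w2 := Pj.lo_lt_hi (len j - 1) (by omega) (by omega)
  have w3 := Pk.lo_nonneg (len k - 1) (by omega) (by omega)
  have w4 := Pk.lo_lt_hi (len k - 1) (by omega) (by omega)
  refine (connect_spec s₁ (x := s.nat vOut 0) eO (hc.ext hP₁ le_rfl) v1 v2 v3 v4 v5 v6 v7 v8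
    (by omega) (by omega) (fun e => e ▸ ht') (fun e => e ▸ hu') (fun _ => ht) (fun _ => hu)
    (by linarith) (by linarith) (Or.inl ⟨rfl, rfl⟩) (Or.inl ⟨rfl, rfl⟩)).seq ?_
  rintro t s₂ hF ⟨g1, g2, g3, g4, g5, g6, g7, g8⟩
  have hP₂ : PieceExt s s₂ := hP₁.trans g3
  have hw : ∀ y < 500, y ≠ aLE → y ≠ aRE → y ≠ vOut → Prog.writesNat connect y = false := by
    set_option maxRecDepth 20000 in decide
  have m1 : ∀ y < 500, y ≠ aLE → y ≠ aRE → y ≠ vOut → s₂.nat y = s.nat y := by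
    intro y hy h1 h2 h3
    rw [hF.1 y (hw y hy h1 h2 h3), n1 y hy]
  have hA₂ : Agree 300 s s₂ := fun y h1 h2 => ⟨m1 y (by omega) (by omega) (by omega) (by omega), by
    rw [((hF.agree 300 (by decide)) y h1 h2).2, n2 y (by omega)]⟩
  have hbe : s₂.nat vStart 0 = x := by
    rw [m1 _ (by norm_num) (by norm_num) (by norm_num) (by norm_num), hstart]
  have ho₂ : s₂.nat vOut 0 ≤ x + len j + len k ∧ x + 1 ≤ s₂.nat vOut 0 := by omega
  have hsteps₂ : PieceSteps s₂ x (s₂.nat vOut 0) := by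
    intro r h1 h2
    rcases lt_or_ge r (s.nat vOut 0) with h3 | h3
    · exact hsteps.ext hP₂ le_rfl r h1 h3
    · exact hP₂.steps r h3 h2
  have hpair : PairAt s s₂ len off j k x (s₂.nat vOut 0 - x) := by
    have e : x + (s₂.nat vOut 0 - x - 1) =
        s.nat vOut 0 + (len j - 1 - c.a + (len k - 1 - c.b)) := by omega
    refine ⟨by omega, by omega, by omega, hx.ext hP₂ hx', ?_, ?_, ?_, ?_⟩
    · rw [e]; exact ⟨g5, g6⟩
    · rw [e]; exact ⟨g7, g8⟩
    · intro r h1 h2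
      obtain ⟨q1, q2, -⟩ := hsteps₂ r h1 (by omega)
      exact ⟨q1, q2⟩
    · intro r h1 h2
      obtain ⟨-, -, q3, q4⟩ := hsteps₂ r h1 (by omega)
      exact ⟨q3, q4⟩
  have htab : ∀ i' < 3, tab i' = 20 ∧ i' = 0 ∨ tab i' = 30 ∧ i' = 1 ∨ tab i' = 10 ∧ i' = 2 := by
    intro i' hi'
    interval_cases i' <;> simp [tab]
  have key : ∀ t' (s₃ : Store), s₃.real = s₂.real ∧ s₃.nat (tab i) 0 = s₂.nat (tab i) 0 + 1 ∧
      s₃.nat (tab i + 1) (s₂.nat (tab i) 0) = s₂.nat vOut 0 - s₂.nat vStart 0 ∧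
      s₃.nat (tab i + 2) (s₂.nat (tab i) 0) = s₂.nat vStart 0 ∧
      (∀ r < s₂.nat (tab i) 0, s₃.nat (tab i + 1) r = s₂.nat (tab i + 1) r ∧
        s₃.nat (tab i + 2) r = s₂.nat (tab i + 2) r) ∧
      (∀ x, x ≠ tab i → x ≠ tab i + 1 → x ≠ tab i + 2 → s₃.nat x = s₂.nat x) → t' ≤ 5 →
      (8 + t + t') + 11 * s.nat vOut 0 ≤ 11 * s₃.nat vOut 0 + 13 ∧
      Agree 300 s s₃ ∧ Grow s s₃ ∧ TripleOk len s₃ ∧ (∀ i < 3, TabOk s s₃ len off i) ∧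
      s₃.nat vTrip 0 = s.nat vTrip 0 ∧
      s₃.nat vOut 0 ≤ x + len j + len k ∧
      s₃.nat 10 0 + s₃.nat 20 0 + s₃.nat 30 0 ≤ s.nat 10 0 + s.nat 20 0 + s.nat 30 0 + 1 ∧
      ∃ r < s₃.nat (tab i) 0, s₃.nat (tab i + 2) r = x ∧ s₃.nat (tab i + 1) r = s₃.nat vOut 0 - x := by
    rintro t' s₃ ⟨k1, k2, k3, k4, k5, k6⟩ ht'
    have hti := htab i li
    have ho₃ : s₃.nat vOut 0 = s₂.nat vOut 0 := by rw [k6 vOut] <;> omega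
    have hP₃ : ∀ r, PieceEq s₂ s₃ r := by
      intro r
      have a1 : s₃.nat aLE = s₂.nat aLE := by rw [k6 aLE] <;> omega
      have a2 : s₃.nat aRE = s₂.nat aRE := by rw [k6 aRE] <;> omega
      constructor <;> simp only [a1, a2, k1]
    have hT₃ : ∀ y, 40 ≤ y → y ≤ 43 → s₃.nat y = s.nat y := by
      intro y h1 h2
      rw [k6 y (by omega) (by omega) (by omega), m1 y (by omega) (by omega) (by omega) (by omega)]
    have hgrow : Grow s s₃ := by
      refine ⟨TripleExt.of_eq hT₃, ?_, fun r hr => (hP₂.old r hr).trans (hP₃ r), ?_, ?_⟩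
      · have := hP₂.le
        omega
      · intro i' hi'
        have := htab i' hi'
        rw [← m1 (tab i') (by omega) (by omega) (by omega) (by omega)]
        by_cases e : i' = i
        · subst e
          omega
        · rw [k6 (tab i') (by omega) (by omega) (by omega)]
      · intro i' hi' r hr
        have := htab i' hi'
        rw [← m1 (tab i') (by omega) (by omega) (by omega) (by omega)] at hr
        rw [← m1 (tab i' + 1) (by omega) (by omega) (by omega) (by omega),
          ← m1 (tab i' + 2) (by omega) (by omega) (by omega) (by omega)]
        by_cases e : i' = i
        · subst e
          exact k5 r hr
        · rw [k6 (tab i' + 1) (by omega) (by omega) (by omega),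
            k6 (tab i' + 2) (by omega) (by omega) (by omega)]
          exact ⟨rfl, rfl⟩
    refine ⟨by omega, ?_, hgrow, htok.of_eq hT₃, ?_, by rw [hT₃ _ (by norm_num) (by norm_num)],
      by omega, ?_, s₂.nat (tab i) 0, by omega, by rw [k4, hbe], by rw [k3, hbe, ho₃]⟩
    · exact hA₂.trans fun y h1 h2 => ⟨k6 y (by omega) (by omega) (by omega), by rw [k1]⟩
    · intro i' hi' r hr
      have hti' := htab i' hi'
      by_cases hr' : r < s.nat (tab i') 0
      · obtain ⟨q1, q2⟩ := hgrow.entry i' hi' r hr'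
        rw [q1, q2]
        have := hok i' hi' r hr'
        have ho := this.out
        exact this.congr (fun y _ hy => hgrow.old y (by omega)) (ho.trans hgrow.out)
      · have e : i' = i := by
          by_contra e
          rw [k6 (tab i') (by omega) (by omega) (by omega),
            m1 (tab i') (by omega) (by omega) (by omega) (by omega)] at hr
          omega
        subst e
        rw [k2, m1 (tab i') (by omega) (by omega) (by omega) (by omega)] at hr
        have e : r = s₂.nat (tab i') 0 := by
          rw [m1 (tab i') (by omega) (by omega) (by omega) (by omega)]
          omega
        rw [e, k3, k4, hbe]
        have hjk : roleJ i' = j ∧ roleK i' = k := by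
          rcases R.roles with ⟨e1, e2, e3⟩ | ⟨e1, e2, e3⟩ | ⟨e1, e2, e3⟩ <;>
            simp [roleJ, roleK, e1, e2, e3]
        rw [hjk.1, hjk.2]
        exact hpair.congr (fun y _ _ => hP₃ y) (by have := hpair.out; omega)
    · have q10 := m1 10 (by norm_num) (by norm_num) (by norm_num) (by norm_num)
      have q20 := m1 20 (by norm_num) (by norm_num) (by norm_num) (by norm_num)
      have q30 := m1 30 (by norm_num) (by norm_num) (by norm_num) (by norm_num)
      rw [← q10, ← q20, ← q30]
      rcases hti with ⟨e, -⟩ | ⟨e, -⟩ | ⟨e, -⟩ <;> rw [e] at k2 k6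
      · rw [k6 10 (by norm_num) (by norm_num) (by norm_num),
          k6 30 (by norm_num) (by norm_num) (by norm_num)]
        omega
      · rw [k6 10 (by norm_num) (by norm_num) (by norm_num),
          k6 20 (by norm_num) (by norm_num) (by norm_num)]
        omega
      · rw [k6 20 (by norm_num) (by norm_num) (by norm_num),
          k6 30 (by norm_num) (by norm_num) (by norm_num)]
        omega
  have eI : s₂.nat vI 0 = i := by
    rw [m1 _ (by norm_num) (by norm_num) (by norm_num) (by norm_num), R.hi]
  have fin : ∀ t' (s₃ : Store), (8 + t + t') = 1 + (1 + (1 + (1 + (1 + (1 + (1 + (1 + (t + t')))))))) :=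
    fun t' s₃ => by omega
  refine runs_ite (fun h => ?_) (fun h => runs_ite (fun h' => ?_) (fun h' => ?_))
  · have hi0 : s₂.nat vI 0 < 1 := h
    have e : tab i = 20 := by rw [show i = 0 by omega]; rfl
    refine (register_spec (by norm_num)).mono ?_
    rintro t' s₃ - ⟨ht3, hrest⟩
    have := key (t' + 1) s₃ (by rw [e]; exact hrest) (by omega)
    rw [fin _ s₃] at this
    exact this
  · have hi0 : ¬ s₂.nat vI 0 < 1 := h
    have hi1 : s₂.nat vI 0 < 2 := h'
    have e : tab i = 30 := by rw [show i = 1 by omega]; rfl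
    refine (register_spec (by norm_num)).mono ?_
    rintro t' s₃ - ⟨ht3, hrest⟩
    have := key (t' + 1 + 1) s₃ (by rw [e]; exact hrest) (by omega)
    rw [fin _ s₃] at this
    exact this
  · have hi0 : ¬ s₂.nat vI 0 < 1 := h
    have hi1 : ¬ s₂.nat vI 0 < 2 := h'
    have e : tab i = 10 := by rw [show i = 2 by omega]; rfl
    refine (register_spec (by norm_num)).mono ?_
    rintro t' s₃ - ⟨ht3, hrest⟩
    have := key (t' + 1 + 1) s₃ (by rw [e]; exact hrest) (by omega)
    rw [fin _ s₃] at this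
    exact this

theorem IsRoles.role {i j k : ℕ} (h : IsRoles i j k) : roleJ i = j ∧ roleK i = k := by
  rcases h with ⟨e1, e2, e3⟩ | ⟨e1, e2, e3⟩ | ⟨e1, e2, e3⟩ <;> simp [roleJ, roleK, e1, e2, e3]

theorem PairAt.congr_left {S S' s : Store} {N : ℕ} (hA : Agree N S S') (hN : 300 ≤ N)
    {len off : ℕ → ℕ} {j k x w : ℕ} :
    PairAt S' s len off j k x w ↔ PairAt S s len off j k x w := by
  constructor <;> rintro ⟨h1, h2, h3, h4, h5, h6, h7, h8⟩
  · simp only [chLo_congr hA hN, chHi_congr hA hN] at h4 h5 h6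
    exact ⟨h1, h2, h3, h4, h5, h6, h7, h8⟩
  · refine ⟨h1, h2, h3, ?_, ?_, ?_, h7, h8⟩ <;>
      simpa only [chLo_congr hA hN, chHi_congr hA hN]

theorem TabOk.congr_left {S S' s : Store} {N : ℕ} (hA : Agree N S S') (hN : 300 ≤ N)
    {len off : ℕ → ℕ} {i : ℕ} : TabOk S' s len off i ↔ TabOk S s len off i := by
  simp only [TabOk, PairAt.congr_left hA hN]

theorem TabOk.ext {S s s' : Store} {len off : ℕ → ℕ} {i : ℕ} (h : TabOk S s len off i)
    (e0 : s'.nat (tab i) = s.nat (tab i)) (e1 : s'.nat (tab i + 1) = s.nat (tab i + 1))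
    (e2 : s'.nat (tab i + 2) = s.nat (tab i + 2)) (ho : s.nat vOut 0 ≤ s'.nat vOut 0)
    (hold : ∀ r < s.nat vOut 0, PieceEq s s' r) : TabOk S s' len off i := by
  intro r hr
  rw [e0] at hr
  rw [e1, e2]
  have := h r hr
  have ho' := this.out
  exact this.congr (fun r _ hr' => hold r (by omega)) (ho'.trans ho)

theorem nodes_keeps : ∀ x < 40, x ≠ aLE → x ≠ aRE → x ≠ vOut → x ≠ aRole →
    Prog.writesNat nodes x = false := by
  set_option maxRecDepth 20000 in decide

theorem tab_lt {i : ℕ} (hi : i < 3) : tab i = 20 ∨ tab i = 30 ∨ tab i = 10 := by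
  interval_cases i <;> simp [tab]

theorem runCase_spec {S s : Store} {len off : ℕ → ℕ} {N : ℕ} {cut : ℕ → ℕ → ℕ} {eps : ℕ → ℝ}
    {θ : ℕ → ℕ → ℝ} {side h' i j k : ℕ} (T : Tables S len off N cut eps θ) (hS : Agree 300 S s)
    (hO : OutOk S s len off) (hR : IsRoles i j k)
    (hi : s.nat vI 0 = i) (hj : s.nat vJ 0 = j) (hk : s.nat vK 0 = k) (hhalf : s.nat vHalf 0 = h')
    (hsd : s.nat vSide 0 = side) (hpos : 1 ≤ h') :
    Runs runCase s fun t s' => t + 9 * s.nat vTrip 0 + 11 * s.nat vOut 0 ≤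
      9 * s'.nat vTrip 0 + 11 * s'.nat vOut 0 +
        (12 * S.nat vLog 0 + 63) * (len j + len k + N) + 26 ∧
      CaseDone S s len off N cut side h' i j k s' := by
  obtain ⟨li, lj, lk⟩ := hR.lt
  obtain ⟨rj, rk⟩ := hR.role
  have T₀ := T.congr hS
  refine (caseStart_spec T₀ hR hi hj hk).seq ?_
  rintro t₁ s₁ hF₁ ⟨ht₁, R₁, A₁, n₁, p₁, c₁⟩
  have A₁' : Agree 300 S s₁ := hS.trans A₁
  rw [← chLo_congr A₁ le_rfl, ← chLo_congr A₁ le_rfl] at c₁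
  have T₁ := T.congr A₁'
  have eO : s₁.nat vOut 0 = s.nat vOut 0 := by rw [n₁ _] <;> norm_num
  have eT : s₁.nat vTrip 0 = s.nat vTrip 0 := by rw [n₁ _] <;> norm_num
  have X₁ : TripleExt s s₁ := TripleExt.of_eq fun c h1 h2 => n₁ c (by omega) (by omega) (by omega)
  have tok₁ : TripleOk len s₁ :=
    hO.tok.of_eq fun c h1 h2 => n₁ c (by omega) (by omega) (by omega)
  have G₁ : Grow s s₁ := by
    refine ⟨X₁, eO.ge, p₁, fun i hi => ?_, fun i hi r _ => ?_⟩
    · rcases tab_lt hi with e | e | e <;> rw [e, n₁ _ (by norm_num) (by norm_num) (by norm_num)]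
    · rcases tab_lt hi with e | e | e <;> rw [e, n₁ _ (by norm_num) (by norm_num) (by norm_num),
        n₁ _ (by norm_num) (by norm_num) (by norm_num)] <;> exact ⟨rfl, rfl⟩
  have O₁ : ∀ i < 3, TabOk S s₁ len off i := fun i hi => by
    refine (hO.tabs i hi).ext ?_ ?_ ?_ eO.ge p₁ <;> rcases tab_lt hi with e | e | e <;>
      rw [e, n₁ _ (by norm_num) (by norm_num) (by norm_num)]
  have eH : s₁.nat vHalf 0 = h' := by rw [hF₁.1 _ (by decide), hhalf]
  have eS : s₁.nat vSide 0 = side := by rw [hF₁.1 _ (by decide), hsd]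
  refine (nodes_spec T₁ R₁ eH eS hpos tok₁ fun h => eO ▸ (c₁ h).2).seq ?_
  rintro t₂ s₂ hF₂ ⟨ht₂, c, D⟩
  rw [eO, eT, (A₁' vLog (by norm_num) (by norm_num)).1] at ht₂
  have n₂ : ∀ x < 40, x ≠ aLE → x ≠ aRE → x ≠ vOut → x ≠ aRole → s₂.nat x = s₁.nat x :=
    fun x h1 h2 h3 h4 h5 => hF₂.1 x (nodes_keeps x h1 h2 h3 h4 h5)
  have A₁₂ : Agree 300 s₁ s₂ := D.agree.mono (by norm_num)
  have A₂' : Agree 300 S s₂ := A₁'.trans A₁₂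
  have G₂ : Grow s₁ s₂ := by
    refine ⟨D.text, D.pext.le, D.pext.old, fun i hi => ?_, fun i hi r _ => ?_⟩
    · rcases tab_lt hi with e | e | e <;>
        rw [e, n₂ _ (by norm_num) (by norm_num) (by norm_num) (by norm_num) (by norm_num)]
    · rcases tab_lt hi with e | e | e <;>
        rw [e, n₂ _ (by norm_num) (by norm_num) (by norm_num) (by norm_num) (by norm_num),
        n₂ _ (by norm_num) (by norm_num) (by norm_num) (by norm_num) (by norm_num)] <;>
        exact ⟨rfl, rfl⟩
  have O₂ : ∀ i < 3, TabOk S s₂ len off i := fun i hi => by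
    refine (O₁ i hi).ext ?_ ?_ ?_ D.pext.le D.pext.old <;> rcases tab_lt hi with e | e | e <;>
      rw [e, n₂ _ (by norm_num) (by norm_num) (by norm_num) (by norm_num) (by norm_num)]
  have num₂ : ∀ x, x = 10 ∨ x = 20 ∨ x = 30 → s₂.nat x 0 = s.nat x 0 := by
    rintro x (rfl | rfl | rfl) <;>
      rw [n₂ _ (by norm_num) (by norm_num) (by norm_num) (by norm_num) (by norm_num),
        n₁ _ (by norm_num) (by norm_num) (by norm_num)]
  have hcount := D.count
  rw [eT] at hcount
  have hv : s₂.nat vRev 0 = s₁.nat vRev 0 := by rw [(D.agree _ (by norm_num) (by norm_num)).1]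
  have cover : ∀ d, (h' + h') * d < N → ∀ x x' y y',
      NodeLeaves side h' ((h' + h') * d) N x x' y y' →
      ∀ z : ℕ → ℂ, z 0 + z 1 + z 2 = 0 → ∀ mi mj mk qi qj qk,
        RepAt S (off i) (cut i x) (cut i x') (z i) mi qi →
        RepAt S (off j) (cut j y) (cut j y') (z j) mj qj →
        RepAt S (off k) (cut k y) (cut k y') (z k) mk qk →
        CovT S s₂ len off z ∨ s₁.nat vRev 0 = 0 ∧
          PiecesCover S s₂ (s.nat vOut 0) (s₂.nat vOut 0) (off j) (off k) (z j) (z k) := by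
    intro d hd x x' y y' hN z hz mi mj mk qi qj qk h1 h2 h3
    have := D.cover d hd x x' y y' hN z hz mi mj mk qi qj qk ((RepAt.congr A₁' le_rfl).2 h1)
      ((RepAt.congr A₁' le_rfl).2 h2) ((RepAt.congr A₁' le_rfl).2 h3)
    rwa [CovT.congr A₁' le_rfl, PiecesCover.congr A₁' le_rfl, eO] at this
  refine runs_ite (fun h => runs_skip ?_) (fun h => ?_)
  · have hr : 0 < s₁.nat vRev 0 := by rw [← hv]; exact h
    have eo : s₂.nat vOut 0 = s.nat vOut 0 := (D.out_eq hr).trans eO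
    refine ⟨by omega, A₁.trans A₁₂, G₁.trans G₂, ⟨D.tok, O₂⟩, hcount, by omega, ?_, ?_⟩
    · rw [num₂ 10 (by simp), num₂ 20 (by simp), num₂ 30 (by simp)]
      omega
    · intro d hd x x' y y' hN z hz mi mj mk qi qj qk h1 h2 h3
      rcases cover d hd x x' y y' hN z hz mi mj mk qi qj qk h1 h2 h3 with g | ⟨g, -⟩
      · exact Or.inl g
      · omega
  · have hr : s₁.nat vRev 0 = 0 := by
      have : ¬ 0 < s₂.nat vRev 0 := h
      omega
    obtain ⟨e1, e2⟩ := c₁ hr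
    obtain ⟨g1, g2, g3, g4, g5, g6, g7, g8⟩ := D.cur hr
    rw [eO] at g8
    have hst : s₂.nat vStart 0 = s.nat vOut 0 := by
      rw [(D.agree _ (by norm_num) (by norm_num)).1, e1]
    have hsteps := D.pext.steps
    rw [eO] at hsteps
    have hle := D.pext.le
    rw [eO] at hle
    have hx := e2.ext D.pext eO.ge
    rw [← chLo_congr A₁₂ le_rfl, ← chLo_congr A₁₂ le_rfl] at hx
    rw [← chHi_congr A₁₂ le_rfl] at g4 g5
    refine (caseFinish_spec (T.congr A₂') (R₁.congr D.agree) (hv.trans hr) hst hx hle hsteps g1 g2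
      g3 g4 g5 g6 g7 g8 (fun i hi => (TabOk.congr_left A₂' le_rfl).2 (O₂ i hi)) D.tok).mono ?_
    rintro t₃ s₃ - ⟨ht₃, A₃, G₃, tok₃, tab₃, eT₃, ho₃, hnum, r, hr1, hr2, hr3⟩
    rw [num₂ 10 (by simp), num₂ 20 (by simp), num₂ 30 (by simp)] at hnum
    have O₃ : OutOk S s₃ len off :=
      ⟨tok₃, fun i hi => (TabOk.congr_left A₂' le_rfl).1 (tab₃ i hi)⟩
    refine ⟨by omega, (A₁.trans A₁₂).trans A₃, (G₁.trans G₂).trans G₃, O₃, by omega, by omega,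
      hnum, ?_⟩
    intro d hd x x' y y' hN z hz mi mj mk qi qj qk h1 h2 h3
    rcases cover d hd x x' y y' hN z hz mi mj mk qi qj qk h1 h2 h3 with g | ⟨-, g⟩
    · exact Or.inl (g.ext G₃.text)
    · refine Or.inr ⟨i, li, r, hr1, ?_⟩
      rw [hr2, hr3, rj, rk]
      have := G₃.out
      exact g.ext (fun r _ hr' => G₃.old r hr') (by omega)

/-! ## All levels -/

/-- Treats a level with chain `i` on one side of the nodes. -/
def runRole (i side : ℕ) : Prog :=
  nset vI (.const i) ;; nset vJ (.const (roleJ i)) ;; nset vK (.const (roleK i)) ;;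
    nset vSide (.const side) ;; runCase

/-- Treats a level for all choices of roles in a list. -/
def runRoles : List (ℕ × ℕ) → Prog
  | [] => .skip
  | q :: l => runRole q.1 q.2 ;; runRoles l

/-- All choices of roles. -/
def allRoles : List (ℕ × ℕ) := [(0, 0), (0, 1), (1, 0), (1, 1), (2, 0), (2, 1)]

/-- Treats all levels. -/
def levels : Prog :=
  nset vHalf 1 ;; .loop (.natLt (nv vHalf) (nv vLeaves))
    (runRoles allRoles ;; nset vHalf (nv vHalf + nv vHalf))

/-- The output has grown validly, by an amount proportional to `q`. -/
structure Progress (S s : Store) (len off : ℕ → ℕ) (W q : ℕ) (s' : Store) : Prop where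
  agree : Agree 300 s s'
  grow : Grow s s'
  ok : OutOk S s' len off
  count : s'.nat vTrip 0 ≤ s.nat vTrip 0 + q * (4 * W)
  out : s'.nat vOut 0 ≤ s.nat vOut 0 + q * W
  num : s'.nat 10 0 + s'.nat 20 0 + s'.nat 30 0 ≤ s.nat 10 0 + s.nat 20 0 + s.nat 30 0 + q

theorem Progress.of_eq {S s s' : Store} {len off : ℕ → ℕ} {W : ℕ} (hO : OutOk S s len off)
    (hn : ∀ x, x < 300 → s'.nat x = s.nat x) (hr : s'.real = s.real) :
    Progress S s len off W 0 s' := by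
  have hP : PieceExt s s' := PieceExt.of_eq fun x _ _ _ => ⟨hn x (by omega), by rw [hr]⟩
  refine ⟨fun x _ h => ⟨hn x h, by rw [hr]⟩, Grow.of_eq (fun x h => hn x (by omega))
    fun x _ => by rw [hr], ⟨hO.tok.of_eq fun x _ _ => hn x (by omega), fun i hi => ?_⟩, ?_, ?_, ?_⟩
  · refine (hO.tabs i hi).ext ?_ ?_ ?_ hP.le hP.old <;> rcases tab_lt hi with e | e | e <;>
      rw [e, hn _ (by norm_num)]
  · rw [hn _ (by norm_num)]; omega
  · rw [hn _ (by norm_num)]; omega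
  · rw [hn 10 (by norm_num), hn 20 (by norm_num), hn 30 (by norm_num)]; omega

theorem Progress.trans {S s s' s'' : Store} {len off : ℕ → ℕ} {W q q' : ℕ}
    (h : Progress S s len off W q s') (h' : Progress S s' len off W q' s'') :
    Progress S s len off W (q + q') s'' := by
  have h1 := h.count
  have h2 := h.out
  have h3 := h.num
  have h4 := h'.count
  have h5 := h'.out
  have h6 := h'.num
  refine ⟨h.agree.trans h'.agree, h.grow.trans h'.grow, h'.ok, ?_, ?_, ?_⟩
  · rw [add_mul]; omega
  · rw [add_mul]; omega
  · omega

/-- All placements that are spread over a node in the given way are covered. -/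
def RoleCovered (S s : Store) (len off : ℕ → ℕ) (N : ℕ) (cut : ℕ → ℕ → ℕ) (h' i side : ℕ) : Prop :=
  ∀ d, (h' + h') * d < N → ∀ x x' y y', NodeLeaves side h' ((h' + h') * d) N x x' y y' →
    ∀ z : ℕ → ℂ, z 0 + z 1 + z 2 = 0 → ∀ mi mj mk qi qj qk,
      RepAt S (off i) (cut i x) (cut i x') (z i) mi qi →
      RepAt S (off (roleJ i)) (cut (roleJ i) y) (cut (roleJ i) y') (z (roleJ i)) mj qj →
      RepAt S (off (roleK i)) (cut (roleK i) y) (cut (roleK i) y') (z (roleK i)) mk qk →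
      CovAll S s len off z

theorem RoleCovered.grow {S s s' : Store} {len off : ℕ → ℕ} {N : ℕ} {cut : ℕ → ℕ → ℕ}
    {h' i side : ℕ} (h : RoleCovered S s len off N cut h' i side) (hO : OutOk S s len off)
    (hg : Grow s s') : RoleCovered S s' len off N cut h' i side :=
  fun d hd x x' y y' hN z hz mi mj mk qi qj qk h1 h2 h3 =>
    (h d hd x x' y y' hN z hz mi mj mk qi qj qk h1 h2 h3).grow hO hg

section
variable {S s : Store} {len off : ℕ → ℕ} {N : ℕ} {cut : ℕ → ℕ → ℕ} {eps : ℕ → ℝ}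
  {θ : ℕ → ℕ → ℝ} {h' W B : ℕ}

theorem runRole_spec (T : Tables S len off N cut eps θ) (hS : Agree 300 S s)
    (hO : OutOk S s len off) {i side : ℕ} (hi : i < 3) (hhalf : s.nat vHalf 0 = h') (hpos : 1 ≤ h')
    (hW : len 0 + len 1 + len 2 = W)
    (hB : (12 * S.nat vLog 0 + 63) * (W + N) + 47 * W + 30 = B) :
    Runs (runRole i side) s fun t s' => t ≤ B ∧ s'.nat vHalf 0 = h' ∧
      Progress S s len off W 1 s' ∧ RoleCovered S s' len off N cut h' i side := by
  refine runs_seq (runs_setNat (runs_seq (runs_setNat (runs_seq (runs_setNat (runs_seq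
    (runs_setNat ?_)))))))
  set s₁ := Store.setNat _ vSide _ _ with hs₁
  have e : ∀ x, x < 301 → s₁.nat x = s.nat x := by
    intro x hx
    rw [hs₁, setNat_nat_of_ne (by omega), setNat_nat_of_ne (by omega), setNat_nat_of_ne (by omega),
      setNat_nat_of_ne (by omega)]
  have P₁ : Progress S s len off W 0 s₁ := Progress.of_eq hO (fun x hx => e x (by omega)) rfl
  have hsum : len i + len (roleJ i) + len (roleK i) = W := by
    interval_cases i <;> simp [roleJ, roleK] <;> omega
  refine (runCase_spec (s := s₁) (h' := h') (side := side) T (hS.trans P₁.agree) P₁.ok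
    (isRoles_role hi) ?_ ?_ ?_ ?_ ?_ hpos).mono ?_
  · simp [hs₁, NatExpr.eval]
  · simp [hs₁, NatExpr.eval]
  · simp [hs₁, NatExpr.eval]
  · rw [e _ (by norm_num), hhalf]
  · simp [hs₁, NatExpr.eval]
  rintro t s₂ hF ⟨ht, D⟩
  have h1 := D.count
  have h2 := D.out
  have q : (12 * S.nat vLog 0 + 63) * (len (roleJ i) + len (roleK i) + N) ≤
    (12 * S.nat vLog 0 + 63) * (W + N) := Nat.mul_le_mul_left _ (by omega)
  have P₂ : Progress S s₁ len off W 1 s₂ :=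
    ⟨D.agree, D.grow, D.ok, by omega, by omega, D.num⟩
  refine ⟨by omega, ?_, ?_, D.cover⟩
  · rw [hF.1 _ (by decide), e _ (by norm_num), hhalf]
  · have := P₁.trans P₂
    rwa [Nat.zero_add] at this

theorem runRoles_spec (T : Tables S len off N cut eps θ) (hpos : 1 ≤ h')
    (hW : len 0 + len 1 + len 2 = W)
    (hB : (12 * S.nat vLog 0 + 63) * (W + N) + 47 * W + 30 = B) (l : List (ℕ × ℕ))
    (hl : ∀ q ∈ l, q.1 < 3) : ∀ s : Store, Agree 300 S s → OutOk S s len off → s.nat vHalf 0 = h' →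
    Runs (runRoles l) s fun t s' => t ≤ l.length * B ∧ s'.nat vHalf 0 = h' ∧
      Progress S s len off W l.length s' ∧
      ∀ q ∈ l, RoleCovered S s' len off N cut h' q.1 q.2 := by
  induction l with
  | nil =>
    intro s hS hO hh
    exact runs_skip ⟨by simp, hh, Progress.of_eq hO (fun _ _ => rfl) rfl, by simp⟩
  | cons q l ih =>
    intro s hS hO hh
    refine (runRole_spec T hS hO (hl q (by simp)) hh hpos hW hB).seq ?_
    rintro t s₁ - ⟨ht, hh₁, P₁, C₁⟩
    refine (ih (fun q hq => hl q (by simp [hq])) s₁ (hS.trans P₁.agree) P₁.ok hh₁).mono ?_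
    rintro t' s₂ - ⟨ht', hh₂, P₂, C₂⟩
    refine ⟨?_, hh₂, ?_, fun q' hq' => ?_⟩
    · rw [List.length_cons, add_mul]
      omega
    · rw [List.length_cons, add_comm]
      exact P₁.trans P₂
    · rcases List.mem_cons.1 hq' with rfl | hq'
      · exact C₁.grow P₁.ok P₂.grow
      · exact C₂ q' hq'

theorem levels_spec (T : Tables S len off N cut eps θ) (hS : Agree 300 S s)
    (hO : OutOk S s len off) (hW : len 0 + len 1 + len 2 = W)
    (hB : (12 * S.nat vLog 0 + 63) * (W + N) + 47 * W + 30 = B) :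
    Runs levels s fun t s' => ∃ l, t ≤ l * (6 * B + 2) + 2 ∧ N ≤ 2 ^ l ∧ (l = 0 ∨ 2 ^ (l - 1) < N) ∧
      Progress S s len off W (6 * l) s' ∧
      ∀ l' < l, ∀ i < 3, ∀ side < 2, RoleCovered S s' len off N cut (2 ^ l') i side := by
  refine runs_seq (runs_setNat ?_)
  set s₁ := Store.setNat _ vHalf _ _ with hs₁
  have P₁ : Progress S s len off W 0 s₁ :=
    Progress.of_eq hO (fun x hx => setNat_nat_of_ne (by omega)) rfl
  refine (runs_loop (fun t s' => ∃ l, t ≤ l * (6 * B + 2) ∧ s'.nat vHalf 0 = 2 ^ l ∧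
      (l = 0 ∨ 2 ^ (l - 1) < N) ∧ Progress S s len off W (6 * l) s' ∧
      ∀ l' < l, ∀ i < 3, ∀ side < 2, RoleCovered S s' len off N cut (2 ^ l') i side)
    (fun s' => N - s'.nat vHalf 0) ?_ ?_).mono ?_
  · exact ⟨0, by simp, by simp [hs₁], Or.inl rfl, P₁, fun l' h => absurd h (by omega)⟩
  · rintro t s₂ - ⟨l, ht, hh, -, P, C⟩ hb
    have hA : Agree 300 S s₂ := hS.trans P.agree
    have hN : s₂.nat vLeaves 0 = N := by
      rw [(hA _ (by norm_num) (by norm_num)).1, T.hleaves]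
    have hb' : 2 ^ l < N := by simpa [hh, hN] using hb
    refine (runRoles_spec T Nat.one_le_two_pow hW hB allRoles (by decide) s₂ hA P.ok hh).seq ?_
    rintro t' s₃ - ⟨ht', hh', P', C'⟩
    refine runs_setNat ?_
    set s₄ := Store.setNat s₃ vHalf _ _ with hs₄
    have P₄ : Progress S s₃ len off W 0 s₄ :=
      Progress.of_eq P'.ok (fun x hx => setNat_nat_of_ne (by omega)) rfl
    have e : s₄.nat vHalf 0 = 2 ^ (l + 1) := by
      simp [hs₄, hh', pow_succ]; omega
    have p : 0 < 2 ^ l := by positivity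
    have p' : 2 ^ (l + 1) = 2 * 2 ^ l := by rw [pow_succ]; omega
    refine ⟨⟨l + 1, ?_, e, Or.inr (by simpa using hb'), ?_, ?_⟩, by omega⟩
    · simp only [allRoles, List.length_cons, List.length_nil] at ht'
      rw [add_mul]
      omega
    · exact (P.trans P').trans P₄
    · intro l' hl i hi side hs
      rcases Nat.lt_succ_iff_lt_or_eq.1 hl with hl | rfl
      · exact (C l' hl i hi side hs).grow P.ok (P'.grow.trans P₄.grow)
      · refine (C' (i, side) ?_).grow P'.ok P₄.grow
        interval_cases i <;> interval_cases side <;> simp [allRoles]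
  · rintro t s₂ - ⟨t', rfl, ⟨l, ht, hh, h1, P, C⟩, hb⟩
    have hN : s₂.nat vLeaves 0 = N := by
      rw [((hS.trans P.agree) _ (by norm_num) (by norm_num)).1, T.hleaves]
    have hb' : N ≤ 2 ^ l := by simpa [hh, hN] using hb
    exact ⟨l, by omega, hb', h1, P, C⟩

end

/-! ## Placements are spread over nodes -/

/-- Three numbers that are not all equal are separated at a unique level of the binary tree. -/
theorem exists_split_level {N : ℕ} {r : ℕ → ℕ} (hr : ∀ c < 3, r c < N)
    (hne : ¬ (r 0 = r 1 ∧ r 1 = r 2)) :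
    ∃ l d, 2 ^ l < N ∧ (2 ^ l + 2 ^ l) * d < N ∧ ∃ i < 3, ∃ side < 2, ∃ x x' y y',
      NodeLeaves side (2 ^ l) ((2 ^ l + 2 ^ l) * d) N x x' y y' ∧
      (x ≤ r i ∧ r i < x') ∧ (y ≤ r (roleJ i) ∧ r (roleJ i) < y') ∧
      y ≤ r (roleK i) ∧ r (roleK i) < y' := by
  have h0 := hr 0 (by norm_num)
  have h1 := hr 1 (by norm_num)
  have h2 := hr 2 (by norm_num)
  have hex : ∃ L, r 0 / 2 ^ L = r 1 / 2 ^ L ∧ r 1 / 2 ^ L = r 2 / 2 ^ L := by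
    refine ⟨N, ?_⟩
    have : N < 2 ^ N := Nat.lt_two_pow_self
    rw [Nat.div_eq_of_lt (by omega), Nat.div_eq_of_lt (by omega), Nat.div_eq_of_lt (by omega)]
    simp
  classical
  obtain ⟨L, hL, hmin⟩ : ∃ L, (r 0 / 2 ^ L = r 1 / 2 ^ L ∧ r 1 / 2 ^ L = r 2 / 2 ^ L) ∧
      ∀ l < L, ¬ (r 0 / 2 ^ l = r 1 / 2 ^ l ∧ r 1 / 2 ^ l = r 2 / 2 ^ l) :=
    ⟨Nat.find hex, Nat.find_spec hex, fun l hl => Nat.find_min hex hl⟩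
  obtain ⟨l, rfl⟩ : ∃ l, L = l + 1 := by
    refine Nat.exists_eq_succ_of_ne_zero fun e => ?_
    subst e
    simp only [pow_zero, Nat.div_one] at hL
    exact hne hL
  have hl := hmin l (by omega)
  obtain ⟨h, hh⟩ : ∃ h, h = 2 ^ l := ⟨_, rfl⟩
  have hpos : 0 < h := by rw [hh]; positivity
  have e2 : 2 ^ (l + 1) = h * 2 := by rw [pow_succ, hh]
  rw [e2, ← Nat.div_div_eq_div_mul, ← Nat.div_div_eq_div_mul, ← Nat.div_div_eq_div_mul] at hL
  rw [← hh] at hl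
  obtain ⟨d, hd⟩ : ∃ d, d = r 0 / h / 2 := ⟨_, rfl⟩
  have key : ∀ c < 3, (r c / h = 2 * d ∧ (h + h) * d ≤ r c ∧ r c < (h + h) * d + h) ∨
      (r c / h = 2 * d + 1 ∧ (h + h) * d + h ≤ r c ∧ r c < (h + h) * d + h + h) := by
    intro c hc
    have hcd : r c / h / 2 = d := by
      interval_cases c
      · exact hd.symm
      · rw [hd, hL.1]
      · rw [hd, hL.1, hL.2]
    have hm := Nat.div_add_mod (r c) h
    have hm' := Nat.mod_lt (r c) hpos
    have e : (h + h) * d = h * (2 * d) := by ring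
    have e' : h * (2 * d + 1) = h * (2 * d) + h := by ring
    rcases (show r c / h = 2 * d ∨ r c / h = 2 * d + 1 by omega) with q | q
    · rw [q] at hm
      exact Or.inl ⟨q, by omega, by omega⟩
    · rw [q] at hm
      exact Or.inr ⟨q, by omega, by omega⟩
  obtain ⟨b, hb⟩ : ∃ b, b = (h + h) * d := ⟨_, rfl⟩
  rw [← hb] at key
  have k0 := key 0 (by norm_num)
  have k1 := key 1 (by norm_num)
  have k2 := key 2 (by norm_num)
  clear key hmin
  refine ⟨l, d, ?_⟩
  rw [← hh, ← hb]
  refine ⟨by omega, by omega, ?_⟩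
  have left : ∀ c, r c < N → r c < b + h → r c < min (b + h) N := fun c h1 h2 => lt_min h2 h1
  have right : ∀ c, r c < N → r c < b + h + h → r c < min (b + h + h) N := fun c h1 h2 =>
    lt_min h2 h1
  have mle : min (b + h) N ≤ b + h := min_le_left _ _
  have first : ∀ i < 3, (b ≤ r i ∧ r i < b + h) →
      (b + h ≤ r (roleJ i) ∧ r (roleJ i) < b + h + h) →
      (b + h ≤ r (roleK i) ∧ r (roleK i) < b + h + h) →
      ∃ i < 3, ∃ side < 2, ∃ x x' y y', NodeLeaves side h b N x x' y y' ∧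
        (x ≤ r i ∧ r i < x') ∧ (y ≤ r (roleJ i) ∧ r (roleJ i) < y') ∧
        y ≤ r (roleK i) ∧ r (roleK i) < y' := by
    intro i hi g1 g2 g3
    obtain ⟨-, lj, lk⟩ := (isRoles_role hi).lt
    exact ⟨i, hi, 0, by norm_num, _, _, _, _, Or.inl ⟨rfl, rfl, rfl, rfl, rfl⟩,
      ⟨g1.1, left _ (hr _ hi) g1.2⟩, ⟨mle.trans g2.1, right _ (hr _ lj) g2.2⟩, mle.trans g3.1,
      right _ (hr _ lk) g3.2⟩
  have second : ∀ i < 3, (b + h ≤ r i ∧ r i < b + h + h) →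
      (b ≤ r (roleJ i) ∧ r (roleJ i) < b + h) → (b ≤ r (roleK i) ∧ r (roleK i) < b + h) →
      ∃ i < 3, ∃ side < 2, ∃ x x' y y', NodeLeaves side h b N x x' y y' ∧
        (x ≤ r i ∧ r i < x') ∧ (y ≤ r (roleJ i) ∧ r (roleJ i) < y') ∧
        y ≤ r (roleK i) ∧ r (roleK i) < y' := by
    intro i hi g1 g2 g3
    obtain ⟨-, lj, lk⟩ := (isRoles_role hi).lt
    exact ⟨i, hi, 1, by norm_num, _, _, _, _, Or.inr ⟨by norm_num, rfl, rfl, rfl, rfl⟩,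
      ⟨mle.trans g1.1, right _ (hr _ hi) g1.2⟩, ⟨g2.1, left _ (hr _ lj) g2.2⟩, g3.1,
      left _ (hr _ lk) g3.2⟩
  rcases k0 with ⟨q0, a0⟩ | ⟨q0, a0⟩ <;> rcases k1 with ⟨q1, a1⟩ | ⟨q1, a1⟩ <;>
    rcases k2 with ⟨q2, a2⟩ | ⟨q2, a2⟩
  · exact absurd ⟨q0.trans q1.symm, q1.trans q2.symm⟩ hl
  · exact second 2 (by norm_num) a2 a0 a1
  · exact second 1 (by norm_num) a1 a0 a2
  · exact first 0 (by norm_num) a0 a1 a2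
  · exact second 0 (by norm_num) a0 a1 a2
  · exact first 1 (by norm_num) a1 a0 a2
  · exact first 2 (by norm_num) a2 a0 a1
  · exact absurd ⟨q0.trans q1.symm, q1.trans q2.symm⟩ hl

theorem Tables.exists_leaf {S : Store} {len off : ℕ → ℕ} {N : ℕ} {cut : ℕ → ℕ → ℕ} {eps : ℕ → ℝ}
    {θ : ℕ → ℕ → ℝ} (T : Tables S len off N cut eps θ) {c m : ℕ} (hc : c < 3) (hm : m < len c) :
    ∃ r < N, cut c r ≤ m ∧ m < cut c (r + 1) := by
  classical
  have hex : ∃ r, m < cut c r := ⟨N, by rw [T.cut_last c hc]; exact hm⟩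
  have h1 := Nat.find_spec hex
  have h2 : Nat.find hex ≤ N := Nat.find_min' hex (by rw [T.cut_last c hc]; exact hm)
  have h3 : Nat.find hex ≠ 0 := fun e => by
    rw [e, T.cut_zero c hc] at h1
    omega
  have h4 := Nat.find_min hex (Nat.sub_one_lt h3)
  refine ⟨Nat.find hex - 1, by omega, by omega, ?_⟩
  rwa [Nat.sub_add_cancel (by omega)]

/-- A placement is covered, or its three edges belong to the same leaf. -/
theorem Tables.covered_or_leaf {S s : Store} {len off : ℕ → ℕ} {N : ℕ} {cut : ℕ → ℕ → ℕ}
    {eps : ℕ → ℝ} {θ : ℕ → ℕ → ℝ} (T : Tables S len off N cut eps θ) {L : ℕ} (hL : N ≤ 2 ^ L)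
    (hC : ∀ l < L, ∀ i < 3, ∀ side < 2, RoleCovered S s len off N cut (2 ^ l) i side)
    {z : ℕ → ℂ} (hz : z 0 + z 1 + z 2 = 0) {m : ℕ → ℕ} {q : ℕ → ℝ}
    (hm : ∀ c < 3, RepAt S (off c) 0 (len c) (z c) (m c) (q c)) :
    CovAll S s len off z ∨ ∃ r < N, ∀ c < 3, cut c r ≤ m c ∧ m c < cut c (r + 1) := by
  have hex : ∀ c, ∃ r, c < 3 → r < N ∧ cut c r ≤ m c ∧ m c < cut c (r + 1) := by
    intro c
    by_cases hc : c < 3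
    · obtain ⟨r, h1, h2⟩ := T.exists_leaf hc (hm c hc).lt
      exact ⟨r, fun _ => ⟨h1, h2⟩⟩
    · exact ⟨0, fun h => absurd h hc⟩
  choose r hr using hex
  by_cases he : r 0 = r 1 ∧ r 1 = r 2
  · refine Or.inr ⟨r 0, (hr 0 (by norm_num)).1, fun c hc => ?_⟩
    have : r 0 = r c := by
      interval_cases c
      exacts [rfl, he.1, he.1.trans he.2]
    rw [this]
    exact (hr c hc).2
  · left
    obtain ⟨l, d, h1, h2, i, hi, side, hs, x, x', y, y', hn, a1, a2, a3⟩ :=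
      exists_split_level (fun c hc => (hr c hc).1) he
    obtain ⟨-, lj, lk⟩ := (isRoles_role hi).lt
    have hN : x' ≤ N ∧ y' ≤ N := by
      have u1 : ∀ a, min a N ≤ N := fun a => min_le_right _ _
      rcases hn with ⟨-, -, rfl, -, rfl⟩ | ⟨-, -, rfl, -, rfl⟩ <;> exact ⟨u1 _, u1 _⟩
    have rep : ∀ c < 3, ∀ x x', x' ≤ N → x ≤ r c ∧ r c < x' →
        RepAt S (off c) (cut c x) (cut c x') (z c) (m c) (q c) := by
      intro c hc x x' hx' hx
      have h := hm c hc
      obtain ⟨g1, g2, g3⟩ := hr c hc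
      exact ⟨(T.cut_mono c hc _ _ hx.1 g1.le).trans g2,
        g3.trans_le (T.cut_mono c hc _ _ hx.2 hx'), h.lo_le, h.le_hi, h.eq⟩
    have hl : l < L := (Nat.pow_lt_pow_iff_right (by norm_num)).1 (h1.trans_le hL)
    exact hC l hl i hi side hs d h2 x x' y y' hn z hz _ _ _ _ _ _ (rep i hi x x' hN.1 a1)
      (rep _ lj y y' hN.2 a2) (rep _ lk y y' hN.2 a3)

/-! ## Building the chains -/

/-- The memory holds a polygon with vertices `V`, a triangle `p` and three arcs. -/
structure Input (s : Store) (n : ℕ) (V p : ℕ → ℂ) (first len : ℕ → ℕ) (lo hi : ℕ → ℝ) : Prop where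
  num : s.nat 0 0 = n
  nfirst : ∀ c < 3, s.nat 0 (1 + 2 * c) = first c
  nlen : ∀ c < 3, s.nat 0 (2 + 2 * c) = len c
  vre : ∀ i < n, s.real 0 i = (V i).re
  vim : ∀ i < n, s.real 1 i = (V i).im
  pre : ∀ c < 3, s.real 2 (2 * c) = (p c).re
  pim : ∀ c < 3, s.real 2 (2 * c + 1) = (p c).im
  rlo : ∀ c < 3, s.real 2 (6 + 2 * c) = lo c
  rhi : ∀ c < 3, s.real 2 (7 + 2 * c) = hi c
  period : ∀ i, V (i % n) = V i
  three_le : 3 ≤ n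
  first_lt : ∀ c < 3, first c < n
  len_pos : ∀ c < 3, 1 ≤ len c
  len_le : ∀ c < 3, len c ≤ n

theorem Input.congr {s s' : Store} {n : ℕ} {V p : ℕ → ℂ} {first len : ℕ → ℕ} {lo hi : ℕ → ℝ}
    (h : Input s n V p first len lo hi) (h0 : s'.nat 0 = s.nat 0) (h1 : s'.real 0 = s.real 0)
    (h2 : s'.real 1 = s.real 1) (h3 : s'.real 2 = s.real 2) :
    Input s' n V p first len lo hi := by
  obtain ⟨a1, a2, a3, a4, a5, a6, a7, a8, a9, a⟩ := h
  refine ⟨?_, ?_, ?_, ?_, ?_, ?_, ?_, ?_, ?_, a, by assumption, by assumption, by assumption,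
    by assumption⟩ <;> simpa only [h0, h1, h2, h3]

/-- The side of the triangle by which a chain is scaled and rotated. -/
def coef (p : ℕ → ℂ) (c : ℕ) : ℂ := p ((c + 1) % 3) - p ((c + 2) % 3)

/-- Base point, direction and parameter range that are stored at a position. -/
noncomputable def entry (s : Store) (x : ℕ) : ℂ × ℂ × ℝ × ℝ :=
  (⟨s.real aBX x, s.real aBY x⟩, ⟨s.real aDX x, s.real aDY x⟩, s.real aLo x, s.real aHi x)

/-- The entry that is prepared in the registers. -/
noncomputable def regs (s : Store) : ℂ × ℂ × ℝ × ℝ :=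
  (⟨s.real 710 0, s.real 711 0⟩, ⟨s.real 712 0, s.real 713 0⟩, s.real 714 0, s.real 715 0)

/-- The entry of an edge of a chain that is passed backwards. -/
noncomputable def flipEntry (e : ℂ × ℂ × ℝ × ℝ) : ℂ × ℂ × ℝ × ℝ :=
  (e.1 + e.2.1, -e.2.1, 1 - e.2.2.2, 1 - e.2.2.1)

/-- The entry of edge `m` of chain `c`. -/
noncomputable def edgeEntry (V p : ℕ → ℂ) (first len : ℕ → ℕ) (lo hi : ℕ → ℝ) (c m : ℕ) :
    ℂ × ℂ × ℝ × ℝ :=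
  (coef p c * V (first c + m), coef p c * (V (first c + m + 1) - V (first c + m)),
    if m = 0 then lo c else 0, if m + 1 = len c then hi c else 1)

/-- Writes the registers to a position of the tables. -/
def writeEntry : Prog :=
  .setReal aBX (nv 703) (rv 710) ;; .setReal aBY (nv 703) (rv 711) ;;
  .setReal aDX (nv 703) (rv 712) ;; .setReal aDY (nv 703) (rv 713) ;;
  .setReal aLo (nv 703) (rv 714) ;; .setReal aHi (nv 703) (rv 715)

/-- Computes the next index of a vertex. -/
def nextIndex : Prog := .ite (.natLt (nv 700 + 1) (nv 0)) (nset 701 (nv 700 + 1)) (nset 701 0)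

/-- Computes base point and direction of an edge. -/
def lineRegs : Prog :=
  rset 704 (.load 0 (nv 700)) ;; rset 705 (.load 1 (nv 700)) ;;
  rset 706 (.load 0 (nv 701) - rv 704) ;; rset 707 (.load 1 (nv 701) - rv 705) ;;
  rset 710 (rv 702 * rv 704 - rv 703 * rv 705) ;; rset 711 (rv 702 * rv 705 + rv 703 * rv 704) ;;
  rset 712 (rv 702 * rv 706 - rv 703 * rv 707) ;; rset 713 (rv 702 * rv 707 + rv 703 * rv 706)

/-- Computes the parameter range of an edge. -/
def rangeRegs (c : ℕ) : Prog :=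
  .ite (.natLt 0 (nv 702)) (rset 714 0) (rset 714 (.load 2 (.const (6 + 2 * c)))) ;;
  .ite (.natLt (nv 702 + 1) (.load 0 (.const (2 + 2 * c)))) (rset 715 1)
    (rset 715 (.load 2 (.const (7 + 2 * c))))

/-- Computes the entry of the same edge passed backwards. -/
def flipRegs : Prog :=
  rset 710 (rv 710 + rv 712) ;; rset 711 (rv 711 + rv 713) ;; rset 712 (0 - rv 712) ;;
  rset 713 (0 - rv 713) ;; rset 716 (rv 714) ;; rset 714 (1 - rv 715) ;; rset 715 (1 - rv 716)

/-- Writes one edge of a chain and of the reversed chain. -/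
def chainStep (c : ℕ) : Prog :=
  nextIndex ;; lineRegs ;; rangeRegs c ;; nset 703 (.load aOff (.const c) + nv 702) ;;
  writeEntry ;; flipRegs ;;
  nset 703 (.load aOff (.const (c + 3)) + (.load 0 (.const (2 + 2 * c)) - 1 - nv 702)) ;;
  writeEntry ;; nset 700 (nv 701) ;; nset 702 (nv 702 + 1)

/-- Writes a chain and its reversal. -/
def chain (c : ℕ) : Prog :=
  .setNat aLen (.const c) (.load 0 (.const (2 + 2 * c))) ;;
  rset 702 (.load 2 (.const (2 * ((c + 1) % 3))) - .load 2 (.const (2 * ((c + 2) % 3)))) ;;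
  rset 703 (.load 2 (.const (2 * ((c + 1) % 3) + 1)) - .load 2 (.const (2 * ((c + 2) % 3) + 1))) ;;
  nset 700 (.load 0 (.const (1 + 2 * c))) ;; nset 702 0 ;;
  .loop (.natLt (nv 702) (.load 0 (.const (2 + 2 * c)))) (chainStep c)

@[simp] theorem eval_natConst (s : Store) (k : ℕ) : (NatExpr.const k).eval s = k := rfl

theorem writeEntry_spec {s : Store} {x : ℕ} (hx : s.nat 703 0 = x) :
    Runs writeEntry s fun t s' => t = 6 ∧ s'.nat = s.nat ∧
      (∀ a, a < 210 ∨ 216 ≤ a → s'.real a = s.real a) ∧ entry s' x = regs s ∧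
      ∀ y, y ≠ x → entry s' y = entry s y := by
  refine runs_seq (runs_setReal (runs_seq (runs_setReal (runs_seq (runs_setReal (runs_seq
    (runs_setReal (runs_seq (runs_setReal (runs_setReal ⟨rfl, rfl, ?_, ?_, ?_⟩))))))))))
  · intro a ha
    funext r
    simp only [Store.setReal_real]
    repeat rw [if_neg (by omega)]
  · simp [entry, regs, hx]
  · intro y hy
    simp [entry, hx, hy]

theorem flipRegs_spec {s : Store} : Runs flipRegs s fun t s' => t = 7 ∧ s'.nat = s.nat ∧
    regs s' = flipEntry (regs s) := by
  refine runs_seq (runs_setReal (runs_seq (runs_setReal (runs_seq (runs_setReal (runs_seq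
    (runs_setReal (runs_seq (runs_setReal (runs_seq (runs_setReal (runs_setReal
      ⟨rfl, rfl, ?_⟩))))))))))))
  simp [regs, flipEntry, Complex.ext_iff]

section
variable {s : Store} {n : ℕ} {V p : ℕ → ℂ} {first len : ℕ → ℕ} {lo hi : ℕ → ℝ}

theorem nextIndex_spec {x : ℕ} (hn : s.nat 0 0 = n) (hpos : 0 < n) (hx : s.nat 700 0 = x % n) :
    Runs nextIndex s fun t s' => t = 2 ∧ s'.nat 701 0 = (x + 1) % n := by
  have e := Nat.add_mod x 1 n
  have hl := Nat.mod_lt x hpos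
  refine runs_ite (fun h => runs_setNat ⟨rfl, ?_⟩) (fun h => runs_setNat ⟨rfl, ?_⟩)
  · have h' : x % n + 1 < n := by simpa [hn, hx] using h
    simp only [Store.setNat_nat, NatExpr.eval_add, NatExpr.eval_load, NatExpr.eval_zero,
      NatExpr.eval_one, hx]
    rw [Nat.mod_eq_of_lt (a := 1) (by omega), Nat.mod_eq_of_lt h'] at e
    simp [e]
  · have h' : ¬ x % n + 1 < n := by simpa [hn, hx] using h
    simp only [Store.setNat_nat, NatExpr.eval_zero]
    rw [← Nat.mod_add_mod, show x % n + 1 = n by omega, Nat.mod_self]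
    simp

theorem lineRegs_spec (h : Input s n V p first len lo hi) {k : ℂ} {i : ℕ}
    (h0 : s.nat 700 0 = i % n) (h1 : s.nat 701 0 = (i + 1) % n)
    (hr : s.real 702 0 = k.re) (hi' : s.real 703 0 = k.im) :
    Runs lineRegs s fun t s' => t = 8 ∧ s'.nat = s.nat ∧
      (regs s').1 = k * V i ∧ (regs s').2.1 = k * (V (i + 1) - V i) := by
  have hn : 0 < n := by have := h.three_le; omega
  have a1 := h.vre _ (Nat.mod_lt i hn)
  have a2 := h.vim _ (Nat.mod_lt i hn)
  have a3 := h.vre _ (Nat.mod_lt (i + 1) hn)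
  have a4 := h.vim _ (Nat.mod_lt (i + 1) hn)
  rw [h.period] at a1 a2 a3 a4
  refine runs_seq (runs_setReal (runs_seq (runs_setReal (runs_seq (runs_setReal (runs_seq
    (runs_setReal (runs_seq (runs_setReal (runs_seq (runs_setReal (runs_seq (runs_setReal
      (runs_setReal ⟨rfl, rfl, ?_, ?_⟩))))))))))))))
  · simp [regs, Complex.ext_iff, h0, hr, hi', a1, a2]
  · simp [regs, Complex.ext_iff, h0, h1, hr, hi', a1, a2, a3, a4]

theorem rangeRegs_spec (h : Input s n V p first len lo hi) {c m : ℕ} (hc : c < 3)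
    (hm : s.nat 702 0 = m) (hml : m < len c) :
    Runs (rangeRegs c) s fun t s' => t = 4 ∧ s'.nat = s.nat ∧ (regs s').1 = (regs s).1 ∧
      (regs s').2.1 = (regs s).2.1 ∧ (regs s').2.2 =
        (if m = 0 then lo c else 0, if m + 1 = len c then hi c else 1) := by
  have l := h.nlen c hc
  have b1 := h.rlo c hc
  have b2 := h.rhi c hc
  refine runs_seq (runs_ite (fun h1 => runs_setReal (runs_ite (fun h2 => runs_setReal
    ⟨rfl, rfl, ?_⟩) (fun h2 => runs_setReal ⟨rfl, rfl, ?_⟩))) (fun h1 => runs_setReal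
      (runs_ite (fun h2 => runs_setReal ⟨rfl, rfl, ?_⟩) (fun h2 => runs_setReal ⟨rfl, rfl, ?_⟩))))
  all_goals
    replace h1 := by simpa [hm] using h1
    replace h2 := by simpa [hm, l] using h2
    simp only [regs]
  · have e1 : m ≠ 0 := by omega
    have e2 : m + 1 ≠ len c := by omega
    simp [e1, e2]
  · have e1 : m ≠ 0 := by omega
    have e2 : m + 1 = len c := by omega
    simp [e1, e2, b2]
  · simp [h1, b1]
    omega
  · simp [h1, b1, b2]
    omega

theorem entry_congr {s s' : Store} (h : ∀ a, 210 ≤ a → a < 216 → s'.real a = s.real a) (y : ℕ) :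
    entry s' y = entry s y := by
  simp only [entry, h aBX (by norm_num) (by norm_num), h aBY (by norm_num) (by norm_num),
    h aDX (by norm_num) (by norm_num), h aDY (by norm_num) (by norm_num),
    h aLo (by norm_num) (by norm_num), h aHi (by norm_num) (by norm_num)]

theorem chainStep_spec (h : Input s n V p first len lo hi) {c m : ℕ} (hc : c < 3)
    (ho : ∀ c < 6, s.nat aOff c = c * n) (hm : s.nat 702 0 = m) (hml : m < len c)
    (hx : s.nat 700 0 = (first c + m) % n) (hr : s.real 702 0 = (coef p c).re)
    (hi' : s.real 703 0 = (coef p c).im) :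
    Runs (chainStep c) s fun t s' => t = 37 ∧ s'.nat 702 0 = m + 1 ∧
      s'.nat 700 0 = (first c + (m + 1)) % n ∧
      entry s' (c * n + m) = edgeEntry V p first len lo hi c m ∧
      entry s' ((c + 3) * n + (len c - 1 - m)) =
        flipEntry (edgeEntry V p first len lo hi c m) ∧
      ∀ y, y ≠ c * n + m → y ≠ (c + 3) * n + (len c - 1 - m) → entry s' y = entry s y := by
  have hn := h.three_le
  have hl := h.len_le c hc
  refine (nextIndex_spec h.num (by omega) hx).seq ?_
  rintro _ s₁ hF₁ ⟨rfl, e1⟩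
  have i1 := h.congr (hF₁.1 _ rfl) (hF₁.2 _ rfl) (hF₁.2 _ rfl) (hF₁.2 _ rfl)
  refine (lineRegs_spec i1 (by rw [hF₁.1 _ rfl, hx]) e1 (by rw [hF₁.2 _ rfl, hr])
    (by rw [hF₁.2 _ rfl, hi'])).seq ?_
  rintro _ s₂ hF₂ ⟨rfl, n2, e2, e3⟩
  have i2 := i1.congr (by rw [n2]) (hF₂.2 _ rfl) (hF₂.2 _ rfl) (hF₂.2 _ rfl)
  refine (rangeRegs_spec i2 hc (by rw [n2, hF₁.1 _ rfl, hm]) hml).seq ?_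
  rintro _ s₃ hF₃ ⟨rfl, n3, e4, e5, e6⟩
  have hreg : regs s₃ = edgeEntry V p first len lo hi c m :=
    Prod.ext (e4.trans e2) (Prod.ext (e5.trans e3) e6)
  have hE : ∀ y, entry s₃ y = entry s y := by
    have k1 : ∀ y, entry s₁ y = entry s y := entry_congr fun a h1 h2 => by
      interval_cases a <;> exact hF₁.2 _ rfl
    have k2 : ∀ y, entry s₂ y = entry s₁ y := entry_congr fun a h1 h2 => by
      interval_cases a <;> exact hF₂.2 _ rfl
    have k3 : ∀ y, entry s₃ y = entry s₂ y := entry_congr fun a h1 h2 => by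
      interval_cases a <;> exact hF₃.2 _ rfl
    exact fun y => by rw [k3, k2, k1]
  have n3' : s₃.nat = s₁.nat := n3.trans n2
  have hoff : ∀ c < 6, s₃.nat aOff c = c * n := by rw [n3', hF₁.1 _ rfl]; exact ho
  have hm3 : s₃.nat 702 0 = m := by rw [n3', hF₁.1 _ rfl, hm]
  have hl3 : s₃.nat 0 (2 + 2 * c) = len c := by rw [n3', hF₁.1 _ rfl, h.nlen c hc]
  refine runs_seq (runs_setNat ?_)
  set s₄ := Store.setNat s₃ 703 _ _ with hs₄
  have q4 : ∀ a, a ≠ 703 → s₄.nat a = s₃.nat a := fun a ha => setNat_nat_of_ne ha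
  refine (writeEntry_spec (x := c * n + m) (by simp [hs₄, hm3, hoff c (by omega)])).seq ?_
  rintro _ s₅ hF₅ ⟨rfl, n5, r5, e7, e8⟩
  have hreg5 : regs s₅ = regs s₄ := by
    simp only [regs, r5 710 (by norm_num), r5 711 (by norm_num), r5 712 (by norm_num),
      r5 713 (by norm_num), r5 714 (by norm_num), r5 715 (by norm_num)]
  refine flipRegs_spec.seq ?_
  rintro _ s₆ hF₆ ⟨rfl, n6, e9⟩
  have k6 : ∀ y, entry s₆ y = entry s₅ y := entry_congr fun a h1 h2 => by
    interval_cases a <;> exact hF₆.2 _ rfl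
  have n64 : s₆.nat = s₄.nat := n6.trans n5
  refine runs_seq (runs_setNat ?_)
  set s₇ := Store.setNat s₆ 703 _ _ with hs₇
  have q7 : ∀ a, a ≠ 703 → s₇.nat a = s₃.nat a := fun a ha => by
    rw [hs₇, setNat_nat_of_ne ha, n64, q4 a ha]
  refine (writeEntry_spec (x := (c + 3) * n + (len c - 1 - m)) ?_).seq ?_
  · simp [hs₇, n64, q4 0, q4 702, q4 201, hm3, hl3, hoff (c + 3) (by omega)]
  rintro _ s₈ hF₈ ⟨rfl, n8, r8, e10, e11⟩
  have hne : c * n + m ≠ (c + 3) * n + (len c - 1 - m) := by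
    rw [add_mul]
    omega
  refine runs_seq (runs_setNat (runs_setNat ⟨rfl, ?_, ?_, ?_, ?_, ?_⟩))
  · simp [n8, q7, hm3]
  · simp [n8, q7, n3', e1, add_assoc]
  · change entry s₈ _ = _
    rw [e11 _ hne]
    change entry s₆ _ = _
    rw [k6, e7]
    exact hreg
  · change entry s₈ _ = _
    rw [e10]
    change regs s₆ = _
    rw [e9, hreg5]
    exact congrArg flipEntry hreg
  · intro y h1 h2
    change entry s₈ _ = _
    rw [e11 _ h2]
    change entry s₆ _ = _
    rw [k6, e8 _ h1]
    exact hE y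

/-- The entries of a chain and of its reversal are in place. -/
def ChainAt (s : Store) (n : ℕ) (V p : ℕ → ℂ) (first len : ℕ → ℕ) (lo hi : ℕ → ℝ) (c : ℕ) : Prop :=
  ∀ m < len c, entry s (c * n + m) = edgeEntry V p first len lo hi c m ∧
    entry s ((c + 3) * n + (len c - 1 - m)) = flipEntry (edgeEntry V p first len lo hi c m)

theorem chain_spec (h : Input s n V p first len lo hi) {c : ℕ} (hc : c < 3)
    (ho : ∀ c < 6, s.nat aOff c = c * n) :
    Runs (chain c) s fun t s' => t ≤ 38 * n + 6 ∧ s'.nat aLen c = len c ∧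
      (∀ c', c' ≠ c → s'.nat aLen c' = s.nat aLen c') ∧ ChainAt s' n V p first len lo hi c ∧
      ∀ y, (∀ m < n, y ≠ c * n + m ∧ y ≠ (c + 3) * n + m) → entry s' y = entry s y := by
  have hn := h.three_le
  have hl := h.len_le c hc
  have p1 := h.len_pos c hc
  refine runs_seq (runs_setNat (runs_seq (runs_setReal (runs_seq (runs_setReal (runs_seq
    (runs_setNat (runs_seq (runs_setNat ?_)))))))))
  set s₁ := Store.setNat _ 702 _ _ with hs₁
  have q1 : ∀ a, a < 700 → a ≠ aLen → s₁.nat a = s.nat a := by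
    intro a h1 h2
    funext r
    simp only [hs₁, Store.setReal_nat, Store.setNat_nat]
    repeat rw [if_neg (by omega)]
  have q2 : ∀ a, a < 700 → s₁.real a = s.real a := by
    intro a h1
    funext r
    simp only [hs₁, Store.setReal_real, Store.setNat_real]
    repeat rw [if_neg (by omega)]
  have i1 : Input s₁ n V p first len lo hi := h.congr (q1 _ (by norm_num) (by norm_num))
    (q2 _ (by norm_num)) (q2 _ (by norm_num)) (q2 _ (by norm_num))
  have c1 : (c + 1) % 3 < 3 := Nat.mod_lt _ (by norm_num)
  have c2 : (c + 2) % 3 < 3 := Nat.mod_lt _ (by norm_num)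
  have a1 : s₁.nat aLen c = len c := by simp [hs₁, h.nlen c hc]
  have a2 : ∀ c', c' ≠ c → s₁.nat aLen c' = s.nat aLen c' := fun c' hc' => by simp [hs₁, hc']
  have a3 : s₁.real 702 0 = (coef p c).re := by
    simp [hs₁, coef, h.pre _ c1, h.pre _ c2]
  have a4 : s₁.real 703 0 = (coef p c).im := by
    simp [hs₁, coef, h.pim _ c1, h.pim _ c2]
  have a5 : s₁.nat 700 0 = first c := by simp [hs₁, h.nfirst c hc]
  have a6 : s₁.nat 702 0 = 0 := by simp [hs₁]
  have a7 : ∀ y, entry s₁ y = entry s y := entry_congr fun a _ h2 => q2 a (by omega)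
  refine (runs_loop (fun t s' => ∃ m ≤ len c, t = 38 * m ∧ s'.nat 702 0 = m ∧
    s'.nat 700 0 = (first c + m) % n ∧
    (∀ m' < m, entry s' (c * n + m') = edgeEntry V p first len lo hi c m' ∧
      entry s' ((c + 3) * n + (len c - 1 - m')) =
        flipEntry (edgeEntry V p first len lo hi c m')) ∧
    ∀ y, (∀ m < n, y ≠ c * n + m ∧ y ≠ (c + 3) * n + m) → entry s' y = entry s y)
    (fun s' => len c - s'.nat 702 0) ?_ ?_).mono ?_
  · refine ⟨0, by omega, rfl, a6, ?_, by omega, fun y _ => a7 y⟩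
    rw [a5, add_zero, Nat.mod_eq_of_lt (h.first_lt c hc)]
  · rintro t s₂ hF ⟨m, hm, ht, b1, b2, b3, b4⟩ hb
    have i2 : Input s₂ n V p first len lo hi := i1.congr (hF.1 _ rfl) (hF.2 _ rfl) (hF.2 _ rfl)
      (hF.2 _ rfl)
    have hb' : m < len c := by simpa [b1, i2.nlen c hc] using hb
    refine (chainStep_spec i2 hc (fun c hc => ?_) b1 hb' b2 ?_ ?_).mono ?_
    · rw [hF.1 _ rfl, q1 _ (by norm_num) (by norm_num), ho c hc]
    · rw [hF.2 _ rfl, a3]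
    · rw [hF.2 _ rfl, a4]
    · rintro _ s₃ - ⟨rfl, d1, d2, d3, d4, d5⟩
      have hmul : (c + 3) * n = c * n + 3 * n := by ring
      refine ⟨⟨m + 1, hb', by omega, d1, d2, fun m' hm' => ?_, fun y hy => ?_⟩, by omega⟩
      · rcases Nat.lt_succ_iff_lt_or_eq.1 hm' with h1 | rfl
        · rw [d5 _ (by omega) (by omega), d5 _ (by omega) (by omega)]
          exact b3 m' h1
        · exact ⟨d3, d4⟩
      · have g1 := (hy m (by omega)).1
        have g2 := (hy (len c - 1 - m) (by omega)).2
        rw [d5 y g1 g2, b4 y hy]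
  · rintro t s₂ hF ⟨t', rfl, ⟨m, hm, ht, b1, b2, b3, b4⟩, hb⟩
    have l2 : s₂.nat 0 (2 + 2 * c) = len c := by rw [hF.1 _ rfl, i1.nlen c hc]
    have hb' : len c ≤ m := by simpa [b1, l2] using hb
    have e : m = len c := by omega
    subst e
    have hL : s₂.nat aLen = s₁.nat aLen := hF.1 _ rfl
    have ht' : 38 * len c ≤ 38 * n := Nat.mul_le_mul_left _ hl
    exact ⟨by omega, by rw [hL, a1], fun c' hc' => by rw [hL, a2 c' hc'], b3, b4⟩

end

/-! ## Powers of two, offsets and signs -/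

/-- Writes a table of the powers of two below the number of vertices. -/
def powers : Prog :=
  nset vLog 0 ;; nset 700 1 ;; .loop (.natLt (nv 700) (nv 0))
    (.setNat aPow (nv vLog) (nv 700) ;; nset vLog (nv vLog + 1) ;; nset 700 (nv 700 + nv 700))

/-- Fixes the places of the chains and of the tables of leaves. -/
def offsets : Prog :=
  .setNat aOff 0 0 ;; .setNat aOff 1 (nv 0) ;; .setNat aOff 2 (.load aOff 1 + nv 0) ;;
  .setNat aOff (.const 3) (.load aOff 2 + nv 0) ;;
  .setNat aOff (.const 4) (.load aOff (.const 3) + nv 0) ;;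
  .setNat aOff (.const 5) (.load aOff (.const 4) + nv 0) ;;
  .setNat aCutOff 0 0 ;; .setNat aCutOff 1 (nv 0 + nv 0 + nv 0 + 1) ;;
  .setNat aCutOff 2 (.load aCutOff 1 + .load aCutOff 1)

theorem powers_spec {s : Store} {n : ℕ} (hn : s.nat 0 0 = n) :
    Runs powers s fun t s' => ∃ K, t ≤ 4 * K + 3 ∧ s'.nat vLog 0 = K ∧ n ≤ 2 ^ K ∧
      (K = 0 ∨ 2 ^ (K - 1) < n) ∧ ∀ k < K, s'.nat aPow k = 2 ^ k := by
  refine runs_seq (runs_setNat (runs_seq (runs_setNat ?_)))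
  set s₁ := Store.setNat _ 700 _ _ with hs₁
  refine (runs_loop (fun t s' => ∃ K, t = 4 * K ∧ s'.nat vLog 0 = K ∧ s'.nat 700 0 = 2 ^ K ∧
    (K = 0 ∨ 2 ^ (K - 1) < n) ∧ ∀ k < K, s'.nat aPow k = 2 ^ k)
    (fun s' => n - s'.nat 700 0) ?_ ?_).mono ?_
  · exact ⟨0, rfl, by simp [hs₁], by simp [hs₁], Or.inl rfl, by omega⟩
  · rintro t s₂ hF ⟨K, ht, b1, b2, -, b4⟩ hb
    have e : s₂.nat 0 0 = n := by rw [hF.1 _ rfl]; simpa [hs₁] using hn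
    have hb' : 2 ^ K < n := by simpa [b2, e] using hb
    have p : 0 < 2 ^ K := by positivity
    have p' : 2 ^ (K + 1) = 2 ^ K + 2 ^ K := by ring
    refine runs_seq (runs_setNat (runs_seq (runs_setNat (runs_setNat
      ⟨⟨K + 1, by omega, ?_, ?_, Or.inr (by simpa using hb'), ?_⟩, ?_⟩))))
    · simp [b1]
    · simp [b2, p']
    · intro k hk
      rcases Nat.lt_succ_iff_lt_or_eq.1 hk with h1 | rfl
      · have : k ≠ K := by omega
        simp [b1, this, b4 k h1]
      · simp [b1, b2]
    · simp [b2]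
      omega
  · rintro t s₂ hF ⟨t', rfl, ⟨K, ht, b1, b2, b3, b4⟩, hb⟩
    have e : s₂.nat 0 0 = n := by rw [hF.1 _ rfl]; simpa [hs₁] using hn
    have hb' : n ≤ 2 ^ K := by simpa [b2, e] using hb
    exact ⟨K, by omega, b1, hb', b3, b4⟩

theorem offsets_spec {s : Store} {n : ℕ} (hn : s.nat 0 0 = n) :
    Runs offsets s fun t s' => t = 9 ∧ (∀ c < 6, s'.nat aOff c = c * n) ∧
      ∀ c < 3, s'.nat aCutOff c = c * (3 * n + 1) := by
  refine runs_seq (runs_setNat (runs_seq (runs_setNat (runs_seq (runs_setNat (runs_seq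
    (runs_setNat (runs_seq (runs_setNat (runs_seq (runs_setNat (runs_seq (runs_setNat (runs_seq
      (runs_setNat (runs_setNat ⟨rfl, ?_, ?_⟩))))))))))))))))
  · intro c hc
    interval_cases c <;> simp [hn] <;> ring
  · intro c hc
    interval_cases c <;> simp [hn] <;> ring

/-- The vector `w` is in the half plane on the left of `u`, including the ray along `u`. -/
def LeftOf (u w : ℂ) : Prop :=
  0 < cross u w ∨ cross u w = 0 ∧ 0 < u.re * w.re + u.im * w.im

/-- Compares the directions stored at two positions. -/
def leftTest (i j : NatExpr) : Test :=
  .or (.realLt 0 (.load aDX i * .load aDY j - .load aDY i * .load aDX j))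
    (.and (.not (.realLt (.load aDX i * .load aDY j - .load aDY i * .load aDX j) 0))
      (.realLt 0 (.load aDX i * .load aDX j + .load aDY i * .load aDY j)))

theorem leftTest_holds {s : Store} {i j : NatExpr} {o a o' b : ℕ} (hi : i.eval s = o + a)
    (hj : j.eval s = o' + b) : (leftTest i j).Holds s ↔ LeftOf (chD s o a) (chD s o' b) := by
  have key : ∀ x y : ℝ, (0 < x ∨ ¬ x < 0 ∧ 0 < y) ↔ (0 < x ∨ x = 0 ∧ 0 < y) := by
    intro x y
    constructor
    · rintro (h | ⟨h1, h2⟩)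
      · exact Or.inl h
      · rcases (not_lt.1 h1).lt_or_eq with h3 | h3
        · exact Or.inl h3
        · exact Or.inr ⟨h3.symm, h2⟩
    · rintro (h | ⟨h1, h2⟩)
      · exact Or.inl h
      · exact Or.inr ⟨h1.not_lt, h2⟩
  rw [LeftOf, ← key]
  simp [leftTest, cross, chD, hi, hj]

/-- The position of the first edge of a chain. -/
def firstPos (c : ℕ) : NatExpr := .load aOff (.const c)
/-- The position of the last edge of a chain. -/
def lastPos (c : ℕ) : NatExpr := .load aOff (.const c) + (.load aLen (.const c) - 1)

/-- Finds the side of a chain with respect to the first edge of chain `i`; a chain that is not on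
one side is noted. -/
def signStep (i c : ℕ) : Prog :=
  .ite (leftTest (firstPos i) (firstPos c))
    (.setReal aSign (.const c) 1 ;;
      .ite (leftTest (firstPos i) (lastPos c)) .skip (nset 700 1))
    (.setReal aSign (.const c) (0 - 1) ;;
      .ite (leftTest (firstPos i) (lastPos c)) (nset 700 1) .skip)

/-- Tries the first edge of chain `i` unless an earlier attempt succeeded. -/
def trySign (i : ℕ) : Prog :=
  .ite (.natLt 0 (nv 700)) (nset 700 0 ;; signStep i 0 ;; signStep i 1 ;; signStep i 2) .skip

/-- Finds signs that bring all chains to one half plane. -/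
def signs : Prog := nset 700 1 ;; trySign 0 ;; trySign 1 ;; trySign 2

/-- With respect to the first edge of chain `i`, chain `c` is on one side. -/
def OneSide (s : Store) (len off : ℕ → ℕ) (i c : ℕ) : Prop :=
  LeftOf (chD s (off i) 0) (chD s (off c) 0) ↔ LeftOf (chD s (off i) 0) (chD s (off c) (len c - 1))

open Classical in
/-- The sign of the side of a chain. -/
noncomputable def sideSign (s : Store) (off : ℕ → ℕ) (i c : ℕ) : ℝ :=
  if LeftOf (chD s (off i) 0) (chD s (off c) 0) then 1 else -1

section
variable {s : Store} {len off : ℕ → ℕ}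

theorem signStep_spec (ho : ∀ c < 3, s.nat aOff c = off c) (hl : ∀ c < 3, s.nat aLen c = len c)
    {i c : ℕ} (hi : i < 3) (hc : c < 3) :
    Runs (signStep i c) s fun t s' => t ≤ 4 ∧
      (s'.nat 700 0 = 0 ↔ s.nat 700 0 = 0 ∧ OneSide s len off i c) ∧
      s'.real aSign c = sideSign s off i c ∧
      ∀ c', c' ≠ c → s'.real aSign c' = s.real aSign c' := by
  have k1 : ∀ s' : Store, s'.nat = s.nat → (∀ a, a ≠ aSign → s'.real a = s.real a) →
      ((leftTest (firstPos i) (lastPos c)).Holds s' ↔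
        LeftOf (chD s (off i) 0) (chD s (off c) (len c - 1))) := by
    intro s' h1 h2
    have e : chD s' = chD s := by
      funext o m
      simp only [chD, h2 aDX (by norm_num), h2 aDY (by norm_num)]
    rw [← e]
    refine leftTest_holds ?_ ?_ <;> simp [firstPos, lastPos, h1, ho i hi, ho c hc, hl c hc]
  have k2 : (leftTest (firstPos i) (firstPos c)).Holds s ↔
      LeftOf (chD s (off i) 0) (chD s (off c) 0) := by
    refine leftTest_holds ?_ ?_ <;> simp [firstPos, ho i hi, ho c hc]
  have r : ∀ v : ℝ, ∀ a, a ≠ aSign → (s.setReal aSign c v).real a = s.real a := by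
    intro v a ha
    funext x
    simp [ha]
  refine runs_ite (fun h => ?_) (fun h => ?_)
  · have h' := k2.1 h
    refine runs_seq (runs_setReal (runs_ite (fun g => runs_skip ?_) (fun g => runs_setNat ?_)))
    · have g' := (k1 (s.setReal aSign c _) rfl (r _)).1 g
      refine ⟨by norm_num, ?_, ?_, fun c' hc' => ?_⟩
      · simp [OneSide, h', g']
      · simp [sideSign, h']
      · simp [hc']
    · have g' : ¬ LeftOf _ _ := fun w => g ((k1 (s.setReal aSign c _) rfl (r _)).2 w)
      refine ⟨by norm_num, ?_, ?_, fun c' hc' => ?_⟩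
      · simp [OneSide, h', g']
      · simp [sideSign, h']
      · simp [hc']
  · have h' : ¬ LeftOf _ _ := fun w => h (k2.2 w)
    refine runs_seq (runs_setReal (runs_ite (fun g => runs_setNat ?_) (fun g => runs_skip ?_)))
    · have g' := (k1 (s.setReal aSign c _) rfl (r _)).1 g
      refine ⟨by norm_num, ?_, ?_, fun c' hc' => ?_⟩
      · simp [OneSide, h', g']
      · simp [sideSign, h']
      · simp [hc']
    · have g' : ¬ LeftOf _ _ := fun w => g ((k1 (s.setReal aSign c _) rfl (r _)).2 w)
      refine ⟨by norm_num, ?_, ?_, fun c' hc' => ?_⟩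
      · simp [OneSide, h', g']
      · simp [sideSign, h']
      · simp [hc']

/-- The outcome of the attempt to use chain `i`. -/
def SignsFound (s : Store) (len off : ℕ → ℕ) (i : ℕ) (s' : Store) : Prop :=
  ∀ c < 3, OneSide s len off i c ∧ s'.real aSign c = sideSign s off i c

theorem trySign_spec {s₀ : Store} (hA : ∀ a, a ≠ 700 → s.nat a = s₀.nat a)
    (hA' : ∀ a, a ≠ aSign → s.real a = s₀.real a)
    (ho : ∀ c < 3, s₀.nat aOff c = off c) (hl : ∀ c < 3, s₀.nat aLen c = len c)
    {i : ℕ} (hi : i < 3) (h0 : s.nat 700 0 = 0 → ∃ i < 3, SignsFound s₀ len off i s) :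
    Runs (trySign i) s fun t s' => t ≤ 14 ∧ (∀ a, a ≠ 700 → s'.nat a = s₀.nat a) ∧
      (∀ a, a ≠ aSign → s'.real a = s₀.real a) ∧
      (s'.nat 700 0 = 0 → ∃ i < 3, SignsFound s₀ len off i s') ∧
      (s.nat 700 0 = 0 ∨ (∀ c < 3, OneSide s₀ len off i c) → s'.nat 700 0 = 0) := by
  refine runs_ite (fun h => ?_) (fun h => runs_skip ?_)
  · have step : ∀ c < 3, ∀ s₁ : Store, (∀ a, a ≠ 700 → s₁.nat a = s₀.nat a) →
        (∀ a, a ≠ aSign → s₁.real a = s₀.real a) →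
        Runs (signStep i c) s₁ fun t s' => t ≤ 4 ∧
          (s'.nat 700 0 = 0 ↔ s₁.nat 700 0 = 0 ∧ OneSide s₀ len off i c) ∧
          s'.real aSign c = sideSign s₀ off i c ∧
          (∀ c', c' ≠ c → s'.real aSign c' = s₁.real aSign c') ∧
          (∀ a, a ≠ 700 → s'.nat a = s₀.nat a) ∧ ∀ a, a ≠ aSign → s'.real a = s₀.real a := by
      intro c hc s₁ h1 h2
      have e : chD s₁ = chD s₀ := by
        funext o m
        simp only [chD, h2 aDX (by norm_num), h2 aDY (by norm_num)]
      refine (signStep_spec (s := s₁) (len := len) (off := off) (by rw [h1 _ (by norm_num)]; exact ho)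
        (by rw [h1 _ (by norm_num)]; exact hl) hi hc).mono ?_
      rintro t s₂ hF ⟨g1, g2, g3, g4⟩
      have e' : sideSign s₁ off i c = sideSign s₀ off i c := by
        unfold sideSign
        rw [e]
      simp only [OneSide, e] at g2
      rw [e'] at g3
      refine ⟨g1, g2, g3, g4, fun a ha => ?_, fun a ha => ?_⟩
      · rw [hF.1 a (by simp [Prog.writesNat, signStep, Ne.symm ha]), h1 a ha]
      · rw [hF.2 a (by simp [Prog.writesReal, signStep, Ne.symm ha]), h2 a ha]
    refine runs_seq (runs_setNat ?_)
    set s₁ := Store.setNat s 700 _ _ with hs₁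
    refine (step 0 (by norm_num) s₁ (fun a ha => by rw [hs₁, setNat_nat_of_ne ha, hA a ha])
      hA').seq ?_
    rintro t₂ s₂ - ⟨a1, a2, a3, a4, a5, a6⟩
    refine (step 1 (by norm_num) s₂ a5 a6).seq ?_
    rintro t₃ s₃ - ⟨b1, b2, b3, b4, b5, b6⟩
    refine (step 2 (by norm_num) s₃ b5 b6).mono ?_
    rintro t₄ s₄ - ⟨c1, c2, c3, c4, c5, c6⟩
    have e1 : s₁.nat 700 0 = 0 := by simp [hs₁]
    refine ⟨by omega, c5, c6, fun h => ?_, fun h' => ?_⟩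
    · rw [c2, b2, a2] at h
      refine ⟨i, hi, fun c hc => ?_⟩
      interval_cases c
      · exact ⟨h.1.1.2, by rw [c4 _ (by norm_num), b4 _ (by norm_num), a3]⟩
      · exact ⟨h.1.2, by rw [c4 _ (by norm_num), b3]⟩
      · exact ⟨h.2, c3⟩
    · rcases h' with h' | h'
      · simp [h'] at h
      · rw [c2, b2, a2]
        exact ⟨⟨⟨e1, h' 0 (by norm_num)⟩, h' 1 (by norm_num)⟩, h' 2 (by norm_num)⟩
  · have h' : s.nat 700 0 = 0 := by simpa using h
    exact ⟨by norm_num, hA, hA', h0, fun _ => h'⟩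

theorem signs_spec (ho : ∀ c < 3, s.nat aOff c = off c) (hl : ∀ c < 3, s.nat aLen c = len c)
    (hex : ∃ i < 3, ∀ c < 3, OneSide s len off i c) :
    Runs signs s fun t s' => t ≤ 43 ∧ ∃ i < 3, SignsFound s len off i s' := by
  refine runs_seq (runs_setNat ?_)
  set s₁ := Store.setNat s 700 _ _ with hs₁
  refine (trySign_spec (s := s₁) (s₀ := s) (fun a ha => setNat_nat_of_ne ha) (fun _ _ => rfl) ho hl
    (i := 0) (by norm_num) (by simp [hs₁])).seq ?_
  rintro t₂ s₂ - ⟨a1, a2, a3, a4, a5⟩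
  refine (trySign_spec a2 a3 ho hl (i := 1) (by norm_num) a4).seq ?_
  rintro t₃ s₃ - ⟨b1, b2, b3, b4, b5⟩
  refine (trySign_spec b2 b3 ho hl (i := 2) (by norm_num) b4).mono ?_
  rintro t₄ s₄ - ⟨c1, c2, c3, c4, c5⟩
  refine ⟨by omega, c4 ?_⟩
  obtain ⟨i, hi, h⟩ := hex
  interval_cases i
  · exact c5 (Or.inl (b5 (Or.inl (a5 (Or.inr h)))))
  · exact c5 (Or.inl (b5 (Or.inr h)))
  · exact c5 (Or.inr h)

end

/-! ## Merging the chains -/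

/-- The current edge of chain `c'` comes before the current edge of chain `c`. -/
def beforeTest (c' c : ℕ) : Test :=
  .and (.natLt (.load 710 (.const c')) (.load aLen (.const c')))
    (.realLt 0 (.load aSign (.const c') * .load aSign (.const c) *
      (.load aDX (.load aOff (.const c') + .load 710 (.const c')) *
          .load aDY (.load aOff (.const c) + .load 710 (.const c)) -
        .load aDY (.load aOff (.const c') + .load 710 (.const c')) *
          .load aDX (.load aOff (.const c) + .load 710 (.const c)))))

/-- Computes the next position in chain `c`; the other chains are `c₁` and `c₂`. -/
def mergeMove (c c₁ c₂ : ℕ) : Prog :=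
  .ite (.and (.natLt (.load 710 (.const c)) (.load aLen (.const c)))
      (.and (.not (beforeTest c₁ c)) (.not (beforeTest c₂ c))))
    (.setNat 711 (.const c) (.load 710 (.const c) + 1)) (.setNat 711 (.const c) (.load 710 (.const c)))

/-- Outputs the current triple of edges. -/
def mergeOut : Prog :=
  .setNat 41 (nv vTrip) (.load 710 0) ;; .setNat 42 (nv vTrip) (.load 710 1) ;;
  .setNat 43 (nv vTrip) (.load 710 2) ;; nset vTrip (nv vTrip + 1)

/-- Moves to the next position in chain `c` and enters it in the table of leaves. -/
def mergeCut (c : ℕ) : Prog :=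
  .setNat 710 (.const c) (.load 711 (.const c)) ;;
  .setNat aCut (.load aCutOff (.const c) + nv 712) (.load 711 (.const c))

/-- Creates a leaf. -/
def mergeStep : Prog :=
  mergeMove 0 1 2 ;; mergeMove 1 0 2 ;; mergeMove 2 0 1 ;;
  .ite (.and (.natLt (.load 710 0) (.load 711 0)) (.and (.natLt (.load 710 1) (.load 711 1))
    (.natLt (.load 710 2) (.load 711 2)))) mergeOut .skip ;;
  nset 712 (nv 712 + 1) ;; mergeCut 0 ;; mergeCut 1 ;; mergeCut 2 ;; .skip

/-- Merges the chains by angle. -/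
def merge : Prog :=
  .setNat 711 0 0 ;; .setNat 711 1 0 ;; .setNat 711 2 0 ;; nset 712 0 ;;
  mergeCut 0 ;; mergeCut 1 ;; mergeCut 2 ;;
  .loop (.or (.natLt (.load 710 0) (.load aLen 0)) (.or (.natLt (.load 710 1) (.load aLen 1))
    (.natLt (.load 710 2) (.load aLen 2)))) mergeStep ;;
  nset vLeaves (nv 712)

/-- The data for the merge. -/
structure MergeCtx (s : Store) (len off : ℕ → ℕ) (M : ℕ) (eps : ℕ → ℝ) (θ : ℕ → ℕ → ℝ) : Prop where
  hoff : ∀ c < 3, s.nat aOff c = off c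
  hlen : ∀ c < 3, s.nat aLen c = len c
  hsign : ∀ c < 3, s.real aSign c = eps c
  hcutOff : ∀ c < 3, s.nat aCutOff c = c * M
  bound : len 0 + len 1 + len 2 < M
  angle : ∀ c < 3, ∀ c' < 3, ∀ m < len c, ∀ m' < len c',
    (0 < eps c * eps c' * cross (chD s (off c) m) (chD s (off c') m') ↔ θ c m < θ c' m')
  mono : ∀ c < 3, ∀ m m', m < m' → m' < len c → θ c m < θ c m'

theorem MergeCtx.congr {s s' : Store} {len off : ℕ → ℕ} {M : ℕ} {eps : ℕ → ℝ} {θ : ℕ → ℕ → ℝ}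
    (T : MergeCtx s len off M eps θ) (h1 : s'.nat aOff = s.nat aOff) (h2 : s'.nat aLen = s.nat aLen)
    (h3 : s'.nat aCutOff = s.nat aCutOff) (h4 : s'.real = s.real) :
    MergeCtx s' len off M eps θ := by
  obtain ⟨a1, a2, a3, a4, a5, a6, a7⟩ := T
  have e : chD s' = chD s := by
    funext o m
    simp only [chD, h4]
  refine ⟨?_, ?_, ?_, ?_, a5, ?_, a7⟩ <;> simpa only [h1, h2, h3, h4, e]

/-- The entry of the table of leaves. -/
def cutAt (s : Store) (M c r : ℕ) : ℕ := s.nat aCut (c * M + r)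

/-- Chain `c` advances from the positions `a`. -/
def Moves (len : ℕ → ℕ) (θ : ℕ → ℕ → ℝ) (a : ℕ → ℕ) (c : ℕ) : Prop :=
  a c < len c ∧ ∀ c' < 3, a c' < len c' → θ c (a c) ≤ θ c' (a c')

theorem exists_moves {len : ℕ → ℕ} {θ : ℕ → ℕ → ℝ} {a : ℕ → ℕ} (h : ∃ c < 3, a c < len c) :
    ∃ c < 3, Moves len θ a c := by
  obtain ⟨c, hc, h⟩ := h
  obtain ⟨c', h1, h2⟩ := Finset.exists_min_image ((Finset.range 3).filter fun c => a c < len c)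
    (fun c => θ c (a c)) ⟨c, by simp [hc, h]⟩
  simp only [Finset.mem_filter, Finset.mem_range] at h1 h2
  exact ⟨c', h1.1, h1.2, fun c'' h3 h4 => h2 c'' ⟨h3, h4⟩⟩

/-- The leaves before position `a` come before the others. -/
def Separates (len : ℕ → ℕ) (θ : ℕ → ℕ → ℝ) (a : ℕ → ℕ) : Prop :=
  ∀ c < 3, ∀ c' < 3, ∀ m < a c, ∀ m' < len c', a c' ≤ m' → θ c m < θ c' m'

theorem Separates.step {len : ℕ → ℕ} {θ : ℕ → ℕ → ℝ} {a b : ℕ → ℕ} (h : Separates len θ a)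
    (hmono : ∀ c < 3, ∀ m m', m < m' → m' < len c → θ c m < θ c m')
    (hb : ∀ c < 3, Moves len θ a c ∧ b c = a c + 1 ∨ ¬ Moves len θ a c ∧ b c = a c) :
    Separates len θ b := by
  intro c hc c' hc' m hm m' hm' hle
  rcases hb c hc with ⟨g1, g2⟩ | ⟨g1, g2⟩
  · rcases hb c' hc' with ⟨g3, g4⟩ | ⟨g3, g4⟩
    · rcases (show m < a c ∨ m = a c by omega) with h1 | rfl
      · exact h c hc c' hc' m h1 m' hm' (by omega)
      · exact (g1.2 c' hc' g3.1).trans_lt (hmono c' hc' _ _ (by omega) hm')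
    · rcases (show m < a c ∨ m = a c by omega) with h1 | rfl
      · exact h c hc c' hc' m h1 m' hm' (by omega)
      · have h2 : a c' < len c' := by omega
        have h3 : ∃ c'' < 3, a c'' < len c'' ∧ θ c'' (a c'') < θ c' (a c') := by
          by_contra hcon
          push Not at hcon
          exact g3 ⟨h2, fun c'' h4 h5 => hcon c'' h4 h5⟩
        obtain ⟨c'', h4, h5, h6⟩ := h3
        refine ((g1.2 c'' h4 h5).trans_lt h6).trans_le ?_
        rcases (show a c' = m' ∨ a c' < m' by omega) with h7 | h7
        · rw [h7]
        · exact (hmono c' hc' _ _ h7 hm').le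
  · refine h c hc c' hc' m (by omega) m' hm' ?_
    rcases hb c' hc' with ⟨_, g4⟩ | ⟨_, g4⟩ <;> omega

section
variable {s s₀ : Store} {len off : ℕ → ℕ} {M : ℕ} {eps : ℕ → ℝ} {θ : ℕ → ℕ → ℝ} {a : ℕ → ℕ}

theorem beforeTest_holds (T : MergeCtx s len off M eps θ) (ha : ∀ c < 3, s.nat 710 c = a c)
    {c c' : ℕ} (hc : c < 3) (hc' : c' < 3) (hl : a c < len c) :
    (beforeTest c' c).Holds s ↔ a c' < len c' ∧ θ c' (a c') < θ c (a c) := by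
  simp only [beforeTest, Test.holds_and, Test.holds_natLt, Test.holds_realLt, NatExpr.eval_load,
    eval_natConst, RealExpr.eval_mul, RealExpr.eval_sub, RealExpr.eval_load, NatExpr.eval_add,
    RealExpr.eval_zero, T.hlen c' hc', ha c' hc', T.hoff c hc, T.hoff c' hc', ha c hc, T.hsign c hc,
    T.hsign c' hc']
  refine and_congr_right fun h => ?_
  rw [← T.angle c' hc' c hc (a c') h (a c) hl]
  rfl

theorem mergeMove_spec (T : MergeCtx s len off M eps θ) (ha : ∀ c < 3, s.nat 710 c = a c)
    {c c₁ c₂ : ℕ} (hc : c < 3) (hc₁ : c₁ < 3) (hc₂ : c₂ < 3)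
    (hall : ∀ c' < 3, c' = c ∨ c' = c₁ ∨ c' = c₂) :
    Runs (mergeMove c c₁ c₂) s fun t s' => t = 2 ∧ s'.real = s.real ∧
      (∀ x, x ≠ 711 → s'.nat x = s.nat x) ∧ (∀ c', c' ≠ c → s'.nat 711 c' = s.nat 711 c') ∧
      (Moves len θ a c ∧ s'.nat 711 c = a c + 1 ∨ ¬ Moves len θ a c ∧ s'.nat 711 c = a c) := by
  have key : (Test.and (.natLt (.load 710 (.const c)) (.load aLen (.const c)))
      (.and (.not (beforeTest c₁ c)) (.not (beforeTest c₂ c)))).Holds s ↔ Moves len θ a c := by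
    simp only [Test.holds_and, Test.holds_not, Test.holds_natLt, NatExpr.eval_load, eval_natConst,
      ha c hc, T.hlen c hc, Moves]
    refine and_congr_right fun h => ?_
    rw [beforeTest_holds T ha hc hc₁ h, beforeTest_holds T ha hc hc₂ h]
    constructor
    · rintro ⟨h1, h2⟩ c' hc' h3
      by_contra h4
      rcases hall c' hc' with rfl | rfl | rfl
      · exact h4 le_rfl
      · exact h1 ⟨h3, not_le.1 h4⟩
      · exact h2 ⟨h3, not_le.1 h4⟩
    · exact fun h1 => ⟨fun h2 => (h1 c₁ hc₁ h2.1).not_gt h2.2,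
        fun h2 => (h1 c₂ hc₂ h2.1).not_gt h2.2⟩
  refine runs_ite (fun h => runs_setNat ⟨rfl, rfl, fun x hx => setNat_nat_of_ne hx, ?_, ?_⟩)
    (fun h => runs_setNat ⟨rfl, rfl, fun x hx => setNat_nat_of_ne hx, ?_, ?_⟩)
  · intro c' hc'
    simp [hc']
  · exact Or.inl ⟨key.1 h, by simp [ha c hc]⟩
  · intro c' hc'
    simp [hc']
  · exact Or.inr ⟨fun h' => h (key.2 h'), by simp [ha c hc]⟩

theorem mergeCut_spec {c r b : ℕ} (hM : s.nat aCutOff c = c * M) (hr : s.nat 712 0 = r)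
    (hb : s.nat 711 c = b) :
    Runs (mergeCut c) s fun t s' => t = 2 ∧ s'.real = s.real ∧
      (∀ x, x ≠ 710 → x ≠ aCut → s'.nat x = s.nat x) ∧ s'.nat 710 c = b ∧
      (∀ c', c' ≠ c → s'.nat 710 c' = s.nat 710 c') ∧ s'.nat aCut (c * M + r) = b ∧
      ∀ x, x ≠ c * M + r → s'.nat aCut x = s.nat aCut x := by
  refine runs_seq (runs_setNat (runs_setNat ⟨rfl, rfl, ?_, ?_, ?_, ?_, ?_⟩))
  · intro x h1 h2
    rw [setNat_nat_of_ne h2, setNat_nat_of_ne h1]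
  · simp [hb]
  · intro c' hc'
    simp [hc']
  · simp [hM, hr, hb]
  · intro x hx
    simp [hM, hr, hx]

/-- Three cuts with the same new positions. -/
theorem mergeCuts_spec {r : ℕ} {b : ℕ → ℕ} (hM : ∀ c < 3, s.nat aCutOff c = c * M)
    (hr : s.nat 712 0 = r) (hb : ∀ c < 3, s.nat 711 c = b c) (hrM : r < M)
    {R : ℕ → Store → Prop} {q : Prog}
    (h : ∀ s', s'.real = s.real → (∀ x, x ≠ 710 → x ≠ aCut → s'.nat x = s.nat x) →
      (∀ c < 3, s'.nat 710 c = b c) → (∀ c < 3, cutAt s' M c r = b c) →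
      (∀ c < 3, ∀ r' < r, cutAt s' M c r' = cutAt s M c r') →
      Runs q s' fun t s'' => R (6 + t) s'') :
    Runs (mergeCut 0 ;; mergeCut 1 ;; mergeCut 2 ;; q) s R := by
  refine (mergeCut_spec (hM 0 (by norm_num)) hr (hb 0 (by norm_num))).seq ?_
  rintro _ s₁ - ⟨rfl, a1, a2, a3, a4, a5, a6⟩
  refine (mergeCut_spec (c := 1) (r := r) (b := b 1) (by rw [a2 _ (by norm_num) (by norm_num)]; exact hM 1 (by norm_num))
    (by rw [a2 _ (by norm_num) (by norm_num)]; exact hr)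
    (by rw [a2 _ (by norm_num) (by norm_num)]; exact hb 1 (by norm_num))).seq ?_
  rintro _ s₂ - ⟨rfl, b1, b2, b3, b4, b5, b6⟩
  refine (mergeCut_spec (c := 2) (r := r) (b := b 2)
    (by rw [b2 _ (by norm_num) (by norm_num), a2 _ (by norm_num) (by norm_num)]; exact hM 2 (by norm_num))
    (by rw [b2 _ (by norm_num) (by norm_num), a2 _ (by norm_num) (by norm_num)]; exact hr)
    (by rw [b2 _ (by norm_num) (by norm_num), a2 _ (by norm_num) (by norm_num)]; exact hb 2 (by norm_num))).seq ?_
  rintro _ s₃ - ⟨rfl, c1, c2, c3, c4, c5, c6⟩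
  refine (h s₃ (by rw [c1, b1, a1]) (fun x h1 h2 => by rw [c2 x h1 h2, b2 x h1 h2, a2 x h1 h2])
    (fun c hc => ?_) (fun c hc => ?_) (fun c hc r' hr' => ?_)).mono ?_
  · interval_cases c
    · rw [c4 _ (by norm_num), b4 _ (by norm_num), a3]
    · rw [c4 _ (by norm_num), b3]
    · exact c3
  · interval_cases c
    · rw [cutAt, c6 _ (by omega), b6 _ (by omega), a5]
    · rw [cutAt, c6 _ (by omega), b5]
    · exact c5
  · rw [cutAt, cutAt]
    have e : ∀ k < 3, c * M + r' ≠ k * M + r := by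
      intro k hk
      interval_cases c <;> interval_cases k <;> omega
    rw [c6 _ (e 2 (by norm_num)), b6 _ (e 1 (by norm_num)), a6 _ (e 0 (by norm_num))]
  · intro t s' _ hR
    convert hR using 1
    omega

end

/-- The leaves up to position `r` have been created. -/
structure MergeInv (s : Store) (len : ℕ → ℕ) (M : ℕ) (θ : ℕ → ℕ → ℝ) (r : ℕ) : Prop where
  hr : s.nat 712 0 = r
  cur : ∀ c < 3, s.nat 710 c = cutAt s M c r
  le : ∀ c < 3, cutAt s M c r ≤ len c
  rle : r ≤ cutAt s M 0 r + cutAt s M 1 r + cutAt s M 2 r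
  zero : ∀ c < 3, cutAt s M c 0 = 0
  step : ∀ r' < r, ∀ c < 3, cutAt s M c r' ≤ cutAt s M c (r' + 1) ∧
    cutAt s M c (r' + 1) ≤ cutAt s M c r' + 1
  sep : ∀ r' ≤ r, Separates len θ fun c => cutAt s M c r'
  trip : s.nat vTrip 0 ≤ r
  tok : TripleOk len s
  out : ∀ r' < r, (∀ c < 3, cutAt s M c r' < cutAt s M c (r' + 1)) →
    ∃ t < s.nat vTrip 0, ∀ c < 3, s.nat (41 + c) t = cutAt s M c r'

section
variable {s s₀ : Store} {len off : ℕ → ℕ} {M : ℕ} {eps : ℕ → ℝ} {θ : ℕ → ℕ → ℝ} {r : ℕ}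

theorem mergeStep_spec (T : MergeCtx s len off M eps θ) (I : MergeInv s len M θ r)
    (hex : ∃ c < 3, s.nat 710 c < len c) :
    Runs mergeStep s fun t s' => t ≤ 20 ∧ s'.real = s.real ∧ MergeInv s' len M θ (r + 1) := by
  obtain ⟨a, ha⟩ : ∃ a : ℕ → ℕ, ∀ c, a c = cutAt s M c r := ⟨_, fun _ => rfl⟩
  have ha' : ∀ c < 3, s.nat 710 c = a c := fun c hc => by rw [I.cur c hc, ha]
  have hle : ∀ c < 3, a c ≤ len c := fun c hc => by rw [ha]; exact I.le c hc
  have hrle : r ≤ a 0 + a 1 + a 2 := by rw [ha, ha, ha]; exact I.rle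
  refine (mergeMove_spec T ha' (c := 0) (c₁ := 1) (c₂ := 2) (by norm_num) (by norm_num)
    (by norm_num) (by omega)).seq ?_
  rintro _ s₁ - ⟨rfl, a1, a2, a3, a4⟩
  have T₁ := T.congr (a2 _ (by norm_num)) (a2 _ (by norm_num)) (a2 _ (by norm_num)) a1
  have ha₁ : ∀ c < 3, s₁.nat 710 c = a c := by rw [a2 _ (by norm_num)]; exact ha'
  refine (mergeMove_spec T₁ ha₁ (c := 1) (c₁ := 0) (c₂ := 2) (by norm_num) (by norm_num)
    (by norm_num) (by omega)).seq ?_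
  rintro _ s₂ - ⟨rfl, b1, b2, b3, b4⟩
  have T₂ := T₁.congr (b2 _ (by norm_num)) (b2 _ (by norm_num)) (b2 _ (by norm_num)) b1
  have ha₂ : ∀ c < 3, s₂.nat 710 c = a c := by rw [b2 _ (by norm_num)]; exact ha₁
  refine (mergeMove_spec T₂ ha₂ (c := 2) (c₁ := 0) (c₂ := 1) (by norm_num) (by norm_num)
    (by norm_num) (by omega)).seq ?_
  rintro _ s₃ - ⟨rfl, c1, c2, c3, c4⟩
  have n3 : ∀ x, x ≠ 711 → s₃.nat x = s.nat x := fun x hx => by rw [c2 x hx, b2 x hx, a2 x hx]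
  have r3 : s₃.real = s.real := by rw [c1, b1, a1]
  have T₃ := T₂.congr (c2 _ (by norm_num)) (c2 _ (by norm_num)) (c2 _ (by norm_num)) c1
  obtain ⟨b, hb⟩ : ∃ b : ℕ → ℕ, ∀ c, b c = s₃.nat 711 c := ⟨_, fun _ => rfl⟩
  have hmove : ∀ c < 3, Moves len θ a c ∧ b c = a c + 1 ∨ ¬ Moves len θ a c ∧ b c = a c := by
    intro c hc
    rw [hb]
    interval_cases c
    · rw [c3 _ (by norm_num), b3 _ (by norm_num)]
      exact a4
    · rw [c3 _ (by norm_num)]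
      exact b4
    · exact c4
  have hbl : ∀ c < 3, a c ≤ b c ∧ b c ≤ a c + 1 ∧ b c ≤ len c := by
    intro c hc
    rcases hmove c hc with ⟨g1, g2⟩ | ⟨g1, g2⟩
    · have := g1.1
      omega
    · have := hle c hc
      omega
  have hsum : a 0 + a 1 + a 2 + 1 ≤ b 0 + b 1 + b 2 := by
    obtain ⟨c, hc, g⟩ := exists_moves (θ := θ) (a := a) (len := len) (by
      obtain ⟨c, hc, h⟩ := hex
      exact ⟨c, hc, by rwa [ha' c hc] at h⟩)
    have e : b c = a c + 1 := by
      rcases hmove c hc with ⟨-, g2⟩ | ⟨g1, -⟩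
      · exact g2
      · exact absurd g g1
    have h0 := hbl 0 (by norm_num)
    have h1 := hbl 1 (by norm_num)
    have h2 := hbl 2 (by norm_num)
    interval_cases c <;> omega
  have hrM : r + 1 < M := by
    have h0 := hbl 0 (by norm_num)
    have h1 := hbl 1 (by norm_num)
    have h2 := hbl 2 (by norm_num)
    have := T.bound
    omega
  have hcut3 : ∀ c r', cutAt s₃ M c r' = cutAt s M c r' := fun c r' => by
    rw [cutAt, n3 _ (by norm_num), cutAt]
  have next : ∀ t s₄, t ≤ 7 → s₄.real = s.real →
      (∀ x, x < 40 ∨ 43 < x → s₄.nat x = s₃.nat x) → s₄.nat vTrip 0 ≤ r + 1 → TripleOk len s₄ →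
      (∀ r' < r + 1, (∀ c < 3, (if r' = r then a c else cutAt s M c r') <
          if r' = r then b c else cutAt s M c (r' + 1)) →
        ∃ t < s₄.nat vTrip 0, ∀ c < 3, s₄.nat (41 + c) t = if r' = r then a c else cutAt s M c r') →
      Runs (nset 712 (nv 712 + 1) ;; mergeCut 0 ;; mergeCut 1 ;; mergeCut 2 ;; .skip) s₄
        fun t' s' => 2 + (2 + (2 + (t + t'))) ≤ 20 ∧ s'.real = s.real ∧
          MergeInv s' len M θ (r + 1) := by
    intro t s₄ ht r4 n4 htr htok hout
    refine runs_seq (runs_setNat ?_)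
    set s₅ := Store.setNat s₄ 712 _ _ with hs₅
    have n5 : ∀ x, x ≠ 712 → s₅.nat x = s₄.nat x := fun x hx => setNat_nat_of_ne hx
    refine mergeCuts_spec (r := r + 1) (b := b) (M := M) ?_ ?_ ?_ hrM ?_
    · rw [n5 _ (by norm_num), n4 _ (by norm_num)]
      exact T₃.hcutOff
    · simp [hs₅, n4, n3, I.hr]
    · intro c _
      rw [n5 _ (by norm_num), n4 _ (by norm_num), hb]
    intro s₆ r6 n6 d1 d2 d3
    have cut_old : ∀ c < 3, ∀ r' ≤ r, cutAt s₆ M c r' = cutAt s M c r' := by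
      intro c hc r' hr'
      rw [d3 c hc r' (by omega), cutAt, n5 _ (by norm_num), n4 _ (by norm_num), ← cutAt, hcut3]
    have trip_eq : ∀ x, x ≤ 43 → s₆.nat x = s₄.nat x := fun x hx => by
      rw [n6 x (by omega) (by omega), n5 x (by omega)]
    refine runs_skip ⟨by omega, by rw [r6]; exact r4, ?_⟩
    refine ⟨?_, fun c hc => by rw [d1 c hc, d2 c hc], fun c hc => ?_, ?_, fun c hc => ?_, ?_, ?_,
      ?_, ?_, ?_⟩
    · rw [n6 _ (by norm_num) (by norm_num)]
      simp [hs₅, n4, n3, I.hr]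
    · rw [d2 c hc]
      exact (hbl c hc).2.2
    · rw [d2 _ (by norm_num), d2 _ (by norm_num), d2 _ (by norm_num)]
      omega
    · rw [cut_old c hc 0 (by omega)]
      exact I.zero c hc
    · intro r' hr' c hc
      rcases Nat.lt_succ_iff_lt_or_eq.1 hr' with h1 | rfl
      · rw [cut_old c hc _ (by omega), cut_old c hc _ (by omega)]
        exact I.step r' h1 c hc
      · rw [cut_old c hc _ le_rfl, d2 c hc, ← ha]
        have := hbl c hc
        omega
    · intro r' hr'
      have sep_congr : ∀ f g : ℕ → ℕ, (∀ c < 3, f c = g c) → Separates len θ g →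
          Separates len θ f := by
        intro f g hfg hg c hc c' hc' m hm m' hm' hle
        rw [hfg c hc] at hm
        rw [hfg c' hc'] at hle
        exact hg c hc c' hc' m hm m' hm' hle
      rcases (show r' ≤ r ∨ r' = r + 1 by omega) with h1 | rfl
      · exact sep_congr _ _ (fun c hc => cut_old c hc r' h1) (I.sep r' h1)
      · refine sep_congr _ b (fun c hc => d2 c hc) (Separates.step (a := a) ?_ T.mono hmove)
        exact sep_congr _ _ (fun c _ => ha c) (I.sep r le_rfl)
    · rw [trip_eq _ (by norm_num)]
      exact htr
    · exact htok.of_eq fun x _ h2 => trip_eq x h2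
    · intro r' hr' h
      obtain ⟨t', h1, h2⟩ := hout r' hr' fun c hc => by
        have := h c hc
        rw [cut_old c hc r' (by omega)] at this
        split_ifs with e
        · subst e
          rwa [d2 c hc, ← ha] at this
        · rwa [cut_old c hc (r' + 1) (by omega)] at this
      refine ⟨t', by rwa [trip_eq _ (by norm_num)], fun c hc => ?_⟩
      rw [trip_eq _ (by omega), h2 c hc, cut_old c hc r' (by omega)]
      split_ifs with e
      · rw [e, ha]
      · rfl
  have hT3 : ∀ x, 40 ≤ x → x ≤ 43 → s₃.nat x = s.nat x := fun x _ h2 => n3 x (by omega)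
  have test : (Test.and (.natLt (.load 710 0) (.load 711 0)) (.and (.natLt (.load 710 1)
      (.load 711 1)) (.natLt (.load 710 2) (.load 711 2)))).Holds s₃ ↔ ∀ c < 3, a c < b c := by
    simp only [Test.holds_and, Test.holds_natLt, NatExpr.eval_load, NatExpr.eval_zero,
      NatExpr.eval_one, NatExpr.eval_two, n3 710 (by norm_num), ha' 0 (by norm_num),
      ha' 1 (by norm_num), ha' 2 (by norm_num), ← hb]
    constructor
    · rintro ⟨h1, h2, h3⟩ c hc
      interval_cases c <;> assumption
    · exact fun h => ⟨h 0 (by norm_num), h 1 (by norm_num), h 2 (by norm_num)⟩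
  have etr : s₃.nat vTrip 0 = s.nat vTrip 0 := by rw [hT3 _ (by norm_num) (by norm_num)]
  have htrip := I.trip
  refine Runs.seq (R := fun t s₄ => t ≤ 7 ∧ s₄.real = s.real ∧
    (∀ x, x < 40 ∨ 43 < x → s₄.nat x = s₃.nat x) ∧ s₄.nat vTrip 0 ≤ r + 1 ∧ TripleOk len s₄ ∧
    ∀ r' < r + 1, (∀ c < 3, (if r' = r then a c else cutAt s M c r') <
          if r' = r then b c else cutAt s M c (r' + 1)) →
        ∃ t < s₄.nat vTrip 0, ∀ c < 3, s₄.nat (41 + c) t = if r' = r then a c else cutAt s M c r')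
    ?_ fun t s₄ _ ⟨h1, h2, h3, h4, h5, h6⟩ => next t s₄ h1 h2 h3 h4 h5 h6
  refine runs_ite (fun h => ?_) (fun h => runs_skip ?_)
  · have h' := test.1 h
    refine runs_seq (runs_setNat (runs_seq (runs_setNat (runs_seq (runs_setNat (runs_setNat
      ⟨by norm_num, r3, ?_, ?_, ?_, ?_⟩))))))
    · intro x hx
      rw [setNat_nat_of_ne (by omega), setNat_nat_of_ne (by omega), setNat_nat_of_ne (by omega),
        setNat_nat_of_ne (by omega)]
    · simp [etr]
      omega
    · intro c hc t ht
      have hl : a c < len c := (h' c hc).trans_le (hbl c hc).2.2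
      have ht' : t = s.nat vTrip 0 ∨ t < s.nat vTrip 0 := by
        simp [etr] at ht
        omega
      have htk : t < s.nat vTrip 0 → s.nat (41 + c) t < len c := I.tok c hc t
      rcases ht' with rfl | ht'
      · interval_cases c <;> simpa [etr, n3, ha'] using hl
      · have := htk ht'
        have hne : t ≠ s.nat vTrip 0 := by omega
        interval_cases c <;> simpa [etr, n3, hne] using this
    · intro r' hr' hc
      by_cases e : r' = r
      · refine ⟨s.nat vTrip 0, by simp [etr], fun c hc => ?_⟩
        rw [if_pos e]
        interval_cases c <;> simp [etr, n3, ha']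
      · simp only [if_neg e] at hc ⊢
        obtain ⟨t, h1, h2⟩ := I.out r' (by omega) hc
        have hne : t ≠ s.nat vTrip 0 := by omega
        refine ⟨t, by simp [etr]; omega, fun c hc => ?_⟩
        have := h2 c hc
        interval_cases c <;> simpa [etr, n3, hne] using this
  · have h' : ¬ ∀ c < 3, a c < b c := fun w => h (test.2 w)
    refine ⟨by norm_num, r3, fun _ _ => rfl, by omega, I.tok.of_eq hT3, ?_⟩
    intro r' hr' hc
    by_cases e : r' = r
    · exact absurd (fun c hc' => by simpa [e] using hc c hc') h'
    · simp only [if_neg e] at hc ⊢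
      obtain ⟨t, h1, h2⟩ := I.out r' (by omega) hc
      refine ⟨t, by omega, fun c hc => ?_⟩
      rw [hT3 _ (by omega) (by omega)]
      exact h2 c hc

end

theorem MergeInv.congr {s s' : Store} {len : ℕ → ℕ} {M : ℕ} {θ : ℕ → ℕ → ℝ} {r : ℕ}
    (I : MergeInv s len M θ r) (h : ∀ x, x ≠ vLeaves → s'.nat x = s.nat x) :
    MergeInv s' len M θ r := by
  have e : cutAt s' M = cutAt s M := by
    funext c x
    rw [cutAt, h _ (by norm_num), cutAt]
  refine ⟨by rw [h _ (by norm_num), I.hr], by rw [h _ (by norm_num), e]; exact I.cur,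
    by rw [e]; exact I.le, by rw [e]; exact I.rle, by rw [e]; exact I.zero, by rw [e]; exact I.step,
    by rw [e]; exact I.sep, by rw [h _ (by norm_num)]; exact I.trip,
    I.tok.of_eq fun x _ _ => h x (by omega), ?_⟩
  intro r' hr' hc
  rw [e] at hc ⊢
  obtain ⟨t, h1, h2⟩ := I.out r' hr' hc
  refine ⟨t, by rwa [h _ (by norm_num)], fun c hc => ?_⟩
  rw [h _ (by omega), h2 c hc]

theorem merge_spec {s : Store} {len off : ℕ → ℕ} {M : ℕ} {eps : ℕ → ℝ} {θ : ℕ → ℕ → ℝ}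
    (T : MergeCtx s len off M eps θ) (h0 : s.nat vTrip 0 = 0) :
    Runs merge s fun t s' => s'.real = s.real ∧ ∃ N, t ≤ 21 * N + 12 ∧ s'.nat vLeaves 0 = N ∧
      MergeInv s' len M θ N ∧ ∀ c < 3, cutAt s' M c N = len c := by
  have hM := T.bound
  refine runs_seq (runs_setNat (runs_seq (runs_setNat (runs_seq (runs_setNat (runs_seq
    (runs_setNat ?_)))))))
  set s₁ := Store.setNat _ 712 _ _ with hs₁
  have n1 : ∀ x, x < 710 → s₁.nat x = s.nat x := fun x hx => by
    rw [hs₁, setNat_nat_of_ne (by omega), setNat_nat_of_ne (by omega), setNat_nat_of_ne (by omega),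
      setNat_nat_of_ne (by omega)]
  refine mergeCuts_spec (r := 0) (b := fun _ => 0) (M := M) (by rw [n1 _ (by norm_num)]; exact T.hcutOff)
    (by simp [hs₁]) (fun c hc => by interval_cases c <;> simp [hs₁]) (by omega) ?_
  intro s₂ r2 n2 d1 d2 _
  have n2' : ∀ x, x < 710 → x ≠ aCut → s₂.nat x = s.nat x := fun x h1 h2 => by
    rw [n2 x (by omega) h2, n1 x h1]
  have T₂ : MergeCtx s₂ len off M eps θ := T.congr (n2' _ (by norm_num) (by norm_num))
    (n2' _ (by norm_num) (by norm_num)) (n2' _ (by norm_num) (by norm_num)) r2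
  have I₂ : MergeInv s₂ len M θ 0 := by
    refine ⟨?_, fun c hc => by rw [d1 c hc, d2 c hc], fun c hc => by rw [d2 c hc]; omega, by omega,
      d2, by omega, ?_, ?_, ?_, by omega⟩
    · rw [n2 _ (by norm_num) (by norm_num)]
      simp [hs₁]
    · intro r' hr' c hc c' _ m hm
      obtain rfl : r' = 0 := by omega
      have := d2 c hc
      simp only [this] at hm
      omega
    · rw [n2' _ (by norm_num) (by norm_num), h0]
    · intro c _ r hr
      rw [n2' _ (by norm_num) (by norm_num), h0] at hr
      omega
  refine Runs.seq (R := fun t s' => s'.real = s.real ∧ ∃ N, t ≤ 21 * N + 1 ∧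
      MergeInv s' len M θ N ∧ ∀ c < 3, cutAt s' M c N = len c) ?_ ?_
  · refine (runs_loop (fun t s' => s'.real = s.real ∧ ∃ N, t ≤ 21 * N ∧ MergeInv s' len M θ N)
      (fun s' => M - s'.nat 712 0) ?_ ?_).mono ?_
    · exact ⟨r2, 0, by omega, I₂⟩
    · rintro t s₃ hF ⟨r3, N, ht, I₃⟩ hb
      have T₃ : MergeCtx s₃ len off M eps θ := T₂.congr (hF.1 _ (by decide)) (hF.1 _ (by decide))
        (hF.1 _ (by decide)) (r3.trans r2.symm)
      have hex : ∃ c < 3, s₃.nat 710 c < len c := by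
        have h1 := T₃.hlen 0 (by norm_num)
        have h2 := T₃.hlen 1 (by norm_num)
        have h3 := T₃.hlen 2 (by norm_num)
        simp only [Test.holds_or, Test.holds_natLt, NatExpr.eval_load, NatExpr.eval_zero,
          NatExpr.eval_one, NatExpr.eval_two, h1, h2, h3] at hb
        rcases hb with h | h | h
        exacts [⟨0, by norm_num, h⟩, ⟨1, by norm_num, h⟩, ⟨2, by norm_num, h⟩]
      refine (mergeStep_spec T₃ I₃ hex).mono ?_
      rintro t' s₄ - ⟨ht', r4, I₄⟩
      refine ⟨⟨r4.trans r3, N + 1, by omega, I₄⟩, ?_⟩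
      have e1 := I₄.le 0 (by norm_num)
      have e2 := I₄.le 1 (by norm_num)
      have e3 := I₄.le 2 (by norm_num)
      have e4 := I₄.rle
      rw [I₃.hr, I₄.hr]
      omega
    · rintro t s₃ hF ⟨t', rfl, ⟨r3, N, ht, I₃⟩, hb⟩
      refine ⟨r3, N, by omega, I₃, fun c hc => ?_⟩
      have hl : ∀ c < 3, s₃.nat aLen c = len c := by rw [hF.1 _ (by decide)]; exact T₂.hlen
      have h4 : ¬ s₃.nat 710 c < len c := by
        intro h
        refine hb ?_
        simp only [Test.holds_or, Test.holds_natLt, NatExpr.eval_load, NatExpr.eval_zero,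
          NatExpr.eval_one, NatExpr.eval_two, hl 0 (by norm_num), hl 1 (by norm_num),
          hl 2 (by norm_num)]
        interval_cases c
        exacts [Or.inl h, Or.inr (Or.inl h), Or.inr (Or.inr h)]
      rw [I₃.cur c hc] at h4
      have := I₃.le c hc
      omega
  · rintro t s₃ - ⟨r3, N, ht, I₃, hl⟩
    refine runs_setNat ⟨r3, N, by omega, ?_, ?_, ?_⟩
    · simp [I₃.hr]
    · exact I₃.congr fun x hx => setNat_nat_of_ne hx
    · intro c hc
      rw [← hl c hc]
      simp [cutAt]

/-! ## Directions of the edges of an arc -/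

/-- The complex number with given (possibly negative) radius and angle. -/
noncomputable def polar (ρ β : ℝ) : ℂ := ⟨ρ * Real.cos β, ρ * Real.sin β⟩

theorem polar_mul (ρ β ρ' β' : ℝ) : polar ρ β * polar ρ' β' = polar (ρ * ρ') (β + β') := by
  simp only [polar, Complex.ext_iff, Complex.mul_re, Complex.mul_im, Real.cos_add, Real.sin_add]
  constructor <;> ring

theorem polar_one : polar 1 0 = 1 := by simp [polar, Complex.ext_iff]

theorem polar_ne_zero {ρ β : ℝ} (h : ρ ≠ 0) : polar ρ β ≠ 0 := by
  intro e
  simp only [polar, Complex.ext_iff, Complex.zero_re, Complex.zero_im, mul_eq_zero, h,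
    false_or] at e
  have := Real.sin_sq_add_cos_sq β
  rw [e.1, e.2] at this
  norm_num at this

theorem polar_norm_arg (z : ℂ) : polar ‖z‖ z.arg = z := by
  apply Complex.ext
  · simp [polar, Complex.norm_mul_cos_arg]
  · simp [polar, Complex.norm_mul_sin_arg]

/-- Every nonzero number has an angle in the upper half plane if the radius may be negative. -/
theorem exists_polar {z : ℂ} (hz : z ≠ 0) : ∃ ρ β, ρ ≠ 0 ∧ 0 ≤ β ∧ β < Real.pi ∧ z = polar ρ β := by
  have hn : ‖z‖ ≠ 0 := norm_ne_zero_iff.2 hz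
  have h1 := Complex.neg_pi_lt_arg z
  have h2 := Complex.arg_le_pi z
  have e := polar_norm_arg z
  have hπ := Real.pi_pos
  rcases lt_or_ge z.arg 0 with h | h
  · refine ⟨-‖z‖, z.arg + Real.pi, neg_ne_zero.2 hn, by linarith, by linarith, ?_⟩
    refine e.symm.trans ?_
    simp [polar, Real.cos_add_pi, Real.sin_add_pi]
  · rcases h2.lt_or_eq with h3 | h3
    · exact ⟨‖z‖, z.arg, hn, h, h3, e.symm⟩
    · refine ⟨-‖z‖, 0, neg_ne_zero.2 hn, le_rfl, hπ, ?_⟩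
      rw [h3] at e
      refine e.symm.trans ?_
      simp [polar]

theorem cross_mul_mul (u v w : ℂ) : cross (u * v) (u * w) = (u.re ^ 2 + u.im ^ 2) * cross v w := by
  simp only [cross, Complex.mul_re, Complex.mul_im]
  ring

theorem cross_polar (ρ β ρ' β' : ℝ) :
    cross (polar ρ β) (polar ρ' β') = ρ * ρ' * Real.sin (β' - β) := by
  simp only [cross, polar, Real.sin_sub]
  ring

theorem normSq_pos' {u : ℂ} (hu : u ≠ 0) : 0 < u.re ^ 2 + u.im ^ 2 := by
  have := Complex.normSq_pos.2 hu
  rw [Complex.normSq_apply] at this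
  linarith [sq u.re, sq u.im]

theorem leftOf_polar {u : ℂ} (hu : u ≠ 0) {ρ β : ℝ} (hρ : 0 < ρ) (h0 : 0 ≤ β)
    (h1 : β < Real.pi + Real.pi / 3) : LeftOf u (u * polar ρ β) ↔ β < Real.pi := by
  have hu' := normSq_pos' hu
  have hπ := Real.pi_pos
  have e1 : cross u (u * polar ρ β) = (u.re ^ 2 + u.im ^ 2) * (ρ * Real.sin β) := by
    simp only [cross, polar, Complex.mul_re, Complex.mul_im]
    ring
  have e2 : u.re * (u * polar ρ β).re + u.im * (u * polar ρ β).im =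
      (u.re ^ 2 + u.im ^ 2) * (ρ * Real.cos β) := by
    simp only [polar, Complex.mul_re, Complex.mul_im]
    ring
  rw [LeftOf, e1, e2]
  simp only [mul_pos_iff_of_pos_left hu', mul_pos_iff_of_pos_left hρ, mul_eq_zero, hu'.ne', hρ.ne',
    false_or]
  constructor
  · intro h
    by_contra hβ
    rw [not_lt] at hβ
    have hs : Real.sin β = -Real.sin (β - Real.pi) := by rw [Real.sin_sub_pi]; ring
    have hc : Real.cos β = -Real.cos (β - Real.pi) := by rw [Real.cos_sub_pi]; ring
    have h2 := Real.sin_nonneg_of_nonneg_of_le_pi (x := β - Real.pi) (by linarith) (by linarith)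
    have h3 := Real.cos_pos_of_mem_Ioo (x := β - Real.pi) ⟨by linarith, by linarith⟩
    rcases h with h | ⟨-, h⟩ <;> linarith
  · intro h
    rcases h0.lt_or_eq with h2 | rfl
    · exact Or.inl (Real.sin_pos_of_pos_of_lt_pi h2 h)
    · simp

theorem leftOf_polar_iff {u : ℂ} (hu : u ≠ 0) {ρ β : ℝ} (hρ : ρ ≠ 0) (h0 : 0 ≤ β)
    (h1 : β < Real.pi) : LeftOf u (u * polar ρ β) ↔ 0 < ρ := by
  have hπ := Real.pi_pos
  rcases hρ.lt_or_gt with h | h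
  · have e := leftOf_polar hu (neg_pos.2 h) h0 (by linarith)
    have g := e.2 h1
    have e1 : u * polar (-ρ) β = -(u * polar ρ β) := by
      simp [polar, Complex.ext_iff]; constructor <;> ring
    rw [e1, LeftOf, cross_neg_right, Complex.neg_re, Complex.neg_im] at g
    refine ⟨fun g' => ?_, fun g' => absurd g' h.not_gt⟩
    rw [LeftOf] at g'
    rcases g with g | ⟨g, k⟩ <;> rcases g' with g' | ⟨g', k'⟩ <;> linarith
  · exact ⟨fun _ => h, fun _ => (leftOf_polar hu h h0 (by linarith)).2 h1⟩

/-- The directions of three chains turn to the left by less than `π / 3` each. -/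
structure Fans (D : ℕ → ℕ → ℂ) (len : ℕ → ℕ) (R τ : ℕ → ℕ → ℝ) : Prop where
  ne_zero : ∀ c < 3, D c 0 ≠ 0
  eq : ∀ c < 3, ∀ m < len c, D c m = D c 0 * polar (R c m) (τ c m)
  pos : ∀ c < 3, ∀ m < len c, 0 < R c m
  zero : ∀ c < 3, τ c 0 = 0
  mono : ∀ c < 3, ∀ m m', m < m' → m' < len c → τ c m < τ c m'
  lt : ∀ c < 3, ∀ m < len c, τ c m < Real.pi / 3
  len_pos : ∀ c < 3, 1 ≤ len c

section
variable {D : ℕ → ℕ → ℂ} {len : ℕ → ℕ} {R τ : ℕ → ℕ → ℝ}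

theorem Fans.tau_le (F : Fans D len R τ) {c m m' : ℕ} (hc : c < 3) (h : m ≤ m') (hm : m' < len c) :
    τ c m ≤ τ c m' := by
  rcases h.lt_or_eq with h | rfl
  · exact (F.mono c hc m m' h hm).le
  · exact le_rfl

/-- The directions of chain `c` relative to the first direction of chain `i`. -/
theorem Fans.relative (F : Fans D len R τ) {i c : ℕ} (hi : i < 3) (hc : c < 3) :
    ∃ ρ β, ρ ≠ 0 ∧ 0 ≤ β ∧ β < Real.pi ∧
      ∀ m < len c, D c m = D i 0 * polar (ρ * R c m) (β + τ c m) := by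
  have hi0 := F.ne_zero i hi
  obtain ⟨ρ, β, h1, h2, h3, h4⟩ := exists_polar (div_ne_zero (F.ne_zero c hc) hi0)
  refine ⟨ρ, β, h1, h2, h3, fun m hm => ?_⟩
  rw [← polar_mul, ← h4, F.eq c hc m hm]
  field_simp

theorem leftOf_neg_radius {u : ℂ} {ρ β : ℝ} : u * polar (-ρ) β = -(u * polar ρ β) := by
  simp [polar, Complex.ext_iff]
  constructor <;> ring

theorem LeftOf.not_neg {u w : ℂ} (h : LeftOf u w) : ¬ LeftOf u (-w) := by
  rw [LeftOf] at h ⊢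
  rw [cross_neg_right, Complex.neg_re, Complex.neg_im]
  rintro (g | ⟨g, k⟩) <;> rcases h with h | ⟨h, k'⟩ <;> linarith

/-- A chain is on one side exactly if its angles stay below `π`. -/
theorem Fans.oneSide_iff (F : Fans D len R τ) {i c : ℕ} (hi : i < 3) (hc : c < 3) {ρ β : ℝ}
    (hρ : ρ ≠ 0) (h0 : 0 ≤ β) (h1 : β < Real.pi)
    (hD : ∀ m < len c, D c m = D i 0 * polar (ρ * R c m) (β + τ c m)) :
    (LeftOf (D i 0) (D c 0) ↔ LeftOf (D i 0) (D c (len c - 1))) ↔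
      β + τ c (len c - 1) < Real.pi := by
  have hl := F.len_pos c hc
  have hu := F.ne_zero i hi
  have p0 := F.pos c hc 0 (by omega)
  have p1 := F.pos c hc (len c - 1) (by omega)
  have t0 := F.zero c hc
  have t1 := F.lt c hc (len c - 1) (by omega)
  have t2 := F.tau_le hc (Nat.zero_le (len c - 1)) (by omega)
  rw [hD 0 (by omega), hD (len c - 1) (by omega), t0, add_zero,
    leftOf_polar_iff hu (mul_ne_zero hρ p0.ne') h0 h1, mul_pos_iff_of_pos_right p0]
  rcases hρ.lt_or_gt with h | h
  · have e := leftOf_polar hu (mul_pos (neg_pos.2 h) p1) (β := β + τ c (len c - 1)) (by linarith)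
      (by linarith)
    rw [neg_mul, leftOf_neg_radius] at e
    rw [← e]
    constructor
    · intro g
      by_contra hcon
      have hz : polar (ρ * R c (len c - 1)) (β + τ c (len c - 1)) ≠ 0 :=
        polar_ne_zero (mul_ne_zero hρ p1.ne')
      have hb : ¬ β + τ c (len c - 1) < Real.pi := fun w => hcon (e.2 w)
      refine h.not_gt (g.2 ?_)
      have e' : polar (ρ * R c (len c - 1)) (β + τ c (len c - 1)) =
          polar (-(ρ * R c (len c - 1))) (β + τ c (len c - 1) - Real.pi) := by
        simp [polar, Real.cos_sub_pi, Real.sin_sub_pi]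
      rw [e', leftOf_polar hu (by nlinarith) (by linarith) (by linarith)]
      linarith
    · exact fun g => ⟨fun h' => absurd h' h.not_gt, fun h' => absurd g h'.not_neg⟩
  · have e := leftOf_polar hu (mul_pos h p1) (β := β + τ c (len c - 1)) (by linarith) (by linarith)
    rw [e]
    exact ⟨fun g => g.1 h, fun g => ⟨fun _ => g, fun _ => h⟩⟩

theorem Fans.exists_oneSide (F : Fans D len R τ) :
    ∃ i < 3, ∀ c < 3, (LeftOf (D i 0) (D c 0) ↔ LeftOf (D i 0) (D c (len c - 1))) := by
  have hπ := Real.pi_pos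
  by_contra hcon
  push Not at hcon
  have key : ∀ i < 3, ∃ c < 3, c ≠ i ∧ ∃ ρ β, ρ ≠ 0 ∧ 2 * Real.pi / 3 < β ∧ β < Real.pi ∧
      D c 0 = D i 0 * polar ρ β := by
    intro i hi
    obtain ⟨c, hc, h⟩ := hcon i hi
    obtain ⟨ρ, β, h1, h2, h3, h4⟩ := F.relative hi hc
    have h5 : ¬ β + τ c (len c - 1) < Real.pi := by
      rw [← F.oneSide_iff hi hc h1 h2 h3 h4]
      intro g
      rcases h with ⟨h, h'⟩ | ⟨h, h'⟩
      · exact h' (g.1 h)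
      · exact h (g.2 h')
    have hl := F.len_pos c hc
    have t1 := F.lt c hc (len c - 1) (by omega)
    have p0 := F.pos c hc 0 (by omega)
    have e := h4 0 (by omega)
    rw [F.zero c hc, add_zero] at e
    refine ⟨c, hc, ?_, ρ * R c 0, β, mul_ne_zero h1 p0.ne', by linarith, h3, e⟩
    rintro rfl
    have e' : polar (ρ * R c 0) β = 1 := by
      have := F.ne_zero c hc
      refine mul_left_cancel₀ this ?_
      rw [← e, mul_one]
    have := congrArg Complex.im e'
    simp only [polar, Complex.one_im, mul_eq_zero, (mul_ne_zero h1 p0.ne'), false_or] at this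
    have hs := Real.sin_pos_of_pos_of_lt_pi (x := β) (by linarith) h3
    linarith
  have cyc : ∀ z : ℂ, z ≠ 0 → ∀ ρ x, ρ ≠ 0 → Real.pi < x → x < 3 * Real.pi → x ≠ 2 * Real.pi →
      z ≠ z * polar ρ x := by
    intro z hz ρ x hρ h1 h2 h3 e
    have e' : polar ρ x = 1 := mul_left_cancel₀ hz (by rw [← e, mul_one])
    have := congrArg Complex.im e'
    simp only [polar, Complex.one_im, mul_eq_zero, hρ, false_or] at this
    rcases h3.lt_or_gt with h4 | h4
    · have := Real.sin_pos_of_pos_of_lt_pi (x := x - Real.pi) (by linarith) (by linarith)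
      rw [Real.sin_sub_pi] at this
      linarith
    · have := Real.sin_pos_of_pos_of_lt_pi (x := x - 2 * Real.pi) (by linarith) (by linarith)
      rw [Real.sin_sub_two_pi] at this
      linarith
  choose! f hf hne ρ β hρ hβ hβ' hD using key
  have two : ∀ a < 3, f (f a) ≠ a := by
    intro a ha e
    have ha' := hf a ha
    have g := hD (f a) ha'
    rw [e, hD a ha, mul_assoc, polar_mul] at g
    have b1 := hβ a ha
    have b2 := hβ' a ha
    have b3 := hβ (f a) ha'
    have b4 := hβ' (f a) ha'
    exact cyc _ (F.ne_zero a ha) _ _ (mul_ne_zero (hρ a ha) (hρ _ ha')) (by linarith) (by linarith)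
      (by linarith) g
  have three : ∀ a < 3, f (f (f a)) ≠ a := by
    intro a ha e
    have ha' := hf a ha
    have ha'' := hf _ ha'
    have g := hD (f (f a)) ha''
    rw [e, hD (f a) ha', hD a ha, mul_assoc, mul_assoc, polar_mul, polar_mul] at g
    have b1 := hβ a ha
    have b2 := hβ' a ha
    have b3 := hβ (f a) ha'
    have b4 := hβ' (f a) ha'
    have b5 := hβ (f (f a)) ha''
    have b6 := hβ' (f (f a)) ha''
    exact cyc _ (F.ne_zero a ha) _ _ (mul_ne_zero (hρ a ha) (mul_ne_zero (hρ _ ha') (hρ _ ha'')))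
      (by linarith) (by linarith) (by linarith) g
  have n0 := hne 0 (by norm_num)
  have n1 := hne (f 0) (hf 0 (by norm_num))
  have n2 := hne (f (f 0)) (hf _ (hf 0 (by norm_num)))
  have a0 := hf 0 (by norm_num)
  have a1 := hf _ a0
  have a2 := hf _ a1
  have w0 := two 0 (by norm_num)
  have w1 := two (f 0) a0
  have w2 := three 0 (by norm_num)
  omega

/-- Angles that order the directions of all chains, reversed where necessary. -/
theorem Fans.exists_angles (F : Fans D len R τ) {i : ℕ} (hi : i < 3)
    (hone : ∀ c < 3, (LeftOf (D i 0) (D c 0) ↔ LeftOf (D i 0) (D c (len c - 1)))) {eps : ℕ → ℝ}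
    (h1 : ∀ c < 3, LeftOf (D i 0) (D c 0) → eps c = 1)
    (h2 : ∀ c < 3, ¬ LeftOf (D i 0) (D c 0) → eps c = -1) :
    ∃ θ : ℕ → ℕ → ℝ, (∀ c < 3, ∀ c' < 3, ∀ m < len c, ∀ m' < len c',
      (0 < eps c * eps c' * cross (D c m) (D c' m') ↔ θ c m < θ c' m')) ∧
      ∀ c < 3, ∀ m m', m < m' → m' < len c → θ c m < θ c m' := by
  have hπ := Real.pi_pos
  have hu := F.ne_zero i hi
  choose! ρ β hρ h0 hβ hD using fun c (hc : c < 3) => F.relative hi hc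
  have hε : ∀ c < 3, 0 < eps c * ρ c := by
    intro c hc
    have hl := F.len_pos c hc
    have p0 := F.pos c hc 0 (by omega)
    have e : LeftOf (D i 0) (D c 0) ↔ 0 < ρ c := by
      rw [hD c hc 0 (by omega), F.zero c hc, add_zero,
        leftOf_polar_iff hu (mul_ne_zero (hρ c hc) p0.ne') (h0 c hc) (hβ c hc),
        mul_pos_iff_of_pos_right p0]
    by_cases h : LeftOf (D i 0) (D c 0)
    · rw [h1 c hc h, one_mul]
      exact e.1 h
    · rw [h2 c hc h]
      have : ¬ 0 < ρ c := fun w => h (e.2 w)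
      have := lt_of_le_of_ne (not_lt.1 this) (hρ c hc)
      linarith
  have hlt : ∀ c < 3, ∀ m < len c, 0 ≤ β c + τ c m ∧ β c + τ c m < Real.pi := by
    intro c hc m hm
    have g := (F.oneSide_iff hi hc (hρ c hc) (h0 c hc) (hβ c hc) (hD c hc)).1 (hone c hc)
    have t1 := F.tau_le hc (show m ≤ len c - 1 by omega) (by omega)
    have t2 := F.tau_le hc (Nat.zero_le m) hm
    rw [F.zero c hc] at t2
    exact ⟨by linarith [h0 c hc], by linarith⟩
  refine ⟨fun c m => β c + τ c m, fun c hc c' hc' m hm m' hm' => ?_, fun c hc m m' h hm' => ?_⟩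
  · have p := F.pos c hc m hm
    have p' := F.pos c' hc' m' hm'
    have hu' := normSq_pos' hu
    obtain ⟨a1, a2⟩ := hlt c hc m hm
    obtain ⟨b1, b2⟩ := hlt c' hc' m' hm'
    have e : eps c * eps c' * cross (D c m) (D c' m') =
        ((D i 0).re ^ 2 + (D i 0).im ^ 2) * ((eps c * ρ c) * (eps c' * ρ c') * (R c m * R c' m')) *
          Real.sin (β c' + τ c' m' - (β c + τ c m)) := by
      rw [hD c hc m hm, hD c' hc' m' hm', cross_mul_mul, cross_polar]
      ring
    rw [e, mul_pos_iff_of_pos_left (mul_pos hu' (mul_pos (mul_pos (hε c hc) (hε c' hc'))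
      (mul_pos p p')))]
    constructor
    · intro h
      by_contra hcon
      have := Real.sin_nonneg_of_nonneg_of_le_pi
        (x := -(β c' + τ c' m' - (β c + τ c m))) (by linarith) (by linarith)
      rw [Real.sin_neg] at this
      linarith
    · exact fun h => Real.sin_pos_of_pos_of_lt_pi (by linarith) (by linarith)
  · have := F.mono c hc m m' h hm'
    linarith

end

/-! ## The polygon -/

namespace ConvexPolygon
variable {n : ℕ} (Q : ConvexPolygon n)

theorem vtx_mod (i : ℕ) : Q.vtx (i % n) = Q.vtx i := by
  simp only [vtx, Nat.mod_mod]

theorem vtx_of_lt {i : ℕ} (h : i < n) : Q.vtx i = Q.vertex ⟨i, h⟩ := by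
  simp only [vtx, Nat.mod_eq_of_lt h]

theorem cross_dir_pos (i : ℕ) : 0 < cross (Q.dir i) (Q.dir (i + 1)) := by
  have hn := Q.three_le
  have hl := Nat.mod_lt i (show 0 < n by omega)
  have e0 := Q.vtx_mod i
  have e1 : Q.vtx (i + 1) = Q.vtx (i % n + 1) := by
    rw [← Q.vtx_mod (i + 1), ← Q.vtx_mod (i % n + 1), Nat.mod_add_mod]
  have e2 : Q.vtx (i + 2) = Q.vtx (i % n + 2) := by
    rw [← Q.vtx_mod (i + 2), ← Q.vtx_mod (i % n + 2), Nat.mod_add_mod]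
  rw [dir, dir, add_assoc, e1, e2, ← e0]
  obtain ⟨a, ha⟩ : ∃ a, a = i % n := ⟨_, rfl⟩
  rw [← ha] at hl ⊢
  have cyc : ∀ u v w : ℂ, cross (v - u) (w - v) = cross (v - u) (w - u) ∧
      cross (v - u) (w - v) = cross (u - w) (v - w) ∧
      cross (v - u) (w - v) = cross (w - v) (u - v) := by
    intro u v w
    simp only [cross, Complex.sub_re, Complex.sub_im]
    refine ⟨?_, ?_, ?_⟩ <;> ring
  rcases (show a + 2 < n ∨ a + 2 = n ∨ a + 1 = n by omega) with h | h | h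
  · rw [Q.vtx_of_lt hl, Q.vtx_of_lt (show a + 1 < n by omega), Q.vtx_of_lt h, (cyc _ _ _).1]
    exact Q.ccw _ _ _ (by simp [Fin.lt_def]) (by simp [Fin.lt_def])
  · have e : Q.vtx (a + 2) = Q.vtx 0 := by rw [← Q.vtx_mod, h, Nat.mod_self]
    rw [e, Q.vtx_of_lt hl, Q.vtx_of_lt (show a + 1 < n by omega), Q.vtx_of_lt (show 0 < n by omega),
      (cyc _ _ _).2.1]
    exact Q.ccw _ _ _ (by simp [Fin.lt_def]; omega) (by simp [Fin.lt_def])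
  · have e : Q.vtx (a + 1) = Q.vtx 0 := by rw [← Q.vtx_mod, h, Nat.mod_self]
    have e' : Q.vtx (a + 2) = Q.vtx 1 := by
      rw [← Q.vtx_mod, show a + 2 = 1 + n by omega, Nat.add_mod_right, Q.vtx_mod]
    rw [e, e', Q.vtx_of_lt hl, Q.vtx_of_lt (show 0 < n by omega), Q.vtx_of_lt (show 1 < n by omega),
      (cyc _ _ _).2.2]
    exact Q.ccw _ _ _ (by simp [Fin.lt_def]) (by simp [Fin.lt_def]; omega)

theorem dir_ne_zero (i : ℕ) : Q.dir i ≠ 0 := by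
  intro h
  have := Q.cross_dir_pos i
  rw [h, cross_zero_left] at this
  exact lt_irrefl _ this

theorem turn_pos (i : ℕ) : 0 < Q.turn i := by
  have h : 0 < (Q.dir (i + 1) / Q.dir i).im := by
    have e : (Q.dir (i + 1) / Q.dir i).im =
        cross (Q.dir i) (Q.dir (i + 1)) / Complex.normSq (Q.dir i) := by
      rw [Complex.div_im, cross]
      ring
    rw [e]
    exact div_pos (Q.cross_dir_pos i) (Complex.normSq_pos.2 (Q.dir_ne_zero i))
  refine lt_of_le_of_ne (Complex.arg_nonneg_iff.2 h.le) fun e => ?_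
  rw [eq_comm, turn, Complex.arg_eq_zero_iff] at e
  exact h.ne' e.2

theorem exists_dir_eq_polar (f m : ℕ) : ∃ R : ℝ, 0 < R ∧
    Q.dir (f + m) = Q.dir f * polar R (∑ k ∈ Finset.range m, Q.turn (f + k)) := by
  induction m with
  | zero => exact ⟨1, one_pos, by simp [polar_one]⟩
  | succ m ih =>
    obtain ⟨R, h1, h2⟩ := ih
    have h3 := Q.dir_ne_zero (f + m)
    have h4 := Q.dir_ne_zero (f + m + 1)
    refine ⟨R * ‖Q.dir (f + m + 1) / Q.dir (f + m)‖,
      mul_pos h1 (norm_pos_iff.2 (div_ne_zero h4 h3)), ?_⟩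
    rw [Finset.sum_range_succ, ← polar_mul, ← mul_assoc, ← h2, turn, polar_norm_arg, ← add_assoc]
    field_simp

end ConvexPolygon

/-- The directions of the edges of three arcs, scaled and rotated. -/
theorem exists_fans {n : ℕ} {Q : ConvexPolygon n} (Γ : ℕ → Arc Q) {k : ℕ → ℂ}
    (hk : ∀ c < 3, k c ≠ 0) :
    ∃ R τ, Fans (fun c m => k c * Q.dir ((Γ c).first + m)) (fun c => (Γ c).len) R τ := by
  choose R h1 h2 using fun (c m : ℕ) => Q.exists_dir_eq_polar (Γ c).first m
  have mono : ∀ c m m', m ≤ m' → ∑ k ∈ Finset.range m, Q.turn ((Γ c).first + k) ≤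
      ∑ k ∈ Finset.range m', Q.turn ((Γ c).first + k) := fun c m m' h =>
    Finset.sum_le_sum_of_subset_of_nonneg (by simpa using h) fun _ _ _ => (Q.turn_pos _).le
  refine ⟨R, fun c m => ∑ k ∈ Finset.range m, Q.turn ((Γ c).first + k), ?_, ?_, ?_, ?_, ?_, ?_, ?_⟩
  · exact fun c hc => mul_ne_zero (hk c hc) (Q.dir_ne_zero _)
  · intro c _ m _
    rw [add_zero, mul_assoc, ← h2]
  · exact fun c _ m _ => h1 c m
  · exact fun c _ => by simp
  · intro c _ m m' h _
    refine lt_of_lt_of_le ?_ (mono c (m + 1) m' h)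
    rw [Finset.sum_range_succ]
    linarith [Q.turn_pos ((Γ c).first + m)]
  · exact fun c _ m hm => (mono c m _ (by omega)).trans_lt (Γ c).turning_lt
  · exact fun c _ => (Γ c).len_pos

/-! ## All tables -/

/-- Writes all tables. -/
def prepare : Prog :=
  powers ;; offsets ;; chain 0 ;; chain 1 ;; chain 2 ;; signs ;; merge

section
variable {s : Store} {n : ℕ} {V p : ℕ → ℂ} {first len : ℕ → ℕ} {lo hi : ℕ → ℝ} {c : ℕ}

theorem ChainAt.congr {s' : Store} (h : ChainAt s n V p first len lo hi c) (hl : len c ≤ n)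
    (he : ∀ a, a = c ∨ a = c + 3 → ∀ m < n, entry s' (a * n + m) = entry s (a * n + m)) :
    ChainAt s' n V p first len lo hi c := by
  intro m hm
  rw [he c (Or.inl rfl) _ (by omega), he (c + 3) (Or.inr rfl) _ (by omega)]
  exact h m hm

theorem ChainAt.fields (h : ChainAt s n V p first len lo hi c) {m : ℕ} (hm : m < len c) :
    chB s (c * n) m = coef p c * V (first c + m) ∧
    chD s (c * n) m = coef p c * (V (first c + m + 1) - V (first c + m)) ∧
    chLo s (c * n) m = (if m = 0 then lo c else 0) ∧
    chHi s (c * n) m = if m + 1 = len c then hi c else 1 := by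
  have e := (h m hm).1
  simp only [entry, edgeEntry, Prod.mk.injEq] at e
  exact e

theorem ChainAt.rev (h : ChainAt s n V p first len lo hi c) {m : ℕ} (hm : m < len c) :
    chB s ((c + 3) * n) m = chB s (c * n) (len c - 1 - m) + chD s (c * n) (len c - 1 - m) ∧
    chD s ((c + 3) * n) m = -chD s (c * n) (len c - 1 - m) ∧
    chLo s ((c + 3) * n) m = 1 - chHi s (c * n) (len c - 1 - m) ∧
    chHi s ((c + 3) * n) m = 1 - chLo s (c * n) (len c - 1 - m) := by
  obtain ⟨e1, e2⟩ := h (len c - 1 - m) (by omega)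
  rw [← e1, show len c - 1 - (len c - 1 - m) = m by omega] at e2
  simp only [entry, flipEntry, Prod.mk.injEq] at e2
  exact e2

end

theorem eq_of_mul_add_eq {a b n m m' : ℕ} (hm : m < n) (hm' : m' < n)
    (h : a * n + m = b * n + m') : a = b := by
  have h1 := congrArg (· / n) h
  simp only [Nat.mul_comm _ n, Nat.mul_add_div (show 0 < n by omega), Nat.div_eq_of_lt hm,
    Nat.div_eq_of_lt hm'] at h1
  omega

/-- The outcome of the preparation. -/
structure Prepared (s : Store) {n : ℕ} {Q : ConvexPolygon n} (p : ℕ → ℂ) (Γ : ℕ → Arc Q) (N : ℕ)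
    (cut : ℕ → ℕ → ℕ) : Prop where
  tables : ∃ eps θ, Tables s (fun c => (Γ c).len) (fun c => c * n) N cut eps θ
  log : s.nat vLog 0 = 0 ∨ 2 ^ (s.nat vLog 0 - 1) < n
  leaves : N ≤ 3 * n
  tok : TripleOk (fun c => (Γ c).len) s
  trip : s.nat vTrip 0 ≤ N
  cut_succ : ∀ r < N, ∀ c < 3, cut c (r + 1) ≤ cut c r + 1
  out : ∀ r < N, (∀ c < 3, cut c r < cut c (r + 1)) →
    ∃ t < s.nat vTrip 0, ∀ c < 3, s.nat (41 + c) t = cut c r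
  base : ∀ c < 3, ∀ m < (Γ c).len, chB s (c * n) m = coef p c * Q.vtx ((Γ c).first + m)
  dir : ∀ c < 3, ∀ m < (Γ c).len, chD s (c * n) m = coef p c * Q.dir ((Γ c).first + m)
  lo : ∀ c < 3, ∀ m < (Γ c).len, chLo s (c * n) m = ((Γ c).edge m).lo
  hi : ∀ c < 3, ∀ m < (Γ c).len, chHi s (c * n) m = ((Γ c).edge m).hi

theorem prepare_spec {s : Store} {n : ℕ} {Q : ConvexPolygon n} {p : ℕ → ℂ} {Γ : ℕ → Arc Q}
    (h : Input s n Q.vtx p (fun c => (Γ c).first) (fun c => (Γ c).len) (fun c => (Γ c).lo)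
      fun c => (Γ c).hi) (hk : ∀ c < 3, coef p c ≠ 0) (h0 : s.nat vTrip 0 = 0) :
    Runs prepare s fun t s' => t ≤ 177 * n + 4 * s'.nat vLog 0 + 85 ∧
      ∃ N cut, Prepared s' p Γ N cut := by
  have hn := h.three_le
  set len : ℕ → ℕ := fun c => (Γ c).len with hlen
  have hle : ∀ c < 3, len c ≤ n := h.len_le
  refine (powers_spec h.num).seq ?_
  rintro t₁ s₁ hF₁ ⟨K, ht₁, k1, k2, k3, k4⟩
  have i₁ := h.congr (hF₁.1 _ rfl) (hF₁.2 _ rfl) (hF₁.2 _ rfl) (hF₁.2 _ rfl)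
  refine (offsets_spec i₁.num).seq ?_
  rintro _ s₂ hF₂ ⟨rfl, o1, o2⟩
  have i₂ := i₁.congr (hF₂.1 _ rfl) (hF₂.2 _ rfl) (hF₂.2 _ rfl) (hF₂.2 _ rfl)
  refine (chain_spec i₂ (c := 0) (by norm_num) o1).seq ?_
  rintro t₃ s₃ hF₃ ⟨ht₃, a1, a2, a3, -⟩
  have i₃ := i₂.congr (hF₃.1 _ rfl) (hF₃.2 _ rfl) (hF₃.2 _ rfl) (hF₃.2 _ rfl)
  refine (chain_spec i₃ (c := 1) (by norm_num) (by rw [hF₃.1 _ rfl]; exact o1)).seq ?_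
  rintro t₄ s₄ hF₄ ⟨ht₄, b1, b2, b3, b4⟩
  have i₄ := i₃.congr (hF₄.1 _ rfl) (hF₄.2 _ rfl) (hF₄.2 _ rfl) (hF₄.2 _ rfl)
  refine (chain_spec i₄ (c := 2) (by norm_num)
    (by rw [hF₄.1 _ rfl, hF₃.1 _ rfl]; exact o1)).seq ?_
  rintro t₅ s₅ hF₅ ⟨ht₅, c1, c2, c3, c4⟩
  have far : ∀ a b, a ≠ b → a ≠ b + 3 → ∀ m < n, ∀ m' < n,
      a * n + m ≠ b * n + m' ∧ a * n + m ≠ (b + 3) * n + m' := fun a b h1 h2 m hm m' hm' =>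
    ⟨fun e => h1 (eq_of_mul_add_eq hm hm' e), fun e => h2 (eq_of_mul_add_eq hm hm' e)⟩
  have C₅ : ∀ c < 3, ChainAt s₅ n Q.vtx p (fun c => (Γ c).first) len (fun c => (Γ c).lo)
      (fun c => (Γ c).hi) c := by
    intro c hc
    interval_cases c
    · refine a3.congr (hle 0 (by norm_num)) fun a ha m hm => ?_
      rw [c4 _ (far a 2 (by omega) (by omega) m hm), b4 _ (far a 1 (by omega) (by omega) m hm)]
    · refine b3.congr (hle 1 (by norm_num)) fun a ha m hm => ?_
      rw [c4 _ (far a 2 (by omega) (by omega) m hm)]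
    · exact c3
  have L₅ : ∀ c < 3, s₅.nat aLen c = len c := by
    intro c hc
    interval_cases c
    · rw [c2 _ (by norm_num), b2 _ (by norm_num), a1]
    · rw [c2 _ (by norm_num), b1]
    · exact c1
  have O₅ : ∀ c < 6, s₅.nat aOff c = c * n := by
    rw [hF₅.1 _ rfl, hF₄.1 _ rfl, hF₃.1 _ rfl]
    exact o1
  have O₅' : ∀ c < 3, s₅.nat aCutOff c = c * (3 * n + 1) := by
    rw [hF₅.1 _ rfl, hF₄.1 _ rfl, hF₃.1 _ rfl]
    exact o2
  have D₅ : ∀ c < 3, ∀ m < len c, chD s₅ (c * n) m = coef p c * Q.dir ((Γ c).first + m) :=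
    fun c hc m hm => ((C₅ c hc).fields hm).2.1
  obtain ⟨R, τ, F⟩ := exists_fans Γ hk
  have hl0 : ∀ c < 3, 1 ≤ len c := F.len_pos
  have F₅ : Fans (fun c => chD s₅ (c * n)) len R τ := by
    obtain ⟨f1, f2, f3, f4, f5, f6, f7⟩ := F
    refine ⟨fun c hc => ?_, fun c hc m hm => ?_, f3, f4, f5, f6, f7⟩
    · simp only [D₅ c hc 0 (hl0 c hc)]
      exact f1 c hc
    · simp only [D₅ c hc m hm, D₅ c hc 0 (hl0 c hc)]
      exact f2 c hc m hm
  refine (signs_spec (len := len) (off := fun c => c * n) (fun c hc => O₅ c (by omega)) L₅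
    F₅.exists_oneSide).seq ?_
  rintro t₆ s₆ hF₆ ⟨ht₆, i, hi, hsg⟩
  have hD : ∀ o, chD s₆ o = chD s₅ o := by
    intro o
    funext m
    simp only [chD, hF₆.2 aDX (by decide), hF₆.2 aDY (by decide)]
  obtain ⟨eps, heps⟩ : ∃ eps, eps = sideSign s₅ (fun c => c * n) i := ⟨_, rfl⟩
  obtain ⟨θ, hθ, hθm⟩ := F₅.exists_angles hi (fun c hc => (hsg c hc).1) (eps := eps)
    (fun c _ h => by rw [heps, sideSign, if_pos h]) (fun c _ h => by rw [heps, sideSign, if_neg h])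
  have O₆ : ∀ c < 6, s₆.nat aOff c = c * n := by rw [hF₆.1 _ (by decide)]; exact O₅
  have L₆ : ∀ c < 3, s₆.nat aLen c = len c := by rw [hF₆.1 _ (by decide)]; exact L₅
  have M₆ : MergeCtx s₆ len (fun c => c * n) (3 * n + 1) eps θ := by
    refine ⟨fun c hc => O₆ c (by omega), L₆, ?_, ?_, ?_, ?_, hθm⟩
    · intro c hc
      rw [(hsg c hc).2, heps]
    · rw [hF₆.1 _ (by decide)]; exact O₅'
    · have := hle 0 (by norm_num)
      have := hle 1 (by norm_num)
      have := hle 2 (by norm_num)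
      omega
    · simp only [hD]
      exact hθ
  refine (merge_spec M₆ ?_).mono ?_
  · rw [hF₆.1 _ (by decide), hF₅.1 _ rfl, hF₄.1 _ rfl, hF₃.1 _ rfl, hF₂.1 _ rfl, hF₁.1 _ rfl, h0]
  rintro t₇ s₇ hF₇ ⟨r₇, N, ht₇, hN, I, hlast⟩
  have E₇ : ∀ y, entry s₇ y = entry s₅ y := entry_congr fun a h1 h2 => by
    rw [r₇]
    interval_cases a <;> exact hF₆.2 _ (by decide)
  have C₇ : ∀ c < 3, ChainAt s₇ n Q.vtx p (fun c => (Γ c).first) len (fun c => (Γ c).lo)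
      (fun c => (Γ c).hi) c := fun c hc => (C₅ c hc).congr (hle c hc) fun _ _ _ _ => E₇ _
  have hlog : s₇.nat vLog 0 = K := by
    rw [hF₇.1 _ (by decide), hF₆.1 _ (by decide), hF₅.1 _ rfl, hF₄.1 _ rfl, hF₃.1 _ rfl,
      hF₂.1 _ rfl, k1]
  have hN3 : N ≤ 3 * n := by
    have := I.rle
    have := I.le 0 (by norm_num)
    have := I.le 1 (by norm_num)
    have := I.le 2 (by norm_num)
    have := M₆.bound
    omega
  refine ⟨by rw [hlog]; omega, N, cutAt s₇ (3 * n + 1), ⟨eps, θ, ?_⟩, by rw [hlog]; exact k3, hN3,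
    I.tok, I.trip, fun r hr c hc => (I.step r hr c hc).2, I.out,
    fun c hc m hm => ((C₇ c hc).fields hm).1, fun c hc m hm => ((C₇ c hc).fields hm).2.1,
    fun c hc m hm => ((C₇ c hc).fields hm).2.2.1, fun c hc m hm => ((C₇ c hc).fields hm).2.2.2⟩
  refine ⟨?_, ?_, hN, ?_, ?_, ?_, ?_, hl0, I.zero, hlast, ?_, ?_, ?_, ?_,
    fun c hc m hm => (C₇ c hc).rev hm, ?_, ?_, ?_⟩
  · rw [hF₇.1 _ (by decide)]; exact O₆
  · rw [hF₇.1 _ (by decide)]; exact L₆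
  · intro c hc r _
    rw [hF₇.1 aCutOff (by decide), M₆.hcutOff c hc, cutAt]
  · rw [r₇]; exact M₆.hsign
  · rw [hlog, hF₇.1 _ (by decide), hF₆.1 _ (by decide), hF₅.1 _ rfl, hF₄.1 _ rfl, hF₃.1 _ rfl,
      hF₂.1 _ rfl]
    exact k4
  · intro c hc
    rw [hlog]
    exact (hle c hc).trans k2
  · intro c hc r r' hr hr'
    induction r', hr using Nat.le_induction with
    | base => exact le_rfl
    | succ k _ ih => exact (ih (by omega)).trans (I.step k (by omega) c hc).1
  · intro c _
    rw [heps, sideSign]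
    split_ifs
    exacts [Or.inl rfl, Or.inr rfl]
  · intro c hc m hm
    rw [((C₇ c hc).fields hm).1, ((C₇ c hc).fields (Nat.lt_of_succ_lt hm)).1,
      ((C₇ c hc).fields (Nat.lt_of_succ_lt hm)).2.1, ← add_assoc]
    ring
  · intro c hc
    have f := fun a (ha : a < len c) => ((C₇ c hc).fields ha).2.2
    constructor
    · intro a _ ha
      rw [(f a ha).1]
      split_ifs
      exacts [(Γ c).lo_nonneg, le_rfl]
    · intro a _ ha
      rw [(f a ha).1, (f a ha).2]
      split_ifs with e1 e2 e2
      · exact (Γ c).lo_lt_hi (by rw [e1] at e2; exact e2.symm)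
      · exact (Γ c).lo_lt_one
      · exact (Γ c).hi_pos
      · exact one_pos
    · intro a _ ha
      rw [(f a ha).2]
      split_ifs
      exacts [(Γ c).hi_le_one, le_rfl]
    · intro a h1 ha
      rw [(f a ha).1, if_neg (by omega)]
    · intro a _ ha
      rw [(f a (Nat.lt_of_succ_lt ha)).2, if_neg ha.ne]
  · intro c hc c' hc' m hm m' hm'
    have e : ∀ o, chD s₇ o = chD s₅ o := fun o => by
      rw [← hD]
      funext m
      simp only [chD, r₇]
    simp only [e]
    exact hθ c hc c' hc' m hm m' hm'
  · intro c hc m m' h1 h2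
    rcases h1.lt_or_eq with h3 | rfl
    · exact (hθm c hc m m' h3 h2).le
    · exact le_rfl
  · intro c hc c' hc' r hr m hm m' hm' hle
    exact I.sep r hr c hc c' hc' m hm m' hm' hle

/-! ## The output -/

/-- Copies the pieces to another table. -/
def copyTo (b : ℕ) : Prog :=
  nset 720 0 ;; .loop (.natLt (nv 720) (nv vOut))
    (.setNat (b + 3) (nv 720) (.load aLE (nv 720)) ;;
    .setNat (b + 4) (nv 720) (.load aRE (nv 720)) ;;
    .setReal (2 * (b + 3)) (nv 720) (.load aLlo (nv 720)) ;;
    .setReal (2 * (b + 3) + 1) (nv 720) (.load aLhi (nv 720)) ;;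
    .setReal (2 * (b + 4)) (nv 720) (.load aRlo (nv 720)) ;;
    .setReal (2 * (b + 4) + 1) (nv 720) (.load aRhi (nv 720)) ;;
    nset 720 (nv 720 + 1))

/-- The left sub-edge of a piece. -/
noncomputable def leftPiece (s : Store) (r : ℕ) : SubEdge :=
  ⟨s.nat aLE r, s.real aLlo r, s.real aLhi r⟩
/-- The right sub-edge of a piece. -/
noncomputable def rightPiece (s : Store) (r : ℕ) : SubEdge :=
  ⟨s.nat aRE r, s.real aRlo r, s.real aRhi r⟩

/-- A piece is in a table. -/
def Copied (s s' : Store) (b r : ℕ) : Prop :=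
  StoresSubEdge s' (b + 3) r (leftPiece s r) ∧ StoresSubEdge s' (b + 4) r (rightPiece s r)

theorem copyTo_spec {s : Store} {b : ℕ} (hb : b = 20 ∨ b = 30) : Runs (copyTo b) s fun t s' =>
    t ≤ 8 * s.nat vOut 0 + 2 ∧ ∀ r < s.nat vOut 0, Copied s s' b r := by
  refine runs_seq (runs_setNat ?_)
  set s₁ := Store.setNat s 720 _ _ with hs₁
  have n1 : ∀ x, x ≠ 720 → s₁.nat x = s.nat x := fun x hx => setNat_nat_of_ne hx
  refine (runs_loop (fun t s' => ∃ k ≤ s.nat vOut 0, t = 8 * k ∧ s'.nat 720 0 = k ∧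
    ∀ r < k, Copied s s' b r) (fun s' => s.nat vOut 0 - s'.nat 720 0) ?_ ?_).mono ?_
  · exact ⟨0, by omega, rfl, by simp [hs₁], by omega⟩
  · rintro t s₂ hF ⟨k, hk, ht, h1, h2⟩ hlt
    obtain ⟨q1, q2, q3, q4, q5, q6, q7⟩ : s₂.nat aLE = s.nat aLE ∧ s₂.nat aRE = s.nat aRE ∧
        s₂.nat vOut = s.nat vOut ∧ s₂.real aLlo = s.real aLlo ∧ s₂.real aLhi = s.real aLhi ∧
        s₂.real aRlo = s.real aRlo ∧ s₂.real aRhi = s.real aRhi := by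
      rcases hb with rfl | rfl <;>
        exact ⟨by rw [hF.1 _ (by decide), n1 _ (by norm_num)],
          by rw [hF.1 _ (by decide), n1 _ (by norm_num)],
          by rw [hF.1 _ (by decide), n1 _ (by norm_num)],
          by rw [hF.2 _ (by decide)]; rfl, by rw [hF.2 _ (by decide)]; rfl,
          by rw [hF.2 _ (by decide)]; rfl, by rw [hF.2 _ (by decide)]; rfl⟩
    have hlt' : k < s.nat vOut 0 := by simpa [h1, q3] using hlt
    refine runs_seq (runs_setNat (runs_seq (runs_setNat (runs_seq (runs_setReal (runs_seq
      (runs_setReal (runs_seq (runs_setReal (runs_seq (runs_setReal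
      (runs_setNat ⟨⟨k + 1, hlt', by omega, ?_, ?_⟩, ?_⟩))))))))))))
    · rcases hb with rfl | rfl <;> simp [h1]
    · intro r hr
      by_cases e : r = k
      · subst e
        rcases hb with rfl | rfl <;>
          simp [Copied, StoresSubEdge, leftPiece, rightPiece, h1, q1, q2, q4, q5, q6, q7]
      · have g := h2 r (by omega)
        rcases hb with rfl | rfl <;> simpa [Copied, StoresSubEdge, h1, e] using g
    · rcases hb with rfl | rfl <;> simp [h1] <;> omega
  · rintro t s₂ hF ⟨t', rfl, ⟨k, hk, ht, h1, h2⟩, hlt⟩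
    have q3 : s₂.nat vOut = s.nat vOut := by
      rw [hF.1 _ (by rcases hb with rfl | rfl <;> decide), n1 _ (by norm_num)]
    have hlt' : s.nat vOut 0 ≤ k := by simpa [h1, q3] using hlt
    exact ⟨by omega, fun r hr => h2 r (by omega)⟩

section
variable {S s : Store} {n : ℕ} {Q : ConvexPolygon n} {p : ℕ → ℂ} {Γ : ℕ → Arc Q} {N : ℕ}
  {cut : ℕ → ℕ → ℕ}

/-- Points on a stored line are points on the edge of the arc. -/
theorem Prepared.point_eq (P : Prepared S p Γ N cut) {c m : ℕ} {t : ℝ} (hc : c < 3)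
    (hk : coef p c ≠ 0) (hm : m < (Γ c).len) (q : ℂ) :
    linePt (chB S (c * n)) (chD S (c * n)) m t = coef p c * q ↔ (Γ c).point m t = q := by
  rw [linePt, P.base c hc m hm, P.dir c hc m hm, Arc.point,
    show ∀ k a b d : ℂ, k * a + b * (k * d) = k * (a + b * d) by intros; ring]
  exact mul_right_inj' hk

theorem exists_pairing {j k x w : ℕ} (P : Prepared S p Γ N cut) (hj : j < 3) (hk : k < 3)
    (hkj : coef p j ≠ 0) (hkk : coef p k ≠ 0)
    (h : PairAt S s (fun c => (Γ c).len) (fun c => c * n) j k x w) :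
    ∃ M : Pairing (Γ j) (Γ k), M.IsIncreasing ∧ M.left.size = w ∧
      (∀ i, M.left.piece i = leftPiece s (x + i) ∧
        M.right.piece (M.map i) = rightPiece s (x + i)) ∧
      ∀ q q', PiecesCover S s x (x + w) (j * n) (k * n) (coef p j * q) (coef p k * q') →
        M.Covers q q' := by
  have lj := (Γ j).len_pos
  have lk := (Γ k).len_pos
  have hw := h.pos
  have lt : ∀ d, d < w → s.nat aLE (x + (w - 1 - d)) < (Γ j).len ∧
      s.nat aRE (x + (w - 1 - d)) < (Γ k).len := by
    intro d
    induction d with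
    | zero =>
      intro _
      have e1 := h.last_left.1
      have e2 := h.last_right.1
      simp only [Nat.sub_zero]
      omega
    | succ d ih =>
      intro hd
      have ih := ih (by omega)
      obtain ⟨g1, g2⟩ := h.next (x + (w - 1 - (d + 1))) (by omega) (by omega)
      rw [show x + (w - 1 - (d + 1)) + 1 = x + (w - 1 - d) by omega] at g1 g2
      rcases g1 with ⟨g1, -⟩ | ⟨g1, -⟩ <;> rcases g2 with ⟨g2, -⟩ | ⟨g2, -⟩ <;> omega
  let A : Subdivision (Γ j) :=
    { size := w
      size_pos := hw
      piece := fun i => leftPiece s (x + i)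
      lo_lt_hi := fun i => (h.lt (x + i) (by omega) (by omega)).1
      first_piece := fun i hi => by
        rw [hi]
        exact ⟨h.start.edgeL, h.start.loL.trans (P.lo j hj 0 lj)⟩
      last_piece := fun i hi => by
        obtain ⟨g1, g2⟩ := h.last_left
        rw [show (i : ℕ) = w - 1 by omega]
        refine ⟨?_, g2.trans ?_⟩
        · change s.nat aLE _ + 1 = _
          rw [g1]
          exact Nat.sub_add_cancel lj
        · rw [P.hi j hj _ (by omega), Arc.edge]
          exact if_pos (Nat.sub_add_cancel lj)
      next_piece := fun i i' hi => by
        have g := (h.next (x + i) (by omega) (by omega)).1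
        rw [add_assoc, ← hi] at g
        exact g }
  let A' : Subdivision (Γ k) :=
    { size := w
      size_pos := hw
      piece := fun i => rightPiece s (x + i)
      lo_lt_hi := fun i => (h.lt (x + i) (by omega) (by omega)).2
      first_piece := fun i hi => by
        rw [hi]
        exact ⟨h.start.edgeR, h.start.loR.trans (P.lo k hk 0 lk)⟩
      last_piece := fun i hi => by
        obtain ⟨g1, g2⟩ := h.last_right
        rw [show (i : ℕ) = w - 1 by omega]
        refine ⟨?_, g2.trans ?_⟩
        · change s.nat aRE _ + 1 = _
          rw [g1]
          exact Nat.sub_add_cancel lk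
        · rw [P.hi k hk _ (by omega), Arc.edge]
          exact if_pos (Nat.sub_add_cancel lk)
      next_piece := fun i i' hi => by
        have g := (h.next (x + i) (by omega) (by omega)).2
        rw [add_assoc, ← hi] at g
        exact g }
  refine ⟨⟨A, A', Equiv.refl (Fin w)⟩, fun _ _ h => h, rfl, fun i => ⟨rfl, rfl⟩, ?_⟩
  rintro q q' ⟨r, t, u, h1, h2, h3, h4, h5, h6, h7, h8⟩
  have g := lt (w - 1 - (r - x)) (by omega)
  rw [show x + (w - 1 - (w - 1 - (r - x))) = r by omega] at g
  have e : x + (r - x) = r := by omega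
  refine ⟨⟨r - x, (by omega : r - x < w)⟩, ⟨t, ?_, ?_⟩, ⟨u, ?_, ?_⟩⟩
  · change t ∈ Set.Icc (s.real aLlo (x + (r - x))) (s.real aLhi (x + (r - x)))
    rw [e]
    exact ⟨h3, h4⟩
  · change (Γ j).point (s.nat aLE (x + (r - x))) t = q
    rw [e]
    exact (P.point_eq hj hkj g.1 q).1 h7
  · change u ∈ Set.Icc (s.real aRlo (x + (r - x))) (s.real aRhi (x + (r - x)))
    rw [e]
    exact ⟨h5, h6⟩
  · change (Γ k).point (s.nat aRE (x + (r - x))) u = q'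
    rw [e]
    exact (P.point_eq hk hkk g.2 q').1 h8

theorem exists_pairings {s' : Store} {i : ℕ} (P : Prepared S p Γ N cut) (hi : i < 3)
    (hk : ∀ c < 3, coef p c ≠ 0) (h : TabOk S s (fun c => (Γ c).len) (fun c => c * n) i)
    (hcopy : ∀ r < s.nat vOut 0, Copied s s' (tab i) r) (h0 : s'.nat (tab i) = s.nat (tab i))
    (h1 : s'.nat (tab i + 1) = s.nat (tab i + 1)) (h2 : s'.nat (tab i + 2) = s.nat (tab i + 2)) :
    ∃ l : List (Pairing (Γ (roleJ i)) (Γ (roleK i))), StoresPairings s' (tab i) l ∧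
      l.length = s.nat (tab i) 0 ∧ (∀ M ∈ l, M.IsIncreasing ∧ M.left.size ≤ 2 * n) ∧
      ∀ q : ℕ → ℂ, CovPair S s (fun c => c * n) i (fun c => coef p c * q c) →
        ∃ M ∈ l, M.Covers (q (roleJ i)) (q (roleK i)) := by
  obtain ⟨-, lj, lk⟩ := (isRoles_role hi).lt
  choose f f1 f2 f3 f4 using fun r : Fin (s.nat (tab i) 0) =>
    exists_pairing P lj lk (hk _ lj) (hk _ lk) (h r r.2)
  refine ⟨List.ofFn f, ⟨by rw [h0, List.length_ofFn], fun r => ?_⟩, List.length_ofFn, ?_, ?_⟩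
  · obtain ⟨r', hr'⟩ : ∃ r' : Fin (s.nat (tab i) 0), (r' : ℕ) = r :=
      ⟨⟨r, by simpa using r.2⟩, rfl⟩
    have e : (List.ofFn f).get r = f r' := by
      rw [List.get_ofFn]
      congr 1
      exact Fin.ext hr'.symm
    rw [e, h1, h2, ← hr']
    refine ⟨(f2 r').symm, _, rfl, fun x => ?_⟩
    rw [(f3 r' x).1, (f3 r' x).2]
    have hx : (x : ℕ) < s.nat (tab i + 1) r' := by rw [← f2 r']; exact x.2
    have ho := (h r' r'.2).out
    exact hcopy _ (by omega)
  · intro M hM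
    obtain ⟨r, rfl⟩ := (List.mem_ofFn' f M).1 hM
    refine ⟨f1 r, ?_⟩
    rw [f2]
    have g : _ ≤ (Γ (roleJ i)).len + (Γ (roleK i)).len := (h r r.2).le
    have := (Γ (roleJ i)).len_le
    have := (Γ (roleK i)).len_le
    omega
  · rintro q ⟨r, hr, hc⟩
    exact ⟨f ⟨r, hr⟩, (List.mem_ofFn' f _).2 ⟨_, rfl⟩, f4 ⟨r, hr⟩ _ _ hc⟩

end

/-! ## The program -/

/-- The program of the theorem. -/
def program : Prog := prepare ;; levels ;; copyTo 20 ;; copyTo 30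

theorem le_log_of_pow_lt {l : ℕ} {m : ℝ} (h : l = 0 ∨ (2 : ℝ) ^ (l - 1) < m) (hm : 1 ≤ m) :
    (l : ℝ) ≤ 1 + 2 * Real.log m := by
  have h0 := Real.log_nonneg hm
  rcases h with rfl | h
  · simp only [Nat.cast_zero]
    linarith
  · have h1 := Real.log_lt_log (by positivity) h
    rw [Real.log_pow] at h1
    have h2 := Real.log_two_gt_d9
    rcases l with _ | l
    · simp only [Nat.cast_zero]
      linarith
    · simp only [Nat.add_sub_cancel] at h1
      push_cast
      nlinarith [Nat.cast_nonneg (α := ℝ) l]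

/-- The bounds on time and output in terms of the logarithm. -/
theorem cost_le {n K l W N B v : ℕ} (hn : 3 ≤ n) (hW : W ≤ 3 * n) (hN : N ≤ 3 * n)
    (hK : K = 0 ∨ 2 ^ (K - 1) < n) (hl : l = 0 ∨ 2 ^ (l - 1) < N)
    (hB : (12 * K + 63) * (W + N) + 47 * W + 30 = B) (hv : v ≤ 6 * l * W) :
    1 ≤ Real.log n ∧ (l : ℝ) ≤ 5 * Real.log n ∧
    ((177 * n + 4 * K + 85 + (l * (6 * B + 2) + 2) + 2 * (8 * v + 2) : ℕ) : ℝ) ≤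
      30000 * n * Real.log n ^ 2 ∧
    ((N + 6 * l * (4 * W) : ℕ) : ℝ) ≤ 30000 * n * Real.log n := by
  have hn' : (3 : ℝ) ≤ n := by exact_mod_cast hn
  have hW' : (W : ℝ) ≤ 3 * n := by exact_mod_cast hW
  have hN' : (N : ℝ) ≤ 3 * n := by exact_mod_cast hN
  have hv' : (v : ℝ) ≤ 6 * l * W := by exact_mod_cast hv
  have hB' : (12 * (K : ℝ) + 63) * (W + N) + 47 * W + 30 = B := by exact_mod_cast hB
  have hx : 1 ≤ Real.log n := by
    rw [Real.le_log_iff_exp_le (by linarith)]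
    have := Real.exp_one_lt_d9
    linarith
  have k1 : (K : ℝ) ≤ 1 + 2 * Real.log n :=
    le_log_of_pow_lt (hK.imp_right fun h => by exact_mod_cast h) (by linarith)
  have l1 : (l : ℝ) ≤ 1 + 2 * Real.log (3 * n) :=
    le_log_of_pow_lt (hl.imp_right fun h => by exact_mod_cast h.trans_le hN) (by linarith)
  rw [Real.log_mul (by norm_num) (by linarith)] at l1
  have l2 := Real.log_le_log (by norm_num) hn'
  set x := Real.log n
  have hl5 : (l : ℝ) ≤ 5 * x := by linarith
  have hnx : (n : ℝ) ≤ n * x := le_mul_of_one_le_right (by linarith) hx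
  have hB5 : (B : ℝ) ≤ 751 * (n * x) := by
    have h1 : (12 * (K : ℝ) + 63) * (W + N) ≤ (36 * x + 63) * (6 * n) := by
      apply mul_le_mul <;> first | positivity | linarith
    nlinarith
  have hlW : (l : ℝ) * W ≤ 15 * (n * x) := by
    have := mul_le_mul hl5 hW' (by positivity) (by positivity)
    linarith
  have hlB : (l : ℝ) * B ≤ 3755 * (n * x * x) := by
    have := mul_le_mul hl5 hB5 (by positivity) (by positivity)
    linarith
  have hnxx : (n : ℝ) * x ≤ n * x * x := le_mul_of_one_le_right (by positivity) hx
  have hxn : x ≤ n * x := le_mul_of_one_le_left (by linarith) (by linarith)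
  refine ⟨hx, hl5, ?_, ?_⟩
  · push_cast
    rw [sq]
    nlinarith
  · push_cast
    nlinarith

section
variable {s : Store} {n : ℕ} {Q : ConvexPolygon n} {p : ℕ → ℂ} {Γ : ℕ → Arc Q}

/-- A point of an arc is on an edge of the chain. -/
theorem Prepared.exists_repAt {N : ℕ} {cut : ℕ → ℕ → ℕ} (P : Prepared s p Γ N cut) {c : ℕ}
    (hc : c < 3) (hk : coef p c ≠ 0) {q : ℂ} (hq : q ∈ (Γ c).carrier) :
    ∃ m t, RepAt s (c * n) 0 (Γ c).len (coef p c * q) m t := by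
  obtain ⟨m, t, ⟨h1, h2⟩, h3⟩ := Set.mem_iUnion.1 hq
  refine ⟨m, t, Nat.zero_le _, m.2, ?_, ?_, (P.point_eq hc hk m.2 q).2 h3⟩
  · rw [P.lo c hc m m.2]; exact h1
  · rw [P.hi c hc m m.2]; exact h2

theorem Prepared.mem_subEdgeSet {N : ℕ} {cut : ℕ → ℕ → ℕ} (P : Prepared s p Γ N cut) {c m : ℕ}
    (hc : c < 3) (hk : coef p c ≠ 0) {q : ℂ} {t : ℝ}
    (h : RepAt s (c * n) 0 (Γ c).len (coef p c * q) m t) :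
    q ∈ (Γ c).subEdgeSet ((Γ c).edge m) := by
  refine ⟨t, ⟨?_, ?_⟩, (P.point_eq hc hk h.lt q).1 h.eq⟩
  · exact (P.lo c hc m h.lt) ▸ h.lo_le
  · exact (P.hi c hc m h.lt) ▸ h.le_hi

theorem program_spec (h : Input s n Q.vtx p (fun c => (Γ c).first) (fun c => (Γ c).len)
      (fun c => (Γ c).lo) fun c => (Γ c).hi) (hk : ∀ c < 3, coef p c ≠ 0)
    (h0 : ∀ a < 200, 0 < a → s.nat a 0 = 0) :
    Runs program s fun t s' => (t : ℝ) ≤ 30000 * n * Real.log n ^ 2 ∧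
      ∃ (M : ∀ i, List (Pairing (Γ (roleJ i)) (Γ (roleK i))))
        (L : List (Fin (Γ 0).len × Fin (Γ 1).len × Fin (Γ 2).len)),
      (∀ i < 3, StoresPairings s' (tab i) (M i) ∧
        ∀ m ∈ M i, m.IsIncreasing ∧ (m.left.size : ℝ) ≤ 30000 * n) ∧
      StoresTriples s' 40 L ∧
      (((M 2).length + (M 0).length + (M 1).length : ℕ) : ℝ) ≤ 30000 * Real.log n ∧
      (L.length : ℝ) ≤ 30000 * n * Real.log n ∧
      ∀ q : ℕ → ℂ, (∀ c < 3, q c ∈ (Γ c).carrier) →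
        coef p 0 * q 0 + coef p 1 * q 1 + coef p 2 * q 2 = 0 →
        (∃ i < 3, ∃ m ∈ M i, m.Covers (q (roleJ i)) (q (roleK i))) ∨
        TripleCovers L (q 0) (q 1) (q 2) := by
  have hle : ∀ c < 3, (Γ c).len ≤ n := h.len_le
  refine (prepare_spec h hk (h0 _ (by norm_num) (by norm_num))).seq ?_
  rintro t₁ S hF₁ ⟨ht₁, N, cut, P⟩
  obtain ⟨eps, θ, T⟩ := P.tables
  have z : ∀ a, a = 10 ∨ a = 15 ∨ a = 20 ∨ a = 30 → S.nat a 0 = 0 := by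
    rintro a (rfl | rfl | rfl | rfl) <;>
      rw [hF₁.1 _ (by decide)] <;> exact h0 _ (by norm_num) (by norm_num)
  have hO : OutOk S S (fun c => (Γ c).len) (fun c => c * n) := by
    refine ⟨P.tok, fun i hi r hr => ?_⟩
    rw [z _ (by have := tab_lt hi; omega)] at hr
    exact absurd hr (Nat.not_lt_zero _)
  refine (levels_spec T (Agree.refl _ _) hO rfl rfl).seq ?_
  rintro t₂ s₂ - ⟨l, ht₂, hNl, hl, G, hC⟩
  refine (copyTo_spec (Or.inl rfl)).seq ?_
  rintro t₃ s₃ hF₃ ⟨ht₃, C₃⟩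
  refine (copyTo_spec (Or.inr rfl)).mono ?_
  rintro t₄ s₄ hF₄ ⟨ht₄, C₄⟩
  have e1 : ∀ a, (copyTo 20).writesNat a = false → (copyTo 30).writesNat a = false →
      s₄.nat a = s₂.nat a := fun a h h' => by rw [hF₄.1 a h', hF₃.1 a h]
  have e2 : ∀ a, (copyTo 20).writesReal a = false → (copyTo 30).writesReal a = false →
      s₄.real a = s₂.real a := fun a h h' => by rw [hF₄.2 a h', hF₃.2 a h]
  have hv : s₂.nat vOut 0 ≤ 6 * l * ((Γ 0).len + (Γ 1).len + (Γ 2).len) := by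
    have := G.out
    rw [z _ (by simp), zero_add] at this
    exact this
  have hcopy : ∀ i < 3, ∀ r < s₂.nat vOut 0, Copied s₂ s₄ (tab i) r := by
    intro i hi r hr
    interval_cases i
    · change Copied s₂ s₄ 20 r
      simp only [Copied, StoresSubEdge]
      rw [hF₄.1 _ (by decide), hF₄.1 _ (by decide), hF₄.2 _ (by decide), hF₄.2 _ (by decide),
        hF₄.2 _ (by decide), hF₄.2 _ (by decide)]
      exact C₃ r hr
    · change Copied s₂ s₄ 30 r
      have := C₄ r (by rwa [hF₃.1 _ (by decide)])
      simp only [Copied, leftPiece, rightPiece] at this ⊢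
      rw [hF₃.1 _ (by decide), hF₃.1 _ (by decide), hF₃.2 _ (by decide), hF₃.2 _ (by decide),
        hF₃.2 _ (by decide), hF₃.2 _ (by decide)] at this
      exact this
    · exact ⟨⟨by rw [e1 _ (by decide) (by decide)]; rfl,
        by rw [e2 _ (by decide) (by decide)]; rfl, by rw [e2 _ (by decide) (by decide)]; rfl⟩,
        by rw [e1 _ (by decide) (by decide)]; rfl,
        by rw [e2 _ (by decide) (by decide)]; rfl, by rw [e2 _ (by decide) (by decide)]; rfl⟩
  have hM : ∀ i, ∃ M : List (Pairing (Γ (roleJ i)) (Γ (roleK i))), i < 3 →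
      StoresPairings s₄ (tab i) M ∧ M.length = s₂.nat (tab i) 0 ∧
      (∀ m ∈ M, m.IsIncreasing ∧ m.left.size ≤ 2 * n) ∧
      ∀ q : ℕ → ℂ, CovPair S s₂ (fun c => c * n) i (fun c => coef p c * q c) →
        ∃ m ∈ M, m.Covers (q (roleJ i)) (q (roleK i)) := by
    intro i
    by_cases hi : i < 3
    · have e : s₄.nat (tab i) = s₂.nat (tab i) ∧ s₄.nat (tab i + 1) = s₂.nat (tab i + 1) ∧
          s₄.nat (tab i + 2) = s₂.nat (tab i + 2) := by
        rcases tab_lt hi with e | e | e <;> rw [e] <;>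
          exact ⟨e1 _ (by decide) (by decide), e1 _ (by decide) (by decide),
            e1 _ (by decide) (by decide)⟩
      obtain ⟨M, g⟩ := exists_pairings P hi hk (G.ok.tabs i hi) (hcopy i hi) e.1 e.2.1 e.2.2
      exact ⟨M, fun _ => g⟩
    · exact ⟨[], fun h => absurd h hi⟩
  choose M hM using hM
  have tok := G.ok.tok
  obtain ⟨c1, c2, c3, c4⟩ := cost_le h.three_le
    (by have := hle 0; have := hle 1; have := hle 2; omega) P.leaves P.log hl rfl hv
  refine ⟨?_, M, List.ofFn fun r : Fin (s₂.nat vTrip 0) => (⟨_, tok 0 (by norm_num) r r.2⟩,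
    ⟨_, tok 1 (by norm_num) r r.2⟩, ⟨_, tok 2 (by norm_num) r r.2⟩), ?_, ?_, ?_, ?_, ?_⟩
  · refine le_trans ?_ c3
    rw [hF₃.1 vOut (by decide)] at ht₄
    exact_mod_cast (show t₁ + (t₂ + (t₃ + t₄)) ≤ _ by omega)
  · intro i hi
    refine ⟨(hM i hi).1, fun m hm => ⟨((hM i hi).2.2.1 m hm).1, ?_⟩⟩
    have : (m.left.size : ℝ) ≤ 2 * n := by exact_mod_cast ((hM i hi).2.2.1 m hm).2
    linarith [Nat.cast_nonneg (α := ℝ) n]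
  · refine ⟨by rw [e1 _ (by decide) (by decide), List.length_ofFn], fun r => ?_⟩
    rw [e1 _ (by decide) (by decide), e1 _ (by decide) (by decide), e1 _ (by decide) (by decide)]
    simp
  · rw [(hM 2 (by norm_num)).2.1, (hM 0 (by norm_num)).2.1, (hM 1 (by norm_num)).2.1]
    have g := G.num
    rw [z 10 (by simp), z 20 (by simp), z 30 (by simp)] at g
    have g' : ((s₂.nat (tab 2) 0 + s₂.nat (tab 0) 0 + s₂.nat (tab 1) 0 : ℕ) : ℝ) ≤ 6 * l := by
      have : s₂.nat (tab 2) 0 + s₂.nat (tab 0) 0 + s₂.nat (tab 1) 0 ≤ 6 * l := by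
        simpa [tab] using g
      exact_mod_cast this
    linarith
  · rw [List.length_ofFn]
    refine le_trans ?_ c4
    exact_mod_cast G.count.trans (Nat.add_le_add_right P.trip _)
  · intro q hq hz
    have hR : ∀ c, ∃ m t, c < 3 → RepAt S (c * n) 0 (Γ c).len (coef p c * q c) m t := by
      intro c
      by_cases hc : c < 3
      · obtain ⟨m, t, g⟩ := P.exists_repAt hc (hk c hc) (hq c hc)
        exact ⟨m, t, fun _ => g⟩
      · exact ⟨0, 0, fun h => absurd h hc⟩
    choose m t hR using hR
    have key : CovAll S s₂ (fun c => (Γ c).len) (fun c => c * n) fun c => coef p c * q c := by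
      rcases T.covered_or_leaf hNl hC (z := fun c => coef p c * q c) hz hR with g | ⟨r, hr, g⟩
      · exact g
      · obtain ⟨x, hx, hx'⟩ := P.out r hr fun c hc => (g c hc).1.trans_lt (g c hc).2
        refine Or.inl (CovT.ext ⟨m, t, hR, x, hx, fun c hc => ?_⟩ G.grow.text)
        rw [hx' c hc]
        have := P.cut_succ r hr c hc
        have := g c hc
        omega
    rcases key with ⟨m, t, g, r, hr, hm⟩ | ⟨i, hi, g⟩
    · refine Or.inr ⟨_, (List.mem_ofFn' _ _).2 ⟨⟨r, hr⟩, rfl⟩, ?_, ?_, ?_⟩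
      · simp only [hm 0 (by norm_num)]
        exact P.mem_subEdgeSet (by norm_num) (hk 0 (by norm_num)) (g 0 (by norm_num))
      · simp only [hm 1 (by norm_num)]
        exact P.mem_subEdgeSet (by norm_num) (hk 1 (by norm_num)) (g 1 (by norm_num))
      · simp only [hm 2 (by norm_num)]
        exact P.mem_subEdgeSet (by norm_num) (hk 2 (by norm_num)) (g 2 (by norm_num))
    · exact Or.inl ⟨i, hi, (hM i hi).2.2.2 q g⟩

end

/-- The three arcs as a sequence. -/
def arcs {n : ℕ} {Q : ConvexPolygon n} (Γ₁ Γ₂ Γ₃ : Arc Q) : ℕ → Arc Q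
  | 0 => Γ₁
  | 1 => Γ₂
  | _ => Γ₃

/-- The vertices of a triangle as a sequence. -/
def corners (p : Fin 3 → ℂ) : ℕ → ℂ
  | 0 => p 0
  | 1 => p 1
  | _ => p 2

theorem input_inputStore {n : ℕ} (Q : ConvexPolygon n) (p : Fin 3 → ℂ) (Γ₁ Γ₂ Γ₃ : Arc Q) :
    Input (inputStore Q p Γ₁ Γ₂ Γ₃) n Q.vtx (corners p) (fun c => (arcs Γ₁ Γ₂ Γ₃ c).first)
      (fun c => (arcs Γ₁ Γ₂ Γ₃ c).len) (fun c => (arcs Γ₁ Γ₂ Γ₃ c).lo)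
      fun c => (arcs Γ₁ Γ₂ Γ₃ c).hi where
  num := rfl
  nfirst c hc := by interval_cases c <;> rfl
  nlen c hc := by interval_cases c <;> rfl
  vre i hi := by simp [inputStore, hi, Q.vtx_of_lt hi]
  vim i hi := by simp [inputStore, hi, Q.vtx_of_lt hi]
  pre c hc := by interval_cases c <;> simp [inputStore, corners]
  pim c hc := by interval_cases c <;> simp [inputStore, corners]
  rlo c hc := by interval_cases c <;> simp [inputStore, arcs]
  rhi c hc := by interval_cases c <;> simp [inputStore, arcs]
  period := Q.vtx_mod
  three_le := Q.three_le
  first_lt c _ := (arcs Γ₁ Γ₂ Γ₃ c).first.2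
  len_pos c _ := (arcs Γ₁ Γ₂ Γ₃ c).len_pos
  len_le c _ := (arcs Γ₁ Γ₂ Γ₃ c).len_le

theorem coef_corners_ne_zero {p : Fin 3 → ℂ} (hp : AffineIndependent ℝ p) {c : ℕ} (hc : c < 3) :
    coef (corners p) c ≠ 0 := by
  have h := hp.injective
  interval_cases c
  · exact sub_ne_zero.2 (h.ne (show (1 : Fin 3) ≠ 2 by decide))
  · exact sub_ne_zero.2 (h.ne (show (2 : Fin 3) ≠ 0 by decide))
  · exact sub_ne_zero.2 (h.ne (show (0 : Fin 3) ≠ 1 by decide))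

end TriangleCover

theorem mainTheorem5 :
    ∃ (prog : Prog) (C : ℝ) (c : ℕ),
      ∀ (n : ℕ) (Q : ConvexPolygon n) (p : Fin 3 → ℂ), AffineIndependent ℝ p →
      ∀ (Γ₁ Γ₂ Γ₃ : Arc Q),
      ∃ (t : ℕ) (s : Store) (M₁₂ : List (Pairing Γ₁ Γ₂)) (M₂₃ : List (Pairing Γ₂ Γ₃))
        (M₁₃ : List (Pairing Γ₁ Γ₃)) (L : List (Fin Γ₁.len × Fin Γ₂.len × Fin Γ₃.len)),
        -- the program halts in near-linear time with the lists in its memory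
        Exec prog (inputStore Q p Γ₁ Γ₂ Γ₃) t s ∧
        (t : ℝ) ≤ C * n * Real.log n ^ c ∧
        StoresPairings s 10 M₁₂ ∧ StoresPairings s 20 M₂₃ ∧ StoresPairings s 30 M₁₃ ∧
        StoresTriples s 40 L ∧
        -- number, monotonicity and size of the pairings, and number of the triples
        ((M₁₂.length + M₂₃.length + M₁₃.length : ℕ) : ℝ) ≤ C * Real.log n ∧
        (∀ M ∈ M₁₂, M.IsIncreasing ∧ (M.left.size : ℝ) ≤ C * n) ∧
        (∀ M ∈ M₂₃, M.IsIncreasing ∧ (M.left.size : ℝ) ≤ C * n) ∧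
        (∀ M ∈ M₁₃, M.IsIncreasing ∧ (M.left.size : ℝ) ≤ C * n) ∧
        (L.length : ℝ) ≤ C * n * Real.log n ∧
        -- every placement is covered
        ∀ φ : ℂ → ℂ, IsSimilarity φ →
          φ (p 0) ∈ Γ₁.carrier → φ (p 1) ∈ Γ₂.carrier → φ (p 2) ∈ Γ₃.carrier →
          (∃ M ∈ M₁₂, M.Covers (φ (p 0)) (φ (p 1))) ∨
          (∃ M ∈ M₂₃, M.Covers (φ (p 1)) (φ (p 2))) ∨
          (∃ M ∈ M₁₃, M.Covers (φ (p 0)) (φ (p 2))) ∨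
          TripleCovers L (φ (p 0)) (φ (p 1)) (φ (p 2)) := by
  refine ⟨program, 30000, 2, fun n Q p hp Γ₁ Γ₂ Γ₃ => ?_⟩
  obtain ⟨t, s, hE, ht, M, L, hM, hL, h1, h2, h3⟩ :=
    program_spec (input_inputStore Q p Γ₁ Γ₂ Γ₃) (fun c hc => coef_corners_ne_zero hp hc)
      fun a _ h => by simp [inputStore, h.ne']
  have m0 := hM 0 (by norm_num)
  have m1 := hM 1 (by norm_num)
  have m2 := hM 2 (by norm_num)
  refine ⟨t, s, M 2, M 0, M 1, L, hE, ht, m2.1, m0.1, m1.1, hL, h1, m2.2, m0.2, m1.2, h2, ?_⟩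
  rintro φ ⟨a, b, -, hφ⟩ q1 q2 q3
  have hq : ∀ c < 3, φ (corners p c) ∈ (arcs Γ₁ Γ₂ Γ₃ c).carrier := by
    intro c hc
    interval_cases c
    exacts [q1, q2, q3]
  rcases h3 (fun c => φ (corners p c)) hq (by simp only [hφ, coef]; ring) with ⟨i, hi, h⟩ | h
  · interval_cases i
    · exact Or.inr (Or.inl h)
    · exact Or.inr (Or.inr (Or.inl h))
    · exact Or.inl h
  · exact Or.inr (Or.inr (Or.inr h))
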